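/- **Theorem (Acting condition).** Let \(s,r\in(0,1]\), \(p,q\in[1,+\infty)\) and \(m\in\mathbb{N}\), \(m\ge 1\), with \(rq=sp\). Let \(\mathcal{M}\) be a nonempty \(m\)-dimensional Riemannian manifold which is either \(\mathbb{R}^m\) or compact, let \(\mathcal{N}\) be a connected Riemannian manifold, which is assumed to be compact if \(sp>m\) or if \(s=p=m=1\), let \(\mathcal{F}\) be a Riemannian manifold, and let \(f:\mathcal{N}\to\mathcal{F}\) be Borel-measurable. Denote by \(d_{\mathcal{M}}, d_{\mathcal{N}}, d_{\mathcal{F}}\) the geodesic distances (equal to \(+\infty\) between different connected components). For \(0<s<1\), let \(W^{s,p}(\mathcal{M},\mathcal{N})\) be the set of measurable maps \(u:\mathcal{M}\to\mathcal{N}\) such that \[ \mathcal{E}_{s,p}(u)=\int_{\mathcal{M}}\int_{\mathcal{M}}\frac{d_{\mathcal{N}}(u(x),u(y))^p}{d_{\mathcal{M}}(x,y)^{m+sp}}\,\mathrm{d}x\,\mathrm{d}y<+\infty , \] and let \(W^{1,p}(\mathcal{M},\mathcal{N})\) be the set of measurable maps \(u:\mathcal{M}\to\mathcal{N}\) that are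 weakly differentiable with \(\mathcal{E}_{1,p}(u)=\int_{\mathcal{M}}|Du|^p<+\infty\), that is, for which there is \(g\in L^p(\mathcal{M},[0,+\infty])\) such that for every \(1\)-Lipschitz function \(\varphi:\mathcal{N}\to\mathbb{R}\) the function \(\varphi\circ u\) is weakly differentiable and \(|D(\varphi\circ u)|\le g\) almost everywhere; \(|Du|\) is the smallest such \(g\). The spaces \(W^{r,q}(\mathcal{M},\mathcal{F})\) are defined in the same way. A sequence \((u_k)\) converges to \(u\) in \(W^{s,p}(\mathcal{M},\mathcal{N})\) if \(\int_{\mathcal{M}}d_{\mathcal{N}}(u_k,u)^p\to0\) and \(\mathcal{E}_{s,p}(u_k)\to\mathcal{E}_{s,p}(u)\) and, when \(s=1\), if moreover \(D(\varphi\circ u_k)\to D(\varphi\circ u)\) in \(L^p\) for every Lipschitz-continuous \(\varphi\in C^1(\mathcal{N},\mathbb{R})\). A set \(\mathcal{U}\subset W^{s,p}(\mathcal{M},\mathcal{N})\) is open if every sequence in \(W^{s,p}(\mathcal{M},\mathcal{N})\) that converges to an element of \(\mathcal{U}\) is eventually in \(\mathcal{U}\). Assume that \(f\circ u\in W^{r,q}(\mathcal{M},\mathcal{F})\)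 for every \(u\in W^{s,p}(\mathcal{M},\mathcal{N})\), or, if \(sp\le m\) and \(s<m\), only that there is a nonempty open set \(\mathcal{U}\subset W^{s,p}(\mathcal{M},\mathcal{N})\) such that \(f\circ u\in W^{r,q}(\mathcal{M},\mathcal{F})\) for every \(u\in\mathcal{U}\). Then there exists a constant \(C\in[0,+\infty)\) such that for all \(x,y\in\mathcal{N}\), if either \(sp<m\) or \(d_{\mathcal{N}}(x,y)\le 1/C\), then \[ d_{\mathcal{F}}(f(x),f(y))\le C\,d_{\mathcal{N}}(x,y)^{p/q}. \] In particular, \(f\) is constant if \(p>q\), and \(f\) is Lipschitz-continuous if \(p=q\). -/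

import Mathlib

open scoped ENNReal NNReal Topology ContDiff Manifold MeasureTheory
open MeasureTheory Filter Bundle

noncomputable section

/-! ### Weak differentials of real-valued functions on a smooth manifold -/

section WeakDifferential

variable {m : ℕ} {M : Type*} [TopologicalSpace M] [ChartedSpace (EuclideanSpace ℝ (Fin m)) M]

/-- `G`, a field of linear forms on the tangent spaces of the `m`-dimensional manifold `M`, is the
weak differential of `g : M → ℝ`: in every chart `e` of `M`, the function `g ∘ e⁻¹` is locally
integrable and its distributional derivative is the locally integrable field
`y ↦ G (e⁻¹ y) ∘ D(e⁻¹)(y)`. -/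
def HasWeakDifferential (g : M → ℝ) (G : ∀ x : M, TangentSpace (𝓡 m) x →L[ℝ] ℝ) : Prop :=
  ∀ e ∈ atlas (EuclideanSpace ℝ (Fin m)) M,
    LocallyIntegrableOn (fun y => g (e.symm y)) e.target volume ∧
    ∀ v : EuclideanSpace ℝ (Fin m),
      LocallyIntegrableOn (fun y => G (e.symm y) (mfderiv (𝓡 m) (𝓡 m) e.symm y v))
        e.target volume ∧
      ∀ ψ : EuclideanSpace ℝ (Fin m) → ℝ, ContDiff ℝ ∞ ψ → HasCompactSupport ψ →
        tsupport ψ ⊆ e.target →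
        ∫ y in e.target, g (e.symm y) * fderiv ℝ ψ y v
          = - ∫ y in e.target, G (e.symm y) (mfderiv (𝓡 m) (𝓡 m) e.symm y v) * ψ y

end WeakDifferential

/-- The dual norm `sup {|ℓ v| : |v| ≤ 1}`, for the Riemannian metric, of a linear form `ℓ` on a tangent
space of a Riemannian manifold. -/
def covectorNorm {m : ℕ} {M : Type*} [TopologicalSpace M] [ChartedSpace (EuclideanSpace ℝ (Fin m)) M]
    [RiemannianBundle (fun x : M => TangentSpace (𝓡 m) x)] {x : M}
    (ℓ : TangentSpace (𝓡 m) x →L[ℝ] ℝ) : ℝ≥0∞ :=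
  ⨆ (v : TangentSpace (𝓡 m) x) (_ : ‖v‖ ≤ 1), ‖ℓ v‖ₑ

/-! ### Sobolev energies and Sobolev spaces of maps between Riemannian manifolds

Everywhere below, `dx` is the Riemannian volume of the `m`-dimensional Riemannian manifold `M`: the
`m`-dimensional Hausdorff measure `μHE[m]` of the geodesic distance, normalised so that it is the
Lebesgue measure on `ℝ^m`. The extended distance `edist` of a Riemannian manifold is its geodesic
distance, which is `∞` between two points of different connected components. -/

section Sobolev

variable (m : ℕ) {M N : Type*}
  [EMetricSpace M] [ChartedSpace (EuclideanSpace ℝ (Fin m)) M]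
  [RiemannianBundle (fun x : M => TangentSpace (𝓡 m) x)]
  [MeasurableSpace M] [BorelSpace M]
  [EMetricSpace N]

/-- The Gagliardo energy `∬ d_N(u(x),u(y))^p / d_M(x,y)^(m+sp) dx dy`. -/
def gagliardoEnergy (s p : ℝ) (u : M → N) : ℝ≥0∞ :=
  ∫⁻ x, ∫⁻ y, edist (u x) (u y) ^ p / edist x y ^ ((m : ℝ) + s * p) ∂μHE[m] ∂μHE[m]

/-- `g` bounds almost everywhere the weak differential of `φ ∘ u`, for all `1`-Lipschitz functions
`φ : N → ℝ`; in other words `|Du| ≤ g` almost everywhere. -/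
structure IsWeakDerivBound (u : M → N) (g : M → ℝ≥0∞) : Prop where
  aemeasurable : AEMeasurable g μHE[m]
  bound : ∀ φ : N → ℝ, LipschitzWith 1 φ →
    ∃ G : ∀ x : M, TangentSpace (𝓡 m) x →L[ℝ] ℝ,
      HasWeakDifferential (fun x => φ (u x)) G ∧ ∀ᵐ x ∂(μHE[m] : Measure M), covectorNorm (G x) ≤ g x

/-- The first-order energy `∫ |Du|^p`, in the intrinsic form: `|Du|` is the smallest function which
bounds the weak differentials of all compositions `φ ∘ u` with `1`-Lipschitz `φ : N → ℝ`. The energy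
is `∞` if there is no bound in `L^p`. When `N` is a closed, isometrically embedded submanifold of
`ℝ^ν`, the energy is finite if and only if `u`, as a map into `ℝ^ν`, is weakly differentiable with a
derivative in `L^p`, and `|Du|` is the operator norm of this derivative. -/
def dirichletEnergy (p : ℝ) (u : M → N) : ℝ≥0∞ :=
  ⨅ (g : M → ℝ≥0∞) (_ : IsWeakDerivBound m u g), ∫⁻ x, g x ^ p ∂μHE[m]

/-- The Sobolev energy of order `s ∈ (0, 1]` and exponent `p`. -/
def sobolevEnergy (s p : ℝ) (u : M → N) : ℝ≥0∞ :=
  if s = 1 then dirichletEnergy m p u else gagliardoEnergy m s p u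

/-- `u ∈ W^{s,p}(M, N)`: `u` is (Lebesgue) measurable and has finite Sobolev energy. -/
structure MemSobolev [MeasurableSpace N] (s p : ℝ) (u : M → N) : Prop where
  aemeasurable : AEMeasurable u μHE[m]
  energy_lt_top : sobolevEnergy m s p u < ⊤

/-- Strong convergence `w k → u` in `W^{s,p}(M, N)`, `N` of dimension `n`: convergence in `L^p` and
convergence of the energies and, when `s = 1`, also convergence in `L^p` of the weak derivatives,
expressed through the compositions with all Lipschitz-continuous `C^1` functions `φ : N → ℝ` (among
them the components of an isometric embedding of `N` into `ℝ^ν`). -/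
structure TendstoSobolev (n : ℕ) [ChartedSpace (EuclideanSpace ℝ (Fin n)) N]
    (s p : ℝ) (w : ℕ → M → N) (u : M → N) : Prop where
  tendsto_Lp : Tendsto (fun k => ∫⁻ x, edist (w k x) (u x) ^ p ∂(μHE[m] : Measure M))
    atTop (𝓝 0)
  tendsto_energy : Tendsto (fun k => sobolevEnergy m s p (w k)) atTop (𝓝 (sobolevEnergy m s p u))
  tendsto_deriv : s = 1 → ∀ (φ : N → ℝ) (L : ℝ≥0), ContMDiff (𝓡 n) 𝓘(ℝ, ℝ) 1 φ →
    LipschitzWith L φ →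
    ∃ (G : ∀ x : M, TangentSpace (𝓡 m) x →L[ℝ] ℝ)
      (W : ℕ → ∀ x : M, TangentSpace (𝓡 m) x →L[ℝ] ℝ),
      HasWeakDifferential (fun x => φ (u x)) G ∧
      (∀ k, HasWeakDifferential (fun x => φ (w k x)) (W k)) ∧
      Tendsto (fun k => ∫⁻ x, covectorNorm (W k x - G x) ^ p ∂(μHE[m] : Measure M)) atTop (𝓝 0)

/-- `U` is an open subset of `W^{s,p}(M, N)`: whenever a sequence in `W^{s,p}(M, N)` converges
strongly to an element of `U`, its terms eventually belong to `U`. -/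
structure IsSobolevOpen [MeasurableSpace N] (n : ℕ) [ChartedSpace (EuclideanSpace ℝ (Fin n)) N]
    (s p : ℝ) (U : Set (M → N)) : Prop where
  mem : ∀ u ∈ U, MemSobolev m s p u
  eventually_mem : ∀ u ∈ U, ∀ w : ℕ → M → N, (∀ k, MemSobolev m s p (w k)) →
    TendstoSobolev m n s p w u → ∀ᶠ k in atTop, w k ∈ U

end Sobolev

end

/-! Suppose that no constant works: for every C there is a pair x, y with d_F(f x, f y) > C d^(p/q),
where d = d_N(x, y), and with d ≤ 1/C unless sp < m. In a ball of radius ρ of a chart of M, let a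
map oscillate between x and y at a scale ε, along a path of length about d. This costs an energy in
W^{s,p} of order d^p ρ^m ε^(-sp), whereas the composition with f has an energy in W^{r,q} of order
at least d_F(f x, f y)^q ρ^m ε^(-rq). Since rq = sp, the second quantity exceeds C^q times the
first. Choosing ε so that the first one is a prescribed small number κ, and C large in terms of κ,
gives an oscillation of cost κ whose composition with f has energy at least 1
(`exists_oscillating_cutoff`, `IsOscillating.hasLargeEnergyOn`, `IsBubble.of_pair`).

The oscillation has to be inserted cheaply into a given map u₀. If sp < m, or sp = m and p > 1,
points have zero capacity (`exists_cutoff_of_small_capacity`). Near a point where u₀ is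
approximately continuous with value b, a neighbourhood of b in N is contracted to b, and then a path
is followed from b to x. Both operations are driven by cutoff functions of small energy, so that the
length of the path does not matter. In the remaining cases N is compact, the bad pairs accumulate at
some b, and u₀ is taken to be the constant b: the path from b to x is short and a fixed cutoff
function suffices. Since u₀ need not be continuous, all modifications are restricted, by cutoff
functions in the target, to the points where u₀ is close to b (`exists_surgery`).

This yields bubbles of energy at most 2⁻ᵏ in disjoint balls. The map obtained from u₀ by inserting
the bubbles of index at least j converges to u₀ as j tends to infinity, and so belongs to the given
open set for some j; but its composition with f has infinite energy, since infinitely many disjoint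
balls contribute at least 1 each. This is the contradiction (`IsBubbleFamily.false_of_tendsto`).

The cases s < 1 and s = 1 share the construction through the axioms of `GradientCalculus`. For s = 1
there is in addition an analytic part: a function whose translates are controlled by integrals along
segments has a weak derivative (`exists_hasWeakDirDeriv_of_translation`), weak derivatives obey a
change of variables, and those of infinitely many bubbles can be summed
(`IsBubbleFamily.exists_glued_field`).

The last two assertions follow by subdividing a path of length L into k equal pieces: the local
estimate gives k C (L/k)^(p/q), which tends to 0 if p > q and equals C L if p = q. -/

noncomputable section

local notation "ℰ" m:max => EuclideanSpace ℝ (Fin m)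

/-! ### Charts of a Riemannian manifold are locally bilipschitz -/

section RiemannianCharts

variable {n : ℕ} {N : Type*} [EMetricSpace N] [ChartedSpace (ℰ n) N] [IsManifold (𝓡 n) ∞ N]

lemma contDiffOn_chart_transition {e c : OpenPartialHomeomorph N (ℰ n)}
    (he : e ∈ atlas (ℰ n) N) (hc : c ∈ atlas (ℰ n) N) :
    ContDiffOn ℝ ∞ (e ∘ c.symm) (c.target ∩ c.symm ⁻¹' e.source) := by
  have h1 := contMDiffOn_of_mem_maximalAtlas (I := 𝓡 n) (n := ∞)
    (IsManifold.subset_maximalAtlas he)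
  have h2 := contMDiffOn_symm_of_mem_maximalAtlas (I := 𝓡 n) (n := ∞)
    (IsManifold.subset_maximalAtlas hc)
  exact contMDiffOn_iff_contDiffOn.1 (h1.comp' h2)

lemma mdifferentiableAt_chart {e : OpenPartialHomeomorph N (ℰ n)}
    (he : e ∈ atlas (ℰ n) N) {x : N} (hx : x ∈ e.source) :
    MDifferentiableAt (𝓡 n) (𝓡 n) e x :=
  mdifferentiableAt_atlas he hx

lemma mdifferentiableAt_chart_symm {e : OpenPartialHomeomorph N (ℰ n)}
    (he : e ∈ atlas (ℰ n) N) {y : ℰ n} (hy : y ∈ e.target) :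
    MDifferentiableAt (𝓡 n) (𝓡 n) e.symm y :=
  mdifferentiableAt_atlas_symm he hy

lemma exists_norm_fderiv_transition_le {e c : OpenPartialHomeomorph N (ℰ n)}
    (he : e ∈ atlas (ℰ n) N) (hc : c ∈ atlas (ℰ n) N) {x : N} (hx : x ∈ e.source)
    (hxc : x ∈ c.source) :
    ∃ C : ℝ, 0 < C ∧ ∀ᶠ y in 𝓝 x, ‖fderiv ℝ (e ∘ c.symm) (c y)‖ ≤ C := by
  have ho : IsOpen (c.target ∩ c.symm ⁻¹' e.source) := c.symm.isOpen_inter_preimage e.open_source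
  have h1 := (contDiffOn_chart_transition he hc).continuousOn_fderiv_of_isOpen ho (by simp)
  have hm : c x ∈ c.target ∩ c.symm ⁻¹' e.source := ⟨c.map_source hxc, by simpa [hxc] using hx⟩
  have h2 : ContinuousAt (fun y => ‖fderiv ℝ (e ∘ c.symm) (c y)‖) x :=
    ((h1.continuousAt (ho.mem_nhds hm)).comp (c.continuousAt hxc)).norm
  refine ⟨‖fderiv ℝ (e ∘ c.symm) (c x)‖ + 1, by positivity, ?_⟩
  filter_upwards [h2.eventually (gt_mem_nhds (lt_add_one _))] with y hy using hy.le

lemma mfderiv_chart_eq {e c : OpenPartialHomeomorph N (ℰ n)}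
    (he : e ∈ atlas (ℰ n) N) (hc : c ∈ atlas (ℰ n) N) {x : N} (hx : x ∈ e.source)
    (hxc : x ∈ c.source) (v : TangentSpace (𝓡 n) x) :
    mfderiv (𝓡 n) (𝓡 n) e x v = fderiv ℝ (e ∘ c.symm) (c x) (mfderiv (𝓡 n) (𝓡 n) c x v) := by
  have ho : IsOpen (c.target ∩ c.symm ⁻¹' e.source) := c.symm.isOpen_inter_preimage e.open_source
  have hm : c x ∈ c.target ∩ c.symm ⁻¹' e.source := ⟨c.map_source hxc, by simpa [hxc] using hx⟩
  have h1 : (e : N → ℰ n) =ᶠ[𝓝 x] (e ∘ c.symm) ∘ c := by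
    filter_upwards [c.open_source.mem_nhds hxc] with y hy
    simp [hy]
  rw [h1.mfderiv_eq]
  have h2 : DifferentiableAt ℝ (e ∘ c.symm) (c x) :=
    ((contDiffOn_chart_transition he hc).contDiffAt (ho.mem_nhds hm)).differentiableAt (by simp)
  rw [mfderiv_comp x h2.mdifferentiableAt (mdifferentiableAt_chart hc hxc), mfderiv_eq_fderiv]
  rfl

lemma mfderiv_chart_symm_eq {e c : OpenPartialHomeomorph N (ℰ n)}
    (he : e ∈ atlas (ℰ n) N) (hc : c ∈ atlas (ℰ n) N) {y : ℰ n} (hy : y ∈ e.target)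
    (hyc : e.symm y ∈ c.source) (v : ℰ n) :
    (show ℰ n from mfderiv (𝓡 n) (𝓡 n) e.symm y v) =
      mfderiv (𝓡 n) (𝓡 n) c.symm (c (e.symm y)) (fderiv ℝ (c ∘ e.symm) y v) := by
  have ho : IsOpen (e.target ∩ e.symm ⁻¹' c.source) := e.symm.isOpen_inter_preimage c.open_source
  have hm : y ∈ e.target ∩ e.symm ⁻¹' c.source := ⟨hy, hyc⟩
  have h1 : (e.symm : ℰ n → N) =ᶠ[𝓝 y] c.symm ∘ (c ∘ e.symm) := by
    filter_upwards [ho.mem_nhds hm] with z hz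
    simp [c.left_inv hz.2]
  have h2 : DifferentiableAt ℝ (c ∘ e.symm) y :=
    ((contDiffOn_chart_transition hc he).contDiffAt (ho.mem_nhds hm)).differentiableAt (by simp)
  have h3 := mfderiv_comp (I := 𝓡 n) (I' := 𝓡 n) (I'' := 𝓡 n) (g := c.symm) (f := c ∘ e.symm) y
    (mdifferentiableAt_chart_symm hc (c.map_source hyc)) h2.mdifferentiableAt
  rw [mfderiv_eq_fderiv] at h3
  have h4 := h1.mfderiv_eq (I := 𝓡 n) (I' := 𝓡 n)
  change (mfderiv (𝓡 n) (𝓡 n) e.symm y : ℰ n →L[ℝ] ℰ n) v = _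
  have h5 : (mfderiv (𝓡 n) (𝓡 n) e.symm y : ℰ n →L[ℝ] ℰ n) =
    (mfderiv (𝓡 n) (𝓡 n) c.symm (c (e.symm y)) : ℰ n →L[ℝ] ℰ n).comp (fderiv ℝ (c ∘ e.symm) y) :=
    h4.trans h3
  rw [h5]; rfl

variable [RiemannianBundle (fun x : N => TangentSpace (𝓡 n) x)]
    [IsContMDiffRiemannianBundle (𝓡 n) ∞ (ℰ n) (fun x : N => TangentSpace (𝓡 n) x)]
lemma isContinuousRiemannianBundle_tangentSpace :
    IsContinuousRiemannianBundle (ℰ n)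
      (fun x : N => TangentSpace (𝓡 n) x) := by
  obtain ⟨g, hg, h⟩ := IsContMDiffRiemannianBundle.exists_contMDiff (IB := 𝓡 n) (n := ∞)
    (F := ℰ n) (E := fun x : N => TangentSpace (𝓡 n) x)
  exact ⟨g, hg.continuous, h⟩

/-- The derivative of the preferred chart is a trivialization of the tangent bundle, and the
continuity of the metric bounds its norm locally. -/
lemma exists_norm_mfderiv_chartAt_le (x : N) : ∃ C : ℝ, 0 < C ∧
    ∀ᶠ y in 𝓝 x, ∀ v : TangentSpace (𝓡 n) y,
      ‖(show ℰ n from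
        mfderiv (𝓡 n) (𝓡 n) (chartAt (ℰ n) x) y v)‖ ≤ C * ‖v‖ := by
  have := isContinuousRiemannianBundle_tangentSpace (n := n) (N := N)
  rcases eventually_norm_trivializationAt_lt (ℰ n)
    (fun x : N => TangentSpace (𝓡 n) x) x with ⟨C, hC, h⟩
  refine ⟨C, hC, ?_⟩
  filter_upwards [h, chart_source_mem_nhds (ℰ n) x] with y hy h'y v
  have h1 := ((trivializationAt (ℰ n)
    (fun x : N => TangentSpace (𝓡 n) x) x).continuousLinearMapAt ℝ y).le_opNorm v
  have h2 : mfderiv (𝓡 n) (𝓡 n) (chartAt (ℰ n) x) y =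
    (trivializationAt (ℰ n)
    (fun x : N => TangentSpace (𝓡 n) x) x).continuousLinearMapAt ℝ y := by
    have := TangentBundle.continuousLinearMapAt_trivializationAt (I := 𝓡 n) h'y
    exact this.symm
  rw [h2]
  exact h1.trans (by gcongr)

lemma exists_norm_mfderiv_chartAt_symm_le (x : N) : ∃ C : ℝ, 0 < C ∧
    ∀ᶠ y in 𝓝 x, ∀ v : ℰ n,
      ‖(show TangentSpace (𝓡 n) y from
        mfderiv (𝓡 n) (𝓡 n) (chartAt (ℰ n) x).symm
          (chartAt (ℰ n) x y) v)‖ ≤ C * ‖v‖ := by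
  have := isContinuousRiemannianBundle_tangentSpace (n := n) (N := N)
  rcases eventually_norm_symmL_trivializationAt_lt (ℰ n)
    (fun x : N => TangentSpace (𝓡 n) x) x with ⟨C, hC, h⟩
  refine ⟨C, hC, ?_⟩
  filter_upwards [h, chart_source_mem_nhds (ℰ n) x] with y hy h'y v
  have h1 := ((trivializationAt (ℰ n)
    (fun x : N => TangentSpace (𝓡 n) x) x).symmL ℝ y).le_opNorm v
  have h2 : ((trivializationAt (ℰ n)
    (fun x : N => TangentSpace (𝓡 n) x) x).symmL ℝ y) v = mfderiv (𝓡 n) (𝓡 n) (chartAt (ℰ n) x).symm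
          (chartAt (ℰ n) x y) v := by
    have := TangentBundle.symmL_trivializationAt (I := 𝓡 n) h'y
    rw [this]
    have h3 : (Set.range (𝓡 n)) = Set.univ := by simp
    rw [h3, mfderivWithin_univ]
    rfl
  rw [← h2]
  exact h1.trans (by gcongr)


lemma exists_norm_mfderiv_chart_le {e : OpenPartialHomeomorph N (ℰ n)}
    (he : e ∈ atlas (ℰ n) N) {x : N} (hx : x ∈ e.source) :
    ∃ C : ℝ, 0 < C ∧ ∀ᶠ y in 𝓝 x, ∀ v : TangentSpace (𝓡 n) y,
      ‖(show ℰ n from mfderiv (𝓡 n) (𝓡 n) e y v)‖ ≤ C * ‖v‖ := by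
  obtain ⟨C, hC, h⟩ := exists_norm_mfderiv_chartAt_le (n := n) x
  obtain ⟨C', hC', h'⟩ := exists_norm_fderiv_transition_le he (chart_mem_atlas (ℰ n) x) hx
    (mem_chart_source (ℰ n) x)
  refine ⟨C' * C, by positivity, ?_⟩
  filter_upwards [h, h', chart_source_mem_nhds (ℰ n) x, e.open_source.mem_nhds hx]
    with y hy hy' hyc hye v
  rw [mfderiv_chart_eq he (chart_mem_atlas (ℰ n) x) hye hyc, mul_assoc]
  exact (ContinuousLinearMap.le_opNorm _ _).trans
    (mul_le_mul hy' (hy v) (norm_nonneg _) hC'.le)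

lemma exists_norm_mfderiv_chart_symm_le {e : OpenPartialHomeomorph N (ℰ n)}
    (he : e ∈ atlas (ℰ n) N) {y₀ : ℰ n} (hy₀ : y₀ ∈ e.target) :
    ∃ C : ℝ, 0 < C ∧ ∀ᶠ y in 𝓝 y₀, ∀ v : ℰ n,
      ‖mfderiv (𝓡 n) (𝓡 n) e.symm y v‖ ≤ C * ‖v‖ := by
  set x := e.symm y₀ with hxdef
  have hx : x ∈ e.source := e.map_target hy₀
  set c := chartAt (ℰ n) x
  have hc : c ∈ atlas (ℰ n) N := chart_mem_atlas (ℰ n) x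
  obtain ⟨C, hC, h⟩ := exists_norm_mfderiv_chartAt_symm_le (n := n) x
  obtain ⟨C', hC', h'⟩ := exists_norm_fderiv_transition_le hc he (mem_chart_source (ℰ n) x) hx
  refine ⟨C * C', by positivity, ?_⟩
  have hcont := e.symm.continuousAt hy₀
  filter_upwards [hcont.eventually h, hcont.eventually h', e.open_target.mem_nhds hy₀,
    hcont.eventually (chart_source_mem_nhds (ℰ n) x)] with y hy hy' hyt hyc v
  rw [e.right_inv hyt] at hy'
  have h1 := mfderiv_chart_symm_eq he hc hyt hyc v
  have h2 := hy (fderiv ℝ (c ∘ e.symm) y v)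
  have h3 : mfderiv (𝓡 n) (𝓡 n) e.symm y v = (show TangentSpace (𝓡 n) (e.symm y) from
      mfderiv (𝓡 n) (𝓡 n) c.symm (c (e.symm y)) (fderiv ℝ (c ∘ e.symm) y v)) := h1
  rw [h3, mul_assoc]
  refine h2.trans ?_
  gcongr
  exact (ContinuousLinearMap.le_opNorm _ _).trans (by gcongr)

variable [IsRiemannianManifold (𝓡 n) N]

/-- The segment between two points of a ball stays in the ball, and the length of its image is at
most C times its Euclidean length. -/
lemma exists_lipschitzOnWith_chart_symm {e : OpenPartialHomeomorph N (ℰ n)}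
    (he : e ∈ atlas (ℰ n) N) {y₀ : ℰ n} (hy₀ : y₀ ∈ e.target) :
    ∃ C : ℝ≥0, ∃ r > 0, Metric.ball y₀ r ⊆ e.target ∧
      LipschitzOnWith C e.symm (Metric.ball y₀ r) := by
  obtain ⟨C, hC, h⟩ := exists_norm_mfderiv_chart_symm_le he hy₀
  obtain ⟨r, hr, hball⟩ := Metric.mem_nhds_iff.1 (h.and (e.open_target.mem_nhds hy₀))
  lift C to ℝ≥0 using hC.le
  refine ⟨C, r, hr, fun y hy => (hball hy).2, fun y hy z hz => ?_⟩
  let η := ContinuousAffineMap.lineMap (R := ℝ) y z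
  have hη : ∀ t ∈ Set.Icc (0 : ℝ) 1, η t ∈ Metric.ball y₀ r := by
    intro t ht
    exact (convex_ball y₀ r).segment_subset hy hz
      (by rw [segment_eq_image_lineMap]; exact ⟨t, ht, rfl⟩)
  have hηd : ContDiff ℝ 1 η := ContinuousAffineMap.contDiff _
  have hγ : ContMDiffOn 𝓘(ℝ, ℝ) (𝓡 n) 1 (e.symm ∘ η) (Set.Icc 0 1) := by
    have h2 := contMDiffOn_symm_of_mem_maximalAtlas (I := 𝓡 n) (n := 1)
      (IsManifold.subset_maximalAtlas he)
    exact h2.comp hηd.contMDiff.contMDiffOn (fun t ht => (hball (hη t ht)).2)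
  rw [IsRiemannianManifold.out (I := 𝓡 n)]
  refine (Manifold.riemannianEDist_le_pathELength hγ (by simp [η, ContinuousAffineMap.coe_lineMap_eq])
    (by simp [η, ContinuousAffineMap.coe_lineMap_eq])
    zero_le_one).trans ?_
  rw [Manifold.pathELength_eq_lintegral_mfderiv_Ioo, ← lintegral_fderiv_lineMap_eq_edist,
    ← lintegral_const_mul' _ _ ENNReal.coe_ne_top, ← restrict_Ioo_eq_restrict_Icc]
  refine setLIntegral_mono' measurableSet_Ioo (fun t ht => ?_)
  have ht' : t ∈ Set.Icc (0 : ℝ) 1 := ⟨ht.1.le, ht.2.le⟩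
  have h1 : fderivWithin ℝ η (Set.Icc 0 1) t = fderiv ℝ η t :=
    fderivWithin_of_mem_nhds (Icc_mem_nhds ht.1 ht.2)
  have h3 := mfderiv_comp (I := 𝓘(ℝ, ℝ)) (I' := 𝓡 n) (I'' := 𝓡 n) (g := e.symm) (f := η) t
    (mdifferentiableAt_chart_symm he (hball (hη t ht')).2)
    (hηd.differentiable one_ne_zero t).mdifferentiableAt
  rw [mfderiv_eq_fderiv] at h3
  rw [h1, h3]
  have h4 := (hball (hη t ht')).1 (fderiv ℝ η t 1)
  rw [← ENNReal.ofReal_coe_nnreal, ← ofReal_norm, ← ofReal_norm,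
    ← ENNReal.ofReal_mul hC.le]
  exact ENNReal.ofReal_le_ofReal h4

/-- A nearly shortest path between two points of the ball of radius r/4 remains in the ball of
radius r, where the derivative of the chart is bounded; the length of its image bounds the distance
in the chart. -/
lemma exists_lipschitzOnWith_chart {e : OpenPartialHomeomorph N (ℰ n)}
    (he : e ∈ atlas (ℰ n) N) {x₀ : N} (hx₀ : x₀ ∈ e.source) :
    ∃ C : ℝ≥0, ∃ V ∈ 𝓝 x₀, V ⊆ e.source ∧ LipschitzOnWith C e V := by
  obtain ⟨C, hC, h⟩ := exists_norm_mfderiv_chart_le he hx₀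
  obtain ⟨r, hr, hball⟩ := EMetric.mem_nhds_iff.1 (h.and (e.open_source.mem_nhds hx₀))
  lift C to ℝ≥0 using hC.le
  have hr4 : r / 4 ≠ 0 := by simp [hr.ne']
  have h3r : r / 4 + r / 4 + r / 4 ≤ r := by
    rw [ENNReal.div_add_div_same, ENNReal.div_add_div_same]
    refine ENNReal.div_le_of_le_mul ?_
    rw [show r * 4 = r + r + r + r by ring]
    exact le_self_add
  refine ⟨C, Metric.eball x₀ (r / 4), Metric.eball_mem_nhds _ (pos_iff_ne_zero.2 hr4),
    fun y hy => (hball (Metric.eball_subset_eball (le_trans (by rw [add_assoc]; exact le_self_add)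
      h3r) hy)).2, fun x hx y hy => ?_⟩
  have hxy : edist x y < r / 4 + r / 4 := by
    refine (edist_triangle_right x y x₀).trans_lt (ENNReal.add_lt_add hx hy)
  have key : ∀ R : ℝ≥0∞, edist x y < R → R ≤ r / 4 + r / 4 → edist (e x) (e y) ≤ C * R := by
    intro R hR hR2
    rw [IsRiemannianManifold.out (I := 𝓡 n)] at hR
    obtain ⟨γ, h0, h1, hγ, hlen⟩ := Manifold.exists_lt_of_riemannianEDist_lt hR
    have hmem : ∀ t ∈ Set.Icc (0 : ℝ) 1, γ t ∈ Metric.eball x₀ r := by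
      intro t ht
      have h5 : edist x (γ t) < R := by
        rw [IsRiemannianManifold.out (I := 𝓡 n)]
        refine lt_of_le_of_lt ?_ hlen
        refine (Manifold.riemannianEDist_le_pathELength (hγ.mono (Set.Icc_subset_Icc_right ht.2))
          h0 rfl ht.1).trans (Manifold.pathELength_mono le_rfl ht.2)
      rw [Metric.mem_eball, edist_comm]
      calc edist x₀ (γ t) ≤ edist x₀ x + edist x (γ t) := edist_triangle _ _ _
        _ < r / 4 + (r / 4 + r / 4) :=
          ENNReal.add_lt_add (by rw [edist_comm]; exact hx) (h5.trans_le hR2)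
        _ ≤ r := by rw [← add_assoc]; exact h3r
    have hd : ContMDiffOn 𝓘(ℝ, ℝ) (𝓡 n) 1 (e ∘ γ) (Set.Icc 0 1) := by
      have h2 := contMDiffOn_of_mem_maximalAtlas (I := 𝓡 n) (n := 1)
        (IsManifold.subset_maximalAtlas he)
      exact h2.comp hγ (fun t ht => (hball (hmem t ht)).2)
    have hd' : ContDiffOn ℝ 1 (e ∘ γ) (Set.Icc 0 1) := contMDiffOn_iff_contDiffOn.1 hd
    have h6 := enorm_sub_le_lintegral_derivWithin_Icc_of_contDiffOn_Icc hd' zero_le_one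
    rw [edist_comm, edist_eq_enorm_sub, ← h0, ← h1]
    refine h6.trans (le_trans ?_ (mul_le_mul' le_rfl hlen.le))
    rw [Manifold.pathELength_eq_lintegral_mfderiv_Ioo,
      ← lintegral_const_mul' _ _ ENNReal.coe_ne_top, ← restrict_Ioo_eq_restrict_Icc]
    refine setLIntegral_mono' measurableSet_Ioo (fun t ht => ?_)
    have ht' : t ∈ Set.Icc (0 : ℝ) 1 := ⟨ht.1.le, ht.2.le⟩
    have hγt : MDifferentiableAt 𝓘(ℝ, ℝ) (𝓡 n) γ t :=
      (hγ.mdifferentiableOn one_ne_zero t ht').mdifferentiableAt (Icc_mem_nhds ht.1 ht.2)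
    have h3 := mfderiv_comp (I := 𝓘(ℝ, ℝ)) (I' := 𝓡 n) (I'' := 𝓡 n) (g := e) (f := γ) t
      (mdifferentiableAt_chart he (hball (hmem t ht')).2) hγt
    rw [mfderiv_eq_fderiv] at h3
    have h8 : derivWithin (e ∘ γ) (Set.Icc 0 1) t =
        mfderiv (𝓡 n) (𝓡 n) e (γ t) (mfderiv 𝓘(ℝ, ℝ) (𝓡 n) γ t 1) := by
      rw [derivWithin_of_mem_nhds (Icc_mem_nhds ht.1 ht.2)]
      exact congrArg (fun T : ℝ →L[ℝ] ℰ n => T (1 : ℝ)) h3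
    have h4 := (hball (hmem t ht')).1 (mfderiv 𝓘(ℝ, ℝ) (𝓡 n) γ t 1)
    have h9 : ‖derivWithin (e ∘ γ) (Set.Icc 0 1) t‖ ≤ C * ‖mfderiv 𝓘(ℝ, ℝ) (𝓡 n) γ t 1‖ := by
      rw [h8]; exact h4
    rw [← ENNReal.ofReal_coe_nnreal, ← ofReal_norm, ← ofReal_norm, ← ENNReal.ofReal_mul hC.le]
    exact ENNReal.ofReal_le_ofReal h9
  -- Shortest paths need not exist, so the bound R on the length decreases to the distance.
  have hlim : Tendsto (fun R : ℝ≥0∞ => (C : ℝ≥0∞) * R) (𝓝[>] (edist x y))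
      (𝓝 (C * edist x y)) :=
    (ENNReal.Tendsto.const_mul tendsto_id (Or.inr ENNReal.coe_ne_top)).mono_left
      nhdsWithin_le_nhds
  have : (𝓝[>] (edist x y)).NeBot := nhdsGT_neBot_of_exists_gt ⟨_, hxy⟩
  refine ge_of_tendsto hlim ?_
  filter_upwards [Ioo_mem_nhdsGT hxy] with R hR using key R hR.1 hR.2.le

end RiemannianCharts

/-! ### Paths, subdivision and local contractions in the target -/

section PathsAndContractions

/-- Balls of infinite radius are both open and closed. -/
lemma edist_ne_top_of_connectedSpace {X : Type*} [EMetricSpace X] [ConnectedSpace X] (x y : X) :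
    edist x y ≠ ⊤ := by
  have h : IsClopen (Metric.eball x ⊤) := ⟨Metric.isClosed_eball_top, Metric.isOpen_eball⟩
  have h2 : Metric.eball x ⊤ = Set.univ := h.eq_univ ⟨x, Metric.mem_eball_self (by simp)⟩
  have h3 : y ∈ Metric.eball x ⊤ := by rw [h2]; trivial
  rw [Metric.mem_eball, edist_comm] at h3
  exact h3.ne

/-- A `C^1` path of length `< L`, reparametrised proportionally to its arc length. -/
lemma exists_lipschitzWith_path {n : ℕ} {N : Type*} [EMetricSpace N] [ChartedSpace (ℰ n) N]
    [RiemannianBundle (fun x : N => TangentSpace (𝓡 n) x)]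
    [IsRiemannianManifold (𝓡 n) N] {x y : N} {L : ℝ≥0} (h : edist x y < L) :
    ∃ σ : ℝ → N, LipschitzWith L σ ∧ σ 0 = x ∧ σ 1 = y := by
  rw [IsRiemannianManifold.out (I := 𝓡 n)] at h
  obtain ⟨γ, h0, h1, hγ, hlen⟩ := Manifold.exists_lt_of_riemannianEDist_lt h
  have hfin : ∀ a b : ℝ, 0 ≤ a → b ≤ 1 → Manifold.pathELength (𝓡 n) γ a b ≠ ⊤ := fun a b ha hb =>
    ((Manifold.pathELength_mono ha hb).trans_lt (hlen.trans ENNReal.coe_lt_top)).ne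
  set s : ℝ → ℝ := fun t => (Manifold.pathELength (𝓡 n) γ 0 t).toReal with hs
  have hsub : ∀ a b : ℝ, 0 ≤ a → a ≤ b → b ≤ 1 →
      s b - s a = (Manifold.pathELength (𝓡 n) γ a b).toReal := by
    intro a b ha hab hb
    simp only [hs]
    rw [← Manifold.pathELength_add ha hab,
      ENNReal.toReal_add (hfin 0 a le_rfl (hab.trans hb)) (hfin a b ha hb)]
    ring
  have hdist : ∀ a b : ℝ, 0 ≤ a → a ≤ b → b ≤ 1 →
      edist (γ a) (γ b) ≤ ENNReal.ofReal (s b - s a) := by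
    intro a b ha hab hb
    rw [hsub a b ha hab hb, ENNReal.ofReal_toReal (hfin a b ha hb),
      IsRiemannianManifold.out (I := 𝓡 n)]
    exact Manifold.riemannianEDist_le_pathELength (hγ.mono (Set.Icc_subset_Icc ha hb)) rfl rfl hab
  have hdist' : ∀ a ∈ Set.Icc (0 : ℝ) 1, ∀ b ∈ Set.Icc (0 : ℝ) 1,
      edist (γ a) (γ b) ≤ edist (s a) (s b) := by
    intro a ha b hb
    rcases le_total a b with hab | hab
    · rw [edist_comm (s a), edist_dist, Real.dist_eq]
      exact (hdist a b ha.1 hab hb.2).trans (ENNReal.ofReal_le_ofReal (le_abs_self _))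
    · rw [edist_comm, edist_dist, Real.dist_eq]
      exact (hdist b a hb.1 hab ha.2).trans (ENNReal.ofReal_le_ofReal (le_abs_self _))
  have hcont : ContinuousOn s (Set.Icc 0 1) := by
    intro t ht
    -- Continuity of the arc length is the absolute continuity of the integral of the speed.
    have key : Tendsto (fun u => ∫⁻ τ in Set.uIcc t u, 
        (Set.Icc (0:ℝ) 1).indicator (fun τ => ‖mfderiv 𝓘(ℝ, ℝ) (𝓡 n) γ τ 1‖ₑ) τ)
        (𝓝[Set.Icc 0 1] t) (𝓝 0) := by
      refine tendsto_setLIntegral_zero ?_ ?_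
      · rw [lintegral_indicator measurableSet_Icc, ← Manifold.pathELength_eq_lintegral_mfderiv_Icc]
        exact hfin 0 1 le_rfl le_rfl
      · have : Tendsto (fun u => ENNReal.ofReal |u - t|) (𝓝[Set.Icc 0 1] t) (𝓝 0) := by
          have h2 : Tendsto (fun u : ℝ => |u - t|) (𝓝[Set.Icc 0 1] t) (𝓝 0) := by
            have : ContinuousAt (fun u : ℝ => |u - t|) t := by fun_prop
            simpa using this.tendsto.mono_left nhdsWithin_le_nhds
          simpa using ENNReal.tendsto_ofReal h2
        refine this.congr (fun u => ?_)
        simp [Set.uIcc]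
        rcases le_total t u with h | h <;> simp [h, abs_of_nonneg, abs_of_nonpos]
    rw [ContinuousWithinAt, tendsto_iff_dist_tendsto_zero]
    have key2 := (ENNReal.tendsto_toReal ENNReal.zero_ne_top).comp key
    refine key2.congr' ?_
    filter_upwards [self_mem_nhdsWithin] with u hu
    simp only [Function.comp]
    rw [setLIntegral_indicator measurableSet_Icc]
    have hsubset : Set.uIcc t u ⊆ Set.Icc 0 1 := Set.uIcc_subset_Icc ht hu
    rw [Set.inter_eq_self_of_subset_right hsubset, Real.dist_eq]
    rcases le_total t u with h | h
    · rw [Set.uIcc_of_le h, ← Manifold.pathELength_eq_lintegral_mfderiv_Icc,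
        ← hsub t u ht.1 h hu.2, abs_of_nonneg]
      rw [hsub t u ht.1 h hu.2]; positivity
    · rw [Set.uIcc_of_ge h, ← Manifold.pathELength_eq_lintegral_mfderiv_Icc,
        ← hsub u t hu.1 h ht.2, abs_of_nonpos] 
      · ring
      · have := hsub u t hu.1 h ht.2
        have h3 : 0 ≤ (Manifold.pathELength (𝓡 n) γ u t).toReal := by positivity
        linarith
  have hs0 : s 0 = 0 := by simp [hs]
  have hs1 : s 1 ≤ L := by
    simpa [hs] using ENNReal.toReal_mono ENNReal.coe_ne_top hlen.le
  have hs1' : 0 ≤ s 1 := by positivity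
  -- The arc length need not be injective, but any choice of the parameter works: by `hdist'`,
  -- points of equal arc length coincide. Clamping τ to [0, 1] defines the path on the whole line.
  have hex : ∀ τ : ℝ, ∃ t ∈ Set.Icc (0 : ℝ) 1, s t = max 0 (min 1 τ) * s 1 := by
    intro τ
    have := intermediate_value_Icc zero_le_one hcont
    have h2 : max 0 (min 1 τ) * s 1 ∈ Set.Icc (s 0) (s 1) := by
      rw [hs0]
      refine ⟨by positivity, mul_le_of_le_one_left hs1' ?_⟩
      simp
    exact this h2
  choose t ht hst using hex
  refine ⟨fun τ => γ (t τ), fun τ τ' => ?_, ?_, ?_⟩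
  · refine (hdist' _ (ht τ) _ (ht τ')).trans ?_
    rw [hst, hst, edist_dist, edist_dist, ← ENNReal.ofReal_coe_nnreal,
      ← ENNReal.ofReal_mul (by positivity)]
    refine ENNReal.ofReal_le_ofReal ?_
    rw [Real.dist_eq, Real.dist_eq, ← sub_mul, abs_mul, mul_comm, abs_of_nonneg hs1']
    have h2 : |max 0 (min 1 τ) - max 0 (min 1 τ')| ≤ |τ - τ'| := by
      refine (abs_max_sub_max_le_max _ _ _ _).trans ?_
      simp only [sub_self, abs_zero]
      refine max_le (abs_nonneg _) ((abs_min_sub_min_le_max _ _ _ _).trans ?_)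
      simp
    gcongr
  · have h2 := hdist' _ ⟨le_rfl, zero_le_one⟩ _ (ht 0)
    rw [hst, hs0] at h2
    have h3 : edist (γ 0) (γ (t 0)) = 0 := by simpa using h2
    rw [← h0]; exact (edist_eq_zero.1 h3).symm
  · have h2 := hdist' _ ⟨zero_le_one, le_rfl⟩ _ (ht 1)
    rw [hst] at h2
    have h3 : edist (γ 1) (γ (t 1)) = 0 := by simpa using h2
    rw [← h1]; exact (edist_eq_zero.1 h3).symm

/-- A path of length at most L is cut into k pieces of length at most L/k ≤ δ, and the local
estimates are summed. -/
lemma edist_le_of_forall_edist_le {n : ℕ} {N F : Type*} [EMetricSpace N] [ChartedSpace (ℰ n) N]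
    [RiemannianBundle (fun x : N => TangentSpace (𝓡 n) x)]
    [IsRiemannianManifold (𝓡 n) N] [EMetricSpace F] {f : N → F} {C α : ℝ≥0} {δ : ℝ≥0∞}
    (hf : ∀ x y, edist x y ≤ δ → edist (f x) (f y) ≤ C * edist x y ^ (α : ℝ)) {x y : N} {L : ℝ≥0}
    (hL : edist x y < L) {k : ℕ} (hk : 0 < k) (hkL : ((L / k : ℝ≥0) : ℝ≥0∞) ≤ δ) :
    edist (f x) (f y) ≤ ((k * (C * (L / k) ^ (α : ℝ)) : ℝ≥0) : ℝ≥0∞) := by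
  obtain ⟨σ, hσ, h0, h1⟩ := exists_lipschitzWith_path (n := n) hL
  have hk' : (k : ℝ) ≠ 0 := by positivity
  have hstep : ∀ i : ℕ, edist (f (σ (i / k))) (f (σ ((i + 1 : ℕ) / k))) ≤
      ((C * (L / k) ^ (α : ℝ) : ℝ≥0) : ℝ≥0∞) := by
    intro i
    have h2 : edist (σ (i / k)) (σ ((i + 1 : ℕ) / k)) ≤ ((L / k : ℝ≥0) : ℝ≥0∞) := by
      refine (hσ _ _).trans (le_of_eq ?_)
      rw [edist_nndist, ← ENNReal.coe_mul]
      congr 1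
      rw [div_eq_mul_inv L]
      congr 1
      ext
      rw [coe_nndist, Real.dist_eq]
      push_cast
      rw [← sub_div, abs_div, abs_of_pos (show (0 : ℝ) < k by positivity)]
      simp [div_eq_mul_inv]
    refine (hf _ _ (h2.trans hkL)).trans ?_
    rw [ENNReal.coe_mul, ENNReal.coe_rpow_of_nonneg _ α.coe_nonneg]
    gcongr
  have hsum := edist_le_range_sum_edist (fun i : ℕ => f (σ (i / k))) k
  simp only [Nat.cast_zero, zero_div, h0, div_self hk', h1] at hsum
  refine hsum.trans ((Finset.sum_le_sum fun i _ => hstep i).trans ?_)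
  simp

/-- Radial contraction of a neighbourhood of `b`, read in a bilipschitz chart. -/
lemma exists_radial_contraction {X V : Type*} [MetricSpace X] [NormedAddCommGroup V]
    [NormedSpace ℝ V] (b : X) (a : X → V) (s : V → X) {C₁ C₂ : ℝ≥0} {r δ : ℝ} (hδ : 0 < δ)
    (hr : 0 < r)
    (ha : ∀ y, dist y b < 3 * δ → a y ∈ Metric.ball (a b) r ∧ s (a y) = y)
    (hs : LipschitzOnWith C₁ s (Metric.ball (a b) r))
    (haL : LipschitzOnWith C₂ a (Metric.ball b (3 * δ))) :
    ∃ L : ℝ≥0, ∃ T : ℝ → X → X, (∀ y, T 0 y = y) ∧ (∀ y, dist y b ≤ δ → T 1 y = b) ∧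
      ∀ t t' y y', dist (T t y) (T t' y') ≤ L * (dist y y' + dist t t') := by
  classical
  set p := a b
  have hb := ha b (by simpa using hδ)
  let cl : ℝ → ℝ := fun t => max 0 (min 1 t)
  have cl0 : ∀ t, 0 ≤ cl t := fun t => le_max_left _ _
  have cl1 : ∀ t, cl t ≤ 1 := fun t => by simp [cl]
  have clL : ∀ t t', |cl t - cl t'| ≤ |t - t'| := by
    intro t t'
    refine (abs_max_sub_max_le_max _ _ _ _).trans ?_
    simp only [sub_self, abs_zero]
    refine max_le (abs_nonneg _) ((abs_min_sub_min_le_max _ _ _ _).trans ?_)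
    simp
  -- Equal to 1 up to distance δ from b and to 0 beyond 2δ: the deformation is already the identity
  -- in the layer between 2δ and 3δ, which makes it match the identity outside.
  let χ : X → ℝ := fun y => cl (2 - dist y b / δ)
  have hχL : ∀ y y', |χ y - χ y'| ≤ dist y y' / δ := by
    intro y y'
    refine (clL _ _).trans ?_
    rw [show 2 - dist y b / δ - (2 - dist y' b / δ) = (dist y' b - dist y b) / δ by ring, abs_div,
      abs_of_pos hδ]
    gcongr
    rw [abs_sub_comm]
    exact abs_dist_sub_le y y' b
  let q : ℝ → X → V := fun t y => p + (1 - cl t * χ y) • (a y - p)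
  have hθ : ∀ t y, 0 ≤ cl t * χ y ∧ cl t * χ y ≤ 1 := fun t y =>
    ⟨mul_nonneg (cl0 _) (cl0 _), mul_le_one₀ (cl1 _) (cl0 _) (cl1 _)⟩
  have hq : ∀ t y, dist y b < 3 * δ → q t y ∈ Metric.ball p r := by
    intro t y hy
    have h1 := (ha y hy).1
    rw [Metric.mem_ball, dist_eq_norm] at h1 ⊢
    simp only [q, add_sub_cancel_left, norm_smul, Real.norm_eq_abs]
    have h2 := hθ t y
    rw [abs_of_nonneg (by linarith)]
    nlinarith [norm_nonneg (a y - p)]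
  let T : ℝ → X → X := fun t y => if dist y b < 3 * δ then s (q t y) else y
  have hfar : ∀ t y, 2 * δ ≤ dist y b → T t y = y := by
    intro t y hy
    simp only [T]
    split_ifs with h
    · have : χ y = 0 := by
        have : 2 - dist y b / δ ≤ 0 := by rw [sub_nonpos, le_div_iff₀ hδ]; linarith
        simp [χ, cl, this]
      simp [q, this, (ha y h).2]
    · rfl
  have hin : ∀ t y, dist y b < 3 * δ → dist (T t y) b ≤ C₁ * r := by
    intro t y hy
    simp only [T, hy, if_true]
    rw [← hb.2]
    refine (hs.dist_le_mul _ (hq t y hy) _ hb.1).trans ?_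
    gcongr
    exact (hq t y hy).le
  set L : ℝ≥0 := C₁ * (C₂ + ⟨r, hr.le⟩ + ⟨r / δ, by positivity⟩) + C₁ * ⟨r / δ, by positivity⟩ + 3
    with hLdef
  have hLcoe : (L : ℝ) = C₁ * (C₂ + r + r / δ) + C₁ * (r / δ) + 3 := by
    rw [hLdef]; push_cast; rfl
  have hrδ : 0 < r / δ := by positivity
  -- If y' lies beyond 3δ and y is really moved, hence within 2δ, then their distance is at least δ,
  -- and the bounded displacement C₁ r is absorbed by (C₁ r/δ) d(y, y').
  have hmixed : ∀ t t' y y', dist y b < 3 * δ → ¬ dist y' b < 3 * δ →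
      dist (T t y) (T t' y') ≤ L * (dist y y' + dist t t') := by
    intro t t' y y' hy hy'
    have hT' : T t' y' = y' := by simp [T, hy']
    have hC1 : (0 : ℝ) ≤ C₁ := C₁.2
    have hC2 : (0 : ℝ) ≤ C₂ := C₂.2
    have hL3 : C₁ * (r / δ) + 3 ≤ (L : ℝ) := by
      rw [hLcoe]
      have : 0 ≤ (C₁ : ℝ) * (C₂ + r + r / δ) := by positivity
      linarith
    have hmono : (C₁ * (r / δ) + 3) * dist y y' ≤ L * (dist y y' + dist t t') :=
      mul_le_mul hL3 (by linarith [dist_nonneg (x := t) (y := t')]) dist_nonneg L.2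
    refine le_trans ?_ hmono
    rw [hT']
    have hd0 := dist_nonneg (x := y) (y := y')
    have hc : 0 ≤ (C₁ : ℝ) * (r / δ) := by positivity
    rcases le_or_gt (2 * δ) (dist y b) with h2 | h2
    · rw [hfar t y h2]; nlinarith
    · have h3 : δ ≤ dist y y' := by
        have := dist_triangle_left y' b y
        rw [dist_comm y b] at *
        have h5 := dist_triangle y' y b
        rw [dist_comm y' y, dist_comm y b] at h5
        linarith [not_lt.1 hy']
      have h4 := hin t y hy
      have h5 : dist (T t y) y' ≤ dist (T t y) b + (dist y b + dist y y') := by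
        refine (dist_triangle _ b _).trans ?_
        gcongr
        rw [dist_comm y b]
        exact dist_triangle _ _ _
      have h6 : C₁ * r ≤ C₁ * (r / δ) * dist y y' := by
        rw [show C₁ * r = C₁ * (r / δ) * δ by field_simp]
        gcongr
      linarith
  refine ⟨L, T, fun y => ?_, fun y hy => ?_, fun t t' y y' => ?_⟩
  · simp only [T]
    split_ifs with h
    · simp [q, cl, (ha y h).2]
    · rfl
  · have h3 : dist y b < 3 * δ := by linarith
    have : χ y = 1 := by
      have : 1 ≤ 2 - dist y b / δ := by
        have : dist y b / δ ≤ 1 := (div_le_one hδ).2 hy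
        linarith
      simp [χ, cl, this]
    have h4 : T 1 y = s p := by simp [T, h3, q, this, cl]
    rw [h4, hb.2]
  · by_cases hy : dist y b < 3 * δ <;> by_cases hy' : dist y' b < 3 * δ
    · simp only [T, hy, hy', if_true]
      refine (hs.dist_le_mul _ (hq t y hy) _ (hq t' y' hy')).trans ?_
      have h1 : dist (a y) (a y') ≤ C₂ * dist y y' := haL.dist_le_mul _ hy _ hy'
      have h2 : dist (q t y) (q t' y') ≤ (C₂ + r + r / δ) * (dist y y' + dist t t') := by
        have e1 : q t y - q t' y' = (1 - cl t * χ y) • (a y - a y') +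
            (cl t' * χ y' - cl t * χ y) • (a y' - p) := by
          simp only [q]; module
        rw [dist_eq_norm, e1]
        refine (norm_add_le _ _).trans ?_
        rw [norm_smul, norm_smul, Real.norm_eq_abs, Real.norm_eq_abs, ← dist_eq_norm,
          ← dist_eq_norm]
        have h3 := hθ t y
        rw [abs_of_nonneg (show 0 ≤ 1 - cl t * χ y by linarith)]
        have h4 : |cl t' * χ y' - cl t * χ y| ≤ dist t t' + dist y y' / δ := by
          rw [show cl t' * χ y' - cl t * χ y = (cl t' - cl t) * χ y' + cl t * (χ y' - χ y) by ring]
          refine (abs_add_le _ _).trans ?_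
          rw [abs_mul, abs_mul, abs_of_nonneg (cl0 t), abs_of_nonneg (show 0 ≤ χ y' from cl0 _)]
          have h5 := clL t' t
          have h6 := hχL y' y
          rw [dist_comm t t', Real.dist_eq, dist_comm y y']
          have h7 : |cl t' - cl t| * χ y' ≤ |t' - t| :=
            (mul_le_of_le_one_right (abs_nonneg _) (cl1 _)).trans h5
          have h8 : cl t * |χ y' - χ y| ≤ dist y' y / δ :=
            (mul_le_of_le_one_left (abs_nonneg _) (cl1 _)).trans h6
          linarith
        have h5 : dist (a y') p ≤ r := le_of_lt (ha y' hy').1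
        have h6 : (1 - cl t * χ y) * dist (a y) (a y') ≤ C₂ * dist y y' :=
          (mul_le_of_le_one_left dist_nonneg (by linarith)).trans h1
        have h7 : |cl t' * χ y' - cl t * χ y| * dist (a y') p ≤ (dist t t' + dist y y' / δ) * r :=
          mul_le_mul h4 h5 dist_nonneg (by positivity)
        refine (add_le_add h6 h7).trans ?_
        have e2 : (C₂ + r + r / δ) * (dist y y' + dist t t') - (C₂ * dist y y' +
          (dist t t' + dist y y' / δ) * r) = r * dist y y' + (C₂ + r / δ) * dist t t' := by
          field_simp; ring
        have : 0 ≤ r * dist y y' + (C₂ + r / δ) * dist t t' := by positivity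
        linarith
      refine (mul_le_mul_of_nonneg_left h2 C₁.coe_nonneg).trans ?_
      rw [← mul_assoc]
      refine mul_le_mul_of_nonneg_right ?_ (by positivity)
      rw [hLcoe]
      have : 0 ≤ C₁ * (r / δ) := by positivity
      linarith
    · exact hmixed t t' y y' hy hy'
    · rw [dist_comm (T t y), dist_comm y, dist_comm t]
      exact hmixed t' t y' y hy' hy
    · simp only [T, hy, hy', if_false]
      have h1 : (1 : ℝ) ≤ L := by
        rw [hLcoe]
        have : 0 ≤ C₁ * (C₂ + r + r / δ) + C₁ * (r / δ) := by positivity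
        linarith
      nlinarith [dist_nonneg (x := y) (y := y'), dist_nonneg (x := t) (y := t')]

/-- Distances are finite because N is connected, so that the radial contraction in a chart applies.
Taking the parameter t to be a cutoff function on M turns a map into one which equals b wherever the
cutoff is 1 and the map was δ-close to b. -/
lemma exists_contraction {n : ℕ} {N : Type*} [EMetricSpace N] [ChartedSpace (ℰ n) N]
    [IsManifold (𝓡 n) ∞ N] [RiemannianBundle (fun x : N => TangentSpace (𝓡 n) x)]
    [IsContMDiffRiemannianBundle (𝓡 n) ∞ (ℰ n) (fun x : N => TangentSpace (𝓡 n) x)]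
    [IsRiemannianManifold (𝓡 n) N] [ConnectedSpace N] (b : N) :
    ∃ δ : ℝ, 0 < δ ∧ ∃ L : ℝ≥0, ∃ T : ℝ → N → N, (∀ y, T 0 y = y) ∧
      (∀ y, edist y b ≤ ENNReal.ofReal δ → T 1 y = b) ∧
      ∀ t t' y y', edist (T t y) (T t' y') ≤ L * (edist y y' + edist t t') := by
  set e := chartAt (ℰ n) b
  have he : e ∈ atlas (ℰ n) N := chart_mem_atlas (ℰ n) b
  have hb : b ∈ e.source := mem_chart_source (ℰ n) b
  obtain ⟨C₁, r, hr, hrt, hs⟩ := exists_lipschitzOnWith_chart_symm he (e.map_source hb)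
  obtain ⟨C₂, W, hW, hWs, ha⟩ := exists_lipschitzOnWith_chart he hb
  let _ : MetricSpace N := EMetricSpace.toMetricSpace edist_ne_top_of_connectedSpace
  have hcont : ContinuousAt e b := e.continuousAt hb
  obtain ⟨δ', hδ', hball⟩ := Metric.mem_nhds_iff.1
    (inter_mem hW (hcont.preimage_mem_nhds (Metric.ball_mem_nhds (e b) hr)))
  obtain ⟨L, T, h0, h1, h2⟩ := exists_radial_contraction b e e.symm (δ := δ' / 3) (by positivity) hr
    (fun y hy => by
      have hy' : y ∈ Metric.ball b δ' := by rw [Metric.mem_ball]; linarith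
      exact ⟨(hball hy').2, e.left_inv (hWs (hball hy').1)⟩) hs
    (ha.mono (fun y hy => (hball (by rw [Metric.mem_ball] at hy ⊢; linarith)).1))
  refine ⟨δ' / 3, by positivity, L, T, h0, fun y hy => h1 y ?_, fun t t' y y' => ?_⟩
  · rw [edist_dist] at hy
    exact (ENNReal.ofReal_le_ofReal_iff (by positivity)).1 hy
  · rw [edist_dist, edist_dist y, edist_dist t, ← ENNReal.ofReal_add dist_nonneg dist_nonneg,
      ← ENNReal.ofReal_coe_nnreal, ← ENNReal.ofReal_mul L.coe_nonneg]
    exact ENNReal.ofReal_le_ofReal (h2 t t' y y')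

end PathsAndContractions

/-! ### Weak directional derivatives in Euclidean space -/

section WeakDirectionalDerivatives

variable {m : ℕ}

/-- `k` is the weak derivative of `h` in the direction `v` on the open set `Ω`. -/
def HasWeakDirDeriv (Ω : Set (ℰ m)) (v : ℰ m) (h k : ℰ m → ℝ) : Prop :=
  LocallyIntegrableOn h Ω volume ∧ LocallyIntegrableOn k Ω volume ∧
    ∀ ψ : ℰ m → ℝ, ContDiff ℝ ∞ ψ → HasCompactSupport ψ → tsupport ψ ⊆ Ω →
      ∫ y in Ω, h y * fderiv ℝ ψ y v = - ∫ y in Ω, k y * ψ y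

lemma hasWeakDifferential_iff {M : Type*} [TopologicalSpace M] [ChartedSpace (ℰ m) M]
    {g : M → ℝ} {G : ∀ x : M, TangentSpace (𝓡 m) x →L[ℝ] ℝ} :
    HasWeakDifferential g G ↔ ∀ e ∈ atlas (ℰ m) M, ∀ v,
      HasWeakDirDeriv e.target v (fun y => g (e.symm y))
        (fun y => G (e.symm y) (mfderiv (𝓡 m) (𝓡 m) e.symm y v)) :=
  ⟨fun h e he v => ⟨(h e he).1, (h e he).2 v⟩,
    fun h e he => ⟨(h e he 0).1, fun v => (h e he v).2⟩⟩

lemma eq_zero_of_notMem_of_tsupport_subset {Ω : Set (ℰ m)} {ψ : ℰ m → ℝ} (h : tsupport ψ ⊆ Ω)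
    {y : ℰ m} (hy : y ∉ Ω) : ψ y = 0 :=
  image_eq_zero_of_notMem_tsupport fun h' => hy (h h')

lemma fderiv_eq_zero_of_notMem_of_tsupport_subset {Ω : Set (ℰ m)} {ψ : ℰ m → ℝ}
    (h : tsupport ψ ⊆ Ω) {y : ℰ m} (hy : y ∉ Ω) : fderiv ℝ ψ y = 0 :=
  image_eq_zero_of_notMem_tsupport fun h' => hy (h (tsupport_fderiv_subset ℝ h'))

lemma setIntegral_mul_of_tsupport_subset {Ω : Set (ℰ m)} {ψ : ℰ m → ℝ} (h : tsupport ψ ⊆ Ω)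
    (k : ℰ m → ℝ) : ∫ y in Ω, k y * ψ y = ∫ y, k y * ψ y :=
  setIntegral_eq_integral_of_forall_compl_eq_zero fun y hy => by
    rw [eq_zero_of_notMem_of_tsupport_subset h hy, mul_zero]

lemma setIntegral_mul_fderiv_of_tsupport_subset {Ω : Set (ℰ m)} {ψ : ℰ m → ℝ}
    (h : tsupport ψ ⊆ Ω) (k : ℰ m → ℝ) (v : ℰ m) :
    ∫ y in Ω, k y * fderiv ℝ ψ y v = ∫ y, k y * fderiv ℝ ψ y v :=
  setIntegral_eq_integral_of_forall_compl_eq_zero fun y hy => by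
    rw [fderiv_eq_zero_of_notMem_of_tsupport_subset h hy]; simp

lemma integrable_mul_of_hasCompactSupport {Ω : Set (ℰ m)} {h ψ : ℰ m → ℝ}
    (hh : LocallyIntegrableOn h Ω volume) (hψ : Continuous ψ) (hc : HasCompactSupport ψ)
    (hs : tsupport ψ ⊆ Ω) : Integrable (fun y => h y * ψ y) volume := by
  refine (integrableOn_iff_integrable_of_support_subset (s := tsupport ψ) ?_).1
    ((hh.integrableOn_compact_subset hs hc).mul_continuousOn hψ.continuousOn hc)
  intro y hy
  exact subset_tsupport ψ (right_ne_zero_of_mul hy)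

lemma integrable_mul_fderiv_of_hasCompactSupport {Ω : Set (ℰ m)} {h ψ : ℰ m → ℝ}
    (hh : LocallyIntegrableOn h Ω volume) (hψ : ContDiff ℝ ∞ ψ) (hc : HasCompactSupport ψ)
    (hs : tsupport ψ ⊆ Ω) (v : ℰ m) : Integrable (fun y => h y * fderiv ℝ ψ y v) volume := by
  have hsub : tsupport (fun y => fderiv ℝ ψ y v) ⊆ tsupport ψ :=
    tsupport_fderiv_apply_subset ℝ v
  refine integrable_mul_of_hasCompactSupport hh ?_ (hc.fderiv_apply ℝ v) (hsub.trans hs)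
  exact (hψ.continuous_fderiv (by simp)).clm_apply continuous_const

namespace HasWeakDirDeriv

variable {Ω Ω' : Set (ℰ m)} {v : ℰ m} {h h' k k' : ℰ m → ℝ}

lemma integral_eq (H : HasWeakDirDeriv Ω v h k) {ψ : ℰ m → ℝ} (hψ : ContDiff ℝ ∞ ψ)
    (hc : HasCompactSupport ψ) (hs : tsupport ψ ⊆ Ω) :
    ∫ y, h y * fderiv ℝ ψ y v = - ∫ y, k y * ψ y := by
  have := H.2.2 ψ hψ hc hs
  rwa [setIntegral_mul_of_tsupport_subset hs, setIntegral_mul_fderiv_of_tsupport_subset hs] at this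

lemma of_integral_eq (h1 : LocallyIntegrableOn h Ω volume) (h2 : LocallyIntegrableOn k Ω volume)
    (H : ∀ ψ : ℰ m → ℝ, ContDiff ℝ ∞ ψ → HasCompactSupport ψ → tsupport ψ ⊆ Ω →
      ∫ y, h y * fderiv ℝ ψ y v = - ∫ y, k y * ψ y) : HasWeakDirDeriv Ω v h k :=
  ⟨h1, h2, fun ψ hψ hc hs => by
    rw [setIntegral_mul_of_tsupport_subset hs, setIntegral_mul_fderiv_of_tsupport_subset hs]
    exact H ψ hψ hc hs⟩

lemma mono (H : HasWeakDirDeriv Ω v h k) (hΩ : Ω' ⊆ Ω) : HasWeakDirDeriv Ω' v h k :=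
  of_integral_eq (H.1.mono_set hΩ) (H.2.1.mono_set hΩ)
    fun _ hψ hc hs => H.integral_eq hψ hc (hs.trans hΩ)

lemma congr_ae (H : HasWeakDirDeriv Ω v h k) (hΩ : MeasurableSet Ω)
    (hh : ∀ᵐ y, y ∈ Ω → h y = h' y) (hk : ∀ᵐ y, y ∈ Ω → k y = k' y) :
    HasWeakDirDeriv Ω v h' k' := by
  have e1 : h =ᵐ[volume.restrict Ω] h' := (ae_restrict_iff' hΩ).2 hh
  have e2 : k =ᵐ[volume.restrict Ω] k' := (ae_restrict_iff' hΩ).2 hk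
  refine ⟨?_, ?_, fun ψ hψ hc hs => ?_⟩
  · intro x hx
    obtain ⟨s, hs, hs'⟩ := H.1 x hx
    refine ⟨Ω ∩ s, Filter.inter_mem self_mem_nhdsWithin hs, ?_⟩
    exact (hs'.mono_set Set.inter_subset_right).congr_fun_ae
      (ae_mono (Measure.restrict_mono Set.inter_subset_left le_rfl) e1)
  · intro x hx
    obtain ⟨s, hs, hs'⟩ := H.2.1 x hx
    refine ⟨Ω ∩ s, Filter.inter_mem self_mem_nhdsWithin hs, ?_⟩
    exact (hs'.mono_set Set.inter_subset_right).congr_fun_ae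
      (ae_mono (Measure.restrict_mono Set.inter_subset_left le_rfl) e2)
  · have := H.2.2 ψ hψ hc hs
    rw [integral_congr_ae (g := fun y => h y * fderiv ℝ ψ y v) (by
      filter_upwards [e1] with y hy; rw [hy]), this, integral_congr_ae]
    filter_upwards [e2] with y hy; rw [hy]

lemma ae_eq (H : HasWeakDirDeriv Ω v h k) (H' : HasWeakDirDeriv Ω v h k') (hΩ : IsOpen Ω) :
    ∀ᵐ y, y ∈ Ω → k y = k' y := by
  have := hΩ.ae_eq_zero_of_integral_contDiff_smul_eq_zero (μ := volume) (f := fun y => k y - k' y)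
    (H.2.1.sub H'.2.1) (fun ψ hψ hc hs => by
      have e1 := H.integral_eq hψ hc hs
      have e2 := H'.integral_eq hψ hc hs
      have i1 := integrable_mul_of_hasCompactSupport H.2.1 hψ.continuous hc hs
      have i2 := integrable_mul_of_hasCompactSupport H'.2.1 hψ.continuous hc hs
      simp only [smul_eq_mul, mul_comm (ψ _), sub_mul]
      rw [integral_sub i1 i2]
      linarith)
  filter_upwards [this] with y hy hyΩ
  exact sub_eq_zero.1 (hy hyΩ)

lemma ae_eq_of_ae_eq (H : HasWeakDirDeriv Ω v h k) (H' : HasWeakDirDeriv Ω v h' k')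
    (hΩ : IsOpen Ω) (hh : ∀ᵐ y, y ∈ Ω → h y = h' y) : ∀ᵐ y, y ∈ Ω → k y = k' y :=
  (H.congr_ae hΩ.measurableSet hh (by simp)).ae_eq H' hΩ

lemma add {v' : ℰ m} (H : HasWeakDirDeriv Ω v h k) (H' : HasWeakDirDeriv Ω v' h k') :
    HasWeakDirDeriv Ω (v + v') h (fun y => k y + k' y) := by
  refine of_integral_eq H.1 (H.2.1.add H'.2.1) fun ψ hψ hc hs => ?_
  have e1 := H.integral_eq hψ hc hs
  have e2 := H'.integral_eq hψ hc hs
  have i1 := integrable_mul_of_hasCompactSupport H.2.1 hψ.continuous hc hs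
  have i2 := integrable_mul_of_hasCompactSupport H'.2.1 hψ.continuous hc hs
  have j1 := integrable_mul_fderiv_of_hasCompactSupport H.1 hψ hc hs v
  have j2 := integrable_mul_fderiv_of_hasCompactSupport H.1 hψ hc hs v'
  simp only [map_add, mul_add, add_mul]
  rw [integral_add j1 j2, integral_add i1 i2]
  linarith

lemma smul (H : HasWeakDirDeriv Ω v h k) (c : ℝ) :
    HasWeakDirDeriv Ω (c • v) h (fun y => c * k y) := by
  refine of_integral_eq H.1 ?_ fun ψ hψ hc hs => ?_
  · intro x hx
    obtain ⟨s, hs, hs'⟩ := H.2.1 x hx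
    exact ⟨s, hs, hs'.const_mul c⟩
  have e1 := H.integral_eq hψ hc hs
  simp only [map_smul, smul_eq_mul, mul_assoc, mul_left_comm (h _)]
  rw [integral_const_mul, integral_const_mul, e1]
  ring

lemma sum {ι : Type*} (s : Finset ι) (c : ι → ℝ) (w : ι → ℰ m) (κ : ι → ℰ m → ℝ)
    (hh : LocallyIntegrableOn h Ω volume)
    (H : ∀ i ∈ s, HasWeakDirDeriv Ω (w i) h (κ i)) :
    HasWeakDirDeriv Ω (∑ i ∈ s, c i • w i) h (fun y => ∑ i ∈ s, c i * κ i y) := by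
  classical
  induction s using Finset.induction_on with
  | empty =>
    simp only [Finset.sum_empty]
    exact of_integral_eq hh (fun x _ => ⟨Set.univ, Filter.univ_mem, by simp [IntegrableOn]⟩)
      (by simp)
  | insert i s hi ih =>
    simp only [Finset.sum_insert hi]
    exact ((H i (Finset.mem_insert_self i s)).smul (c i)).add
      (ih fun j hj => H j (Finset.mem_insert_of_mem hj))

lemma const_mul (H : HasWeakDirDeriv Ω v h k) (c : ℝ) :
    HasWeakDirDeriv Ω v (fun y => c * h y) (fun y => c * k y) := by
  refine of_integral_eq ?_ ?_ fun ψ hψ hc hs => ?_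
  · intro x hx
    obtain ⟨s, hs, hs'⟩ := H.1 x hx
    exact ⟨s, hs, hs'.const_mul c⟩
  · intro x hx
    obtain ⟨s, hs, hs'⟩ := H.2.1 x hx
    exact ⟨s, hs, hs'.const_mul c⟩
  have e1 := H.integral_eq hψ hc hs
  simp only [mul_assoc]
  rw [integral_const_mul, integral_const_mul, e1]
  ring

/-- Weak differentiability is a local property. -/
lemma union {Ω₁ Ω₂ : Set (ℰ m)} (h₁ : IsOpen Ω₁) (h₂ : IsOpen Ω₂)
    (H₁ : HasWeakDirDeriv Ω₁ v h k) (H₂ : HasWeakDirDeriv Ω₂ v h k) :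
    HasWeakDirDeriv (Ω₁ ∪ Ω₂) v h k := by
  have hloc : ∀ {f : ℰ m → ℝ}, LocallyIntegrableOn f Ω₁ volume → LocallyIntegrableOn f Ω₂ volume →
      LocallyIntegrableOn f (Ω₁ ∪ Ω₂) volume := by
    rintro f f1 f2 x (hx | hx)
    · obtain ⟨s, hs, hs'⟩ := f1 x hx
      rw [h₁.nhdsWithin_eq hx] at hs
      exact ⟨s, nhdsWithin_le_nhds hs, hs'⟩
    · obtain ⟨s, hs, hs'⟩ := f2 x hx
      rw [h₂.nhdsWithin_eq hx] at hs
      exact ⟨s, nhdsWithin_le_nhds hs, hs'⟩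
  refine of_integral_eq (hloc H₁.1 H₂.1) (hloc H₁.2.1 H₂.2.1) fun ψ hψ hc hs => ?_
  -- Partition of unity: χ is 1 near the part of the support of ψ outside Ω₂ and is supported in Ω₁,
  -- so χψ is a test function on Ω₁ and (1 - χ)ψ one on Ω₂.
  have hK : IsCompact (tsupport ψ \ Ω₂) := hc.diff h₂
  have hKΩ : tsupport ψ \ Ω₂ ⊆ Ω₁ := fun x hx => (hs hx.1).resolve_right hx.2
  obtain ⟨δ, hδ, hthick⟩ := hK.exists_cthickening_subset_open h₁ hKΩ
  obtain ⟨χ, hχ1, hχ0, -⟩ := exists_contMDiffMap_one_nhds_of_subset_interior 𝓘(ℝ, ℰ m) (n := ⊤)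
    (s := tsupport ψ \ Ω₂) (t := Metric.cthickening δ (tsupport ψ \ Ω₂)) hK.isClosed
    ((Metric.self_subset_thickening hδ _).trans
      (interior_maximal (Metric.thickening_subset_cthickening δ _) Metric.isOpen_thickening))
  have hχs : ContDiff ℝ ∞ χ := χ.contMDiff.contDiff
  have hts : tsupport χ ⊆ Ω₁ := by
    refine (closure_minimal ?_ Metric.isClosed_cthickening).trans hthick
    intro x hx
    by_contra h
    exact hx (hχ0 x h)
  have a1 : tsupport (fun x => χ x * ψ x) ⊆ Ω₁ := (tsupport_mul_subset_left).trans hts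
  have a2 : tsupport (fun x => (1 - χ x) * ψ x) ⊆ Ω₂ := by
    intro x hx
    by_contra hx2
    have hxψ : x ∈ tsupport ψ := tsupport_mul_subset_right hx
    have hev : ∀ᶠ y in 𝓝 x, χ y = 1 := (eventually_nhdsSet_iff_forall.1 hχ1) x ⟨hxψ, hx2⟩
    have : x ∉ tsupport (fun x => (1 - χ x) * ψ x) := by
      rw [notMem_tsupport_iff_eventuallyEq]
      filter_upwards [hev] with y hy
      simp [hy]
    exact this hx
  have s1 : ContDiff ℝ ∞ (fun x => χ x * ψ x) := hχs.mul hψ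
  have s2 : ContDiff ℝ ∞ (fun x => (1 - χ x) * ψ x) := (contDiff_const.sub hχs).mul hψ
  have c1 : HasCompactSupport (fun x => χ x * ψ x) := hc.mul_left
  have c2 : HasCompactSupport (fun x => (1 - χ x) * ψ x) := hc.mul_left
  have e1 := H₁.integral_eq s1 c1 a1
  have e2 := H₂.integral_eq s2 c2 a2
  have hsum : ψ = fun x => χ x * ψ x + (1 - χ x) * ψ x := by ext x; ring
  have hfd : ∀ y, fderiv ℝ ψ y v = fderiv ℝ (fun x => χ x * ψ x) y v +
      fderiv ℝ (fun x => (1 - χ x) * ψ x) y v := by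
    intro y
    conv_lhs => rw [hsum]
    rw [fderiv_fun_add (s1.differentiable (by simp) y) (s2.differentiable (by simp) y)]
    rfl
  have i1 := integrable_mul_of_hasCompactSupport H₁.2.1 s1.continuous c1 a1
  have i2 := integrable_mul_of_hasCompactSupport H₂.2.1 s2.continuous c2 a2
  have j1 := integrable_mul_fderiv_of_hasCompactSupport H₁.1 s1 c1 a1 v
  have j2 := integrable_mul_fderiv_of_hasCompactSupport H₂.1 s2 c2 a2 v
  simp only [hfd, mul_add]
  rw [integral_add j1 j2, e1, e2, ← neg_add, ← integral_add i1 i2]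
  congr 2
  ext y
  ring

end HasWeakDirDeriv

end WeakDirectionalDerivatives

/-! ### Testing weak derivatives against merely continuous fields -/

section WeakDivergence

variable {m : ℕ}

/-- If `θ` is the divergence `∑ ∂_{w i} (X i)` of a continuous compactly supported field, it may be
tested against a weakly differentiable function. -/
lemma integral_mul_eq_neg_sum_of_divergence {Ω : Set (ℰ m)} (hΩ : IsOpen Ω) {ι : Type*}
    (s : Finset ι) (w : ι → ℰ m) (κ : ι → ℰ m → ℝ) {h : ℰ m → ℝ}
    (hh : LocallyIntegrableOn h Ω volume) (H : ∀ i ∈ s, HasWeakDirDeriv Ω (w i) h (κ i))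
    {X : ι → ℰ m → ℝ} {θ : ℰ m → ℝ} (hX : ∀ i ∈ s, Continuous (X i)) (hθ : Continuous θ)
    {K : Set (ℰ m)} (hK : IsCompact K) (hKΩ : K ⊆ Ω) (hXK : ∀ i ∈ s, ∀ y ∉ K, X i y = 0)
    (hθK : ∀ y ∉ K, θ y = 0)
    (hdiv : ∀ η : ℰ m → ℝ, ContDiff ℝ ∞ η → HasCompactSupport η →
      ∫ y, η y * θ y = - ∑ i ∈ s, ∫ y, fderiv ℝ η y (w i) * X i y) :
    ∫ y, h y * θ y = - ∑ i ∈ s, ∫ y, κ i y * X i y := by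
  obtain ⟨δ, hδ, hthick⟩ := hK.exists_cthickening_subset_open hΩ hKΩ
  set K' := Metric.cthickening δ K with hK'
  have hK'c : IsCompact K' := hK.cthickening
  -- Mollifiers of radius at most δ, so that regularised functions remain supported in the
  -- δ-thickening of K, which lies in Ω.
  let φ : ℕ → ContDiffBump (0 : ℰ m) := fun n =>
    ⟨δ / (2 * (n + 1)), δ / (n + 1), by positivity, by
      apply div_lt_div_of_pos_left hδ (by positivity); linarith [(n.cast_nonneg : (0 : ℝ) ≤ n)]⟩
  have hφ0 : Tendsto (fun n => (φ n).rOut) atTop (𝓝 0) := by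
    have := (tendsto_const_nhds (x := δ)).div_atTop
      (tendsto_natCast_atTop_atTop (R := ℝ) |>.atTop_add (tendsto_const_nhds (x := (1 : ℝ))))
    exact this
  have hφδ : ∀ n, (φ n).rOut ≤ δ := fun n => div_le_self hδ.le (by linarith [(n.cast_nonneg : (0 : ℝ) ≤ n)])
  let reg : ℕ → (ℰ m → ℝ) → ℰ m → ℝ := fun n Y =>
    convolution ((φ n).normed volume) Y (ContinuousLinearMap.lsmul ℝ ℝ) volume
  have hregC : ∀ n Y, Continuous Y → ContDiff ℝ ∞ (reg n Y) := fun n Y hY =>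
    (φ n).hasCompactSupport_normed.contDiff_convolution_left _ (φ n).contDiff_normed
      hY.locallyIntegrable
  have hregS : ∀ n Y, (∀ y ∉ K, Y y = 0) → ∀ y ∉ K', reg n Y y = 0 := by
    intro n Y hY y hy
    by_contra hne
    have h1 := support_convolution_subset (μ := volume) (ContinuousLinearMap.lsmul ℝ ℝ) hne
    obtain ⟨a, ha, b, hb, rfl⟩ := h1
    rw [(φ n).support_normed_eq] at ha
    have hbK : b ∈ K := by by_contra h; exact hb (hY b h)
    apply hy
    apply Metric.mem_cthickening_of_dist_le (a + b) b δ K hbK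
    rw [dist_eq_norm, add_sub_cancel_right, ← dist_zero_right]
    exact (Metric.mem_ball.1 ha).le.trans (hφδ n)
  have hregT : ∀ n Y, (∀ y ∉ K, Y y = 0) → tsupport (reg n Y) ⊆ K' := fun n Y hY =>
    closure_minimal (fun y hy => by by_contra h; exact hy (hregS n Y hY y h))
      Metric.isClosed_cthickening
  have hregcs : ∀ n Y, (∀ y ∉ K, Y y = 0) → HasCompactSupport (reg n Y) := fun n Y hY =>
    hK'c.of_isClosed_subset (isClosed_tsupport _) (hregT n Y hY)
  have hswap : ∀ n Y y, reg n Y y = ∫ t, (φ n).normed volume (y - t) * Y t := fun n Y y => by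
    simp only [reg, convolution_eq_swap]; rfl
  have hregfd : ∀ n Y, Continuous Y → ∀ y u, fderiv ℝ (reg n Y) y u =
      ∫ t, fderiv ℝ ((φ n).normed volume) (y - t) u * Y t := by
    intro n Y hY y u
    have hcd : ContDiff ℝ 1 ((φ n).normed volume) := (φ n).contDiff_normed
    rw [((φ n).hasCompactSupport_normed.hasFDerivAt_convolution_left (ContinuousLinearMap.lsmul ℝ ℝ)
      hcd hY.locallyIntegrable y).fderiv, convolution_eq_swap,
      ContinuousLinearMap.integral_apply]
    · rfl
    · have hcs : HasCompactSupport ((φ n).normed (volume : Measure (ℰ m))) :=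
        (φ n).hasCompactSupport_normed
      have := (hcs.fderiv (𝕜 := ℝ)).convolutionExists_left (μ := volume)
        (ContinuousLinearMap.precompL (ℰ m) (ContinuousLinearMap.lsmul ℝ ℝ))
        (hcd.continuous_fderiv one_ne_zero) hY.locallyIntegrable y
      exact this.integrable_swap
  -- The divergence commutes with the mollification: `hdiv` is applied to the reflected mollifier
  -- translated to y.
  have hsum : ∀ n y, ∑ i ∈ s, fderiv ℝ (reg n (X i)) y (w i) = reg n θ y := by
    intro n y
    let η : ℰ m → ℝ := fun t => (φ n).normed volume (y - t)
    have hη : ContDiff ℝ ∞ η := ((φ n).contDiff_normed).comp (contDiff_const.sub contDiff_id)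
    have hηc : HasCompactSupport η :=
      (φ n).hasCompactSupport_normed.comp_homeomorph (Homeomorph.subLeft y)
    have hηd : ∀ t u, fderiv ℝ η t u = - fderiv ℝ ((φ n).normed volume) (y - t) u := by
      intro t u
      have h1 : HasFDerivAt (fun t : ℰ m => y - t) (-ContinuousLinearMap.id ℝ (ℰ m)) t := by
        exact (hasFDerivAt_id t).const_sub y
      have h2 : DifferentiableAt ℝ ((φ n).normed volume) (y - t) :=
        ((φ n).contDiff_normed (n := 1)).differentiable one_ne_zero _
      have := (h2.hasFDerivAt.comp t h1).fderiv
      rw [show η = (φ n).normed volume ∘ (fun t => y - t) from rfl, this]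
      simp
    have h3 := hdiv η hη hηc
    rw [hswap, show (∫ t, (φ n).normed volume (y - t) * θ t) = ∫ t, η t * θ t from rfl, h3,
      ← Finset.sum_neg_distrib]
    refine Finset.sum_congr rfl fun i hi => ?_
    rw [hregfd n _ (hX i hi), ← integral_neg]
    simp only [hηd, neg_mul, neg_neg]
  have hstep : ∀ n, ∫ y, h y * reg n θ y = - ∑ i ∈ s, ∫ y, κ i y * reg n (X i) y := by
    intro n
    simp only [← hsum, Finset.mul_sum]
    rw [integral_finsetSum, ← Finset.sum_neg_distrib]
    · exact Finset.sum_congr rfl fun i hi => (H i hi).integral_eq (hregC n _ (hX i hi))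
        (hregcs n _ (hXK i hi)) ((hregT n _ (hXK i hi)).trans hthick)
    · exact fun i hi => integrable_mul_fderiv_of_hasCompactSupport hh (hregC n _ (hX i hi))
        (hregcs n _ (hXK i hi)) ((hregT n _ (hXK i hi)).trans hthick) _
  have hlim : ∀ f : ℰ m → ℝ, LocallyIntegrableOn f Ω volume → ∀ Y, Continuous Y →
      (∀ y ∉ K, Y y = 0) →
      Tendsto (fun n => ∫ y, f y * reg n Y y) atTop (𝓝 (∫ y, f y * Y y)) := by
    intro f hf Y hY hYK
    obtain ⟨C, hC⟩ := hK.exists_bound_of_continuousOn hY.continuousOn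
    have hC' : ∀ y, ‖Y y‖ ≤ max C 0 := by
      intro y
      by_cases hy : y ∈ K
      · exact (hC y hy).trans (le_max_left _ _)
      · simp [hYK y hy]
    have hbd : ∀ n y, ‖reg n Y y‖ ≤ max C 0 := by
      intro n y
      have := dist_convolution_le (μ := volume) (f := (φ n).normed volume) (g := Y) (x₀ := y)
        (R := (φ n).rOut) (ε := max C 0) (z₀ := 0) (le_max_right _ _) (φ n).support_normed_eq.subset
        (φ n).nonneg_normed (φ n).integral_normed hY.aestronglyMeasurable
        (fun x _ => by rw [dist_zero_right]; exact hC' x)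
      rwa [dist_zero_right] at this
    have hfK : IntegrableOn f K' volume := hf.integrableOn_compact_subset hthick hK'c
    refine tendsto_integral_of_dominated_convergence
      (K'.indicator fun y => ‖f y‖ * max C 0) ?_ ?_ ?_ ?_
    · intro n
      exact (integrable_mul_of_hasCompactSupport hf (hregC n Y hY).continuous (hregcs n Y hYK)
        ((hregT n Y hYK).trans hthick)).aestronglyMeasurable
    · rw [integrable_indicator_iff hK'c.measurableSet]
      exact hfK.norm.mul_const _
    · intro n
      refine Eventually.of_forall fun y => ?_
      by_cases hy : y ∈ K'
      · rw [Set.indicator_of_mem hy, norm_mul]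
        gcongr
        exact hbd n y
      · rw [Set.indicator_of_notMem hy, hregS n Y hYK y hy]; simp
    · refine Eventually.of_forall fun y => ?_
      exact (ContDiffBump.convolution_tendsto_right_of_continuous hφ0 hY y).const_mul _
  have l1 := hlim h hh θ hθ hθK
  have l2 : Tendsto (fun n => - ∑ i ∈ s, ∫ y, κ i y * reg n (X i) y) atTop
      (𝓝 (- ∑ i ∈ s, ∫ y, κ i y * X i y)) :=
    (tendsto_finsetSum s fun i hi =>
      hlim (κ i) (H i hi).2.1 (X i) (hX i hi) (hXK i hi)).neg
  exact tendsto_nhds_unique l1 (l2.congr fun n => (hstep n).symm)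

end WeakDivergence

/-! ### Increments of weakly differentiable functions along translations -/

section TranslationFormula

variable {m : ℕ}

lemma integrable_comp_add_smul {k : ℰ m → ℝ} (hk : Integrable k volume) (v : ℰ m) :
    Integrable (fun z : ℝ × ℰ m => k (z.2 + z.1 • v))
      ((volume.restrict (Set.Icc (0 : ℝ) 1)).prod volume) := by
  have hmp : MeasurePreserving (fun z : ℝ × ℰ m => (z.1, z.2 + z.1 • v))
      ((volume.restrict (Set.Icc (0 : ℝ) 1)).prod volume)
      ((volume.restrict (Set.Icc (0 : ℝ) 1)).prod volume) :=
    (MeasurePreserving.id _).skew_product (g := fun t (x : ℰ m) => x + t • v) (by fun_prop)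
      (Eventually.of_forall fun t => (measurePreserving_add_right volume (t • v)).map_eq)
  exact hmp.integrable_comp_of_integrable (g := fun z => k z.2) (hk.comp_snd _)

lemma integral_mul_integral_translate {k ψ : ℰ m → ℝ} (hk : Integrable k volume)
    (hψ : Continuous ψ) (hc : HasCompactSupport ψ) (v : ℰ m) :
    ∫ x, k x * ∫ t in Set.Icc (0 : ℝ) 1, ψ (x - t • v) =
      ∫ x, ψ x * ∫ t in Set.Icc (0 : ℝ) 1, k (x + t • v) := by
  obtain ⟨C, hC⟩ := hc.exists_bound_of_continuous hψ
  have i1 : Integrable (fun z : ℝ × ℰ m => k z.2 * ψ (z.2 - z.1 • v))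
      ((volume.restrict (Set.Icc (0 : ℝ) 1)).prod volume) := by
    refine (hk.comp_snd _).mul_bdd (c := C) ?_ (Eventually.of_forall fun z => hC _)
    exact (hψ.comp (by fun_prop)).aestronglyMeasurable
  have i2 : Integrable (fun z : ℝ × ℰ m => k (z.2 + z.1 • v) * ψ z.2)
      ((volume.restrict (Set.Icc (0 : ℝ) 1)).prod volume) := by
    refine (integrable_comp_add_smul hk v).mul_bdd (c := C) ?_ (Eventually.of_forall fun z => hC _)
    exact (hψ.comp (by fun_prop)).aestronglyMeasurable
  calc ∫ x, k x * ∫ t in Set.Icc (0 : ℝ) 1, ψ (x - t • v)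
      = ∫ x, ∫ t in Set.Icc (0 : ℝ) 1, k x * ψ (x - t • v) := by
        simp only [integral_const_mul]
    _ = ∫ t in Set.Icc (0 : ℝ) 1, ∫ x, k x * ψ (x - t • v) :=
        (integral_integral_swap (f := fun t x => k x * ψ (x - t • v)) i1).symm
    _ = ∫ t in Set.Icc (0 : ℝ) 1, ∫ x, k (x + t • v) * ψ x := by
        congr 1
        ext t
        rw [← integral_add_right_eq_self (fun x => k x * ψ (x - t • v)) (t • v)]
        simp
    _ = ∫ x, ∫ t in Set.Icc (0 : ℝ) 1, k (x + t • v) * ψ x :=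
        integral_integral_swap (f := fun t x => k (x + t • v) * ψ x) i2
    _ = _ := by
        congr 1
        ext x
        rw [integral_mul_const, mul_comm]

lemma sub_eq_setIntegral_fderiv {η : ℰ m → ℝ} (hη : ContDiff ℝ 1 η) (x v : ℰ m) :
    η (x + v) - η x = ∫ t in Set.Icc (0 : ℝ) 1, fderiv ℝ η (x + t • v) v := by
  have h1 : ∀ t ∈ Set.uIcc (0 : ℝ) 1,
      HasDerivAt (fun t : ℝ => η (x + t • v)) (fderiv ℝ η (x + t • v) v) t := by
    intro t _
    have h2 : HasDerivAt (fun t : ℝ => x + t • v) v t := by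
      simpa using ((hasDerivAt_id t).smul_const v).const_add x
    exact ((hη.differentiable one_ne_zero _).hasFDerivAt.comp_hasDerivAt t h2)
  have h3 : Continuous fun t : ℝ => fderiv ℝ η (x + t • v) v :=
    ((hη.continuous_fderiv one_ne_zero).comp (by fun_prop)).clm_apply continuous_const
  have := intervalIntegral.integral_eq_sub_of_hasDerivAt h1 (h3.intervalIntegrable _ _)
  rw [integral_Icc_eq_integral_Ioc, ← intervalIntegral.integral_of_le zero_le_one, this]
  simp

/-- The fundamental theorem of calculus along translations for weakly differentiable functions. -/
lemma HasWeakDirDeriv.ae_sub_eq_integral {Ω W : Set (ℰ m)} {v : ℰ m} {h k : ℰ m → ℝ}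
    (H : HasWeakDirDeriv Ω v h k) (hΩ : IsOpen Ω) (hW : IsOpen W)
    (hWΩ : ∀ x ∈ W, ∀ t ∈ Set.Icc (0 : ℝ) 1, x + t • v ∈ Ω)
    (hh : IntegrableOn h Ω volume) (hk : IntegrableOn k Ω volume) :
    ∀ᵐ x, x ∈ W → h (x + v) - h x = ∫ t in Set.Icc (0 : ℝ) 1, k (x + t • v) := by
  set h' := Ω.indicator h with hh'
  set k' := Ω.indicator k with hk'
  have ih : Integrable h' volume := (integrable_indicator_iff hΩ.measurableSet).2 hh
  have ik : Integrable k' volume := (integrable_indicator_iff hΩ.measurableSet).2 hk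
  have ik2 : Integrable (fun x => ∫ t in Set.Icc (0 : ℝ) 1, k' (x + t • v)) volume :=
    (integrable_comp_add_smul ik v).integral_prod_right
  have ih2 : Integrable (fun x => h' (x + v)) volume := ih.comp_add_right v
  have key := hW.ae_eq_zero_of_integral_contDiff_smul_eq_zero (μ := volume)
    (f := fun x => h' (x + v) - h' x - ∫ t in Set.Icc (0 : ℝ) 1, k' (x + t • v))
    (((ih2.sub ih).sub ik2).locallyIntegrable.locallyIntegrableOn W) (fun ψ hψ hc hs => by
      have hψc := hψ.continuous
      obtain ⟨C, hC⟩ := hc.exists_bound_of_continuous hψc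
      have hbd : ∀ f : ℰ m → ℝ, Integrable f volume → Integrable (fun x => ψ x * f x) volume :=
        fun f hf => hf.bdd_mul hψc.aestronglyMeasurable (Eventually.of_forall hC)
      let K : Set (ℰ m) := (fun z : ℝ × ℰ m => z.2 + z.1 • v) '' (Set.Icc (0 : ℝ) 1 ×ˢ tsupport ψ)
      have hK : IsCompact K := (isCompact_Icc.prod hc).image (by fun_prop)
      have hKΩ : K ⊆ Ω := by
        rintro _ ⟨⟨t, x⟩, ⟨ht, hx⟩, rfl⟩
        exact hWΩ x (hs hx) t ht
      have hKmem : ∀ t ∈ Set.Icc (0 : ℝ) 1, ∀ x ∉ K, ψ (x - t • v) = 0 := by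
        intro t ht x hx
        by_contra hne
        exact hx ⟨(t, x - t • v), ⟨ht, subset_tsupport ψ hne⟩, by simp⟩
      -- The derivative in the direction v of the average Ψ of the translates of ψ is ψ - ψ(· - v).
      -- Testing h against this difference gives -∫ k Ψ, and Fubini moves the average from ψ to k.
      -- Only the continuity of Ψ is needed, thanks to the divergence lemma.
      let Ψ : ℰ m → ℝ := fun x => ∫ t in Set.Icc (0 : ℝ) 1, ψ (x - t • v)
      have hΨ : Continuous Ψ :=
        continuous_parametric_integral_of_continuous
          (f := fun (x : ℰ m) (t : ℝ) => ψ (x - t • v)) (by fun_prop) isCompact_Icc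
      have hHrest : ∀ η : ℰ m → ℝ, ContDiff ℝ ∞ η → HasCompactSupport η →
          ∫ y, η y * (ψ y - ψ (y - v)) = - ∑ i ∈ {()}, ∫ y, fderiv ℝ η y v * Ψ y := by
        intro η hη hηc
        have hη1 : ContDiff ℝ 1 η := hη.of_le (by exact_mod_cast le_top)
        have iη : Integrable (fun y => fderiv ℝ η y v) volume :=
          ((hη1.continuous_fderiv one_ne_zero).clm_apply
            continuous_const).integrable_of_hasCompactSupport (hηc.fderiv_apply ℝ v)
        rw [Finset.sum_singleton, integral_mul_integral_translate iη hψc hc v]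
        simp only [← sub_eq_setIntegral_fderiv hη1, mul_sub]
        have iηψ : Integrable (fun x => η x * ψ x) volume :=
          (hη.continuous.mul hψc).integrable_of_hasCompactSupport hc.mul_left
        have iηψ' : Integrable (fun x => η x * ψ (x - v)) volume :=
          (hη.continuous.mul (hψc.comp (by fun_prop))).integrable_of_hasCompactSupport
            hηc.mul_right
        have iηψ2 : Integrable (fun x => ψ x * η (x + v)) volume :=
          (hψc.mul (hη.continuous.comp (by fun_prop))).integrable_of_hasCompactSupport
            hc.mul_right
        have iηψ3 : Integrable (fun x => ψ x * η x) volume := by simpa only [mul_comm] using iηψ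
        rw [integral_sub iηψ iηψ', integral_sub iηψ2 iηψ3,
          ← integral_add_right_eq_self (fun x => η x * ψ (x - v)) v]
        simp only [add_sub_cancel_right, mul_comm (ψ _)]
        ring
      have hTE := integral_mul_eq_neg_sum_of_divergence hΩ {()} (fun _ => v) (fun _ => k) H.1
        (fun _ _ => H) (X := fun _ => Ψ) (θ := fun y => ψ y - ψ (y - v)) (fun _ _ => hΨ)
        (hψc.sub (hψc.comp (by fun_prop))) hK hKΩ
        (fun _ _ y hy => by
          simp only [Ψ]
          rw [setIntegral_congr_fun measurableSet_Icc (fun t ht => hKmem t ht y hy)]; simp)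
        (fun y hy => by
          have h0 := hKmem 0 ⟨le_rfl, zero_le_one⟩ y hy
          have h1 := hKmem 1 ⟨zero_le_one, le_rfl⟩ y hy
          simp only [zero_smul, sub_zero, one_smul] at h0 h1
          rw [h0, h1, sub_zero])
        hHrest
      rw [Finset.sum_singleton] at hTE
      have e1 : ∫ y, h y * (ψ y - ψ (y - v)) = ∫ y, h' y * (ψ y - ψ (y - v)) := by
        congr 1; ext y
        by_cases hy : y ∈ Ω
        · simp [hh', hy]
        · have hyK : y ∉ K := fun h => hy (hKΩ h)
          have h0 := hKmem 0 ⟨le_rfl, zero_le_one⟩ y hyK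
          have h1 := hKmem 1 ⟨zero_le_one, le_rfl⟩ y hyK
          simp only [zero_smul, sub_zero, one_smul] at h0 h1
          simp [h0, h1]
      have e2 : ∫ y, k y * Ψ y = ∫ y, k' y * Ψ y := by
        congr 1; ext y
        by_cases hy : y ∈ Ω
        · simp [hk', hy]
        · have hyK : y ∉ K := fun h => hy (hKΩ h)
          have : Ψ y = 0 := by
            simp only [Ψ]
            rw [setIntegral_congr_fun measurableSet_Icc (fun t ht => hKmem t ht y hyK)]; simp
          simp [this]
      rw [e1, e2, integral_mul_integral_translate ik hψc hc v] at hTE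
      simp only [smul_eq_mul, mul_sub]
      have i6 : Integrable (fun x => ψ x * h' (x + v) - ψ x * h' x) volume :=
        (hbd _ ih2).sub (hbd _ ih)
      rw [integral_sub i6 (hbd _ ik2),
        integral_sub (hbd _ ih2) (hbd _ ih)]
      have i4 : Integrable (fun y => h' y * ψ y) volume := by
        simpa only [mul_comm] using hbd _ ih
      have i5 : Integrable (fun y => h' y * ψ (y - v)) volume :=
        ih.mul_bdd (c := C) (hψc.comp (by fun_prop)).aestronglyMeasurable
          (Eventually.of_forall fun y => hC _)
      simp only [mul_sub] at hTE
      rw [integral_sub i4 i5, ← integral_add_right_eq_self (fun y => h' y * ψ (y - v)) v] at hTE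
      simp only [add_sub_cancel_right] at hTE
      simp only [mul_comm (ψ _)] at hTE ⊢
      linarith)
  filter_upwards [key] with x hx hxW
  have h0 : x ∈ Ω := by simpa using hWΩ x hxW 0 ⟨le_rfl, zero_le_one⟩
  have h1 : x + v ∈ Ω := by simpa using hWΩ x hxW 1 ⟨zero_le_one, le_rfl⟩
  have h2 := hx hxW
  have h3 : ∫ t in Set.Icc (0 : ℝ) 1, k' (x + t • v) =
      ∫ t in Set.Icc (0 : ℝ) 1, k (x + t • v) :=
    setIntegral_congr_fun measurableSet_Icc fun t ht => by
      simp [hk', hWΩ x hxW t ht]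
  rw [h3] at h2
  simp only [hh', Set.indicator_of_mem h0, Set.indicator_of_mem h1] at h2
  linarith

end TranslationFormula

/-! ### Bounding the distributional derivative by controlling translates -/

section WeakDerivativeExistence

variable {m : ℕ}

lemma lintegral_mul_lintegral_translate {f G : ℰ m → ℝ≥0∞} (hf : Measurable f)
    (hG : Measurable G) (v : ℰ m) :
    ∫⁻ x, f x * ∫⁻ t in Set.Icc (0 : ℝ) 1, G (x + t • v) =
      ∫⁻ t in Set.Icc (0 : ℝ) 1, ∫⁻ x, f (x - t • v) * G x := by
  calc ∫⁻ x, f x * ∫⁻ t in Set.Icc (0 : ℝ) 1, G (x + t • v)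
      = ∫⁻ x, ∫⁻ t in Set.Icc (0 : ℝ) 1, f x * G (x + t • v) := by
        refine lintegral_congr fun x => ?_
        rw [lintegral_const_mul _ (by fun_prop)]
    _ = ∫⁻ t in Set.Icc (0 : ℝ) 1, ∫⁻ x, f x * G (x + t • v) := by
        rw [lintegral_lintegral_swap]
        exact Measurable.aemeasurable (by fun_prop)
    _ = _ := by
        refine lintegral_congr fun t => ?_
        rw [← lintegral_sub_right_eq_self _ (t • v)]
        simp

/-- The derivative of ψ is the limit of its difference quotients; a translation moves the difference
onto H, where the hypothesis applies, and Fubini moves the average over the segment onto ψ.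
Replacing the translates of ψ by ψ costs at most L ε ‖v‖ ∫ G, which vanishes in the limit. -/
lemma enorm_integral_mul_fderiv_le {B : Set (ℰ m)} (hB : IsOpen B) {v : ℰ m} {H : ℰ m → ℝ}
    (hH : IntegrableOn H B volume) {G : ℰ m → ℝ≥0∞} (hG : Measurable G)
    (hGi : ∫⁻ x in B, G x ≠ ⊤)
    (hyp : ∀ ε : ℝ, 0 < ε → ∀ᵐ x, x ∈ B → x + ε • v ∈ B →
      ‖H (x + ε • v) - H x‖ₑ ≤ ‖ε • v‖ₑ * ∫⁻ t in Set.Icc (0 : ℝ) 1, G (x + t • ε • v))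
    {ψ : ℰ m → ℝ} (hψ : ContDiff ℝ ∞ ψ) (hc : HasCompactSupport ψ) (hs : tsupport ψ ⊆ B) :
    ‖∫ y, H y * fderiv ℝ ψ y v‖ₑ ≤ ‖v‖ₑ * ∫⁻ y in B, ‖ψ y‖ₑ * G y := by
  set H' := B.indicator H with hH'
  set G' := B.indicator G with hG'
  have hG'm : Measurable G' := hG.indicator hB.measurableSet
  have iH : Integrable H' volume := (integrable_indicator_iff hB.measurableSet).2 hH
  have hG'i : ∫⁻ x, G' x ≠ ⊤ := by rwa [hG', lintegral_indicator hB.measurableSet]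
  obtain ⟨L, hL⟩ := hψ.lipschitzWith_of_hasCompactSupport hc (by simp)
  have hψc := hψ.continuous
  obtain ⟨C, hC⟩ := hc.exists_bound_of_continuous hψc
  obtain ⟨δ, hδ, hthick⟩ := IsCompact.exists_cthickening_subset_open hc hB hs
  have hψ0 : ∀ y ∉ B, ψ y = 0 := fun y hy => eq_zero_of_notMem_of_tsupport_subset hs hy
  have bound : ∀ ε : ℝ, 0 < ε → ε * ‖v‖ ≤ δ →
      ‖∫ y, H' y * (ε⁻¹ * (ψ y - ψ (y - ε • v)))‖ₑ ≤
        ‖v‖ₑ * ((∫⁻ y, ‖ψ y‖ₑ * G' y) + ENNReal.ofReal (L * (ε * ‖v‖)) * ∫⁻ y, G' y) := by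
    intro ε hε hεδ
    have i1 : Integrable (fun y => H' y * ψ y) volume :=
      iH.mul_bdd (c := C) hψc.aestronglyMeasurable (Eventually.of_forall hC)
    have i2 : Integrable (fun y => H' y * ψ (y - ε • v)) volume :=
      iH.mul_bdd (c := C) (hψc.comp (by fun_prop)).aestronglyMeasurable
        (Eventually.of_forall fun y => hC _)
    have i3 : Integrable (fun y => H' (y + ε • v) * ψ y) volume :=
      (iH.comp_add_right (ε • v)).mul_bdd (c := C) hψc.aestronglyMeasurable
        (Eventually.of_forall hC)
    have e1 : ∫ y, H' y * (ε⁻¹ * (ψ y - ψ (y - ε • v))) =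
        ε⁻¹ * ∫ y, (H' y - H' (y + ε • v)) * ψ y := by
      have : ∀ y, H' y * (ε⁻¹ * (ψ y - ψ (y - ε • v))) =
        ε⁻¹ * (H' y * ψ y - H' y * ψ (y - ε • v)) := fun y => by ring
      simp only [this, sub_mul]
      rw [integral_const_mul, integral_sub i1 i2, integral_sub i1 i3,
        ← integral_add_right_eq_self (fun y => H' y * ψ (y - ε • v)) (ε • v)]
      simp
    have e2 : ∫⁻ y, ‖(H' y - H' (y + ε • v)) * ψ y‖ₑ ≤
        ∫⁻ y, ‖ψ y‖ₑ * (‖ε • v‖ₑ * ∫⁻ t in Set.Icc (0 : ℝ) 1, G' (y + t • ε • v)) := by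
      refine lintegral_mono_ae ?_
      filter_upwards [hyp ε hε] with y hy
      rw [enorm_mul, mul_comm]
      by_cases hyψ : ψ y = 0
      · simp [hyψ]
      gcongr
      have hyt : y ∈ tsupport ψ := subset_tsupport ψ hyψ
      have hmem : ∀ t ∈ Set.Icc (0 : ℝ) 1, y + t • ε • v ∈ B := by
        intro t ht
        refine hthick (Metric.mem_cthickening_of_dist_le _ y δ _ hyt ?_)
        rw [dist_eq_norm, add_sub_cancel_left, norm_smul, norm_smul, Real.norm_of_nonneg ht.1,
          Real.norm_of_nonneg hε.le]
        have : 0 ≤ ε * ‖v‖ := by positivity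
        nlinarith [ht.2]
      have h0 := hmem 0 ⟨le_rfl, zero_le_one⟩
      have h1 := hmem 1 ⟨zero_le_one, le_rfl⟩
      simp only [zero_smul, add_zero, one_smul] at h0 h1
      rw [hH', Set.indicator_of_mem h0, Set.indicator_of_mem h1, enorm_sub_rev]
      refine (hy h0 h1).trans (mul_le_mul_right (le_of_eq ?_) _)
      exact setLIntegral_congr_fun measurableSet_Icc fun t ht => by
        rw [hG', Set.indicator_of_mem (hmem t ht)]
    have e3 : ∫⁻ y, ‖ψ y‖ₑ * (‖ε • v‖ₑ * ∫⁻ t in Set.Icc (0 : ℝ) 1, G' (y + t • ε • v)) =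
        ‖ε • v‖ₑ * ∫⁻ t in Set.Icc (0 : ℝ) 1, ∫⁻ y, ‖ψ (y - t • ε • v)‖ₑ * G' y := by
      rw [← lintegral_mul_lintegral_translate (f := fun y => ‖ψ y‖ₑ) hψc.measurable.enorm hG'm,
        ← lintegral_const_mul' _ _ (by simp)]
      refine lintegral_congr fun y => ?_
      ring
    have e4 : ∀ t ∈ Set.Icc (0 : ℝ) 1, ∫⁻ y, ‖ψ (y - t • ε • v)‖ₑ * G' y ≤
        (∫⁻ y, ‖ψ y‖ₑ * G' y) + ENNReal.ofReal (L * (ε * ‖v‖)) * ∫⁻ y, G' y := by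
      intro t ht
      rw [← lintegral_const_mul _ hG'm, ← lintegral_add_right _ (by fun_prop)]
      refine lintegral_mono fun y => ?_
      rw [← add_mul]
      gcongr
      have h1 : ‖ψ (y - t • ε • v)‖ ≤ ‖ψ y‖ + L * (ε * ‖v‖) := by
        have h2 := hL.dist_le_mul (y - t • ε • v) y
        rw [dist_eq_norm, dist_eq_norm, sub_sub_cancel_left, norm_neg, norm_smul, norm_smul,
          Real.norm_of_nonneg ht.1, Real.norm_of_nonneg hε.le] at h2
        have h3 : t * (ε * ‖v‖) ≤ ε * ‖v‖ := by
          have : 0 ≤ ε * ‖v‖ := by positivity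
          nlinarith [ht.2]
        have h4 := mul_le_mul_of_nonneg_left h3 L.coe_nonneg
        have h5 := norm_sub_norm_le (ψ (y - t • ε • v)) (ψ y)
        linarith
      rw [← ofReal_norm, ← ofReal_norm, ← ENNReal.ofReal_add (norm_nonneg _) (by positivity)]
      exact ENNReal.ofReal_le_ofReal h1
    rw [e1, enorm_mul]
    calc ‖ε⁻¹‖ₑ * ‖∫ y, (H' y - H' (y + ε • v)) * ψ y‖ₑ
        ≤ ‖ε⁻¹‖ₑ * (‖ε • v‖ₑ * ∫⁻ t in Set.Icc (0 : ℝ) 1,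
          ((∫⁻ y, ‖ψ y‖ₑ * G' y) + ENNReal.ofReal (L * (ε * ‖v‖)) * ∫⁻ y, G' y)) := by
          gcongr
          refine (enorm_integral_le_lintegral_enorm _).trans (e2.trans (e3.le.trans ?_))
          exact mul_le_mul_right (setLIntegral_mono' measurableSet_Icc e4) _
      _ = _ := by
          rw [setLIntegral_const, Real.volume_Icc, sub_zero, ENNReal.ofReal_one, mul_one,
            enorm_smul, ← mul_assoc, ← mul_assoc, ← enorm_mul, inv_mul_cancel₀ hε.ne',
            enorm_one, one_mul]
  have hlim : Tendsto (fun n : ℕ => ∫ y, H' y * ((1 / ((n : ℝ) + 1))⁻¹ *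
      (ψ y - ψ (y - (1 / ((n : ℝ) + 1)) • v)))) atTop (𝓝 (∫ y, H' y * fderiv ℝ ψ y v)) := by
    refine tendsto_integral_of_dominated_convergence (fun y => ‖H' y‖ * (L * ‖v‖)) ?_
      (iH.norm.mul_const _) ?_ ?_
    · intro n
      refine iH.aestronglyMeasurable.mul (Continuous.aestronglyMeasurable ?_)
      exact continuous_const.mul (hψc.sub (hψc.comp (by fun_prop)))
    · intro n
      refine Eventually.of_forall fun y => ?_
      have hpos : (0 : ℝ) < 1 / ((n : ℝ) + 1) := by positivity
      rw [norm_mul, norm_mul, norm_inv, Real.norm_of_nonneg hpos.le]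
      refine mul_le_mul_of_nonneg_left ?_ (norm_nonneg _)
      rw [inv_mul_le_iff₀ hpos]
      have h2 := hL.dist_le_mul y (y - (1 / ((n : ℝ) + 1)) • v)
      rw [dist_eq_norm, dist_eq_norm, sub_sub_cancel, norm_smul, Real.norm_of_nonneg hpos.le] at h2
      linarith
    · refine Eventually.of_forall fun y => ?_
      have h1 : HasDerivAt (fun t : ℝ => ψ (y - t • v)) (- fderiv ℝ ψ y v) 0 := by
        have h2 : HasDerivAt (fun t : ℝ => y - t • v) (-v) 0 := by
          simpa using ((hasDerivAt_id (0 : ℝ)).smul_const v).const_sub y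
        have h3 : HasFDerivAt ψ (fderiv ℝ ψ y) (y - (0 : ℝ) • v) := by
          simpa using (hψ.differentiable (by simp) y).hasFDerivAt
        have h4 := h3.comp_hasDerivAt (0 : ℝ) h2
        rw [map_neg] at h4
        exact h4
      have h4 := (hasDerivAt_iff_tendsto_slope_zero.1 h1)
      have h5 : Tendsto (fun n : ℕ => 1 / ((n : ℝ) + 1)) atTop (𝓝[≠] 0) :=
        tendsto_nhdsWithin_iff.2 ⟨tendsto_one_div_add_atTop_nhds_zero_nat,
          Eventually.of_forall fun n => by
            simp only [Set.mem_compl_iff, Set.mem_singleton_iff]; positivity⟩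
      have h6 := (h4.comp h5).neg
      simp only [neg_neg] at h6
      refine (h6.congr fun n => ?_).const_mul _
      simp only [Function.comp_apply, zero_add, zero_smul, sub_zero, smul_eq_mul]
      ring
  have hlim2 : Tendsto (fun n : ℕ => ‖v‖ₑ * ((∫⁻ y, ‖ψ y‖ₑ * G' y) +
      ENNReal.ofReal (L * ((1 / ((n : ℝ) + 1)) * ‖v‖)) * ∫⁻ y, G' y)) atTop
      (𝓝 (‖v‖ₑ * ((∫⁻ y, ‖ψ y‖ₑ * G' y) + ENNReal.ofReal (L * (0 * ‖v‖)) * ∫⁻ y, G' y))) := by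
    refine ENNReal.Tendsto.const_mul (Tendsto.const_add _ ?_) (Or.inr (by simp))
    refine ENNReal.Tendsto.mul_const ?_ (Or.inr hG'i)
    refine ENNReal.tendsto_ofReal ?_
    exact (tendsto_one_div_add_atTop_nhds_zero_nat.mul_const _).const_mul _
  have hfin : ∀ᶠ n : ℕ in atTop, (1 / ((n : ℝ) + 1)) * ‖v‖ ≤ δ := by
    have : Tendsto (fun n : ℕ => (1 / ((n : ℝ) + 1)) * ‖v‖) atTop (𝓝 (0 * ‖v‖)) :=
      tendsto_one_div_add_atTop_nhds_zero_nat.mul_const _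
    rw [zero_mul] at this
    exact this.eventually_le_const hδ
  have hle := le_of_tendsto_of_tendsto (hlim.enorm) hlim2
    (hfin.mono fun n hn => bound _ (by positivity) hn)
  have e5 : ∫ y, H y * fderiv ℝ ψ y v = ∫ y, H' y * fderiv ℝ ψ y v := by
    congr 1; ext y
    by_cases hy : y ∈ B
    · simp [hH', hy]
    · simp [fderiv_eq_zero_of_notMem_of_tsupport_subset hs hy]
  rw [e5]
  refine hle.trans (le_of_eq ?_)
  simp only [zero_mul, mul_zero, ENNReal.ofReal_zero, add_zero]
  rw [← lintegral_indicator hB.measurableSet]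
  congr 2
  ext y
  by_cases hy : y ∈ B <;> simp [hG', hy]

end WeakDerivativeExistence

/-! ### Representation of bounded functionals by densities -/

section RieszRepresentation

/-- By the bound, ℓ factors through the range of T; Hahn–Banach extends it and the Riesz theorem
represents it. -/
lemma exists_inner_eq_of_abs_le {V E : Type*} [AddCommGroup V] [Module ℝ V]
    [NormedAddCommGroup E] [InnerProductSpace ℝ E] [CompleteSpace E] (T : V →ₗ[ℝ] E)
    (ℓ : V →ₗ[ℝ] ℝ) (C : ℝ) (h : ∀ x, |ℓ x| ≤ C * ‖T x‖) : ∃ f : E, ∀ x, ℓ x = inner ℝ f (T x) := by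
  have hker : LinearMap.ker T ≤ LinearMap.ker ℓ := by
    intro x hx
    have := h x
    rw [LinearMap.mem_ker.1 hx, norm_zero, mul_zero] at this
    exact LinearMap.mem_ker.2 (abs_nonpos_iff.1 this)
  let ℓ' : LinearMap.range T →ₗ[ℝ] ℝ :=
    ((LinearMap.ker T).liftQ ℓ hker).comp T.quotKerEquivRange.symm.toLinearMap
  have hℓ' : ∀ x, ℓ' ⟨T x, LinearMap.mem_range_self T x⟩ = ℓ x := by
    intro x
    have : T.quotKerEquivRange.symm ⟨T x, LinearMap.mem_range_self T x⟩ =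
        (LinearMap.ker T).mkQ x := T.quotKerEquivRange_symm_apply_image x _
    simp [ℓ', this]
  have hb : ∀ y : LinearMap.range T, ‖ℓ' y‖ ≤ C * ‖y‖ := by
    rintro ⟨_, x, rfl⟩
    rw [hℓ']
    exact h x
  obtain ⟨g, hg, -⟩ := exists_extension_norm_eq (LinearMap.range T) (ℓ'.mkContinuous C hb)
  refine ⟨(InnerProductSpace.toDual ℝ E).symm g, fun x => ?_⟩
  rw [InnerProductSpace.toDual_symm_apply, ← hℓ' x]
  exact (hg ⟨T x, LinearMap.mem_range_self T x⟩).symm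

variable {m : ℕ}

/-- The smooth functions with compact support in `B`. -/
def testFunctions (B : Set (ℰ m)) : Submodule ℝ (ℰ m → ℝ) where
  carrier := {ψ | ContDiff ℝ ∞ ψ ∧ HasCompactSupport ψ ∧ tsupport ψ ⊆ B}
  add_mem' := fun ⟨a1, a2, a3⟩ ⟨b1, b2, b3⟩ =>
    ⟨a1.add b1, a2.add b2, (tsupport_add _ _).trans (Set.union_subset a3 b3)⟩
  zero_mem' := ⟨contDiff_const, HasCompactSupport.zero, by simp [tsupport]⟩
  smul_mem' := fun c _ ⟨a1, a2, a3⟩ =>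
    ⟨contDiff_const.smul a1, a2.smul_left (f := fun _ => c),
      (tsupport_smul_subset_right (fun _ => c) _).trans a3⟩

/-- The bound controls the L¹ norm for a finite measure ν whose density dominates G, hence by
Cauchy–Schwarz the functional is bounded for the norm of L²(ν) and the Riesz theorem gives a
density. The pointwise bound follows by testing with mollifiers at Lebesgue points, so G enters only
through its integrability. -/
lemma exists_density_of_enorm_le {B : Set (ℰ m)} (hB : IsOpen B) {G : ℰ m → ℝ≥0∞}
    (hG : Measurable G) (hGi : ∫⁻ x in B, G x ≠ ⊤) (hBv : volume B ≠ ⊤)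
    (ℓ : testFunctions B →ₗ[ℝ] ℝ) (c : ℝ≥0)
    (hℓ : ∀ ψ : testFunctions B, ‖ℓ ψ‖ₑ ≤ c * ∫⁻ y in B, ‖(ψ : ℰ m → ℝ) y‖ₑ * G y) :
    ∃ k : ℰ m → ℝ, IntegrableOn k B volume ∧
      (∀ ψ : testFunctions B, ℓ ψ = ∫ y, k y * (ψ : ℰ m → ℝ) y) ∧
      ∀ᵐ x, x ∈ B → ‖k x‖ₑ ≤ c * G x := by
  have hGtop : ∀ᵐ x ∂volume.restrict B, G x < ⊤ := ae_lt_top hG hGi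
  let g : ℰ m → ℝ≥0 := fun x => (G x).toNNReal + 1
  have hgm : Measurable g := hG.ennreal_toNNReal.add_const 1
  let ν : Measure (ℰ m) := (volume.restrict B).withDensity fun x => g x
  have hν : IsFiniteMeasure ν := by
    refine isFiniteMeasure_withDensity ?_
    have : ∫⁻ x in B, (g x : ℝ≥0∞) ≤ ∫⁻ x in B, (G x + 1) := by
      refine lintegral_mono fun x => ?_
      simp only [g, ENNReal.coe_add, ENNReal.coe_one]
      gcongr
      exact ENNReal.coe_toNNReal_le_self
    refine ne_top_of_le_ne_top ?_ this
    rw [lintegral_add_left hG]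
    simp [hGi, hBv]
  have hmem : ∀ ψ : testFunctions B, MemLp (ψ : ℰ m → ℝ) 2 ν := by
    rintro ⟨ψ, hψ⟩
    obtain ⟨C, hC⟩ := hψ.2.1.exists_bound_of_continuous hψ.1.continuous
    exact MemLp.of_bound hψ.1.continuous.aestronglyMeasurable C (Eventually.of_forall hC)
  let T : testFunctions B →ₗ[ℝ] Lp ℝ 2 ν :=
    { toFun := fun ψ => (hmem ψ).toLp _
      map_add' := fun ψ φ => MemLp.toLp_add (hmem ψ) (hmem φ)
      map_smul' := fun a ψ => MemLp.toLp_const_smul a (hmem ψ) }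
  have hbound : ∀ ψ, |ℓ ψ| ≤ (c * (ν Set.univ).toReal ^ (1 / 2 : ℝ)) * ‖T ψ‖ := by
    intro ψ
    have h1 : ∫⁻ y in B, ‖(ψ : ℰ m → ℝ) y‖ₑ * G y ≤ eLpNorm (ψ : ℰ m → ℝ) 1 ν := by
      rw [eLpNorm_one_eq_lintegral_enorm, lintegral_withDensity_eq_lintegral_mul₀
        hgm.coe_nnreal_ennreal.aemeasurable
        (ψ.2.1.continuous.measurable.enorm.aemeasurable)]
      refine lintegral_mono_ae ?_
      filter_upwards [hGtop] with x hx
      simp only [Pi.mul_apply, g]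
      rw [mul_comm]
      gcongr
      rw [ENNReal.coe_add, ENNReal.coe_toNNReal hx.ne]
      exact le_self_add
    have h2 := eLpNorm_le_eLpNorm_mul_rpow_measure_univ (μ := ν) (p := 1) (q := 2)
      (by norm_num) (hmem ψ).1
    have h3 : ‖ℓ ψ‖ₑ ≤ c * (eLpNorm (ψ : ℰ m → ℝ) 2 ν * ν Set.univ ^ (1 / 2 : ℝ)) := by
      refine (hℓ ψ).trans ?_
      gcongr
      refine h1.trans (h2.trans (le_of_eq ?_))
      norm_num
    have h4 := ENNReal.toReal_mono (by
      refine ENNReal.mul_ne_top (by simp) (ENNReal.mul_ne_top (hmem ψ).2.ne ?_)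
      exact ENNReal.rpow_ne_top_of_nonneg (by norm_num) (measure_ne_top _ _)) h3
    rw [toReal_enorm, ENNReal.toReal_mul, ENNReal.toReal_mul, ← ENNReal.toReal_rpow] at h4
    have h5 : ‖T ψ‖ = (eLpNorm (ψ : ℰ m → ℝ) 2 ν).toReal := Lp.norm_toLp _ (hmem ψ)
    rw [h5, ← Real.norm_eq_abs]
    refine h4.trans (le_of_eq ?_)
    simp only [ENNReal.coe_toReal]
    ring
  obtain ⟨f, hf⟩ := exists_inner_eq_of_abs_le T ℓ _ hbound
  let k : ℰ m → ℝ := fun x => (g x : ℝ) * f x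
  have hfi : Integrable f ν := (Lp.memLp f).integrable (by norm_num)
  have hki : IntegrableOn k B volume := by
    have := (integrable_withDensity_iff_integrable_smul hgm).1 hfi
    exact this
  have hrep : ∀ ψ : testFunctions B, ℓ ψ = ∫ y, k y * (ψ : ℰ m → ℝ) y := by
    intro ψ
    rw [hf, L2.inner_def, ← setIntegral_mul_of_tsupport_subset ψ.2.2.2]
    have h1 : ∫ x, inner ℝ (f x) (T ψ x) ∂ν = ∫ x, f x * (ψ : ℰ m → ℝ) x ∂ν := by
      refine integral_congr_ae ?_
      filter_upwards [(hmem ψ).coeFn_toLp] with x hx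
      have : T ψ x = (ψ : ℰ m → ℝ) x := hx
      rw [this]
      simp [mul_comm]
    rw [h1, integral_withDensity_eq_integral_smul hgm]
    refine integral_congr_ae (Eventually.of_forall fun x => ?_)
    simp only [k, NNReal.smul_def, smul_eq_mul, mul_assoc]
  refine ⟨k, hki, hrep, ?_⟩
  -- the pointwise bound, by testing against approximate identities
  set k' := B.indicator k with hk'
  set G' := B.indicator (fun x => (G x).toReal) with hG'
  have hk'i : Integrable k' volume := (integrable_indicator_iff hB.measurableSet).2 hki
  have hG'i : Integrable G' volume := by
    rw [hG', integrable_indicator_iff hB.measurableSet]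
    exact integrable_toReal_of_lintegral_ne_top hG.aemeasurable hGi
  let φ : ℕ → ContDiffBump (0 : ℰ m) := fun n =>
    ⟨1 / (2 * (n + 1)), 1 / (n + 1), by positivity, by
      apply div_lt_div_of_pos_left one_pos (by positivity)
      linarith [(n.cast_nonneg : (0 : ℝ) ≤ n)]⟩
  have hφ0 : Tendsto (fun n => (φ n).rOut) atTop (𝓝 0) :=
    tendsto_one_div_add_atTop_nhds_zero_nat
  -- A bounded ratio of outer and inner radii makes mollifications converge almost everywhere for
  -- locally integrable functions.
  have hφK : ∀ᶠ n in atTop, (φ n).rOut ≤ 2 * (φ n).rIn := Eventually.of_forall fun n => by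
    simp only [φ]
    have : (0 : ℝ) < n + 1 := by positivity
    field_simp
    rfl
  have hc1 := ContDiffBump.ae_convolution_tendsto_right_of_locallyIntegrable (μ := volume)
    (K := 2) hφ0 hφK hk'i.locallyIntegrable
  have hc2 := ContDiffBump.ae_convolution_tendsto_right_of_locallyIntegrable (μ := volume)
    (K := 2) hφ0 hφK hG'i.locallyIntegrable
  filter_upwards [hc1, hc2, (ae_restrict_iff' hB.measurableSet).1 hGtop] with x h1 h2 hGx hx
  obtain ⟨δ, hδ, hball⟩ := Metric.isOpen_iff.1 hB x hx
  have hle : ∀ᶠ n in atTop, ‖convolution ((φ n).normed volume) k'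
      (ContinuousLinearMap.lsmul ℝ ℝ) volume x‖ ≤ c * convolution ((φ n).normed volume) G'
      (ContinuousLinearMap.lsmul ℝ ℝ) volume x := by
    filter_upwards [hφ0.eventually_lt_const hδ] with n hn
    let ψ : ℰ m → ℝ := fun t => (φ n).normed volume (x - t)
    have hψs : Function.support ψ ⊆ Metric.closedBall x (φ n).rOut := by
      intro t ht
      have : x - t ∈ Function.support ((φ n).normed (volume : Measure (ℰ m))) := ht
      rw [(φ n).support_normed_eq, Metric.mem_ball, dist_zero_right, ← dist_eq_norm,
        dist_comm] at this
      exact this.le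
    have hψ : ψ ∈ testFunctions B :=
      ⟨((φ n).contDiff_normed).comp (contDiff_const.sub contDiff_id),
        (φ n).hasCompactSupport_normed.comp_homeomorph (Homeomorph.subLeft x),
        (closure_minimal hψs Metric.isClosed_closedBall).trans
          ((Metric.closedBall_subset_ball hn).trans hball)⟩
    have hψ0 : ∀ t, 0 ≤ ψ t := fun t => (φ n).nonneg_normed _
    have e1 : convolution ((φ n).normed volume) k' (ContinuousLinearMap.lsmul ℝ ℝ) volume x =
        ℓ ⟨ψ, hψ⟩ := by
      rw [hrep, convolution_eq_swap]
      congr 1; ext t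
      by_cases ht : t ∈ B
      · simp [hk', ht, ψ, mul_comm]
      · have : ψ t = 0 := eq_zero_of_notMem_of_tsupport_subset hψ.2.2 ht
        simp [hk', ht, this]
    have e2 : convolution ((φ n).normed volume) G' (ContinuousLinearMap.lsmul ℝ ℝ) volume x =
        ∫ t, ψ t * G' t := by
      rw [convolution_eq_swap]
      rfl
    have e3 : ENNReal.ofReal (∫ t, ψ t * G' t) = ∫⁻ y in B, ‖ψ y‖ₑ * G y := by
      obtain ⟨C, hC⟩ := hψ.2.1.exists_bound_of_continuous hψ.1.continuous
      rw [ofReal_integral_eq_lintegral_ofReal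
        (hG'i.bdd_mul hψ.1.continuous.aestronglyMeasurable (Eventually.of_forall hC))
        (Eventually.of_forall fun t => mul_nonneg (hψ0 t)
          (Set.indicator_nonneg (fun _ _ => ENNReal.toReal_nonneg) _)),
        ← lintegral_indicator hB.measurableSet]
      refine lintegral_congr_ae ?_
      filter_upwards [(ae_restrict_iff' hB.measurableSet).1 hGtop] with t ht
      by_cases htB : t ∈ B
      · simp only [hG', Set.indicator_of_mem htB]
        rw [ENNReal.ofReal_mul (hψ0 t), ENNReal.ofReal_toReal (ht htB).ne,
          Real.enorm_of_nonneg (hψ0 t)]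
      · simp [hG', htB]
    have h3 := hℓ ⟨ψ, hψ⟩
    rw [e1, e2]
    simp only at h3
    rw [← e3, ← ofReal_norm, ← ENNReal.ofReal_coe_nnreal, ← ENNReal.ofReal_mul c.coe_nonneg] at h3
    refine (ENNReal.ofReal_le_ofReal_iff (mul_nonneg c.coe_nonneg
      (integral_nonneg fun t => mul_nonneg (hψ0 t) ?_))).1 h3
    exact Set.indicator_nonneg (fun _ _ => ENNReal.toReal_nonneg) _
  have h4 := le_of_tendsto_of_tendsto h1.norm (h2.const_mul (c : ℝ)) hle
  simp only [hk', hG', Set.indicator_of_mem hx] at h4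
  rw [← ofReal_norm, ← ENNReal.ofReal_toReal (hGx hx).ne, ← ENNReal.ofReal_coe_nnreal,
    ← ENNReal.ofReal_mul c.coe_nonneg]
  exact ENNReal.ofReal_le_ofReal h4

/-- A function whose translates are controlled by the integrals of `G` along segments is weakly
differentiable. -/
theorem exists_hasWeakDirDeriv_of_translation {B : Set (ℰ m)} (hB : IsOpen B)
    (hBv : volume B ≠ ⊤) {v : ℰ m} {H : ℰ m → ℝ} (hH : IntegrableOn H B volume)
    {G : ℰ m → ℝ≥0∞} (hG : Measurable G) (hGi : ∫⁻ x in B, G x ≠ ⊤)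
    (hyp : ∀ ε : ℝ, 0 < ε → ∀ᵐ x, x ∈ B → x + ε • v ∈ B →
      ‖H (x + ε • v) - H x‖ₑ ≤ ‖ε • v‖ₑ * ∫⁻ t in Set.Icc (0 : ℝ) 1, G (x + t • ε • v)) :
    ∃ k : ℰ m → ℝ, HasWeakDirDeriv B v H k ∧ IntegrableOn k B volume ∧
      ∀ᵐ x, x ∈ B → ‖k x‖ₑ ≤ ‖v‖ₑ * G x := by
  have iH := fun ψ : testFunctions B =>
    integrable_mul_fderiv_of_hasCompactSupport hH.locallyIntegrableOn ψ.2.1 ψ.2.2.1 ψ.2.2.2 v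
  let ℓ : testFunctions B →ₗ[ℝ] ℝ :=
    { toFun := fun ψ => -∫ y, H y * fderiv ℝ (ψ : ℰ m → ℝ) y v
      map_add' := fun ψ φ => by
        rw [← neg_add, ← integral_add (iH ψ) (iH φ)]
        congr 2; ext y
        rw [Submodule.coe_add, fderiv_add (ψ.2.1.differentiable (by simp) y)
          (φ.2.1.differentiable (by simp) y)]
        simp [mul_add]
      map_smul' := fun a ψ => by
        rw [RingHom.id_apply, smul_eq_mul, mul_neg, ← integral_const_mul]
        congr 2; ext y
        rw [Submodule.coe_smul, fderiv_const_smul (ψ.2.1.differentiable (by simp) y)]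
        simp only [FunLike.coe_smul, Pi.smul_apply, smul_eq_mul]
        ring }
  obtain ⟨k, hk, hrep, hle⟩ := exists_density_of_enorm_le hB hG hGi hBv ℓ ‖v‖₊ fun ψ => by
    have := enorm_integral_mul_fderiv_le hB hH hG hGi hyp ψ.2.1 ψ.2.2.1 ψ.2.2.2
    simpa [ℓ, enorm_neg, enorm_eq_nnnorm v] using this
  refine ⟨k, HasWeakDirDeriv.of_integral_eq hH.locallyIntegrableOn hk.locallyIntegrableOn
    fun ψ h1 h2 h3 => ?_, hk, hle⟩
  rw [← hrep ⟨ψ, h1, h2, h3⟩]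
  simp [ℓ]

end RieszRepresentation

/-! ### Change of variables for weak derivatives -/

section ChangeOfVariables

variable {m : ℕ}

lemma continuous_indicator_of_isCompact {X : Type*} [TopologicalSpace X] [T2Space X] {Ω K : Set X}
    {f : X → ℝ} (hΩ : IsOpen Ω) (hK : IsCompact K) (hKΩ : K ⊆ Ω) (hf : ContinuousOn f Ω)
    (hfK : ∀ x ∉ K, f x = 0) : Continuous (Ω.indicator f) := by
  rw [continuous_iff_continuousAt]
  intro x
  by_cases hx : x ∈ Ω
  · refine (hf.continuousAt (hΩ.mem_nhds hx)).congr ?_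
    filter_upwards [hΩ.mem_nhds hx] with y hy
    rw [Set.indicator_of_mem hy]
  · have hxK : Kᶜ ∈ 𝓝 x := hK.isClosed.isOpen_compl.mem_nhds fun h => hx (hKΩ h)
    refine (continuousAt_const (y := (0 : ℝ))).congr ?_
    filter_upwards [hxK] with y hy
    by_cases hyΩ : y ∈ Ω
    · rw [Set.indicator_of_mem hyΩ, hfK y hy]
    · rw [Set.indicator_of_notMem hyΩ]

variable (c : OpenPartialHomeomorph (ℰ m) (ℰ m))

lemma hasFDerivWithinAt_of_contDiffOn {c : OpenPartialHomeomorph (ℰ m) (ℰ m)}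
    (hc : ContDiffOn ℝ ∞ c c.source) {x : ℰ m} (hx : x ∈ c.source) :
    HasFDerivAt c (fderiv ℝ c x) x :=
  ((hc.differentiableOn (by simp)).differentiableAt (c.open_source.mem_nhds hx)).hasFDerivAt

variable {c}

lemma setIntegral_source_eq (hs : ContDiffOn ℝ ∞ c.symm c.target) (g : ℰ m → ℝ) :
    ∫ y in c.source, g y = ∫ x in c.target, |(fderiv ℝ c.symm x).det| * g (c.symm x) := by
  rw [← c.symm_image_target_eq_source]
  exact integral_image_eq_integral_abs_det_fderiv_smul volume c.open_target.measurableSet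
    (fun x hx => (hasFDerivWithinAt_of_contDiffOn (c := c.symm) hs hx).hasFDerivWithinAt)
    c.symm.injOn g

lemma locallyIntegrableOn_comp_of_contDiffOn (hs : ContDiffOn ℝ ∞ c.symm c.target)
    {g : ℰ m → ℝ} (hg : LocallyIntegrableOn (fun x => g (c.symm x)) c.target volume) :
    LocallyIntegrableOn g c.source volume := by
  rw [locallyIntegrableOn_iff c.open_source.isLocallyClosed]
  intro K hK hKc
  have himg : IsCompact (c '' K) := hKc.image_of_continuousOn (c.continuousOn.mono hK)
  have hsub : c '' K ⊆ c.target := by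
    rintro _ ⟨x, hx, rfl⟩
    exact c.map_source (hK hx)
  have hKeq : c.symm '' (c '' K) = K := by
    rw [Set.image_image]
    have : ∀ x ∈ K, c.symm (c x) = x := fun x hx => c.left_inv (hK hx)
    rw [Set.image_congr this, Set.image_id']
  have := (integrableOn_image_iff_integrableOn_abs_det_fderiv_smul volume himg.measurableSet
    (fun x hx => (hasFDerivWithinAt_of_contDiffOn (c := c.symm) hs
      (hsub hx)).hasFDerivWithinAt) (c.symm.injOn.mono hsub) g).2 (by
        have h1 : IntegrableOn (fun x => g (c.symm x)) (c '' K) volume :=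
          (locallyIntegrableOn_iff c.open_target.isLocallyClosed).1 hg _ hsub himg
        have h2 : ContinuousOn (fun x => |(fderiv ℝ c.symm x).det|) (c '' K) := by
          have h3 := (hs.continuousOn_fderiv_of_isOpen c.open_target (by simp)).mono hsub
          exact (ContinuousLinearMap.continuous_det.comp_continuousOn h3).abs
        simpa only [smul_eq_mul] using h1.continuousOn_mul h2 himg)
  rwa [hKeq] at this

/-- The change of variables formula for weak derivatives. -/
theorem HasWeakDirDeriv.comp_of_contDiffOn (hc : ContDiffOn ℝ ∞ c c.source)
    (hs : ContDiffOn ℝ ∞ c.symm c.target) {h : ℰ m → ℝ} {k : ℰ m → ℰ m →L[ℝ] ℝ}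
    (H : ∀ v, HasWeakDirDeriv c.target v (fun x => h (c.symm x)) fun x => k (c.symm x) v)
    (v : ℰ m) : HasWeakDirDeriv c.source v h fun y => k y (fderiv ℝ c y v) := by
  let b := (EuclideanSpace.basisFun (Fin m) ℝ).toBasis
  let a : Fin m → ℰ m → ℝ := fun i x => fderiv ℝ c (c.symm x) v i
  have hdet : ContinuousOn (fun x => |(fderiv ℝ c.symm x).det|) c.target :=
    (ContinuousLinearMap.continuous_det.comp_continuousOn
      (hs.continuousOn_fderiv_of_isOpen c.open_target (by simp))).abs
  have hfc : ContinuousOn (fun y => fderiv ℝ c y v) c.source :=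
    (hc.continuousOn_fderiv_of_isOpen c.open_source (by simp)).clm_apply continuousOn_const
  have hac : ∀ i, ContinuousOn (a i) c.target := fun i => by
    have h1 : ContinuousOn (fun x => fderiv ℝ c (c.symm x) v) c.target :=
      hfc.comp c.continuousOn_symm c.mapsTo_symm
    exact (EuclideanSpace.proj (𝕜 := ℝ) i).continuous.comp_continuousOn h1
  have hsum : ∀ w : ℰ m, w = ∑ i, w i • b i := fun w => by
    simpa [b] using ((EuclideanSpace.basisFun (Fin m) ℝ).sum_repr w).symm
  have hkexp : ∀ x ∈ c.target, k (c.symm x) (fderiv ℝ c (c.symm x) v) =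
      ∑ i, a i x * k (c.symm x) (b i) := fun x _ => by
    conv_lhs => rw [hsum (fderiv ℝ c (c.symm x) v)]
    simp [a]
  refine of_integral_eq (locallyIntegrableOn_comp_of_contDiffOn hs (H 0).1)
    (locallyIntegrableOn_comp_of_contDiffOn hs ?_) fun ψ hψ hψc hψs => ?_
  · rw [locallyIntegrableOn_iff c.open_target.isLocallyClosed]
    intro K hK hKc
    have h1 : IntegrableOn (fun x => ∑ i, a i x * k (c.symm x) (b i)) K volume :=
      integrable_finsetSum _ fun i _ =>
        ((locallyIntegrableOn_iff c.open_target.isLocallyClosed).1 (H (b i)).2.1 K hK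
          hKc).continuousOn_mul ((hac i).mono hK) hKc
    exact h1.congr_fun (fun x hx => (hkexp x (hK hx)).symm) hKc.measurableSet
  have hKc : IsCompact (c '' tsupport ψ) :=
    IsCompact.image_of_continuousOn hψc (c.continuousOn.mono hψs)
  have hKt : c '' tsupport ψ ⊆ c.target := by
    rintro _ ⟨x, hx, rfl⟩
    exact c.map_source (hψs hx)
  have hKmem : ∀ x ∈ c.target, x ∉ c '' tsupport ψ → c.symm x ∉ tsupport ψ := fun x hx hxK h' =>
    hxK ⟨_, h', c.right_inv hx⟩
  have hψ' : Continuous fun y => fderiv ℝ ψ y v :=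
    (hψ.continuous_fderiv (by simp)).clm_apply continuous_const
  -- The transported derivative θ₀ of the test function is the divergence of the transported field
  -- X₀. This identity is checked weakly, by integration by parts on the source side, so that the
  -- Jacobian determinant is never differentiated.
  let θ₀ : ℰ m → ℝ := fun x => |(fderiv ℝ c.symm x).det| * fderiv ℝ ψ (c.symm x) v
  let X₀ : Fin m → ℰ m → ℝ := fun i x => |(fderiv ℝ c.symm x).det| * (a i x * ψ (c.symm x))
  have hθ₀ : ∀ x ∈ c.target, x ∉ c '' tsupport ψ → θ₀ x = 0 := fun x hx hxK => by
    have : fderiv ℝ ψ (c.symm x) = 0 :=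
      image_eq_zero_of_notMem_tsupport fun h => hKmem x hx hxK (tsupport_fderiv_subset ℝ h)
    simp [θ₀, this]
  have hX₀ : ∀ i, ∀ x ∈ c.target, x ∉ c '' tsupport ψ → X₀ i x = 0 := fun i x hx hxK => by
    simp [X₀, image_eq_zero_of_notMem_tsupport (hKmem x hx hxK)]
  have hind : ∀ f : ℰ m → ℝ, ContinuousOn f c.target →
      (∀ x ∈ c.target, x ∉ c '' tsupport ψ → f x = 0) →
      Continuous (c.target.indicator f) ∧ ∀ y ∉ c '' tsupport ψ, c.target.indicator f y = 0 := by
    intro f hf hf0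
    have h0 : ∀ y ∉ c '' tsupport ψ, c.target.indicator f y = 0 := fun y hy => by
      by_cases hyt : y ∈ c.target
      · rw [Set.indicator_of_mem hyt, hf0 y hyt hy]
      · rw [Set.indicator_of_notMem hyt]
    refine ⟨?_, h0⟩
    have := continuous_indicator_of_isCompact c.open_target hKc hKt
      (f := c.target.indicator f) (hf.congr fun x hx => Set.indicator_of_mem hx f) h0
    rwa [Set.indicator_indicator, Set.inter_self] at this
  have cθ := hind θ₀ (hdet.mul (hψ'.comp_continuousOn c.continuousOn_symm)) hθ₀
  have cX := fun i => hind (X₀ i) (hdet.mul ((hac i).mul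
    (hψ.continuous.comp_continuousOn c.continuousOn_symm))) (hX₀ i)
  have hTE := integral_mul_eq_neg_sum_of_divergence c.open_target Finset.univ (fun i => b i)
    (fun i x => k (c.symm x) (b i)) (H 0).1 (fun i _ => H (b i))
    (X := fun i => c.target.indicator (X₀ i)) (θ := c.target.indicator θ₀)
    (fun i _ => (cX i).1) cθ.1 hKc hKt (fun i _ => (cX i).2) cθ.2 (by
      intro η hη hηc
      have hη1 := hη.differentiable (by simp)
      have hcd : ∀ x ∈ c.source, HasFDerivAt (fun y => η (c y))
          ((fderiv ℝ η (c x)).comp (fderiv ℝ c x)) x := fun x hx =>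
        (hη1 (c x)).hasFDerivAt.comp x (hasFDerivWithinAt_of_contDiffOn hc hx)
      have hηc' : ContinuousOn (fun y => η (c y)) c.source :=
        hη.continuous.comp_continuousOn c.continuousOn
      have hi : ∀ f g : ℰ m → ℝ, ContinuousOn f c.source → Continuous g →
          (∀ y ∉ tsupport ψ, g y = 0) → Integrable (fun y => f y * g y) volume := by
        intro f g hf hg hg0
        refine (integrableOn_iff_integrable_of_support_subset (s := tsupport ψ) ?_).1
          ((hf.mono hψs).mul hg.continuousOn |>.integrableOn_compact hψc)
        intro y hy
        by_contra h
        exact hy (by simp [hg0 y h])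
      have hψ0 : ∀ y ∉ tsupport ψ, ψ y = 0 := fun y hy => image_eq_zero_of_notMem_tsupport hy
      have hdψ0 : ∀ y ∉ tsupport ψ, fderiv ℝ ψ y v = 0 := fun y hy => by
        have : fderiv ℝ ψ y = 0 :=
          image_eq_zero_of_notMem_tsupport fun h => hy (tsupport_fderiv_subset ℝ h)
        simp [this]
      have hdηc : ContinuousOn (fun y => fderiv ℝ (fun y => η (c y)) y v) c.source := by
        refine ContinuousOn.congr (f := fun y => fderiv ℝ η (c y) (fderiv ℝ c y v)) ?_
          fun y hy => by rw [(hcd y hy).fderiv]; rfl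
        exact ((hη.continuous_fderiv (by simp)).comp_continuousOn c.continuousOn).clm_apply hfc
      have ibp := integral_mul_fderiv_eq_neg_fderiv_mul_of_integrable (μ := volume)
        (f := fun y => η (c y)) (g := ψ) (v := v)
        (hi _ _ hdηc hψ.continuous hψ0) (hi _ _ hηc' hψ' hdψ0) (hi _ _ hηc' hψ.continuous hψ0)
        (fun x hx => (hcd x (hψs hx)).differentiableAt)
        (fun x _ => hψ.differentiable (by simp) x)
      have l1 : ∫ y, η y * c.target.indicator θ₀ y = ∫ y, η (c y) * fderiv ℝ ψ y v := by
        rw [← setIntegral_mul_fderiv_of_tsupport_subset hψs (fun y => η (c y)) v,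
          setIntegral_source_eq hs, ← integral_indicator c.open_target.measurableSet]
        congr 1; ext x
        by_cases hx : x ∈ c.target
        · simp only [Set.indicator_of_mem hx, θ₀, c.right_inv hx]; ring
        · simp [Set.indicator_of_notMem hx]
      have l2 : ∑ i, ∫ y, fderiv ℝ η y (b i) * c.target.indicator (X₀ i) y =
          ∫ y, fderiv ℝ (fun y => η (c y)) y v * ψ y := by
        rw [← integral_finsetSum]
        · rw [← setIntegral_mul_of_tsupport_subset hψs (fun y => fderiv ℝ (fun y => η (c y)) y v),
            setIntegral_source_eq hs, ← integral_indicator c.open_target.measurableSet]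
          congr 1; ext x
          by_cases hx : x ∈ c.target
          · simp only [Set.indicator_of_mem hx, X₀]
            rw [(hcd _ (c.map_target hx)).fderiv, ContinuousLinearMap.comp_apply, c.right_inv hx]
            conv_rhs => rw [hsum (fderiv ℝ c (c.symm x) v)]
            simp only [map_sum, map_smul, smul_eq_mul, Finset.sum_mul, Finset.mul_sum]
            refine Finset.sum_congr rfl fun i _ => ?_
            simp only [a]
            ring
          · simp [Set.indicator_of_notMem hx]
        · intro i _
          refine (((hη.continuous_fderiv (by simp)).clm_apply
            continuous_const).mul (cX i).1).integrable_of_hasCompactSupport ?_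
          exact HasCompactSupport.intro hKc fun x hx => by rw [Pi.mul_apply, (cX i).2 x hx, mul_zero]
      rw [l1, l2]
      exact ibp)
  have r1 : ∫ y, h y * fderiv ℝ ψ y v = ∫ x, h (c.symm x) * c.target.indicator θ₀ x := by
    rw [← setIntegral_mul_fderiv_of_tsupport_subset hψs h v,
      setIntegral_source_eq hs, ← integral_indicator c.open_target.measurableSet]
    congr 1; ext x
    by_cases hx : x ∈ c.target
    · simp only [Set.indicator_of_mem hx, θ₀]; ring
    · simp [Set.indicator_of_notMem hx]
  have r2 : ∫ y, k y (fderiv ℝ c y v) * ψ y =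
      ∑ i, ∫ x, k (c.symm x) (b i) * c.target.indicator (X₀ i) x := by
    rw [← integral_finsetSum]
    · rw [← setIntegral_mul_of_tsupport_subset hψs (fun y => k y (fderiv ℝ c y v)),
        setIntegral_source_eq hs, ← integral_indicator c.open_target.measurableSet]
      congr 1; ext x
      by_cases hx : x ∈ c.target
      · simp only [Set.indicator_of_mem hx, X₀]
        rw [hkexp x hx]
        simp only [Finset.sum_mul, Finset.mul_sum]
        refine Finset.sum_congr rfl fun i _ => ?_
        ring
      · simp [Set.indicator_of_notMem hx]
    · intro i _
      have hts : tsupport (c.target.indicator (X₀ i)) ⊆ c '' tsupport ψ :=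
        closure_minimal (fun x hx => by by_contra h; exact hx ((cX i).2 x h)) hKc.isClosed
      exact integrable_mul_of_hasCompactSupport (H (b i)).2.1 (cX i).1
        (hKc.of_isClosed_subset (isClosed_tsupport _) hts) (hts.trans hKt)
  rw [r1, r2]
  exact hTE

end ChangeOfVariables

/-! ### Weak differentiability is local and independent of the chart -/

section LocalToGlobal

variable {m : ℕ}

/-- The support of a test function is compact, and the open sets on which k is the weak derivative
are stable under finite unions. -/
lemma HasWeakDirDeriv.of_forall_exists {Ω : Set (ℰ m)} {v : ℰ m} {h k : ℰ m → ℝ}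
    (H : ∀ x ∈ Ω, ∃ W : Set (ℰ m), IsOpen W ∧ x ∈ W ∧ HasWeakDirDeriv W v h k) :
    HasWeakDirDeriv Ω v h k := by
  refine of_integral_eq ?_ ?_ fun ψ hψ hc hs => ?_
  · intro x hx
    obtain ⟨W, hW, hxW, hd⟩ := H x hx
    obtain ⟨s, hs, hs'⟩ := hd.1 x hxW
    rw [hW.nhdsWithin_eq hxW] at hs
    exact ⟨s, nhdsWithin_le_nhds hs, hs'⟩
  · intro x hx
    obtain ⟨W, hW, hxW, hd⟩ := H x hx
    obtain ⟨s, hs, hs'⟩ := hd.2.1 x hxW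
    rw [hW.nhdsWithin_eq hxW] at hs
    exact ⟨s, nhdsWithin_le_nhds hs, hs'⟩
  · have : ∃ W, IsOpen W ∧ tsupport ψ ⊆ W ∧ HasWeakDirDeriv W v h k := by
      refine IsCompact.induction_on (p := fun s => ∃ W, IsOpen W ∧ s ⊆ W ∧
        HasWeakDirDeriv W v h k) hc ?_ ?_ ?_ ?_
      · refine ⟨∅, isOpen_empty, le_rfl, fun x hx => hx.elim, fun x hx => hx.elim, ?_⟩
        intro ψ _ _ h
        simp
      · rintro s t hst ⟨W, h1, h2, h3⟩
        exact ⟨W, h1, hst.trans h2, h3⟩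
      · rintro s t ⟨W, h1, h2, h3⟩ ⟨W', h1', h2', h3'⟩
        exact ⟨W ∪ W', h1.union h1', Set.union_subset_union h2 h2', h3.union h1 h1' h3'⟩
      · intro x hx
        obtain ⟨W, hW, hxW, hd⟩ := H x (hs hx)
        exact ⟨W, mem_nhdsWithin_of_mem_nhds (hW.mem_nhds hxW), W, hW, le_rfl, hd⟩
    obtain ⟨W, -, hψW, hd⟩ := this
    exact hd.integral_eq hψ hc hψW

lemma HasWeakDirDeriv.congr {Ω : Set (ℰ m)} {v : ℰ m} {h k h' k' : ℰ m → ℝ}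
    (H : HasWeakDirDeriv Ω v h k) (hΩ : MeasurableSet Ω)
    (hh : ∀ y ∈ Ω, h y = h' y) (hk : ∀ y ∈ Ω, k y = k' y) : HasWeakDirDeriv Ω v h' k' :=
  H.congr_ae hΩ (Eventually.of_forall hh) (Eventually.of_forall hk)

variable {M : Type*} [TopologicalSpace M] [ChartedSpace (ℰ m) M]

/-- `G` is the weak differential of `g` on the open subset `W` of the domain of the chart `e`. -/
def HasWeakDifferentialIn (e : OpenPartialHomeomorph M (ℰ m)) (W : Set (ℰ m)) (g : M → ℝ)
    (G : ∀ x : M, TangentSpace (𝓡 m) x →L[ℝ] ℝ) : Prop :=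
  ∀ v, HasWeakDirDeriv W v (fun y => g (e.symm y))
    (fun y => G (e.symm y) (mfderiv (𝓡 m) (𝓡 m) e.symm y v))

lemma hasWeakDifferential_iff_in {g : M → ℝ} {G : ∀ x : M, TangentSpace (𝓡 m) x →L[ℝ] ℝ} :
    HasWeakDifferential g G ↔
      ∀ e ∈ atlas (ℰ m) M, HasWeakDifferentialIn e e.target g G :=
  hasWeakDifferential_iff

variable {M : Type*} [EMetricSpace M] [ChartedSpace (ℰ m) M] [IsManifold (𝓡 m) ∞ M]

/-- The transition map, restricted to W, satisfies the change of variables formula; the chain rule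
identifies the transported field with the one read in the new chart. -/
lemma HasWeakDifferentialIn.transfer {e c : OpenPartialHomeomorph M (ℰ m)}
    (he : e ∈ atlas (ℰ m) M) (hc : c ∈ atlas (ℰ m) M) {W : Set (ℰ m)} (hW : IsOpen W)
    {g : M → ℝ} {G : ∀ x : M, TangentSpace (𝓡 m) x →L[ℝ] ℝ}
    (H : HasWeakDifferentialIn e W g G) :
    HasWeakDifferentialIn c (c.target ∩ c.symm ⁻¹' (e.source ∩ e ⁻¹' W)) g G := by
  intro v
  let τ : OpenPartialHomeomorph (ℰ m) (ℰ m) := ((c.symm.trans e).symm.restr W).symm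
  have hτ : ∀ y, τ y = e (c.symm y) := fun y => rfl
  have hτs : ∀ y, τ.symm y = c (e.symm y) := fun y => rfl
  have htgt : τ.target = (e.target ∩ e.symm ⁻¹' c.source) ∩ W := by
    simp [τ, hW.interior_eq]
  have hsrc : τ.source = c.target ∩ c.symm ⁻¹' (e.source ∩ e ⁻¹' W) := by
    ext y
    simp only [τ, OpenPartialHomeomorph.symm_source, OpenPartialHomeomorph.restr_target,
      OpenPartialHomeomorph.symm_target, OpenPartialHomeomorph.trans_source,
      hW.interior_eq, OpenPartialHomeomorph.symm_symm]
    simp [and_assoc]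
  have d1 : ContDiffOn ℝ ∞ τ τ.source := by
    refine (contDiffOn_chart_transition he hc).mono ?_
    rw [hsrc]
    exact fun y hy => ⟨hy.1, hy.2.1⟩
  have d2 : ContDiffOn ℝ ∞ τ.symm τ.target := by
    refine (contDiffOn_chart_transition hc he).mono ?_
    rw [htgt]
    exact Set.inter_subset_left
  let k : ℰ m → ℰ m →L[ℝ] ℝ := fun y =>
    (show ℰ m →L[ℝ] ℝ from G (c.symm y)).comp
      (show ℰ m →L[ℝ] ℰ m from mfderiv (𝓡 m) (𝓡 m) e.symm (e (c.symm y)))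
  have key := HasWeakDirDeriv.comp_of_contDiffOn (c := τ) d1 d2 (h := fun y => g (c.symm y))
    (k := k) (fun w => by
      refine ((H w).mono ?_).congr τ.open_target.measurableSet ?_ ?_
      · rw [htgt]; exact Set.inter_subset_right
      · intro y hy
        rw [htgt] at hy
        rw [hτs, c.left_inv hy.1.2]
      · intro y hy
        rw [htgt] at hy
        -- The two sides involve tangent spaces at points that are only propositionally equal;
        -- generalising the points allows substitution.
        have aux : ∀ z y', z = e.symm y → y' = y → (show ℰ m →L[ℝ] ℝ from G z)
            ((show ℰ m →L[ℝ] ℰ m from mfderiv (𝓡 m) (𝓡 m) e.symm y') w) =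
            G (e.symm y) (mfderiv (𝓡 m) (𝓡 m) e.symm y w) := by
          rintro _ _ rfl rfl; rfl
        have h2 : c.symm (τ.symm y) = e.symm y := by rw [hτs, c.left_inv hy.1.2]
        exact (aux (c.symm (τ.symm y)) (e (c.symm (τ.symm y))) h2
          (by rw [h2, e.right_inv hy.1.1])).symm) v
  rw [hsrc] at key
  refine key.congr ?_ (fun _ _ => rfl) ?_
  · rw [← hsrc]; exact τ.open_source.measurableSet
  · intro y hy
    have h1 := mfderiv_chart_symm_eq hc he hy.1 hy.2.1 v
    change G (c.symm y) _ = _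
    exact congrArg (fun w : ℰ m => (show ℰ m →L[ℝ] ℝ from G (c.symm y)) w) h1.symm

/-- Weak differentiability can be checked locally, in one chart around each point. -/
theorem hasWeakDifferential_of_local {g : M → ℝ} {G : ∀ x : M, TangentSpace (𝓡 m) x →L[ℝ] ℝ}
    (H : ∀ x : M, ∃ e ∈ atlas (ℰ m) M, ∃ W : Set (ℰ m), IsOpen W ∧
      x ∈ e.source ∧ e x ∈ W ∧ HasWeakDifferentialIn e W g G) : HasWeakDifferential g G := by
  rw [hasWeakDifferential_iff_in]
  intro c hc v
  refine HasWeakDirDeriv.of_forall_exists fun y hy => ?_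
  obtain ⟨e, he, W, hW, hx, hxW, hd⟩ := H (c.symm y)
  refine ⟨_, ?_, ?_, hd.transfer he hc hW v⟩
  · exact c.symm.isOpen_inter_preimage (e.isOpen_inter_preimage hW)
  · exact ⟨hy, hx, hxW⟩

end LocalToGlobal

/-! ### Comparison of the Riemannian volume with the Lebesgue measure -/

section RiemannianVolume

lemma LipschitzOnWith.euclideanHausdorffMeasure_image_le {X Y : Type*} [EMetricSpace X]
    [EMetricSpace Y] [MeasurableSpace X] [BorelSpace X] [MeasurableSpace Y] [BorelSpace Y]
    {K : ℝ≥0} {f : X → Y} {s : Set X} (h : LipschitzOnWith K f s) (d : ℕ) :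
    μHE[d] (f '' s) ≤ (K : ℝ≥0∞) ^ d * μHE[d] s := by
  have := h.hausdorffMeasure_image_le (d := d) (Nat.cast_nonneg d)
  rw [ENNReal.rpow_natCast] at this
  simp only [Measure.euclideanHausdorffMeasure_def, Measure.smul_apply, ENNReal.smul_def,
    smul_eq_mul]
  rw [mul_left_comm]
  gcongr

lemma aemeasurable_chart_symm {m : ℕ} {M : Type*} [TopologicalSpace M] [MeasurableSpace M]
    [BorelSpace M] (e : OpenPartialHomeomorph M (ℰ m)) {K : Set (ℰ m)}
    (hKe : K ⊆ e.target) : AEMeasurable e.symm (volume.restrict K) :=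
  (e.continuousOn_symm.aemeasurable e.open_target.measurableSet).mono_measure
    (Measure.restrict_mono hKe le_rfl)

section ChartComparison

variable {m : ℕ} {M : Type*} [EMetricSpace M] [MeasurableSpace M] [BorelSpace M]

lemma map_chart_symm_le {e : OpenPartialHomeomorph M (ℰ m)} {K : Set (ℰ m)}
    (hKe : K ⊆ e.target) {C : ℝ≥0}
    (hC : ∀ A ⊆ K, volume A ≤ C * (μHE[m] : Measure M) (e.symm '' A)) :
    (volume.restrict K).map e.symm ≤
      (C : ℝ≥0∞) • (μHE[m] : Measure M).restrict (e.symm '' K) := by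
  refine Measure.le_iff.2 fun A hA => ?_
  rw [Measure.map_apply_of_aemeasurable (aemeasurable_chart_symm e hKe) hA, Measure.smul_apply,
    smul_eq_mul, Measure.restrict_apply hA]
  have h0 : NullMeasurableSet (e.symm ⁻¹' A) (volume.restrict K) :=
    (aemeasurable_chart_symm e hKe).nullMeasurableSet_preimage hA
  rw [Measure.restrict_apply₀ h0]
  refine (hC _ Set.inter_subset_right).trans ?_
  gcongr
  rintro _ ⟨y, hy, rfl⟩
  exact ⟨hy.1, y, hy.2, rfl⟩

lemma setLIntegral_comp_chart_symm_le {e : OpenPartialHomeomorph M (ℰ m)} {K : Set (ℰ m)}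
    (hKe : K ⊆ e.target) {C : ℝ≥0}
    (hC : ∀ A ⊆ K, volume A ≤ C * (μHE[m] : Measure M) (e.symm '' A)) {f : M → ℝ≥0∞}
    (hf : Measurable f) :
    ∫⁻ y in K, f (e.symm y) ≤ C * ∫⁻ x in e.symm '' K, f x ∂μHE[m] := by
  rw [← lintegral_map' hf.aemeasurable (aemeasurable_chart_symm e hKe)]
  refine (lintegral_mono' (map_chart_symm_le hKe hC) le_rfl).trans (le_of_eq ?_)
  rw [lintegral_smul_measure, smul_eq_mul]

end ChartComparison

variable {m : ℕ} {M : Type*} [EMetricSpace M] [ChartedSpace (ℰ m) M] [IsManifold (𝓡 m) ∞ M]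
  [RiemannianBundle (fun x : M => TangentSpace (𝓡 m) x)]
  [IsContMDiffRiemannianBundle (𝓡 m) ∞ (ℰ m) (fun x : M => TangentSpace (𝓡 m) x)]
  [IsRiemannianManifold (𝓡 m) M]

lemma exists_bilipschitz_chart {e : OpenPartialHomeomorph M (ℰ m)}
    (he : e ∈ atlas (ℰ m) M) {y₀ : ℰ m} (hy₀ : y₀ ∈ e.target) :
    ∃ C : ℝ≥0, ∃ r > 0, Metric.ball y₀ r ⊆ e.target ∧
      LipschitzOnWith C e.symm (Metric.ball y₀ r) ∧
      LipschitzOnWith C e (e.symm '' Metric.ball y₀ r) := by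
  obtain ⟨C, r, hr, hsub, hC⟩ := exists_lipschitzOnWith_chart_symm he hy₀
  obtain ⟨C', V, hV, hVe, hC'⟩ := exists_lipschitzOnWith_chart he (e.map_target hy₀)
  obtain ⟨r', hr', hball⟩ := Metric.mem_nhds_iff.1
    ((e.continuousAt_symm hy₀).preimage_mem_nhds hV)
  refine ⟨max C C', min r r', lt_min hr hr', ?_, ?_, ?_⟩
  · exact (Metric.ball_subset_ball (min_le_left _ _)).trans hsub
  · exact (hC.mono (Metric.ball_subset_ball (min_le_left _ _))).weaken (le_max_left _ _)
  · refine (hC'.mono ?_).weaken (le_max_right _ _)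
    rintro _ ⟨y, hy, rfl⟩
    exact hball (Metric.ball_subset_ball (min_le_right _ _) hy)

variable [MeasurableSpace M] [BorelSpace M]

/-- A C-Lipschitz map increases the m-dimensional Hausdorff measure by at most the factor C^m, and
the normalised Hausdorff measure of ℝ^m is the Lebesgue measure. -/
lemma exists_volume_comparison_nhds {e : OpenPartialHomeomorph M (ℰ m)}
    (he : e ∈ atlas (ℰ m) M) {y₀ : ℰ m} (hy₀ : y₀ ∈ e.target) :
    ∃ C : ℝ≥0, ∃ r > 0, Metric.ball y₀ r ⊆ e.target ∧ ∀ A ⊆ Metric.ball y₀ r,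
      volume A ≤ C * (μHE[m] : Measure M) (e.symm '' A) ∧
      (μHE[m] : Measure M) (e.symm '' A) ≤ C * volume A := by
  obtain ⟨C, r, hr, hsub, h1, h2⟩ := exists_bilipschitz_chart he hy₀
  refine ⟨C ^ m, r, hr, hsub, fun A hA => ⟨?_, ?_⟩⟩
  · have := (h2.mono (Set.image_mono hA)).euclideanHausdorffMeasure_image_le m
    rw [Set.image_image, Set.image_congr (fun x hx => e.right_inv (hsub (hA hx))),
      Set.image_id', EuclideanSpace.euclideanHausdorffMeasure_eq_volume] at this
    simpa using this
  · have := (h1.mono hA).euclideanHausdorffMeasure_image_le m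
    rw [EuclideanSpace.euclideanHausdorffMeasure_eq_volume] at this
    simpa using this

lemma ae_chart_of_ae {e : OpenPartialHomeomorph M (ℰ m)} (he : e ∈ atlas (ℰ m) M)
    {P : M → Prop} (hP : ∀ᵐ x ∂(μHE[m] : Measure M), P x) :
    ∀ᵐ y, y ∈ e.target → P (e.symm y) := by
  rw [ae_iff]
  refine measure_null_of_locally_null _ fun y hy => ?_
  simp only [Set.mem_ofPred_eq, Classical.not_imp] at hy
  obtain ⟨C, r, hr, -, h⟩ := exists_volume_comparison_nhds (M := M) he hy.1
  refine ⟨Metric.ball y r ∩ {y | ¬(y ∈ e.target → P (e.symm y))}, ?_, ?_⟩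
  · exact Filter.inter_mem (mem_nhdsWithin_of_mem_nhds (Metric.ball_mem_nhds y hr))
      self_mem_nhdsWithin
  · refine le_antisymm ((h _ Set.inter_subset_left).1.trans ?_) zero_le
    rw [measure_mono_null _ (ae_iff.1 hP), mul_zero]
    rintro _ ⟨z, hz, rfl⟩
    have := hz.2
    simp only [Set.mem_ofPred_eq, Classical.not_imp] at this
    exact this.2

/-- The volume comparison is local; by the Lindelöf property countably many balls of comparison
cover A. -/
lemma measure_chart_symm_image_eq_zero {e : OpenPartialHomeomorph M (ℰ m)}
    (he : e ∈ atlas (ℰ m) M) {A : Set (ℰ m)} (hA : A ⊆ e.target) (h0 : volume A = 0) :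
    (μHE[m] : Measure M) (e.symm '' A) = 0 := by
  choose! C r hr _ h using fun y (hy : y ∈ e.target) =>
    exists_volume_comparison_nhds (M := M) he hy
  obtain ⟨T, hTA, hTc, hT⟩ := TopologicalSpace.countable_cover_nhdsWithin
    (f := fun y => Metric.ball y (r y)) (s := A)
    fun y hy => mem_nhdsWithin_of_mem_nhds (Metric.ball_mem_nhds y (hr y (hA hy)))
  have hsub : e.symm '' A ⊆ ⋃ y ∈ T, e.symm '' (A ∩ Metric.ball y (r y)) := by
    rintro _ ⟨z, hz, rfl⟩
    obtain ⟨y, hy, hzy⟩ := Set.mem_iUnion₂.1 (hT hz)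
    exact Set.mem_iUnion₂.2 ⟨y, hy, z, ⟨hz, hzy⟩, rfl⟩
  refine measure_mono_null hsub ((measure_biUnion_null_iff hTc).2 fun y hy => ?_)
  refine le_antisymm ((h y (hA (hTA hy)) _ Set.inter_subset_right).2.trans ?_) zero_le
  rw [measure_mono_null Set.inter_subset_left h0, mul_zero]

lemma ae_of_ae_chart {e : OpenPartialHomeomorph M (ℰ m)} (he : e ∈ atlas (ℰ m) M)
    {P : M → Prop} {W : Set (ℰ m)} (hP : ∀ᵐ y, y ∈ W → P (e.symm y)) :
    ∀ᵐ x ∂(μHE[m] : Measure M), x ∈ e.source → e x ∈ W → P x := by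
  rw [ae_iff] at hP ⊢
  refine measure_mono_null ?_ (measure_chart_symm_image_eq_zero (M := M) he
    (A := {y | ¬(y ∈ W → P (e.symm y))} ∩ e.target) Set.inter_subset_right
    (measure_mono_null Set.inter_subset_left hP))
  intro x hx
  simp only [Set.mem_ofPred_eq, Classical.not_imp] at hx
  refine ⟨e x, ⟨?_, e.map_source hx.1⟩, e.left_inv hx.1⟩
  simp only [Set.mem_ofPred_eq, Classical.not_imp, e.left_inv hx.1]
  exact hx.2

lemma isLocallyFiniteMeasure_euclideanHausdorffMeasure :
    IsLocallyFiniteMeasure (μHE[m] : Measure M) := by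
  refine ⟨fun x => ?_⟩
  obtain ⟨C, r, hr, hsub, h⟩ := exists_volume_comparison_nhds (M := M)
    (chart_mem_atlas (ℰ m) x) (mem_chart_target (ℰ m) x)
  refine ⟨(chartAt (ℰ m) x).symm '' Metric.ball (chartAt (ℰ m) x x) r, ?_, ?_⟩
  · refine ((chartAt (ℰ m) x).symm.isOpen_image_of_subset_source Metric.isOpen_ball
      hsub).mem_nhds ?_
    exact ⟨_, Metric.mem_ball_self hr, (chartAt (ℰ m) x).left_inv (mem_chart_source (ℰ m) x)⟩
  · exact (h _ le_rfl).2.trans_lt (ENNReal.mul_lt_top (by simp) measure_ball_lt_top)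

lemma nullSingletonClass_euclideanHausdorffMeasure (hm : 1 ≤ m) : NullSingletonClass (μHE[m] : Measure M) := by
  refine ⟨fun x => ?_⟩
  have : Nonempty (Fin m) := ⟨⟨0, hm⟩⟩
  have h := measure_chart_symm_image_eq_zero (M := M) (chart_mem_atlas (ℰ m) x)
    (A := {chartAt (ℰ m) x x}) (by simp) (by simp)
  simpa using h

end RiemannianVolume

/-! ### Integrals of truncated singular kernels -/

section KernelEstimate

variable {X : Type*} [EMetricSpace X] [MeasurableSpace X] [BorelSpace X]

/-- On the shell the denominator is at least a^(m+β), while the volume is at most A (2a)^m. -/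
lemma setLIntegral_shell_le {μ : Measure X} {x : X} {A : ℝ≥0} {m : ℕ}
    (hA : ∀ t : ℝ, 0 < t → μ {z | edist x z ≤ ENNReal.ofReal t} ≤ A * ENNReal.ofReal (t ^ m))
    {β : ℝ} {c : ℝ≥0∞} {f : ℝ≥0∞ → ℝ≥0∞} {a : ℝ} (ha : 0 < a) (hβ : 0 ≤ β)
    (hf : ∀ d, d ≤ ENNReal.ofReal (2 * a) → f d ≤ c) :
    ∫⁻ z in {z | ENNReal.ofReal a < edist x z ∧ edist x z ≤ ENNReal.ofReal (2 * a)},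
      f (edist x z) / edist x z ^ ((m : ℝ) + β) ∂μ ≤
      c * (A * 2 ^ m) * ENNReal.ofReal (a ^ (-β)) := by
  have hms : MeasurableSet {z | ENNReal.ofReal a < edist x z ∧
      edist x z ≤ ENNReal.ofReal (2 * a)} := by
    have h1 : Measurable fun z => edist x z := measurable_edist_right
    exact (measurableSet_lt measurable_const h1).inter (measurableSet_le h1 measurable_const)
  calc _ ≤ ∫⁻ z in {z | ENNReal.ofReal a < edist x z ∧ edist x z ≤ ENNReal.ofReal (2 * a)},
        c * (ENNReal.ofReal (a ^ ((m : ℝ) + β)))⁻¹ ∂μ := by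
        refine setLIntegral_mono' hms fun z hz => ?_
        rw [ENNReal.div_eq_inv_mul, mul_comm]
        gcongr
        · exact hf _ hz.2
        · rw [← ENNReal.ofReal_rpow_of_pos ha]
          exact ENNReal.rpow_le_rpow hz.1.le (by positivity)
    _ ≤ c * (ENNReal.ofReal (a ^ ((m : ℝ) + β)))⁻¹ * (A * ENNReal.ofReal ((2 * a) ^ m)) := by
        rw [setLIntegral_const]
        gcongr
        exact (measure_mono fun z hz => hz.2).trans (hA _ (by positivity))
    _ = _ := by
        rw [← ENNReal.ofReal_inv_of_pos (by positivity), mul_pow, ENNReal.ofReal_mul (by positivity),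
          Real.rpow_add ha, Real.rpow_neg ha.le, mul_inv, ENNReal.ofReal_mul (by positivity),
          ENNReal.ofReal_pow (by norm_num)]
        have : ENNReal.ofReal (a ^ (m : ℝ))⁻¹ * ENNReal.ofReal (a ^ m) = 1 := by
          rw [← ENNReal.ofReal_mul (by positivity), Real.rpow_natCast,
            inv_mul_cancel₀ (by positivity), ENNReal.ofReal_one]
        calc _ = c * (A * ENNReal.ofReal 2 ^ m) * ENNReal.ofReal (a ^ β)⁻¹ *
            (ENNReal.ofReal (a ^ (m : ℝ))⁻¹ * ENNReal.ofReal (a ^ m)) := by ring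
          _ = _ := by rw [this, mul_one]; norm_num

lemma tsum_ofReal_mul_pow_lt_top (c : ℝ) {b : ℝ} (hb : 0 ≤ b) (hb1 : b < 1) :
    ∑' k : ℕ, ENNReal.ofReal (c * b ^ k) < ⊤ := by
  have hs : Summable fun k : ℕ => |c| * b ^ k :=
    (summable_geometric_of_lt_one hb hb1).mul_left _
  refine lt_of_le_of_lt (ENNReal.tsum_le_tsum fun k => ENNReal.ofReal_le_ofReal
    (mul_le_mul_of_nonneg_right (le_abs_self c) (by positivity))) ?_
  rw [← ENNReal.ofReal_tsum_of_nonneg (fun k => by positivity) hs]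
  exact ENNReal.ofReal_lt_top

/-- The truncated singular kernel `min (1, d / l) ^ p / d ^ (m + s p)` has an integral of order
`l ^ (- s p)` on a space whose balls have at most the Euclidean volume growth. -/
theorem exists_lintegral_kernel_le {m : ℕ} {s p : ℝ} (hs : 0 < s) (hs1 : s < 1) (hp : 0 < p)
    (A : ℝ≥0) : ∃ C : ℝ≥0, ∀ (μ : Measure X) (x : X),
      (∀ t : ℝ, 0 < t → μ {z | edist x z ≤ ENNReal.ofReal t} ≤ A * ENNReal.ofReal (t ^ m)) →
      ∀ l : ℝ, 0 < l → ∫⁻ z, min 1 (edist x z / ENNReal.ofReal l) ^ p /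
        edist x z ^ ((m : ℝ) + s * p) ∂μ ≤ C * ENNReal.ofReal (l ^ (-(s * p))) := by
  -- Ratios of the geometric series over dyadic shells: b₁ for distances below l, where the
  -- numerator (d/l)^p gives convergence because s < 1, and b₂ for distances above l, where s p > 0
  -- suffices.
  let b₁ : ℝ := (2 : ℝ)⁻¹ ^ ((1 - s) * p)
  let b₂ : ℝ := (2 : ℝ)⁻¹ ^ (s * p)
  have hb₁ : b₁ < 1 := Real.rpow_lt_one (by norm_num) (by norm_num)
    (mul_pos (sub_pos.2 hs1) hp)
  have hb₂ : b₂ < 1 := Real.rpow_lt_one (by norm_num) (by norm_num) (mul_pos hs hp)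
  have hb₁0 : 0 ≤ b₁ := by positivity
  have hb₂0 : 0 ≤ b₂ := by positivity
  let S : ℝ≥0∞ := A * 2 ^ m * ((∑' k : ℕ, ENNReal.ofReal ((2 : ℝ) ^ (s * p) * b₁ ^ k)) +
    ∑' k : ℕ, ENNReal.ofReal (1 * b₂ ^ k))
  have hS : S ≠ ⊤ := ENNReal.mul_ne_top (by finiteness) (ENNReal.add_ne_top.2
    ⟨(tsum_ofReal_mul_pow_lt_top _ hb₁0 hb₁).ne, (tsum_ofReal_mul_pow_lt_top _ hb₂0 hb₂).ne⟩)
  refine ⟨S.toNNReal, fun μ x hA l hl => ?_⟩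
  rw [ENNReal.coe_toNNReal hS]
  set f : ℝ≥0∞ → ℝ≥0∞ := fun d => min 1 (d / ENNReal.ofReal l) ^ p with hf
  let N : ℕ → Set X := fun k => {z | ENNReal.ofReal (l * 2⁻¹ ^ (k + 1)) < edist x z ∧
    edist x z ≤ ENNReal.ofReal (2 * (l * 2⁻¹ ^ (k + 1)))}
  let P : ℕ → Set X := fun k => {z | ENNReal.ofReal (l * 2 ^ k) < edist x z ∧
    edist x z ≤ ENNReal.ofReal (2 * (l * 2 ^ k))}
  have hβ : (0 : ℝ) ≤ s * p := by positivity
  have hN : ∀ k, ∫⁻ z in N k, f (edist x z) / edist x z ^ ((m : ℝ) + s * p) ∂μ ≤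
      A * 2 ^ m * ENNReal.ofReal ((2 : ℝ) ^ (s * p) * b₁ ^ k) *
        ENNReal.ofReal (l ^ (-(s * p))) := by
    intro k
    have h1 := setLIntegral_shell_le (μ := μ) (x := x) hA (β := s * p)
      (c := ENNReal.ofReal ((2⁻¹ ^ k : ℝ) ^ p)) (f := f) (a := l * 2⁻¹ ^ (k + 1)) (by positivity) hβ
      (by
        intro d hd
        rw [hf, ← ENNReal.ofReal_rpow_of_nonneg (by positivity) hp.le]
        refine ENNReal.rpow_le_rpow ((min_le_right _ _).trans ?_) hp.le
        refine ENNReal.div_le_of_le_mul (hd.trans ?_)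
        rw [← ENNReal.ofReal_mul (by positivity)]
        refine ENNReal.ofReal_le_ofReal (le_of_eq ?_)
        rw [pow_succ]; ring)
    refine h1.trans (le_of_eq ?_)
    have e1 : (2⁻¹ ^ k : ℝ) ^ p * (l * 2⁻¹ ^ (k + 1)) ^ (-(s * p)) =
        (2 : ℝ) ^ (s * p) * b₁ ^ k * l ^ (-(s * p)) := by
      rw [Real.mul_rpow hl.le (by positivity), pow_succ, Real.mul_rpow (by positivity) (by norm_num)]
      have e2 : ((2 : ℝ)⁻¹) ^ (-(s * p)) = 2 ^ (s * p) := by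
        rw [Real.inv_rpow (by norm_num), ← Real.rpow_neg (by norm_num), neg_neg]
      have e3 : b₁ ^ k = (2⁻¹ ^ k : ℝ) ^ p * (2⁻¹ ^ k : ℝ) ^ (-(s * p)) := by
        rw [← Real.rpow_add (by positivity), ← Real.rpow_natCast, ← Real.rpow_natCast,
          ← Real.rpow_mul (by norm_num), ← Real.rpow_mul (by norm_num)]
        congr 1; ring
      rw [e2, e3]; ring
    calc _ = A * 2 ^ m * (ENNReal.ofReal ((2⁻¹ ^ k : ℝ) ^ p) *
          ENNReal.ofReal ((l * 2⁻¹ ^ (k + 1)) ^ (-(s * p)))) := by ring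
      _ = _ := by
          rw [← ENNReal.ofReal_mul (by positivity), e1, ENNReal.ofReal_mul (by positivity)]
          ring
  have hP : ∀ k, ∫⁻ z in P k, f (edist x z) / edist x z ^ ((m : ℝ) + s * p) ∂μ ≤
      A * 2 ^ m * ENNReal.ofReal (1 * b₂ ^ k) * ENNReal.ofReal (l ^ (-(s * p))) := by
    intro k
    have h1 := setLIntegral_shell_le (μ := μ) (x := x) hA (β := s * p)
      (c := 1) (f := f) (a := l * 2 ^ k) (by positivity) hβ
      (by
        intro d hd
        rw [hf]
        exact (ENNReal.rpow_le_rpow (min_le_left _ _) hp.le).trans (by simp))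
    refine h1.trans (le_of_eq ?_)
    have e1 : (l * 2 ^ k) ^ (-(s * p)) = b₂ ^ k * l ^ (-(s * p)) := by
      rw [Real.mul_rpow hl.le (by positivity)]
      have e3 : b₂ ^ k = (2 ^ k : ℝ) ^ (-(s * p)) := by
        simp only [b₂]
        rw [Real.inv_rpow (by norm_num), ← Real.rpow_neg (by norm_num), ← Real.rpow_natCast,
          ← Real.rpow_natCast, ← Real.rpow_mul (by norm_num), ← Real.rpow_mul (by norm_num)]
        congr 1; ring
      rw [e3]; ring
    rw [e1, one_mul, one_mul, ENNReal.ofReal_mul (by positivity)]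
    ring
  -- The shells miss only the distances 0 and ∞, where the quotient vanishes by the conventions 0/0
  -- = 0 and t/∞ = 0 of the extended nonnegative reals.
  have hsupp : ∀ z, z ∉ (⋃ k, N k) ∪ ⋃ k, P k →
      f (edist x z) / edist x z ^ ((m : ℝ) + s * p) = 0 := by
    intro z hz
    have hmsp : (0 : ℝ) < m + s * p := by positivity
    by_cases h0 : edist x z = 0
    · simp [hf, h0, hp]
    by_cases ht : edist x z = ⊤
    · simp [ht, ENNReal.top_rpow_of_pos hmsp]
    exfalso
    apply hz
    set d := (edist x z).toReal with hd
    have hdd : edist x z = ENNReal.ofReal d := (ENNReal.ofReal_toReal ht).symm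
    have hd0 : 0 < d := ENNReal.toReal_pos h0 ht
    rcases le_or_gt d l with h | h
    · left
      have h2 : d / l ≤ 1 := (div_le_one hl).2 h
      obtain ⟨k, hk1, hk2⟩ := exists_nat_pow_near_of_lt_one (y := (2⁻¹ : ℝ))
        (div_pos hd0 hl) h2 (by norm_num) (by norm_num)
      refine Set.mem_iUnion.2 ⟨k, ?_, ?_⟩
      · rw [hdd]
        refine (ENNReal.ofReal_lt_ofReal_iff hd0).2 ?_
        rwa [lt_div_iff₀' hl] at hk1
      · rw [hdd]
        refine ENNReal.ofReal_le_ofReal ?_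
        rw [div_le_iff₀' hl] at hk2
        refine hk2.trans (le_of_eq ?_)
        rw [pow_succ]; ring
    · right
      have hpos : 0 < l := hl
      obtain ⟨k, hk1, hk2⟩ : ∃ k : ℕ, l * 2 ^ k < d ∧ d ≤ 2 * (l * 2 ^ k) := by
        obtain ⟨k, hk1, hk2⟩ := exists_nat_pow_near_of_lt_one (x := l / d) (y := (2⁻¹ : ℝ))
          (by positivity) ((div_le_one hd0).2 h.le) (by norm_num) (by norm_num)
        rw [lt_div_iff₀ hd0, inv_pow, inv_mul_lt_iff₀ (by positivity), pow_succ] at hk1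
        rw [div_le_iff₀ hd0, inv_pow, le_inv_mul_iff₀ (by positivity)] at hk2
        -- The shells are open at their inner radius, so a distance equal to l 2^(k+1) belongs to
        -- the shell of index k.
        rcases hk2.lt_or_eq with h3 | h3
        · exact ⟨k, by linarith, by linarith⟩
        · rcases k with _ | k
          · simp at h3; linarith
          · rw [pow_succ] at h3
            refine ⟨k, ?_, by linarith⟩
            have : 0 < 2 ^ k * l := by positivity
            linarith
      refine Set.mem_iUnion.2 ⟨k, ?_, ?_⟩
      · rw [hdd]
        exact (ENNReal.ofReal_lt_ofReal_iff hd0).2 hk1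
      · rw [hdd]
        exact ENNReal.ofReal_le_ofReal hk2
  have hmN : ∀ a b : ℝ≥0∞, MeasurableSet {z | a < edist x z ∧ edist x z ≤ b} := fun a b => by
    have h1 : Measurable fun z => edist x z := measurable_edist_right
    exact (measurableSet_lt measurable_const h1).inter (measurableSet_le h1 measurable_const)
  have hmeas : MeasurableSet ((⋃ k, N k) ∪ ⋃ k, P k) :=
    (MeasurableSet.iUnion fun k => hmN _ _).union (MeasurableSet.iUnion fun k => hmN _ _)
  calc ∫⁻ z, f (edist x z) / edist x z ^ ((m : ℝ) + s * p) ∂μ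
      = ∫⁻ z in (⋃ k, N k) ∪ ⋃ k, P k, f (edist x z) / edist x z ^ ((m : ℝ) + s * p) ∂μ := by
        rw [← lintegral_indicator hmeas]
        refine lintegral_congr fun z => ?_
        by_cases hz : z ∈ (⋃ k, N k) ∪ ⋃ k, P k
        · rw [Set.indicator_of_mem hz]
        · rw [Set.indicator_of_notMem hz, hsupp z hz]
    _ ≤ (∫⁻ z in ⋃ k, N k, f (edist x z) / edist x z ^ ((m : ℝ) + s * p) ∂μ) +
        ∫⁻ z in ⋃ k, P k, f (edist x z) / edist x z ^ ((m : ℝ) + s * p) ∂μ :=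
        lintegral_union_le _ _ _
    _ ≤ (∑' k, A * 2 ^ m * ENNReal.ofReal ((2 : ℝ) ^ (s * p) * b₁ ^ k) *
          ENNReal.ofReal (l ^ (-(s * p)))) +
        ∑' k, A * 2 ^ m * ENNReal.ofReal (1 * b₂ ^ k) * ENNReal.ofReal (l ^ (-(s * p))) := by
        gcongr
        · exact (lintegral_iUnion_le _ _).trans (ENNReal.tsum_le_tsum hN)
        · exact (lintegral_iUnion_le _ _).trans (ENNReal.tsum_le_tsum hP)
    _ = _ := by
        rw [ENNReal.tsum_mul_right, ENNReal.tsum_mul_right, ENNReal.tsum_mul_left,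
          ENNReal.tsum_mul_left]
        ring

end KernelEstimate

/-! ### Balls with uniform constants in charts of M -/

section ChartBalls

/-- A ball in a chart on which the chart is bilipschitz and the Riemannian volume is comparable to
the Lebesgue measure, with constants `Λ`. -/
structure ChartBall {m : ℕ} {M : Type*} [EMetricSpace M] [ChartedSpace (ℰ m) M]
    [RiemannianBundle (fun x : M => TangentSpace (𝓡 m) x)] [MeasurableSpace M] [BorelSpace M]
    (e : OpenPartialHomeomorph M (ℰ m)) (y₀ : ℰ m) (R : ℝ) (Λ : ℝ≥0) : Prop where
  mem_atlas : e ∈ atlas (ℰ m) M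
  pos : 0 < R
  one_le : 1 ≤ Λ
  subset_target : Metric.closedBall y₀ (2 * R) ⊆ e.target
  edist_symm_le : ∀ y ∈ Metric.closedBall y₀ (2 * R), ∀ z ∈ Metric.closedBall y₀ (2 * R),
    edist (e.symm y) (e.symm z) ≤ Λ * edist y z
  edist_le : ∀ y ∈ Metric.closedBall y₀ (2 * R), ∀ z ∈ Metric.closedBall y₀ (2 * R),
    edist y z ≤ Λ * edist (e.symm y) (e.symm z)
  volume_le : ∀ A ⊆ Metric.closedBall y₀ (2 * R),
    volume A ≤ Λ * (μHE[m] : Measure M) (e.symm '' A)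
  le_volume : ∀ A ⊆ Metric.closedBall y₀ (2 * R),
    (μHE[m] : Measure M) (e.symm '' A) ≤ Λ * volume A
  exists_symm_eq : ∀ y ∈ Metric.closedBall y₀ R, ∀ x, edist (e.symm y) x ≤ (Λ : ℝ≥0∞)⁻¹ →
    ∃ z ∈ Metric.ball y₀ (2 * R), e.symm z = x
  measure_closedBall_le : ∀ y ∈ Metric.closedBall y₀ R, ∀ t : ℝ, 0 < t →
    (μHE[m] : Measure M) {x | edist (e.symm y) x ≤ ENNReal.ofReal t} ≤ Λ * ENNReal.ofReal (t ^ m)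
  norm_mfderiv_symm_le : ∀ y ∈ Metric.closedBall y₀ (2 * R), ∀ v : ℰ m,
    ‖mfderiv (𝓡 m) (𝓡 m) e.symm y v‖ ≤ Λ * ‖v‖
  norm_mfderiv_le : ∀ y ∈ Metric.closedBall y₀ (2 * R), ∀ v : TangentSpace (𝓡 m) (e.symm y),
    ‖(show ℰ m from mfderiv (𝓡 m) (𝓡 m) e (e.symm y) v)‖ ≤ Λ * ‖v‖

variable {m : ℕ} {M : Type*} [EMetricSpace M] [ChartedSpace (ℰ m) M] [IsManifold (𝓡 m) ∞ M]
  [RiemannianBundle (fun x : M => TangentSpace (𝓡 m) x)]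
  [IsContMDiffRiemannianBundle (𝓡 m) ∞ (ℰ m) (fun x : M => TangentSpace (𝓡 m) x)]
  [IsRiemannianManifold (𝓡 m) M] [MeasurableSpace M] [BorelSpace M]

lemma volume_closedBall_le {t : ℝ} (ht : 0 ≤ t) (y : ℰ m) :
    volume (Metric.closedBall y t) =
      ENNReal.ofReal (t ^ m) * volume (Metric.ball (0 : ℰ m) 1) := by
  rw [Measure.addHaar_closedBall _ _ ht, finrank_euclideanSpace_fin]

/-- All the properties hold on small balls, by local comparison and compactness, except the volume
growth at all radii. This is where the alternative `hM` is needed: a compact M has finite volume,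
and for Euclidean M the growth is exact. -/
lemma exists_chartBall
    (hM : CompactSpace M ∨ ∃ Φ : M ≃ₘ⟮𝓡 m, 𝓡 m⟯ EuclideanSpace ℝ (Fin m), Isometry Φ) (x : M) :
    ∃ (e : OpenPartialHomeomorph M (ℰ m)) (R : ℝ) (Λ : ℝ≥0), x ∈ e.source ∧
      ChartBall e (e x) R Λ := by
  set e := chartAt (ℰ m) x
  have he : e ∈ atlas (ℰ m) M := chart_mem_atlas (ℰ m) x
  have hx : x ∈ e.source := mem_chart_source (ℰ m) x
  set y₀ := e x
  have hy₀ : y₀ ∈ e.target := e.map_source hx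
  obtain ⟨C₁, r₁, hr₁, hsub₁, h11, h12⟩ := exists_bilipschitz_chart he hy₀
  obtain ⟨C₂, r₂, hr₂, hsub₂, h2⟩ := exists_volume_comparison_nhds (M := M) he hy₀
  obtain ⟨C₃, hC₃, h3⟩ := exists_norm_mfderiv_chart_symm_le he hy₀
  obtain ⟨C₄, hC₄, h4⟩ := exists_norm_mfderiv_chart_le he (e.map_target hy₀)
  obtain ⟨r₃, hr₃, h3⟩ := Metric.mem_nhds_iff.1 h3
  obtain ⟨r₄, hr₄, h4⟩ := Metric.mem_nhds_iff.1 ((e.continuousAt_symm hy₀).preimage_mem_nhds h4)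
  set R : ℝ := min (min r₁ r₂) (min r₃ r₄) / 4 with hR
  have hRpos : 0 < R := by positivity
  have hRlt : 2 * R < min (min r₁ r₂) (min r₃ r₄) := by
    have : 0 < min (min r₁ r₂) (min r₃ r₄) := by positivity
    rw [hR]; linarith
  have hball : Metric.closedBall y₀ (2 * R) ⊆
      Metric.ball y₀ (min (min r₁ r₂) (min r₃ r₄)) := Metric.closedBall_subset_ball hRlt
  have b1 : Metric.closedBall y₀ (2 * R) ⊆ Metric.ball y₀ r₁ :=
    hball.trans (Metric.ball_subset_ball ((min_le_left _ _).trans (min_le_left _ _)))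
  have b2 : Metric.closedBall y₀ (2 * R) ⊆ Metric.ball y₀ r₂ :=
    hball.trans (Metric.ball_subset_ball ((min_le_left _ _).trans (min_le_right _ _)))
  have b3 : Metric.closedBall y₀ (2 * R) ⊆ Metric.ball y₀ r₃ :=
    hball.trans (Metric.ball_subset_ball ((min_le_right _ _).trans (min_le_left _ _)))
  have b4 : Metric.closedBall y₀ (2 * R) ⊆ Metric.ball y₀ r₄ :=
    hball.trans (Metric.ball_subset_ball ((min_le_right _ _).trans (min_le_right _ _)))
  have bR : Metric.closedBall y₀ R ⊆ Metric.closedBall y₀ (2 * R) :=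
    Metric.closedBall_subset_closedBall (by linarith)
  -- separation from the complement of the large ball
  obtain ⟨δ, hδ, hsep⟩ := IsCompact.exists_cthickening_subset_open
    (s := e.symm '' Metric.closedBall y₀ R) (t := e.symm '' Metric.ball y₀ (2 * R))
    ((isCompact_closedBall y₀ R).image_of_continuousOn
      (e.continuousOn_symm.mono (bR.trans (b1.trans hsub₁))))
    (e.symm.isOpen_image_of_subset_source Metric.isOpen_ball
      (Metric.ball_subset_closedBall.trans (b1.trans hsub₁)))
    (Set.image_mono (Metric.closedBall_subset_ball (by linarith)))
  have hsep' : ∀ y ∈ Metric.closedBall y₀ R, ∀ x, edist (e.symm y) x ≤ ENNReal.ofReal δ →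
      ∃ z ∈ Metric.ball y₀ (2 * R), e.symm z = x := by
    intro y hy x hx
    obtain ⟨z, hz, hzx⟩ := hsep (Metric.mem_cthickening_of_edist_le x (e.symm y) δ _ ⟨y, hy, rfl⟩
      (by rwa [edist_comm]))
    exact ⟨z, hz, hzx⟩
  -- volume growth
  have hgrowth : ∃ A : ℝ≥0, ∀ y ∈ Metric.closedBall y₀ R, ∀ t : ℝ, 0 < t →
      (μHE[m] : Measure M) {x | edist (e.symm y) x ≤ ENNReal.ofReal t} ≤
        A * ENNReal.ofReal (t ^ m) := by
    have hv : volume (Metric.ball (0 : ℰ m) 1) ≠ ⊤ := measure_ball_lt_top.ne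
    rcases hM with hM | ⟨Φ, hΦ⟩
    · have := isLocallyFiniteMeasure_euclideanHausdorffMeasure (m := m) (M := M)
      have hfin : (μHE[m] : Measure M) Set.univ ≠ ⊤ := measure_ne_top _ _
      let A₁ : ℝ≥0∞ := C₂ * (C₁ : ℝ≥0∞) ^ m * volume (Metric.ball (0 : ℰ m) 1)
      let A₂ : ℝ≥0∞ := (μHE[m] : Measure M) Set.univ * ENNReal.ofReal (δ⁻¹ ^ m)
      have hA : A₁ + A₂ ≠ ⊤ := by
        refine ENNReal.add_ne_top.2 ⟨ENNReal.mul_ne_top (by finiteness) hv,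
          ENNReal.mul_ne_top hfin ENNReal.ofReal_ne_top⟩
      refine ⟨(A₁ + A₂).toNNReal, fun y hy t ht => ?_⟩
      rw [ENNReal.coe_toNNReal hA]
      rcases le_or_gt t δ with htδ | htδ
      · have hsubset : {x | edist (e.symm y) x ≤ ENNReal.ofReal t} ⊆
            e.symm '' (Metric.closedBall y (C₁ * t) ∩ Metric.closedBall y₀ (2 * R)) := by
          intro x hx
          obtain ⟨z, hz, rfl⟩ := hsep' y hy x (le_trans hx (ENNReal.ofReal_le_ofReal htδ))
          refine ⟨z, ⟨?_, Metric.ball_subset_closedBall hz⟩, rfl⟩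
          have h5 := h12 ⟨y, b1 (bR hy), rfl⟩ ⟨z, b1 (Metric.ball_subset_closedBall hz), rfl⟩
          rw [e.right_inv (hsub₁ (b1 (bR hy))),
            e.right_inv (hsub₁ (b1 (Metric.ball_subset_closedBall hz)))] at h5
          rw [Metric.mem_closedBall, dist_comm, ← ENNReal.ofReal_le_ofReal_iff (by positivity),
            ← edist_dist, ENNReal.ofReal_mul C₁.coe_nonneg, ENNReal.ofReal_coe_nnreal]
          exact h5.trans (mul_le_mul_right hx _)
        refine (measure_mono hsubset).trans (((h2 _ (Set.inter_subset_right.trans b2)).2).trans ?_)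
        calc C₂ * volume (Metric.closedBall y (C₁ * t) ∩ Metric.closedBall y₀ (2 * R))
            ≤ C₂ * volume (Metric.closedBall y (C₁ * t)) := by
              gcongr; exact Set.inter_subset_left
          _ = A₁ * ENNReal.ofReal (t ^ m) := by
              rw [volume_closedBall_le (by positivity), mul_pow, ENNReal.ofReal_mul (by positivity),
                ENNReal.ofReal_pow C₁.coe_nonneg, ENNReal.ofReal_coe_nnreal]
              simp only [A₁]; ring
          _ ≤ _ := by gcongr; exact le_self_add
      -- Beyond the radius δ the total volume, multiplied by (t/δ)^m ≥ 1, is a sufficient bound.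
      · calc (μHE[m] : Measure M) {x | edist (e.symm y) x ≤ ENNReal.ofReal t}
            ≤ (μHE[m] : Measure M) Set.univ * 1 := by
              rw [mul_one]; exact measure_mono (Set.subset_univ _)
          _ ≤ (μHE[m] : Measure M) Set.univ * (ENNReal.ofReal (δ⁻¹ ^ m) *
              ENNReal.ofReal (t ^ m)) := by
              gcongr
              rw [← ENNReal.ofReal_mul (by positivity), ← mul_pow, ENNReal.one_le_ofReal]
              refine one_le_pow₀ ?_
              rw [inv_mul_eq_div, one_le_div hδ]
              exact htδ.le
          _ = A₂ * ENNReal.ofReal (t ^ m) := by simp only [A₂]; ring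
          _ ≤ _ := by gcongr; exact le_add_self
    · refine ⟨(volume (Metric.ball (0 : ℰ m) 1)).toNNReal, fun y hy t ht => ?_⟩
      rw [ENNReal.coe_toNNReal hv]
      have h5 := hΦ.euclideanHausdorffMeasure_image (d := m)
        {x | edist (e.symm y) x ≤ ENNReal.ofReal t}
      rw [EuclideanSpace.euclideanHausdorffMeasure_eq_volume] at h5
      rw [← h5, mul_comm, ← volume_closedBall_le ht.le (Φ (e.symm y))]
      refine measure_mono ?_
      rintro _ ⟨z, hz, rfl⟩
      rw [Metric.mem_closedBall, dist_comm, ← ENNReal.ofReal_le_ofReal_iff ht.le, ← edist_dist,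
        hΦ.edist_eq]
      exact hz
  obtain ⟨A, hA⟩ := hgrowth
  set Λ : ℝ≥0 := 1 + C₁ + C₂ + C₃.toNNReal + C₄.toNNReal + A + δ.toNNReal⁻¹ with hΛ
  have l1 : C₁ ≤ Λ := le_add_right (le_add_right (le_add_right (le_add_right (le_add_right (le_add_self)))))
  have l2 : C₂ ≤ Λ := le_add_right (le_add_right (le_add_right (le_add_right (le_add_self))))
  have l3 : C₃ ≤ Λ := (Real.le_coe_toNNReal _).trans (NNReal.coe_le_coe.2
    (le_add_right (le_add_right (le_add_right (le_add_self)))))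
  have l4 : C₄ ≤ Λ := (Real.le_coe_toNNReal _).trans (NNReal.coe_le_coe.2
    (le_add_right (le_add_right (le_add_self))))
  have l5 : A ≤ Λ := le_add_right (le_add_self)
  have l6 : δ.toNNReal⁻¹ ≤ Λ := le_add_self
  refine ⟨e, R, Λ, hx, he, hRpos, ?_, b1.trans hsub₁, ?_, ?_, ?_, ?_, ?_, ?_, ?_, ?_⟩
  · exact le_add_right (le_add_right (le_add_right (le_add_right (le_add_right (le_self_add)))))
  · exact fun y hy z hz => (h11 (b1 hy) (b1 hz)).trans (by gcongr)
  · intro y hy z hz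
    have h5 := h12 ⟨y, b1 hy, rfl⟩ ⟨z, b1 hz, rfl⟩
    rw [e.right_inv (hsub₁ (b1 hy)), e.right_inv (hsub₁ (b1 hz))] at h5
    exact h5.trans (by gcongr)
  · exact fun A hA => ((h2 A (hA.trans b2)).1).trans (by gcongr)
  · exact fun A hA => ((h2 A (hA.trans b2)).2).trans (by gcongr)
  · refine fun y hy x hxy => hsep' y hy x (hxy.trans ?_)
    rw [ENNReal.inv_le_iff_inv_le, ENNReal.ofReal, ← ENNReal.coe_inv (by simpa using hδ)]
    exact_mod_cast l6
  · exact fun y hy t ht => (hA y hy t ht).trans (by gcongr)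
  · exact fun y hy v => (h3 (b3 hy) v).trans (by gcongr)
  · exact fun y hy v => (h4 (b4 hy) v).trans (by gcongr)

end ChartBalls

/-! ### Functions supported in a chart -/

section ChartLift

variable {m : ℕ} {M : Type*} [TopologicalSpace M]

/-- A function on `ℝ^m`, read on the domain of a chart and extended by zero. -/
def chartLift (e : OpenPartialHomeomorph M (ℰ m)) (η : ℰ m → ℝ) : M → ℝ :=
  e.source.indicator fun x => η (e x)

variable {e : OpenPartialHomeomorph M (ℰ m)} {η : ℰ m → ℝ}

lemma chartLift_symm {y : ℰ m} (hy : y ∈ e.target) : chartLift e η (e.symm y) = η y := by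
  rw [chartLift, Set.indicator_of_mem (e.map_target hy), e.right_inv hy]

lemma measurable_chartLift [MeasurableSpace M] [BorelSpace M] (hη : Continuous η) :
    Measurable (chartLift e η) := by
  classical
  rw [chartLift, ← Set.piecewise_eq_indicator]
  exact ContinuousOn.measurable_piecewise (hη.comp_continuousOn e.continuousOn)
    continuousOn_const e.open_source.measurableSet

lemma chartLift_eq_zero {K : Set (ℰ m)} (h : ∀ y ∉ K, η y = 0) {x : M}
    (hx : x ∉ e.symm '' K) : chartLift e η x = 0 := by
  by_cases hxe : x ∈ e.source
  · rw [chartLift, Set.indicator_of_mem hxe]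
    exact h _ fun hy => hx ⟨_, hy, e.left_inv hxe⟩
  · rw [chartLift, Set.indicator_of_notMem hxe]

lemma chartLift_mem_Icc (h : ∀ y, η y ∈ Set.Icc (0 : ℝ) 1) (x : M) :
    chartLift e η x ∈ Set.Icc (0 : ℝ) 1 := by
  by_cases hxe : x ∈ e.source
  · rw [chartLift, Set.indicator_of_mem hxe]
    exact h _
  · rw [chartLift, Set.indicator_of_notMem hxe]
    exact ⟨le_rfl, zero_le_one⟩

end ChartLift

/-! ### Axioms for gradients, and the fractional case -/

section GradientCalculus

/-- An abstract notion of gradient for two-point functions `D` (such as `D x y = d (w x) (w y)`),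
covering the difference quotients of the fractional Sobolev spaces and the upper gradients of the
first-order ones. -/
structure GradientCalculus {m : ℕ} {M : Type*} [EMetricSpace M] [MeasurableSpace M]
    (e : OpenPartialHomeomorph M (ℰ m)) (y₀ : ℰ m) (R s p : ℝ) where
  ν : Measure (M × M)
  IsGrad : (M → M → ℝ≥0∞) → (M × M → ℝ≥0∞) → Prop
  mono : ∀ {D D' G}, (∀ x y, D x y ≤ D' x y) → IsGrad D' G → IsGrad D G
  add : ∀ {D D' G G'}, IsGrad D G → IsGrad D' G' →
    IsGrad (fun x y => D x y + D' x y) (fun z => G z + G' z)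
  const_mul : ∀ {D G} (c : ℝ≥0), IsGrad D G → IsGrad (fun x y => c * D x y) (fun z => c * G z)
  measure_point : ∀ x, ν {z | z.1 = x ∨ z.2 = x} = 0
  -- The scaling law of the energy: a cutoff with Lipschitz constant 1/l, supported in a ball of
  -- radius ϱ, costs ϱ^m l^(-sp), uniformly in the ball and in the cutoff. For s < 1 the gradient is
  -- nonlocal and is only required to vanish when both points lie outside of the ball.
  cutoff : ∃ C : ℝ≥0, ∀ (c : ℰ m) (ϱ : ℝ) (l : ℝ≥0) (η : ℰ m → ℝ), 0 < l → l ≤ 1 → 0 < ϱ →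
    Metric.closedBall c ϱ ⊆ Metric.ball y₀ R → LipschitzWith l⁻¹ η →
    (∀ y, η y ∈ Set.Icc (0 : ℝ) 1) → (∀ y ∉ Metric.closedBall c ϱ, η y = 0) →
    ∃ G, Measurable G ∧ IsGrad (fun x y => edist (chartLift e η x) (chartLift e η y)) G ∧
      (∀ z : M × M, z.1 ∉ e.symm '' Metric.closedBall c ϱ →
        z.2 ∉ e.symm '' Metric.closedBall c ϱ → G z = 0) ∧
      ∫⁻ z, G z ^ p ∂ν ≤ C * ENNReal.ofReal (ϱ ^ m * (l : ℝ) ^ (-(s * p)))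

variable {m : ℕ} {M : Type*} [EMetricSpace M] [ChartedSpace (ℰ m) M]
  [RiemannianBundle (fun x : M => TangentSpace (𝓡 m) x)] [MeasurableSpace M] [BorelSpace M]
  {e : OpenPartialHomeomorph M (ℰ m)} {y₀ : ℰ m} {R : ℝ} {Λ : ℝ≥0}

namespace ChartBall

lemma image_subset_of_subset (hB : ChartBall e y₀ R Λ) {K : Set (ℰ m)}
    (hK : K ⊆ Metric.ball y₀ R) : K ⊆ Metric.closedBall y₀ (2 * R) :=
  hK.trans (Metric.ball_subset_closedBall.trans
    (Metric.closedBall_subset_closedBall (by linarith [hB.pos])))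

lemma measurableSet_image (hB : ChartBall e y₀ R Λ) {c : ℰ m} {ϱ : ℝ}
    (hc : Metric.closedBall c ϱ ⊆ Metric.ball y₀ R) :
    MeasurableSet (e.symm '' Metric.closedBall c ϱ) :=
  ((isCompact_closedBall c ϱ).image_of_continuousOn (e.continuousOn_symm.mono
    ((hB.image_subset_of_subset hc).trans hB.subset_target))).isClosed.measurableSet

lemma measure_image_le (hB : ChartBall e y₀ R Λ) {c : ℰ m} {ϱ : ℝ} (hϱ : 0 ≤ ϱ)
    (hc : Metric.closedBall c ϱ ⊆ Metric.ball y₀ R) :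
    (μHE[m] : Measure M) (e.symm '' Metric.closedBall c ϱ) ≤
      Λ * (ENNReal.ofReal (ϱ ^ m) * volume (Metric.ball (0 : ℰ m) 1)) := by
  rw [← volume_closedBall_le hϱ c]
  exact hB.le_volume _ (hB.image_subset_of_subset hc)

/-- If x' is within 1/Λ of x, both points lie in the chart and the bilipschitz bound applies.
Otherwise the quotient on the right is at least 1, because l ≤ 1. The bound is the numerator of the
truncated kernel at length l/Λ. -/
lemma edist_chartLift_le (hB : ChartBall e y₀ R Λ) {c : ℰ m} {ϱ : ℝ} {l : ℝ≥0} {η : ℰ m → ℝ}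
    (hl : 0 < l) (hl1 : l ≤ 1) (hc : Metric.closedBall c ϱ ⊆ Metric.ball y₀ R)
    (hη : LipschitzWith l⁻¹ η) (h01 : ∀ y, η y ∈ Set.Icc (0 : ℝ) 1) {x x' : M}
    (hx : x ∈ e.symm '' Metric.closedBall c ϱ) :
    edist (chartLift e η x) (chartLift e η x') ≤
      min 1 (edist x x' / ENNReal.ofReal (l / Λ : ℝ≥0)) := by
  have hΛ : 0 < Λ := zero_lt_one.trans_le hB.one_le
  refine le_min ?_ ?_
  · obtain ⟨a0, a1⟩ := chartLift_mem_Icc (e := e) h01 x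
    obtain ⟨b0, b1⟩ := chartLift_mem_Icc (e := e) h01 x'
    rw [edist_dist, Real.dist_eq, ← ENNReal.ofReal_one]
    exact ENNReal.ofReal_le_ofReal (abs_le.2 ⟨by linarith, by linarith⟩)
  · obtain ⟨y, hy, rfl⟩ := hx
    have hyR := hc hy
    have hy2 := hB.image_subset_of_subset hc hy
    have hdiv : ∀ d : ℝ≥0∞, d / ENNReal.ofReal (l / Λ : ℝ≥0) = (l⁻¹ : ℝ≥0) * (Λ * d) := by
      intro d
      rw [ENNReal.ofReal_coe_nnreal, ENNReal.div_eq_inv_mul, ENNReal.coe_div hΛ.ne',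
        ENNReal.inv_div (Or.inl (by simp)) (Or.inl (by simpa using hΛ.ne')),
        ENNReal.coe_inv hl.ne', ENNReal.div_eq_inv_mul, mul_assoc]
    rw [hdiv]
    by_cases hd : edist (e.symm y) x' ≤ (Λ : ℝ≥0∞)⁻¹
    · obtain ⟨z, hz, rfl⟩ := hB.exists_symm_eq y (Metric.ball_subset_closedBall hyR) x' hd
      have hz2 := Metric.ball_subset_closedBall hz
      rw [chartLift_symm (hB.subset_target hy2), chartLift_symm (hB.subset_target hz2)]
      exact (hη y z).trans (mul_le_mul_right (hB.edist_le _ hy2 _ hz2) _)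
    · obtain ⟨a0, a1⟩ := chartLift_mem_Icc (e := e) h01 (e.symm y)
      obtain ⟨b0, b1⟩ := chartLift_mem_Icc (e := e) h01 x'
      calc edist (chartLift e η (e.symm y)) (chartLift e η x') ≤ 1 * 1 := by
            rw [edist_dist, Real.dist_eq, mul_one, ← ENNReal.ofReal_one]
            exact ENNReal.ofReal_le_ofReal (abs_le.2 ⟨by linarith, by linarith⟩)
        _ ≤ _ := by
            gcongr
            · rw [ENNReal.one_le_coe_iff]
              exact one_le_inv_iff₀.2 ⟨hl, hl1⟩
            · have h1 : (Λ : ℝ≥0∞) * (Λ : ℝ≥0∞)⁻¹ = 1 :=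
                ENNReal.mul_inv_cancel (by simpa using hΛ.ne') (by simp)
              rw [← h1]
              exact mul_le_mul_right (not_le.1 hd).le _

end ChartBall

lemma measurable_kernel [SecondCountableTopology M] (a p β : ℝ) :
    Measurable fun z : M × M => min 1 (edist z.1 z.2 / ENNReal.ofReal a) ^ p /
      edist z.1 z.2 ^ β := by
  fun_prop

/-- Gradients for the fractional Sobolev spaces: `IsGrad D G` means that `D ≤ G`, and the measure is
`d(x, y)^(- m - s p) dx dy`. -/
def fractionalGradientCalculus [SecondCountableTopology M] (hm : 1 ≤ m)
    [IsManifold (𝓡 m) ∞ M]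
    [IsContMDiffRiemannianBundle (𝓡 m) ∞ (ℰ m) (fun x : M => TangentSpace (𝓡 m) x)]
    [IsRiemannianManifold (𝓡 m) M] (hB : ChartBall e y₀ R Λ) {s p : ℝ} (hs : 0 < s) (hs1 : s < 1)
    (hp : 0 < p) : GradientCalculus e y₀ R s p where
  ν := ((μHE[m] : Measure M).prod μHE[m]).withDensity
    fun z => (edist z.1 z.2 ^ ((m : ℝ) + s * p))⁻¹
  IsGrad D G := ∀ x y, D x y ≤ G (x, y)
  mono h H x y := (h x y).trans (H x y)
  add H H' x y := add_le_add (H x y) (H' x y)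
  const_mul c H x y := mul_le_mul_right (H x y) _
  measure_point x := by
    have := isLocallyFiniteMeasure_euclideanHausdorffMeasure (m := m) (M := M)
    have := nullSingletonClass_euclideanHausdorffMeasure (M := M) hm
    refine withDensity_absolutelyContinuous _ _ ?_
    refine le_antisymm ((measure_union_le {z : M × M | z.1 = x} {z | z.2 = x}).trans ?_) zero_le
    have e1 : {z : M × M | z.1 = x} = {x} ×ˢ Set.univ := by ext; simp
    have e2 : {z : M × M | z.2 = x} = Set.univ ×ˢ {x} := by ext; simp
    rw [e1, e2, Measure.prod_prod, Measure.prod_prod]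
    simp
  cutoff := by
    have := isLocallyFiniteMeasure_euclideanHausdorffMeasure (m := m) (M := M)
    obtain ⟨C, hC⟩ := exists_lintegral_kernel_le (X := M) (m := m) hs hs1 hp Λ
    have hΛ : 0 < Λ := zero_lt_one.trans_le hB.one_le
    have hv : volume (Metric.ball (0 : ℰ m) 1) ≠ ⊤ := measure_ball_lt_top.ne
    refine ⟨2 * (Λ * (volume (Metric.ball (0 : ℰ m) 1)).toNNReal * (C * Λ ^ (s * p))),
      fun c ϱ l η hl hl1 hϱ hc hη h01 h0 => ⟨fun z => edist (chartLift e η z.1)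
        (chartLift e η z.2), ?_, fun _ _ => le_rfl, ?_, ?_⟩⟩
    · have h1 := measurable_chartLift (M := M) (e := e) hη.continuous
      fun_prop
    · intro z h1 h2
      simp only [chartLift_eq_zero h0 h1, chartLift_eq_zero h0 h2, edist_self]
    · set K := e.symm '' Metric.closedBall c ϱ with hK
      have hKm : MeasurableSet K := hB.measurableSet_image hc
      let k : M × M → ℝ≥0∞ := fun z => min 1 (edist z.1 z.2 / ENNReal.ofReal (l / Λ : ℝ≥0)) ^ p /
        edist z.1 z.2 ^ ((m : ℝ) + s * p)
      have hk : Measurable k := measurable_kernel _ _ _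
      have hksymm : ∀ x y, k (x, y) = k (y, x) := fun x y => by simp only [k, edist_comm]
      let k₁ : M × M → ℝ≥0∞ := (Prod.fst ⁻¹' K).indicator k
      let k₂ : M × M → ℝ≥0∞ := (Prod.snd ⁻¹' K).indicator k
      have hk₁ : Measurable k₁ := hk.indicator (measurable_fst hKm)
      have hk₂ : Measurable k₂ := hk.indicator (measurable_snd hKm)
      have hmeas := measurable_chartLift (M := M) (e := e) hη.continuous
      -- Only pairs with a point in K contribute; the kernel being symmetric, the two halves have
      -- equal integrals.
      have hle : ∀ z : M × M, (edist z.1 z.2 ^ ((m : ℝ) + s * p))⁻¹ *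
          edist (chartLift e η z.1) (chartLift e η z.2) ^ p ≤ k₁ z + k₂ z := by
        intro z
        by_cases h1 : z.1 ∈ K
        · refine le_trans ?_ le_self_add
          simp only [k₁, Set.indicator_of_mem (show z ∈ Prod.fst ⁻¹' K from h1), k]
          rw [ENNReal.div_eq_inv_mul]
          gcongr
          exact hB.edist_chartLift_le hl hl1 hc hη h01 h1
        by_cases h2 : z.2 ∈ K
        · refine le_trans ?_ le_add_self
          simp only [k₂, Set.indicator_of_mem (show z ∈ Prod.snd ⁻¹' K from h2), k]
          rw [ENNReal.div_eq_inv_mul, edist_comm (chartLift e η z.1), edist_comm z.1]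
          gcongr
          exact hB.edist_chartLift_le hl hl1 hc hη h01 h2
        · rw [chartLift_eq_zero h0 h1, chartLift_eq_zero h0 h2, edist_self,
            ENNReal.zero_rpow_of_pos hp, mul_zero]
          exact zero_le
      have hint : ∫⁻ z, k₁ z ∂((μHE[m] : Measure M).prod μHE[m]) ≤
          Λ * (ENNReal.ofReal (ϱ ^ m) * volume (Metric.ball (0 : ℰ m) 1)) *
            (C * ENNReal.ofReal ((l / Λ : ℝ≥0) ^ (-(s * p)))) := by
        rw [lintegral_prod _ hk₁.aemeasurable]
        calc ∫⁻ x, ∫⁻ y, k₁ (x, y) ∂μHE[m] ∂(μHE[m] : Measure M)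
            ≤ ∫⁻ x in K, (C * ENNReal.ofReal ((l / Λ : ℝ≥0) ^ (-(s * p)))) ∂(μHE[m]) := by
              rw [← lintegral_indicator hKm]
              refine lintegral_mono fun x => ?_
              by_cases hx : x ∈ K
              · rw [Set.indicator_of_mem hx]
                have : ∀ y, k₁ (x, y) = k (x, y) := fun y =>
                  Set.indicator_of_mem (show (x, y) ∈ Prod.fst ⁻¹' K from hx) _
                simp only [this]
                obtain ⟨y, hy, rfl⟩ := hx
                exact hC _ _ (hB.measure_closedBall_le y (Metric.ball_subset_closedBall (hc hy)))
                  _ (NNReal.coe_pos.2 (div_pos hl hΛ))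
              · have : ∀ y, k₁ (x, y) = 0 := fun y =>
                  Set.indicator_of_notMem (show (x, y) ∉ Prod.fst ⁻¹' K from hx) _
                simp [this]
          _ ≤ _ := by
              rw [setLIntegral_const, mul_comm]
              gcongr
              exact hB.measure_image_le hϱ.le hc
      have hint2 : ∫⁻ z, k₂ z ∂((μHE[m] : Measure M).prod μHE[m]) =
          ∫⁻ z, k₁ z ∂((μHE[m] : Measure M).prod μHE[m]) := by
        rw [← lintegral_prod_swap]
        refine lintegral_congr fun z => ?_
        by_cases hz : z.1 ∈ K
        · simp only [k₁, k₂]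
          rw [Set.indicator_of_mem (show z.swap ∈ Prod.snd ⁻¹' K from hz),
            Set.indicator_of_mem (show z ∈ Prod.fst ⁻¹' K from hz)]
          exact hksymm _ _
        · simp only [k₁, k₂]
          rw [Set.indicator_of_notMem (show z.swap ∉ Prod.snd ⁻¹' K from hz),
            Set.indicator_of_notMem (show z ∉ Prod.fst ⁻¹' K from hz)]
      rw [lintegral_withDensity_eq_lintegral_mul₀ (Measurable.aemeasurable (by fun_prop))
        (Measurable.aemeasurable (by fun_prop))]
      refine (lintegral_mono hle).trans ?_
      rw [lintegral_add_left hk₁, hint2, ← two_mul]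
      refine (mul_le_mul_right hint _).trans (le_of_eq ?_)
      push_cast
      rw [ENNReal.coe_toNNReal hv, Real.div_rpow l.coe_nonneg Λ.coe_nonneg,
        Real.rpow_neg Λ.coe_nonneg, div_inv_eq_mul, ENNReal.ofReal_mul (by positivity),
        ENNReal.ofReal_mul (by positivity), ← NNReal.coe_rpow l, ← NNReal.coe_rpow Λ,
        ENNReal.ofReal_coe_nnreal, ENNReal.ofReal_coe_nnreal]
      ring

end GradientCalculus

/-! ### Gradients of first order -/

section FirstOrderGradientCalculus

/-- S is an interval [a, b]. Since g vanishes on [0, 1] outside of it, continuity gives g 0 = g a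
and g 1 = g b, and the increment between a and b is at most L (b - a). -/
lemma edist_le_mul_volume_of_eq_zero {L : ℝ≥0} {g : ℝ → ℝ} (hg : LipschitzWith L g) {S : Set ℝ}
    (hS : S ⊆ Set.Icc 0 1) (hc : IsClosed S) (ho : S.OrdConnected)
    (h0 : ∀ t ∈ Set.Icc (0 : ℝ) 1, t ∉ S → g t = 0) : edist (g 0) (g 1) ≤ L * volume S := by
  have m0 : (0 : ℝ) ∈ Set.Icc (0 : ℝ) 1 := ⟨le_rfl, zero_le_one⟩
  have m1 : (1 : ℝ) ∈ Set.Icc (0 : ℝ) 1 := ⟨zero_le_one, le_rfl⟩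
  rcases S.eq_empty_or_nonempty with rfl | hne
  · simp [h0 0 m0, h0 1 m1]
  have hcomp : IsCompact S := isCompact_Icc.of_isClosed_subset hc hS
  have hconn : IsConnected S := ⟨hne, ho.isPreconnected⟩
  obtain ⟨a, b, hab, rfl⟩ : ∃ a b : ℝ, a ≤ b ∧ S = Set.Icc a b :=
    ⟨_, _, (csInf_le hcomp.bddBelow hne.some_mem).trans (le_csSup hcomp.bddAbove hne.some_mem),
      eq_Icc_of_connected_compact hconn hcomp⟩
  have ha := hS ⟨le_rfl, hab⟩
  have hb := hS ⟨hab, le_rfl⟩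
  have e0 : g 0 = g a := by
    rcases ha.1.eq_or_lt with rfl | h
    · rfl
    have h1 : Tendsto g (𝓝[<] a) (𝓝 (g a)) := hg.continuous.continuousAt.tendsto.mono_left
      nhdsWithin_le_nhds
    have h2 : Tendsto g (𝓝[<] a) (𝓝 0) := by
      refine tendsto_const_nhds.congr' ?_
      filter_upwards [Ioo_mem_nhdsLT h] with t ht
      exact (h0 t ⟨ht.1.le, ht.2.le.trans ha.2⟩ fun h => absurd h.1 (not_le.2 ht.2)).symm
    rw [tendsto_nhds_unique h1 h2]
    exact h0 0 m0 fun h' => absurd h'.1 (not_le.2 h)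
  have e1 : g 1 = g b := by
    rcases hb.2.eq_or_lt with rfl | h
    · rfl
    have h1 : Tendsto g (𝓝[>] b) (𝓝 (g b)) := hg.continuous.continuousAt.tendsto.mono_left
      nhdsWithin_le_nhds
    have h2 : Tendsto g (𝓝[>] b) (𝓝 0) := by
      refine tendsto_const_nhds.congr' ?_
      filter_upwards [Ioo_mem_nhdsGT h] with t ht
      exact (h0 t ⟨hb.1.trans ht.1.le, ht.2.le⟩ fun h => absurd h.2 (not_le.2 ht.1)).symm
    rw [tendsto_nhds_unique h1 h2]
    exact h0 1 m1 fun h' => absurd h'.2 (not_le.2 h)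
  rw [e0, e1]
  refine (hg a b).trans (le_of_eq ?_)
  rw [Real.volume_Icc, edist_dist, Real.dist_eq, abs_sub_comm, abs_of_nonneg (sub_nonneg.2 hab)]

variable {m : ℕ} {M : Type*} [EMetricSpace M] [ChartedSpace (ℰ m) M]
  [RiemannianBundle (fun x : M => TangentSpace (𝓡 m) x)] [MeasurableSpace M] [BorelSpace M]
  {e : OpenPartialHomeomorph M (ℰ m)} {y₀ : ℰ m} {R : ℝ} {Λ : ℝ≥0}

/-- The times at which a segment is in the ball form an interval, so that L times the indicator of
the ball is an upper gradient of η along every segment. -/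
lemma edist_translate_le_of_eq_zero {L : ℝ≥0} {η : ℰ m → ℝ} (hη : LipschitzWith L η) {c : ℰ m}
    {ϱ : ℝ} (h0 : ∀ y ∉ Metric.closedBall c ϱ, η y = 0) (y v : ℰ m) :
    edist (η y) (η (y + v)) ≤ ‖v‖ₑ * ∫⁻ t in Set.Icc (0 : ℝ) 1,
      (Metric.closedBall c ϱ).indicator (fun _ => (L : ℝ≥0∞)) (y + t • v) := by
  set S : Set ℝ := Set.Icc 0 1 ∩ (fun t : ℝ => y + t • v) ⁻¹' Metric.closedBall c ϱ
  have hcont : Continuous fun t : ℝ => y + t • v := by fun_prop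
  have hlip : LipschitzWith (L * ‖v‖₊) fun t : ℝ => η (y + t • v) := by
    have h1 : LipschitzWith ‖v‖₊ fun t : ℝ => y + t • v := fun t t' => le_of_eq ?_
    · exact hη.comp h1
    rw [edist_add_left, edist_eq_enorm_sub, ← sub_smul, enorm_smul, edist_eq_enorm_sub, mul_comm,
      enorm_eq_nnnorm v]
  have hconv : Convex ℝ ((fun t : ℝ => y + t • v) ⁻¹' Metric.closedBall c ϱ) := by
    intro t ht t' ht' a b ha hb hab
    have h1 := convex_closedBall c ϱ ht ht' ha hb hab
    have h2 : a • (y + t • v) + b • (y + t' • v) = y + (a • t + b • t') • v := by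
      rw [smul_add, smul_add, add_add_add_comm, ← add_smul, hab, one_smul, smul_smul, smul_smul,
        ← add_smul, smul_eq_mul, smul_eq_mul]
    rwa [h2] at h1
  have h1 := edist_le_mul_volume_of_eq_zero hlip (S := S) Set.inter_subset_left
    (isClosed_Icc.inter (Metric.isClosed_closedBall.preimage hcont))
    (((convex_Icc 0 1).inter hconv).ordConnected)
    (fun t ht htS => h0 _ fun h => htS ⟨ht, h⟩)
  simp only [zero_smul, add_zero, one_smul] at h1
  refine h1.trans (le_of_eq ?_)
  have e1 : ∀ t : ℝ, (Metric.closedBall c ϱ).indicator (fun _ => (L : ℝ≥0∞)) (y + t • v) =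
      ((fun t : ℝ => y + t • v) ⁻¹' Metric.closedBall c ϱ).indicator (fun _ => (L : ℝ≥0∞)) t :=
    fun t => rfl
  simp only [e1]
  rw [lintegral_indicator_const (Metric.isClosed_closedBall.preimage hcont).measurableSet,
    Measure.restrict_apply (Metric.isClosed_closedBall.preimage hcont).measurableSet,
    Set.inter_comm, ENNReal.coe_mul, enorm_eq_nnnorm v]
  ring

/-- Gradients for the first-order Sobolev spaces: `IsGrad D G` means that `D x y` is controlled by
the integral of `G` along the segment from `x` to `y` in the chart. -/
def firstOrderGradientCalculus [SecondCountableTopology M] (hm : 1 ≤ m)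
    [IsManifold (𝓡 m) ∞ M]
    [IsContMDiffRiemannianBundle (𝓡 m) ∞ (ℰ m) (fun x : M => TangentSpace (𝓡 m) x)]
    [IsRiemannianManifold (𝓡 m) M] (hB : ChartBall e y₀ R Λ) {p : ℝ} (hp : 0 < p) :
    GradientCalculus e y₀ R 1 p where
  ν := (μHE[m] : Measure M).map fun x => (x, x)
  IsGrad D G := ∀ v, ∀ᵐ y, y ∈ Metric.ball y₀ R → y + v ∈ Metric.ball y₀ R →
    D (e.symm y) (e.symm (y + v)) ≤
      ‖v‖ₑ * ∫⁻ t in Set.Icc (0 : ℝ) 1, G (e.symm (y + t • v), e.symm (y + t • v))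
  mono h H v := by
    filter_upwards [H v] with y hy h1 h2
    exact (h _ _).trans (hy h1 h2)
  add H H' v := by
    filter_upwards [H v, H' v] with y hy hy' h1 h2
    refine (add_le_add (hy h1 h2) (hy' h1 h2)).trans ?_
    rw [← mul_add]
    gcongr
    exact le_lintegral_add _ _
  const_mul c H v := by
    filter_upwards [H v] with y hy h1 h2
    refine (mul_le_mul_right (hy h1 h2) _).trans ?_
    rw [mul_left_comm]
    gcongr
    exact lintegral_const_mul_le _ _
  measure_point x := by
    have := nullSingletonClass_euclideanHausdorffMeasure (M := M) hm
    have h1 : MeasurableSet {z : M × M | z.1 = x ∨ z.2 = x} :=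
      (measurable_fst (measurableSet_singleton x)).union
        (measurable_snd (measurableSet_singleton x))
    rw [Measure.map_apply (by fun_prop) h1]
    simp
  cutoff := by
    have hv : volume (Metric.ball (0 : ℰ m) 1) ≠ ⊤ := measure_ball_lt_top.ne
    refine ⟨Λ * (volume (Metric.ball (0 : ℰ m) 1)).toNNReal,
      fun c ϱ l η hl hl1 hϱ hc hη h01 h0 => ?_⟩
    have hKm := hB.measurableSet_image hc
    set K := e.symm '' Metric.closedBall c ϱ with hK
    have hGm : Measurable fun z : M × M =>
        K.indicator (fun _ => ((l⁻¹ : ℝ≥0) : ℝ≥0∞)) z.1 :=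
      (measurable_const.indicator hKm).comp measurable_fst
    refine ⟨_, hGm, ?_, ?_, ?_⟩
    · intro v
      refine Eventually.of_forall fun y hy hyv => ?_
      have hseg : ∀ t ∈ Set.Icc (0 : ℝ) 1, y + t • v ∈ e.target := fun t ht => by
        refine hB.subset_target (hB.image_subset_of_subset le_rfl ?_)
        exact (convex_ball y₀ R).add_smul_mem hy hyv ht
      have h1 := edist_translate_le_of_eq_zero hη h0 y v
      have a0 := hseg 0 ⟨le_rfl, zero_le_one⟩
      have a1 := hseg 1 ⟨zero_le_one, le_rfl⟩
      simp only [zero_smul, add_zero, one_smul] at a0 a1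
      simp only [chartLift_symm a0, chartLift_symm a1]
      refine h1.trans (mul_le_mul_right (le_of_eq ?_) _)
      refine setLIntegral_congr_fun measurableSet_Icc fun t ht => ?_
      by_cases htc : y + t • v ∈ Metric.closedBall c ϱ
      · have : e.symm (y + t • v) ∈ K := ⟨_, htc, rfl⟩
        simp only [Set.indicator_of_mem htc, Set.indicator_of_mem this]
      · have : e.symm (y + t • v) ∉ K := by
          rintro ⟨z, hz, hzy⟩
          have := e.symm.injOn (hB.subset_target (hB.image_subset_of_subset hc hz))
            (hseg t ht) hzy
          exact htc (this ▸ hz)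
        simp only [Set.indicator_of_notMem htc, Set.indicator_of_notMem this]
    · intro z h1 _
      exact Set.indicator_of_notMem h1 _
    · rw [lintegral_map (hGm.pow_const p) (by fun_prop)]
      have e1 : ∀ x, K.indicator (fun _ => ((l⁻¹ : ℝ≥0) : ℝ≥0∞)) x ^ p =
          K.indicator (fun _ => ((l⁻¹ : ℝ≥0) : ℝ≥0∞) ^ p) x := by
        intro x
        by_cases hx : x ∈ K
        · simp [hx]
        · simp [hx, hp]
      simp only [e1]
      rw [lintegral_indicator_const hKm]
      refine (mul_le_mul_right (hB.measure_image_le hϱ.le hc) _).trans (le_of_eq ?_)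
      push_cast
      rw [ENNReal.coe_toNNReal hv, ENNReal.ofReal_mul (by positivity), one_mul,
        ← NNReal.coe_rpow, ENNReal.ofReal_coe_nnreal, ENNReal.coe_rpow_of_ne_zero hl.ne',
        ENNReal.coe_inv hl.ne', ENNReal.inv_rpow, ENNReal.rpow_neg]
      ring

end FirstOrderGradientCalculus

/-! ### Radial and oscillating cutoff functions -/

section Cutoffs

/-- The function equal to `1` on `(-∞, a]`, to `0` on `[2 a, ∞)` and affine in between. -/
def tent (a r : ℝ) : ℝ := max 0 (min 1 (2 - r / a))

lemma tent_mem_Icc (a r : ℝ) : tent a r ∈ Set.Icc (0 : ℝ) 1 :=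
  ⟨le_max_left _ _, max_le zero_le_one (min_le_left _ _)⟩

lemma tent_eq_one {a r : ℝ} (ha : 0 < a) (h : r ≤ a) : tent a r = 1 := by
  have : r / a ≤ 1 := (div_le_one ha).2 h
  rw [tent, min_eq_left (by linarith), max_eq_right zero_le_one]

lemma tent_eq_zero {a r : ℝ} (ha : 0 < a) (h : 2 * a ≤ r) : tent a r = 0 := by
  have : 2 ≤ r / a := (le_div_iff₀ ha).2 h
  rw [tent, max_eq_left]
  exact (min_le_right _ _).trans (by linarith)

lemma lipschitzWith_tent (a : ℝ≥0) : LipschitzWith a⁻¹ (tent a) := by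
  have h1 : LipschitzWith a⁻¹ fun r : ℝ => 2 - r / a := by
    refine LipschitzWith.of_dist_le_mul fun x y => ?_
    rw [Real.dist_eq, Real.dist_eq, sub_sub_sub_cancel_left, ← sub_div, abs_div,
      abs_of_nonneg a.coe_nonneg, abs_sub_comm, div_eq_inv_mul, NNReal.coe_inv]
  exact (h1.const_min 1).const_max 0

lemma lipschitzWith_mul_of_mem_Icc {X : Type*} [PseudoEMetricSpace X] {f g : X → ℝ} {K L : ℝ≥0}
    (hf : LipschitzWith K f) (hg : LipschitzWith L g) (hf1 : ∀ x, f x ∈ Set.Icc (0 : ℝ) 1)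
    (hg1 : ∀ x, g x ∈ Set.Icc (0 : ℝ) 1) : LipschitzWith (K + L) fun x => f x * g x := by
  intro x y
  have h1 : edist (f x * g x) (f y * g y) ≤ edist (f x) (f y) + edist (g x) (g y) := by
    rw [edist_dist, edist_dist, edist_dist, ← ENNReal.ofReal_add dist_nonneg dist_nonneg]
    refine ENNReal.ofReal_le_ofReal ?_
    rw [Real.dist_eq, Real.dist_eq, Real.dist_eq]
    have h2 : f x * g x - f y * g y = (f x - f y) * g x + f y * (g x - g y) := by ring
    rw [h2]
    refine (abs_add_le _ _).trans ?_
    rw [abs_mul, abs_mul, abs_of_nonneg (hg1 x).1, abs_of_nonneg (hf1 y).1]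
    have h3 := mul_le_of_le_one_right (abs_nonneg (f x - f y)) (hg1 x).2
    have h4 := mul_le_of_le_one_left (abs_nonneg (g x - g y)) (hf1 y).2
    linarith
  refine h1.trans ?_
  rw [ENNReal.coe_add, add_mul]
  exact add_le_add (hf x y) (hg x y)

variable {m : ℕ}

lemma lipschitzWith_tent_dist {X : Type*} [PseudoMetricSpace X] (a : ℝ≥0) (c : X) :
    LipschitzWith a⁻¹ fun y : X => tent a (dist y c) := by
  have := (lipschitzWith_tent a).comp (LipschitzWith.dist_left c)
  rwa [mul_one] at this

/-- The distance to the integers, truncated so as to be locally constant near the integers and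
near the half-integers. -/
def sawtooth (t : ℝ) : ℝ :=
  max 0 (min 1 (4 * Metric.infDist t (Set.range ((↑) : ℤ → ℝ)) - 1 / 2))

lemma sawtooth_mem_Icc (t : ℝ) : sawtooth t ∈ Set.Icc (0 : ℝ) 1 :=
  ⟨le_max_left _ _, max_le zero_le_one (min_le_left _ _)⟩

lemma lipschitzWith_sawtooth : LipschitzWith 4 sawtooth := by
  have h1 : LipschitzWith 4 fun t : ℝ =>
      4 * Metric.infDist t (Set.range ((↑) : ℤ → ℝ)) - 1 / 2 := by
    refine LipschitzWith.of_dist_le_mul fun x y => ?_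
    have := (Metric.lipschitz_infDist_pt (Set.range ((↑) : ℤ → ℝ))).dist_le_mul x y
    rw [Real.dist_eq, sub_sub_sub_cancel_right, ← mul_sub, abs_mul, abs_of_pos (by norm_num)]
    rw [Real.dist_eq, NNReal.coe_one, one_mul] at this
    push_cast
    gcongr
  exact (h1.const_min 1).const_max 0

lemma sawtooth_eq_zero {t : ℝ} {n : ℤ} (h : |t - n| ≤ 1 / 16) : sawtooth t = 0 := by
  have h1 : Metric.infDist t (Set.range ((↑) : ℤ → ℝ)) ≤ 1 / 16 := by
    refine (Metric.infDist_le_dist_of_mem (Set.mem_range_self n)).trans ?_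
    rwa [Real.dist_eq]
  rw [sawtooth, max_eq_left]
  exact (min_le_right _ _).trans (by linarith)

/-- The two errors leave a distance of at least 1/2 - 1/8 = 3/8 to the integers, and 4 · 3/8 - 1/2 =
1. -/
lemma sawtooth_eq_one {t a : ℝ} {n : ℤ} (h : |t - n| ≤ 1 / 16) (ha : |a - 1 / 2| ≤ 1 / 16) :
    sawtooth (t + a) = 1 := by
  have h1 : 3 / 8 ≤ Metric.infDist (t + a) (Set.range ((↑) : ℤ → ℝ)) := by
    refine (Metric.le_infDist (Set.range_nonempty _)).2 ?_
    rintro _ ⟨k, rfl⟩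
    rw [abs_le] at h ha
    rw [Real.dist_eq, le_abs]
    rcases le_or_gt k n with hk | hk
    · left
      have : (k : ℝ) ≤ n := by exact_mod_cast hk
      linarith
    · right
      have : (n : ℝ) + 1 ≤ k := by exact_mod_cast hk
      linarith
  rw [sawtooth, min_eq_left (by linarith), max_eq_right zero_le_one]

/-- The eight phases are spaced by 1/8, so that one of them is within 1/16 of an integer. -/
lemma exists_abs_add_sub_le (t : ℝ) : ∃ j : Fin 8, ∃ n : ℤ, |t + (j : ℕ) / 8 - n| ≤ 1 / 16 := by
  set q := round (8 * t)
  have hq : |8 * t - q| ≤ 1 / 2 := abs_sub_round (8 * t)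
  have hj0 : 0 ≤ (-q) % 8 := Int.emod_nonneg _ (by norm_num)
  have hj8 : (-q) % 8 < 8 := Int.emod_lt_of_pos _ (by norm_num)
  refine ⟨⟨((-q) % 8).toNat, by omega⟩, (q + (-q) % 8) / 8, ?_⟩
  have h1 : ((((-q) % 8).toNat : ℕ) : ℝ) = (((-q) % 8 : ℤ) : ℝ) := by
    have : ((((-q) % 8).toNat : ℕ) : ℤ) = (-q) % 8 := Int.toNat_of_nonneg hj0
    exact_mod_cast this
  have h2 : 8 * ((q + (-q) % 8) / 8) = q + (-q) % 8 := by omega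
  have h3 : (8 : ℝ) * (((q + (-q) % 8) / 8 : ℤ) : ℝ) = q + (((-q) % 8 : ℤ) : ℝ) := by
    exact_mod_cast h2
  simp only [h1]
  rw [abs_le] at hq ⊢
  constructor <;> linarith

/-- A rapidly oscillating cutoff function: on a set of definite proportion it takes the value `0`
while its translates by all vectors close to `(ε / 2) e₀` take the value `1`. -/
lemma exists_oscillating_cutoff (i₀ : Fin m) (c : ℰ m) {ρ ε : ℝ≥0} (hε : 0 < ε) (hερ : 2 * ε ≤ ρ) :
    ∃ θ : ℰ m → ℝ, LipschitzWith (ε / 5)⁻¹ θ ∧ (∀ y, θ y ∈ Set.Icc (0 : ℝ) 1) ∧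
      (∀ y ∉ Metric.closedBall c (2 * ρ), θ y = 0) ∧
      ∃ S ⊆ Metric.ball c (ρ / 2), MeasurableSet S ∧
        volume (Metric.ball c (ρ / 2)) ≤ 8 * volume S ∧
        ∀ y ∈ S, θ y = 0 ∧
          ∀ v, ‖v - EuclideanSpace.single i₀ ((ε : ℝ) / 2)‖ ≤ ε / 16 →
            y + v ∈ Metric.ball c ρ ∧ θ (y + v) = 1 := by
  have hρ : 0 < ρ := lt_of_lt_of_le (by positivity) hερ
  have hερ' : 2 * (ε : ℝ) ≤ ρ := by exact_mod_cast hερ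
  have hε' : (0 : ℝ) < ε := hε
  have hρ' : (0 : ℝ) < ρ := hρ
  let T : Fin 8 → ℰ m → ℝ := fun j y => y i₀ / ε + (j : ℕ) / 8
  have hT : ∀ j, Continuous (T j) := fun j => by fun_prop
  let S : Fin 8 → Set (ℰ m) := fun j => Metric.ball c (ρ / 2) ∩
    ⋃ n : ℤ, {y | |T j y - n| ≤ 1 / 16}
  have hSm : ∀ j, MeasurableSet (S j) := fun j => by
    refine Metric.isOpen_ball.measurableSet.inter (MeasurableSet.iUnion fun n => ?_)
    have : Continuous fun y => |T j y - n| := ((hT j).sub continuous_const).abs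
    exact (isClosed_le this continuous_const).measurableSet
  have hcover : Metric.ball c (ρ / 2 : ℝ) ⊆ ⋃ j, S j := by
    intro y hy
    obtain ⟨j, n, hjn⟩ := exists_abs_add_sub_le (y i₀ / ε)
    exact Set.mem_iUnion.2 ⟨j, hy, Set.mem_iUnion.2 ⟨n, hjn⟩⟩
  -- Pigeonhole: one of the eight sets carries at least an eighth of the volume of the half ball,
  -- independently of ε.
  obtain ⟨j, hj⟩ : ∃ j, volume (Metric.ball c (ρ / 2 : ℝ)) ≤ 8 * volume (S j) := by
    by_contra! h
    have h1 : volume (Metric.ball c (ρ / 2 : ℝ)) ≤ ∑ j, volume (S j) :=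
      (measure_mono hcover).trans (measure_iUnion_fintype_le _ _)
    have h2 : ∑ j : Fin 8, 8 * volume (S j) < ∑ j : Fin 8, volume (Metric.ball c (ρ / 2 : ℝ)) :=
      ENNReal.sum_lt_sum_of_nonempty Finset.univ_nonempty fun j _ => h j
    rw [← Finset.mul_sum, Finset.sum_const, Finset.card_univ, Fintype.card_fin, nsmul_eq_mul] at h2
    exact absurd (mul_le_mul_right h1 8) (not_le.2 (by exact_mod_cast h2))
  refine ⟨fun y => tent ρ (dist y c) * sawtooth (T j y), ?_, ?_, ?_, S j, Set.inter_subset_left,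
    hSm j, hj, ?_⟩
  · have h1 : LipschitzWith ε⁻¹ (T j) := by
      refine LipschitzWith.of_dist_le_mul fun x y => ?_
      rw [Real.dist_eq, add_sub_add_right_eq_sub, ← sub_div, abs_div, abs_of_pos hε',
        div_eq_inv_mul, dist_eq_norm, NNReal.coe_inv]
      gcongr
      exact PiLp.norm_apply_le (x - y) i₀ |>.trans' (by simp)
    refine (lipschitzWith_mul_of_mem_Icc (lipschitzWith_tent_dist ρ c)
      (lipschitzWith_sawtooth.comp h1) (fun _ => tent_mem_Icc _ _)
      (fun _ => sawtooth_mem_Icc _)).weaken ?_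
    -- The Lipschitz constant is at most 1/ρ + 4/ε ≤ 5/ε, whence the length ε/5.
    rw [inv_div]
    have : ρ⁻¹ ≤ ε⁻¹ := inv_anti₀ hε (le_trans (le_mul_of_one_le_left' (by norm_num)) hερ)
    calc ρ⁻¹ + 4 * ε⁻¹ ≤ ε⁻¹ + 4 * ε⁻¹ := by gcongr
      _ = 5 / ε := by rw [div_eq_mul_inv]; ring
  · exact fun y => unitInterval.mul_mem (tent_mem_Icc _ _) (sawtooth_mem_Icc _)
  · intro y hy
    rw [Metric.mem_closedBall, not_le] at hy
    simp only [tent_eq_zero hρ' hy.le, zero_mul]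
  · rintro y ⟨hy, hyS⟩
    obtain ⟨n, hn⟩ := Set.mem_iUnion.1 hyS
    refine ⟨by simp only [sawtooth_eq_zero hn, mul_zero], fun v hv => ?_⟩
    have h1 : ‖v‖ ≤ 9 / 16 * ε := by
      have := norm_le_norm_add_norm_sub' v (EuclideanSpace.single i₀ ((ε : ℝ) / 2))
      rw [PiLp.norm_single, Real.norm_of_nonneg (by positivity)] at this
      linarith
    have h2 : y + v ∈ Metric.ball c ρ := by
      rw [Metric.mem_ball, dist_eq_norm] at hy ⊢
      have := norm_add_le (y - c) v
      rw [show y + v - c = y - c + v by abel]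
      linarith
    refine ⟨h2, ?_⟩
    have h3 : T j (y + v) = T j y + v i₀ / ε := by
      simp only [T, PiLp.add_apply]; ring
    have h4 : |v i₀ / ε - 1 / 2| ≤ 1 / 16 := by
      have h5 := PiLp.norm_apply_le (v - EuclideanSpace.single i₀ ((ε : ℝ) / 2)) i₀
      have h6 : (v - EuclideanSpace.single i₀ ((ε : ℝ) / 2)) i₀ = v i₀ - ε / 2 := by simp
      rw [h6, Real.norm_eq_abs] at h5
      have h7 : v i₀ / ε - 1 / 2 = (v i₀ - ε / 2) / ε := by field_simp
      rw [h7, abs_div, abs_of_pos hε', div_le_iff₀ hε']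
      linarith
    simp only [h3, sawtooth_eq_one hn h4, mul_one]
    exact tent_eq_one hρ' (Metric.mem_ball.1 h2).le

end Cutoffs

/-! ### Cutoff functions of small energy -/

section Capacity

variable {m : ℕ} {M : Type*} [EMetricSpace M] [MeasurableSpace M]
  {e : OpenPartialHomeomorph M (ℰ m)} {y₀ : ℰ m} {R s p : ℝ} {Λ : ℝ≥0}

/-- The pairs of points one of which lies in the image of the ball of centre `c` and radius `ϱ`. -/
def ballRegion (e : OpenPartialHomeomorph M (ℰ m)) (c : ℰ m) (ϱ : ℝ) : Set (M × M) :=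
  {z | z.1 ∈ e.symm '' Metric.closedBall c ϱ ∨ z.2 ∈ e.symm '' Metric.closedBall c ϱ}

lemma ballRegion_mono {c : ℰ m} {ϱ ϱ' : ℝ} (h : ϱ ≤ ϱ') :
    ballRegion e c ϱ ⊆ ballRegion e c ϱ' := by
  have := Set.image_mono (f := e.symm) (Metric.closedBall_subset_closedBall (x := c) h)
  exact fun z hz => hz.imp (fun h => this h) (fun h => this h)

namespace GradientCalculus

variable (𝒢 : GradientCalculus (M := M) e y₀ R s p)

/-- `η` is a cutoff function for the ball of centre `c` and radius `ϱ`. -/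
structure IsCutoff (c : ℰ m) (ϱ ϱ₁ : ℝ) (a : ℝ) (η : ℰ m → ℝ) : Prop where
  continuous : Continuous η
  mem_Icc : ∀ y, η y ∈ Set.Icc (0 : ℝ) a
  eq_zero : ∀ y ∉ Metric.closedBall c ϱ, η y = 0
  eq_of_mem : ∀ y ∈ Metric.closedBall c ϱ₁, η y = a

lemma isCutoff_tent (c : ℰ m) {ρ : ℝ≥0} (hρ : 0 < ρ) :
    IsCutoff c (2 * ρ) ρ 1 fun y => tent ρ (dist y c) where
  continuous := (lipschitzWith_tent_dist ρ c).continuous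
  mem_Icc _ := tent_mem_Icc _ _
  eq_zero y hy := by
    rw [Metric.mem_closedBall, not_le] at hy
    exact tent_eq_zero hρ hy.le
  eq_of_mem y hy := tent_eq_one hρ hy

/-- The scaling law with ϱ = 2ρ and l = ρ gives an energy of order ρ^(m-sp): small with ρ in the
subcritical case, but only bounded in the critical one. -/
lemma exists_gradient_tent {C : ℝ≥0}
    (hC : ∀ (c : ℰ m) (ϱ : ℝ) (l : ℝ≥0) (η : ℰ m → ℝ), 0 < l → l ≤ 1 → 0 < ϱ →
      Metric.closedBall c ϱ ⊆ Metric.ball y₀ R → LipschitzWith l⁻¹ η →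
      (∀ y, η y ∈ Set.Icc (0 : ℝ) 1) → (∀ y ∉ Metric.closedBall c ϱ, η y = 0) →
      ∃ G, Measurable G ∧ 𝒢.IsGrad (fun x y => edist (chartLift e η x) (chartLift e η y)) G ∧
        (∀ z : M × M, z.1 ∉ e.symm '' Metric.closedBall c ϱ →
          z.2 ∉ e.symm '' Metric.closedBall c ϱ → G z = 0) ∧
        ∫⁻ z, G z ^ p ∂𝒢.ν ≤ C * ENNReal.ofReal (ϱ ^ m * (l : ℝ) ^ (-(s * p))))
    {c : ℰ m} {ρ : ℝ≥0} (hρ : 0 < ρ) (hρ1 : ρ ≤ 1)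
    (hc : Metric.closedBall c (2 * ρ) ⊆ Metric.ball y₀ R) :
    ∃ G, Measurable G ∧ 𝒢.IsGrad (fun x y => edist (chartLift e (fun y => tent ρ (dist y c)) x)
        (chartLift e (fun y => tent ρ (dist y c)) y)) G ∧
      (∀ z ∉ ballRegion e c (2 * ρ), G z = 0) ∧
      ∫⁻ z, G z ^ p ∂𝒢.ν ≤ C * 2 ^ m * ENNReal.ofReal ((ρ : ℝ) ^ ((m : ℝ) - s * p)) := by
  have h := isCutoff_tent c hρ
  obtain ⟨G, h1, h2, h3, h4⟩ := hC c (2 * ρ) ρ _ hρ hρ1 (by positivity) hc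
    (lipschitzWith_tent_dist ρ c) h.mem_Icc h.eq_zero
  refine ⟨G, h1, h2, fun z hz => ?_, h4.trans (le_of_eq ?_)⟩
  · simp only [ballRegion, Set.mem_ofPred_eq, not_or] at hz
    exact h3 z hz.1 hz.2
  · have : (2 * (ρ : ℝ)) ^ m * (ρ : ℝ) ^ (-(s * p)) = 2 ^ m * (ρ : ℝ) ^ ((m : ℝ) - s * p) := by
      rw [sub_eq_add_neg, Real.rpow_add (NNReal.coe_pos.2 hρ), Real.rpow_natCast, mul_pow, mul_assoc]
    rw [this, ENNReal.ofReal_mul (by positivity), ENNReal.ofReal_pow (by norm_num), mul_assoc]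
    norm_num

variable [ChartedSpace (ℰ m) M] [RiemannianBundle (fun x : M => TangentSpace (𝓡 m) x)]
  [BorelSpace M]

lemma _root_.ChartBall.measurableSet_ballRegion (hB : ChartBall e y₀ R Λ) {c : ℰ m} {ϱ : ℝ}
    (hc : Metric.closedBall c ϱ ⊆ Metric.ball y₀ R) : MeasurableSet (ballRegion e c ϱ) :=
  (measurable_fst (hB.measurableSet_image hc)).union (measurable_snd (hB.measurableSet_image hc))

/-- The energy of a gradient concentrates on no point. -/
lemma exists_setLIntegral_ballRegion_le (hB : ChartBall e y₀ R Λ) {c : ℰ m} {ϱ : ℝ} (hϱ : 0 < ϱ)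
    (hc : Metric.closedBall c ϱ ⊆ Metric.ball y₀ R) {F : M × M → ℝ≥0∞}
    (hFi : ∫⁻ z, F z ∂𝒢.ν ≠ ⊤) {κ : ℝ≥0∞} (hκ : 0 < κ) :
    ∃ ϱ' : ℝ, 0 < ϱ' ∧ ϱ' ≤ ϱ ∧ ∫⁻ z in ballRegion e c ϱ', F z ∂𝒢.ν ≤ κ := by
  let μ' := 𝒢.ν.withDensity F
  have hfin : IsFiniteMeasure μ' := isFiniteMeasure_withDensity hFi
  let Z : ℕ → Set (M × M) := fun n => ballRegion e c (ϱ / (n + 1))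
  have hle : ∀ n : ℕ, ϱ / ((n : ℝ) + 1) ≤ ϱ := fun n =>
    div_le_self hϱ.le (by linarith [(n.cast_nonneg : (0 : ℝ) ≤ n)])
  have hsub : ∀ n : ℕ, Metric.closedBall c (ϱ / ((n : ℝ) + 1)) ⊆ Metric.ball y₀ R := fun n =>
    (Metric.closedBall_subset_closedBall (hle n)).trans hc
  have hZm : ∀ n, MeasurableSet (Z n) := fun n => hB.measurableSet_ballRegion (hsub n)
  have hanti : Antitone Z := fun n n' hn => ballRegion_mono (by
    apply div_le_div_of_nonneg_left hϱ.le (by positivity)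
    have : (n : ℝ) ≤ n' := by exact_mod_cast hn
    linarith)
  have hlim := tendsto_measure_iInter_atTop (μ := μ') (fun n => (hZm n).nullMeasurableSet) hanti
    ⟨0, measure_ne_top _ _⟩
  -- The intersection consists of pairs with a coordinate equal to the centre, a null set by
  -- `measure_point`.
  have hinter : μ' (⋂ n, Z n) = 0 := by
    refine withDensity_absolutelyContinuous _ _
      (measure_mono_null ?_ (𝒢.measure_point (e.symm c)))
    intro z hz
    by_contra hne
    simp only [Set.mem_ofPred_eq, not_or] at hne
    have hcR : c ∈ e.target := hB.subset_target
      (hB.image_subset_of_subset hc (Metric.mem_closedBall_self hϱ.le))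
    have key : ∀ x : M, x ≠ e.symm c → ∃ n : ℕ,
        x ∉ e.symm '' Metric.closedBall c (ϱ / ((n : ℝ) + 1)) := by
      intro x hx
      by_contra! h
      obtain ⟨y, hy, rfl⟩ := h 0
      have hye : y ∈ e.target := hB.subset_target (hB.image_subset_of_subset (hsub 0) hy)
      have hyc : y ≠ c := fun h => hx (by rw [h])
      obtain ⟨n, hn⟩ := exists_nat_gt (ϱ / dist y c)
      obtain ⟨y', hy', he⟩ := h n
      have := e.symm.injOn (hB.subset_target (hB.image_subset_of_subset (hsub n) hy')) hye he
      rw [this, Metric.mem_closedBall, le_div_iff₀ (by positivity)] at hy'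
      rw [div_lt_iff₀ (dist_pos.2 hyc)] at hn
      have := dist_pos.2 hyc
      nlinarith
    obtain ⟨n₁, h1⟩ := key _ hne.1
    obtain ⟨n₂, h2⟩ := key _ hne.2
    have := Set.mem_iInter.1 hz (max n₁ n₂)
    rcases this with h | h
    · have := hanti (le_max_left n₁ n₂)
      refine h1 (Set.image_mono (Metric.closedBall_subset_closedBall ?_) h)
      apply div_le_div_of_nonneg_left hϱ.le (by positivity)
      have : (n₁ : ℝ) ≤ (max n₁ n₂ : ℕ) := by exact_mod_cast le_max_left _ _
      linarith
    · refine h2 (Set.image_mono (Metric.closedBall_subset_closedBall ?_) h)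
      apply div_le_div_of_nonneg_left hϱ.le (by positivity)
      have : (n₂ : ℝ) ≤ (max n₁ n₂ : ℕ) := by exact_mod_cast le_max_right _ _
      linarith
  rw [hinter] at hlim
  obtain ⟨n, hn⟩ := (hlim.eventually_le_const hκ).exists
  refine ⟨ϱ / (n + 1), by positivity, hle n, ?_⟩
  rwa [Function.comp_apply, withDensity_apply _ (hZm n)] at hn

/-- In the subcritical case, and in the critical case if `p > 1`, points have capacity zero. -/
theorem exists_cutoff_of_small_capacity (hB : ChartBall e y₀ R Λ) (hp : 1 ≤ p)
    (hcrit : s * p < m ∨ (s * p = m ∧ 1 < p)) {c : ℰ m} {ϱ : ℝ} (hϱ : 0 < ϱ)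
    (hc : Metric.closedBall c ϱ ⊆ Metric.ball y₀ R) {κ : ℝ≥0∞} (hκ : 0 < κ) :
    ∃ ϱ₁ : ℝ, 0 < ϱ₁ ∧ ϱ₁ ≤ ϱ ∧ ∃ η : ℰ m → ℝ, IsCutoff c ϱ ϱ₁ 1 η ∧ ∃ G, Measurable G ∧
      𝒢.IsGrad (fun x y => edist (chartLift e η x) (chartLift e η y)) G ∧
      ∫⁻ z, G z ^ p ∂𝒢.ν ≤ κ := by
  obtain ⟨C, hC⟩ := 𝒢.cutoff
  have hp0 : 0 < p := zero_lt_one.trans_le hp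
  rcases hcrit with hcrit | ⟨hcrit, hp1⟩
  · have hlim : Tendsto (fun ρ : ℝ => C * 2 ^ m * ENNReal.ofReal (ρ ^ ((m : ℝ) - s * p)))
        (𝓝[>] 0) (𝓝 0) := by
      have h1 : Tendsto (fun ρ : ℝ => ρ ^ ((m : ℝ) - s * p)) (𝓝[>] 0) (𝓝 0) := by
        have := (Real.continuousAt_rpow_const 0 ((m : ℝ) - s * p)
          (Or.inr (sub_pos.2 hcrit).le)).tendsto
        rw [Real.zero_rpow (sub_pos.2 hcrit).ne'] at this
        exact this.mono_left nhdsWithin_le_nhds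
      have h2 := ENNReal.tendsto_ofReal h1
      rw [ENNReal.ofReal_zero] at h2
      have := ENNReal.Tendsto.const_mul h2 (a := (C : ℝ≥0∞) * 2 ^ m) (Or.inr (by finiteness))
      rwa [mul_zero] at this
    obtain ⟨ρ, ⟨hρ1, hρ2⟩, hρκ⟩ := (Filter.Eventually.and (p := fun ρ => ρ ∈ Set.Ioc 0 _)
      (Ioc_mem_nhdsGT (lt_min one_pos (half_pos hϱ)))
      (hlim.eventually_le_const hκ)).exists
    have hρ1 : 0 < ρ := hρ1
    lift ρ to ℝ≥0 using hρ1.le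
    have h2ρ : 2 * (ρ : ℝ) ≤ ϱ := by linarith [hρ2.trans (min_le_right _ _)]
    obtain ⟨G, h1, h2, -, h4⟩ := 𝒢.exists_gradient_tent hC (c := c) (NNReal.coe_pos.1 hρ1)
      (by exact_mod_cast hρ2.trans (min_le_left _ _))
      ((Metric.closedBall_subset_closedBall h2ρ).trans hc)
    have h := isCutoff_tent c (NNReal.coe_pos.1 hρ1)
    refine ⟨ρ, hρ1, by linarith, _, ⟨h.continuous, h.mem_Icc, fun y hy => h.eq_zero y fun hy' =>
      hy (Metric.closedBall_subset_closedBall h2ρ hy'), h.eq_of_mem⟩, G, h1, h2, h4.trans hρκ⟩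
  -- the critical case: sums of cutoff functions with well separated scales
  let A : ℝ≥0∞ := C * 2 ^ m + 1
  have hA0 : 0 < A := by positivity
  have hAt : A ≠ ⊤ := by finiteness
  -- A plateau of height J is reached with an energy growing like J rather than J^p: each new tent
  -- is supported where the sum of the previous ones has little energy. Division by the height then
  -- leaves J^(1-p), which tends to 0 because p > 1.
  have hstep : ∀ J : ℕ, ∃ ϱ₁ : ℝ, 0 < ϱ₁ ∧ ϱ₁ ≤ ϱ ∧ ∃ η : ℰ m → ℝ, IsCutoff c ϱ ϱ₁ J η ∧
      ∃ G, Measurable G ∧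
      𝒢.IsGrad (fun x y => edist (chartLift e η x) (chartLift e η y)) G ∧
      ∫⁻ z, G z ^ p ∂𝒢.ν ≤ (J + 1) * (2 ^ p * A) := by
    intro J
    induction J with
    | zero =>
      obtain ⟨ρ, ⟨hρ1, hρ2⟩⟩ : ∃ ρ : ℝ, 0 < ρ ∧ ρ ≤ min 1 (ϱ / 2) :=
        ⟨_, lt_min one_pos (half_pos hϱ), le_rfl⟩
      lift ρ to ℝ≥0 using hρ1.le
      have h2ρ : 2 * (ρ : ℝ) ≤ ϱ := by linarith [hρ2.trans (min_le_right _ _)]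
      obtain ⟨G, h1, h2, -, h4⟩ := 𝒢.exists_gradient_tent hC (c := c) (NNReal.coe_pos.1 hρ1)
        (by exact_mod_cast hρ2.trans (min_le_left _ _))
        ((Metric.closedBall_subset_closedBall h2ρ).trans hc)
      refine ⟨ρ, hρ1, by linarith, fun _ => 0, ⟨continuous_const, by simp, by simp, by simp⟩, G,
        h1, 𝒢.mono (fun x y => ?_) h2, h4.trans ?_⟩
      · have : ∀ x, chartLift e (fun _ => (0 : ℝ)) x = 0 := fun x =>
          chartLift_eq_zero (K := ∅) (by simp) (by simp)
        rw [this, this, edist_self]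
        exact zero_le
      · rw [hcrit, sub_self, Real.rpow_zero, ENNReal.ofReal_one, mul_one, Nat.cast_zero, zero_add,
          one_mul]
        calc (C : ℝ≥0∞) * 2 ^ m ≤ 1 * A := by rw [one_mul]; exact le_self_add
          _ ≤ _ := by
            gcongr
            exact ENNReal.one_le_rpow (by norm_num) hp0
    | succ J ih =>
      obtain ⟨ϱ₁, hϱ₁, hϱ₁ϱ, η, hη, G, hG, hGg, hGi⟩ := ih
      have hfin : ∫⁻ z, G z ^ p ∂𝒢.ν ≠ ⊤ := ne_top_of_le_ne_top (by finiteness) hGi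
      obtain ⟨ϱ₂, hϱ₂, hϱ₂ϱ₁, hsmall⟩ := 𝒢.exists_setLIntegral_ballRegion_le hB hϱ₁
        ((Metric.closedBall_subset_closedBall hϱ₁ϱ).trans hc) hfin hA0
      obtain ⟨ρ, ⟨hρ1, hρ2⟩⟩ : ∃ ρ : ℝ, 0 < ρ ∧ ρ ≤ min 1 (ϱ₂ / 2) :=
        ⟨_, lt_min one_pos (half_pos hϱ₂), le_rfl⟩
      lift ρ to ℝ≥0 using hρ1.le
      have h2ρ : 2 * (ρ : ℝ) ≤ ϱ₂ := by linarith [hρ2.trans (min_le_right _ _)]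
      have hcρ : Metric.closedBall c (2 * ρ) ⊆ Metric.ball y₀ R :=
        (Metric.closedBall_subset_closedBall (h2ρ.trans (hϱ₂ϱ₁.trans hϱ₁ϱ))).trans hc
      obtain ⟨G', h1, h2, h3, h4⟩ := 𝒢.exists_gradient_tent hC (c := c) (NNReal.coe_pos.1 hρ1)
        (by exact_mod_cast hρ2.trans (min_le_left _ _)) hcρ
      have h := isCutoff_tent c (NNReal.coe_pos.1 hρ1)
      set ζ : ℰ m → ℝ := fun y => tent ρ (dist y c)
      refine ⟨ρ, hρ1, by linarith, fun y => η y + ζ y, ⟨hη.continuous.add h.continuous,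
        fun y => ?_, fun y hy => ?_, fun y hy => ?_⟩, fun z => G z + G' z, hG.add h1,
        𝒢.mono (fun x y => ?_) (𝒢.add hGg h2), ?_⟩
      · obtain ⟨a1, a2⟩ := hη.mem_Icc y
        obtain ⟨b1, b2⟩ := h.mem_Icc y
        push_cast
        exact ⟨by linarith, by linarith⟩
      · rw [hη.eq_zero y hy, h.eq_zero y fun hy' => hy (Metric.closedBall_subset_closedBall
          (by linarith) hy'), add_zero]
      · rw [hη.eq_of_mem y (Metric.closedBall_subset_closedBall (by linarith) hy),
          h.eq_of_mem y hy]
        push_cast; rfl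
      · have hadd : ∀ x, chartLift e (fun y => η y + ζ y) x =
            chartLift e η x + chartLift e ζ x := fun x =>
          congrFun (Set.indicator_add e.source (fun x => η (e x)) fun x => ζ (e x)) x
        rw [hadd, hadd]
        exact edist_add_add_le _ _ _ _
      · set Z := ballRegion e c (2 * ρ)
        have hZ : MeasurableSet Z := hB.measurableSet_ballRegion hcρ
        have h4' : ∫⁻ z, G' z ^ p ∂𝒢.ν ≤ A := by
          refine h4.trans ?_
          rw [hcrit, sub_self, Real.rpow_zero, ENNReal.ofReal_one, mul_one]
          exact le_self_add
        rw [← lintegral_add_compl _ hZ]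
        -- On Z both gradients have energy at most A, which adds 2^(p-1) · 2A = 2^p A; outside of Z
        -- the new gradient vanishes and the induction hypothesis applies.
        have i1 : ∫⁻ z in Z, (G z + G' z) ^ p ∂𝒢.ν ≤ 2 ^ (p - 1) * (A + A) := by
          calc _ ≤ ∫⁻ z in Z, 2 ^ (p - 1) * (G z ^ p + G' z ^ p) ∂𝒢.ν :=
                lintegral_mono fun z => ENNReal.rpow_add_le_mul_rpow_add_rpow _ _ hp
            _ = 2 ^ (p - 1) * (∫⁻ z in Z, G z ^ p ∂𝒢.ν + ∫⁻ z in Z, G' z ^ p ∂𝒢.ν) := by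
                rw [lintegral_const_mul _ (by fun_prop), lintegral_add_left (by fun_prop)]
            _ ≤ _ := by
                gcongr
                · exact (lintegral_mono_set (ballRegion_mono h2ρ)).trans hsmall
                · exact (setLIntegral_le_lintegral _ _).trans h4'
        have i2 : ∫⁻ z in Zᶜ, (G z + G' z) ^ p ∂𝒢.ν ≤ (J + 1) * (2 ^ p * A) := by
          refine le_trans (le_of_eq ?_) ((setLIntegral_le_lintegral Zᶜ _).trans hGi)
          refine setLIntegral_congr_fun hZ.compl fun z hz => ?_
          simp only [h3 z hz, add_zero]
        refine (add_le_add i1 i2).trans (le_of_eq ?_)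
        have : (2 : ℝ≥0∞) ^ p = 2 ^ (p - 1) * 2 := by
          nth_rewrite 3 [← ENNReal.rpow_one 2]
          rw [← ENNReal.rpow_add _ _ (by norm_num) (by norm_num)]
          simp
        push_cast
        rw [this]
        ring
  have hlim : Tendsto (fun J : ℕ => ENNReal.ofReal (((J : ℝ) + 1) ^ (-(p - 1))) * (2 ^ p * A * 2))
      atTop (𝓝 0) := by
    have h1 : Tendsto (fun J : ℕ => ((J : ℝ) + 1) ^ (-(p - 1))) atTop (𝓝 0) :=
      (tendsto_rpow_neg_atTop (sub_pos.2 hp1)).comp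
        (tendsto_natCast_atTop_atTop.atTop_add tendsto_const_nhds)
    have h2 := ENNReal.tendsto_ofReal h1
    rw [ENNReal.ofReal_zero] at h2
    have := ENNReal.Tendsto.mul_const h2 (b := 2 ^ p * A * 2) (Or.inr (by finiteness))
    rwa [zero_mul] at this
  obtain ⟨J, hJ⟩ := (hlim.eventually_le_const hκ).exists
  obtain ⟨ϱ₁, hϱ₁, hϱ₁ϱ, η, hη, G, hG, hGg, hGi⟩ := hstep (J + 1)
  set a : ℝ≥0 := ((J : ℝ≥0) + 1)⁻¹ with ha
  have ha' : (a : ℝ) * ((J + 1 : ℕ) : ℝ) = 1 := by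
    rw [ha]; push_cast; exact inv_mul_cancel₀ (by positivity)
  refine ⟨ϱ₁, hϱ₁, hϱ₁ϱ, fun y => a * η y, ⟨continuous_const.mul hη.continuous, fun y => ?_,
    fun y hy => ?_, fun y hy => ?_⟩, fun z => a * G z, hG.const_mul _,
    𝒢.mono (fun x y => ?_) (𝒢.const_mul a hGg), ?_⟩
  · obtain ⟨a1, a2⟩ := hη.mem_Icc y
    exact ⟨by positivity, by rw [← ha']; gcongr⟩
  · simp only [hη.eq_zero y hy, mul_zero]
  · simp only [hη.eq_of_mem y hy, ha']
  · have hmul : ∀ x, chartLift e (fun y => (a : ℝ) * η y) x = a * chartLift e η x := fun x => by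
      by_cases hx : x ∈ e.source <;> simp [chartLift, hx]
    rw [hmul, hmul, edist_dist, edist_dist, Real.dist_eq, Real.dist_eq, ← mul_sub, abs_mul,
      abs_of_nonneg a.coe_nonneg, ENNReal.ofReal_mul a.coe_nonneg, ENNReal.ofReal_coe_nnreal]
  · simp only [ENNReal.mul_rpow_of_nonneg _ _ hp0.le]
    rw [lintegral_const_mul _ (hG.pow_const p)]
    refine le_trans ?_ hJ
    refine (mul_le_mul_right hGi _).trans ?_
    -- J + 2 ≤ 2 (J + 1), the source of the last factor 2 in `hlim`.
    have h2 : (((J + 1 : ℕ) : ℝ≥0∞) + 1) ≤ 2 * ((J : ℝ≥0∞) + 1) := by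
      push_cast
      rw [mul_add, two_mul, add_assoc]
      gcongr
      · exact le_add_self
      · norm_num
    calc (a : ℝ≥0∞) ^ p * ((((J + 1 : ℕ) : ℝ≥0∞) + 1) * (2 ^ p * A))
        ≤ (a : ℝ≥0∞) ^ p * ((2 * ((J : ℝ≥0∞) + 1)) * (2 ^ p * A)) := by gcongr
      _ = ((a : ℝ≥0∞) ^ p * ((J : ℝ≥0∞) + 1)) * (2 ^ p * A * 2) := by ring
      _ = _ := by
        congr 1
        have h3 : ENNReal.ofReal (a : ℝ) = (a : ℝ≥0∞) := ENNReal.ofReal_coe_nnreal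
        have h4 : ((J : ℝ≥0∞) + 1) = ENNReal.ofReal ((J : ℝ) + 1) := by
          rw [ENNReal.ofReal_add (by positivity) zero_le_one, ENNReal.ofReal_natCast,
            ENNReal.ofReal_one]
        rw [← h3, h4, ENNReal.ofReal_rpow_of_nonneg a.coe_nonneg hp0.le,
          ← ENNReal.ofReal_mul (by positivity)]
        congr 1
        have h5 : (a : ℝ) = ((J : ℝ) + 1)⁻¹ := by rw [ha]; push_cast; rfl
        rw [h5, Real.inv_rpow (by positivity), ← Real.rpow_neg (by positivity), neg_sub,
          sub_eq_add_neg, add_comm 1, Real.rpow_add (by positivity), Real.rpow_one]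

end GradientCalculus

end Capacity

/-! ### Modifying a map along paths in the target -/

section TargetSurgery

variable {M N : Type*} [EMetricSpace N]

/-- The map `v`, modified where `θ ≠ 0` to follow the path `γ` with parameter `θ`. -/
def followPath (v : M → N) (θ : M → ℝ) (γ : ℝ → N) (z : M) : N :=
  open Classical in if θ z = 0 then v z else γ (θ z)

lemma followPath_of_eq_zero {v : M → N} {θ : M → ℝ} {γ : ℝ → N} {z : M} (h : θ z = 0) :
    followPath v θ γ z = v z := by
  rw [followPath, if_pos h]

lemma followPath_eq {v : M → N} {θ : M → ℝ} {γ : ℝ → N} {z : M} (h : v z = γ 0) :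
    followPath v θ γ z = γ (θ z) := by
  by_cases h0 : θ z = 0
  · rw [followPath_of_eq_zero h0, h, h0]
  · rw [followPath, if_neg h0]

lemma measurable_followPath [MeasurableSpace M] [MeasurableSpace N] [BorelSpace N] {v : M → N}
    {θ : M → ℝ} {γ : ℝ → N} (hv : Measurable v) (hθ : Measurable θ) (hγ : Continuous γ) :
    Measurable (followPath v θ γ) := by
  classical
  exact Measurable.ite (hθ (measurableSet_singleton 0)) hv (hγ.measurable.comp hθ)

/-- Since v equals γ 0 wherever θ does not vanish, v and γ ∘ θ match across the boundary of {θ = 0}: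
the triangle inequality through γ 0 settles the mixed cases. -/
lemma edist_followPath_le {v : M → N} {θ : M → ℝ} {γ : ℝ → N} {Λ : ℝ≥0}
    (hγ : LipschitzWith Λ γ) (h : ∀ z, θ z ≠ 0 → v z = γ 0) (z z' : M) :
    edist (followPath v θ γ z) (followPath v θ γ z') ≤
      edist (v z) (v z') + Λ * edist (θ z) (θ z') := by
  by_cases h0 : θ z = 0
  · by_cases h1 : θ z' = 0
    · rw [followPath_of_eq_zero h0, followPath_of_eq_zero h1]
      exact le_self_add
    · rw [followPath_of_eq_zero h0, followPath_eq (h z' h1)]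
      refine (edist_triangle _ (γ 0) _).trans ?_
      rw [h z' h1]
      refine add_le_add le_rfl ?_
      rw [← h0]
      exact hγ _ _
  · by_cases h1 : θ z' = 0
    · rw [followPath_of_eq_zero h1, followPath_eq (h z h0), add_comm]
      refine (edist_triangle _ (γ 0) _).trans ?_
      rw [h z h0]
      refine add_le_add ?_ le_rfl
      rw [← h1]
      exact hγ _ _
    · rw [followPath_eq (h z h0), followPath_eq (h z' h1)]
      exact (hγ _ _).trans le_add_self

lemma edist_followPath_self_le {v : M → N} {θ : M → ℝ} {γ : ℝ → N} {Λ : ℝ≥0}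
    (hγ : LipschitzWith Λ γ) (h : ∀ z, θ z ≠ 0 → v z = γ 0) (hθ : ∀ z, θ z ∈ Set.Icc (0 : ℝ) 1)
    (z : M) : edist (followPath v θ γ z) (v z) ≤ Λ := by
  by_cases h0 : θ z = 0
  · rw [followPath_of_eq_zero h0, edist_self]
    exact zero_le
  · rw [followPath_eq (h z h0), h z h0]
    refine (hγ _ _).trans ?_
    have : edist (θ z) 0 ≤ 1 := by
      rw [edist_dist, Real.dist_eq, sub_zero, ← ENNReal.ofReal_one]
      exact ENNReal.ofReal_le_ofReal (abs_le.2 ⟨by linarith [(hθ z).1], (hθ z).2⟩)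
    exact (mul_le_mul_right this _).trans (by rw [mul_one])

lemma edist_mul_le {a b a' b' : ℝ} (ha : b ∈ Set.Icc (0 : ℝ) 1) (hb : a' ∈ Set.Icc (0 : ℝ) 1) :
    edist (a * b) (a' * b') ≤ edist a a' + edist b b' := by
  rw [edist_dist, edist_dist, edist_dist, ← ENNReal.ofReal_add dist_nonneg dist_nonneg]
  refine ENNReal.ofReal_le_ofReal ?_
  rw [Real.dist_eq, Real.dist_eq, Real.dist_eq]
  have h2 : a * b - a' * b' = (a - a') * b + a' * (b - b') := by ring
  rw [h2]
  refine (abs_add_le _ _).trans ?_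
  rw [abs_mul, abs_mul, abs_of_nonneg ha.1, abs_of_nonneg hb.1]
  have h3 := mul_le_of_le_one_right (abs_nonneg (a - a')) ha.2
  have h4 := mul_le_of_le_one_left (abs_nonneg (b - b')) hb.2
  linarith

lemma lipschitzWith_toReal_edist [ConnectedSpace N] (b : N) :
    LipschitzWith 1 fun y : N => (edist y b).toReal := by
  intro y y'
  have h1 := edist_ne_top_of_connectedSpace y b
  have h2 := edist_ne_top_of_connectedSpace y' b
  have h3 := edist_ne_top_of_connectedSpace y y'
  rw [ENNReal.coe_one, one_mul, edist_dist, Real.dist_eq]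
  refine ENNReal.ofReal_le_of_le_toReal (abs_sub_le_iff.2 ⟨?_, ?_⟩)
  · rw [sub_le_iff_le_add, ← ENNReal.toReal_add h3 h2]
    exact ENNReal.toReal_mono (ENNReal.add_ne_top.2 ⟨h3, h2⟩) (edist_triangle _ _ _)
  · rw [sub_le_iff_le_add, ← ENNReal.toReal_add h3 h1]
    refine ENNReal.toReal_mono (ENNReal.add_ne_top.2 ⟨h3, h1⟩) ?_
    rw [edist_comm y y']
    exact edist_triangle _ _ _

/-- Cutoff in the target at distance `a` from `b`. -/
def targetCutoff (b : N) (a : ℝ≥0) (y : N) : ℝ := tent a (edist y b).toReal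

lemma lipschitzWith_targetCutoff [ConnectedSpace N] (b : N) (a : ℝ≥0) :
    LipschitzWith a⁻¹ (targetCutoff b a) := by
  have := (lipschitzWith_tent a).comp (lipschitzWith_toReal_edist b)
  rwa [mul_one] at this

lemma targetCutoff_eq_one {b y : N} {a : ℝ≥0} (ha : 0 < a) (h : edist y b ≤ a) :
    targetCutoff b a y = 1 :=
  tent_eq_one (NNReal.coe_pos.2 ha) (ENNReal.toReal_le_coe_of_le_coe h)

lemma edist_lt_of_targetCutoff_ne_zero [ConnectedSpace N] {b y : N} {a : ℝ≥0} (ha : 0 < a)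
    (h : targetCutoff b a y ≠ 0) : edist y b < (2 * a : ℝ≥0) := by
  by_contra! hle
  refine h (tent_eq_zero (NNReal.coe_pos.2 ha) ?_)
  have := ENNReal.toReal_mono (edist_ne_top_of_connectedSpace y b) hle
  simpa using this

/-- Replacing a map near `b` by a map into the union of two paths, the second of which is
followed back and forth. -/
theorem exists_surgery [ConnectedSpace N] [MeasurableSpace M] [MeasurableSpace N] [BorelSpace N]
    {u₀ v : M → N} (hu₀ : Measurable u₀) (hv : Measurable v) {β θ : M → ℝ} (hβ : Measurable β)
    (hθ : Measurable θ) (hβ1 : ∀ z, β z ∈ Set.Icc (0 : ℝ) 1) (hθ1 : ∀ z, θ z ∈ Set.Icc (0 : ℝ) 1)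
    {b x y : N} {a : ℝ≥0} (ha : 0 < a)
    (hvb : ∀ z, β z ≠ 0 → edist (u₀ z) b < (4 * a : ℝ≥0) → v z = b)
    (hβθ : ∀ z, θ z ≠ 0 → β z = 1) {γ σ : ℝ → N} {Λ L : ℝ≥0} (hγ : LipschitzWith Λ γ)
    (hσ : LipschitzWith L σ) (hγ0 : γ 0 = b) (hγ1 : γ 1 = x) (hσ0 : σ 0 = x) (hσ1 : σ 1 = y) :
    ∃ w : M → N, Measurable w ∧ (∀ z, β z = 0 → w z = v z) ∧
      (∀ z, edist (w z) (v z) ≤ Λ + L) ∧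
      (∀ z, edist (u₀ z) b ≤ a → β z = 1 → θ z = 0 → w z = x) ∧
      (∀ z, edist (u₀ z) b ≤ a → β z = 1 → θ z = 1 → w z = y) ∧
      ∀ z z', edist (w z) (w z') ≤ edist (v z) (v z') +
        (Λ * edist (β z) (β z') + (L * edist (θ z) (θ z') +
          ((Λ + L) * a⁻¹ : ℝ≥0) * edist (u₀ z) (u₀ z'))) := by
  have h2a : 0 < 2 * a := by positivity
  -- Since u₀ is not continuous, both cutoffs are multiplied by cutoffs of the value u₀. The first
  -- acts up to distance 4a from b and is complete up to 2a, where the second one begins to act, so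
  -- that the second path always starts from x.
  let θ₁ : M → ℝ := fun z => β z * targetCutoff b (2 * a) (u₀ z)
  let θ₂ : M → ℝ := fun z => θ z * targetCutoff b a (u₀ z)
  have hc : ∀ a' : ℝ≥0, Measurable fun z => targetCutoff b a' (u₀ z) := fun a' =>
    (lipschitzWith_targetCutoff b a').continuous.measurable.comp hu₀
  have hθ₁ : Measurable θ₁ := hβ.mul (hc _)
  have hθ₂ : Measurable θ₂ := hθ.mul (hc _)
  have hc1 : ∀ a' z, targetCutoff b a' (u₀ z) ∈ Set.Icc (0 : ℝ) 1 := fun a' z => tent_mem_Icc _ _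
  have m1 : ∀ z, θ₁ z ∈ Set.Icc (0 : ℝ) 1 := fun z =>
    ⟨mul_nonneg (hβ1 z).1 (hc1 _ z).1, mul_le_one₀ (hβ1 z).2 (hc1 _ z).1 (hc1 _ z).2⟩
  have m2 : ∀ z, θ₂ z ∈ Set.Icc (0 : ℝ) 1 := fun z =>
    ⟨mul_nonneg (hθ1 z).1 (hc1 _ z).1, mul_le_one₀ (hθ1 z).2 (hc1 _ z).1 (hc1 _ z).2⟩
  have hv1 : ∀ z, θ₁ z ≠ 0 → v z = γ 0 := by
    intro z hz
    rw [hγ0]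
    refine hvb z (left_ne_zero_of_mul hz) ?_
    have := edist_lt_of_targetCutoff_ne_zero h2a (right_ne_zero_of_mul hz)
    rwa [← mul_assoc, show (2 : ℝ≥0) * 2 = 4 by norm_num] at this
  have hone : ∀ z, β z = 1 → edist (u₀ z) b ≤ (2 * a : ℝ≥0) → followPath v θ₁ γ z = x := by
    intro z hz h
    have h1 : θ₁ z = 1 := by simp only [θ₁, hz, targetCutoff_eq_one h2a h, mul_one]
    rw [followPath_eq (hv1 z (by rw [h1]; exact one_ne_zero)), h1, hγ1]
  have hv2 : ∀ z, θ₂ z ≠ 0 → followPath v θ₁ γ z = σ 0 := by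
    intro z hz
    rw [hσ0]
    exact hone z (hβθ z (left_ne_zero_of_mul hz))
      (edist_lt_of_targetCutoff_ne_zero ha (right_ne_zero_of_mul hz)).le
  have hle : (a : ℝ≥0∞) ≤ (2 * a : ℝ≥0) := by
    rw [ENNReal.coe_le_coe, two_mul]
    exact le_self_add
  have hval : ∀ z, edist (u₀ z) b ≤ a → β z = 1 →
      followPath (followPath v θ₁ γ) θ₂ σ z = σ (θ z) := by
    intro z h hz
    rw [followPath_eq (by rw [hone z hz (h.trans hle), hσ0])]
    simp only [θ₂, targetCutoff_eq_one ha h, mul_one]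
  refine ⟨followPath (followPath v θ₁ γ) θ₂ σ, measurable_followPath (measurable_followPath hv hθ₁
    hγ.continuous) hθ₂ hσ.continuous, fun z hz => ?_, fun z => ?_, fun z h1 h2 h3 => ?_,
    fun z h1 h2 h3 => ?_, fun z z' => ?_⟩
  · have hθz : θ z = 0 := by
      by_contra h
      rw [hβθ z h] at hz
      exact one_ne_zero hz
    rw [followPath_of_eq_zero (by simp only [θ₂, hθz, zero_mul]),
      followPath_of_eq_zero (by simp only [θ₁, hz, zero_mul])]
  · rw [add_comm]
    exact (edist_triangle _ (followPath v θ₁ γ z) _).trans (add_le_add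
      (edist_followPath_self_le hσ hv2 m2 z) (edist_followPath_self_le hγ hv1 m1 z))
  · rw [hval z h1 h2, h3, hσ0]
  · rw [hval z h1 h2, h3, hσ1]
  · refine (edist_followPath_le hσ hv2 z z').trans ?_
    have e1 : edist (θ₁ z) (θ₁ z') ≤ edist (β z) (β z') + (a⁻¹ : ℝ≥0) * edist (u₀ z) (u₀ z') := by
      refine (edist_mul_le (hc1 _ z) (hβ1 z')).trans (add_le_add le_rfl
        ((lipschitzWith_targetCutoff b _ _ _).trans ?_))
      refine mul_le_mul_left ?_ _
      rw [ENNReal.coe_le_coe]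
      refine inv_anti₀ ha ?_
      rw [two_mul]
      exact le_self_add
    have e2 : edist (θ₂ z) (θ₂ z') ≤ edist (θ z) (θ z') + (a⁻¹ : ℝ≥0) * edist (u₀ z) (u₀ z') :=
      (edist_mul_le (hc1 _ z) (hθ1 z')).trans (add_le_add le_rfl
        (lipschitzWith_targetCutoff b _ _ _))
    refine (add_le_add ((edist_followPath_le hγ hv1 z z').trans (add_le_add le_rfl
      (mul_le_mul_right e1 _))) (mul_le_mul_right e2 _)).trans (le_of_eq ?_)
    push_cast
    ring

end TargetSurgery

/-! ### Dual norms of covectors -/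

section CovectorNorm

variable {m : ℕ} {M : Type*} [TopologicalSpace M] [ChartedSpace (ℰ m) M]
    [RiemannianBundle (fun x : M => TangentSpace (𝓡 m) x)]

lemma enorm_apply_le_covectorNorm {x : M} (ℓ : TangentSpace (𝓡 m) x →L[ℝ] ℝ)
    (v : TangentSpace (𝓡 m) x) {C : ℝ≥0} (hv : ‖v‖ ≤ C) : ‖ℓ v‖ₑ ≤ C * covectorNorm ℓ := by
  have key : ∀ D : ℝ≥0, 0 < D → ‖v‖ ≤ D → ‖ℓ v‖ₑ ≤ D * covectorNorm ℓ := by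
    intro D hD hvD
    have h1 : ‖ℓ ((D : ℝ)⁻¹ • v)‖ₑ ≤ covectorNorm ℓ := by
      refine le_iSup₂ (f := fun (v : TangentSpace (𝓡 m) x) (_ : ‖v‖ ≤ 1) => ‖ℓ v‖ₑ)
        ((D : ℝ)⁻¹ • v) ?_
      rw [norm_smul, norm_inv, Real.norm_of_nonneg D.coe_nonneg, inv_mul_le_iff₀ (by exact_mod_cast hD),
        mul_one]
      exact hvD
    calc ‖ℓ v‖ₑ = ‖ℓ ((D : ℝ) • ((D : ℝ)⁻¹ • v))‖ₑ := by
          rw [smul_inv_smul₀ (by exact_mod_cast hD.ne')]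
      _ = D * ‖ℓ ((D : ℝ)⁻¹ • v)‖ₑ := by
          rw [map_smul, smul_eq_mul, enorm_mul]
          congr 1
          rw [Real.enorm_eq_ofReal D.coe_nonneg, ENNReal.ofReal_coe_nnreal]
      _ ≤ _ := mul_le_mul_right h1 _
  rcases eq_or_ne C 0 with rfl | hC
  · have : v = 0 := norm_le_zero_iff.1 (by simpa using hv)
    simp [this]
  · exact key C (pos_iff_ne_zero.2 hC) hv

end CovectorNorm

/-! ### Lower bounds for the energy of oscillating maps -/

section LowerBound

lemma lintegral_enorm_rpow_le {α : Type*} [MeasurableSpace α] {μ : Measure α}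
    [IsProbabilityMeasure μ] {q : ℝ} (hq : 1 ≤ q) {f : α → ℝ} (hf : AEStronglyMeasurable f μ) :
    (∫⁻ x, ‖f x‖ₑ ∂μ) ^ q ≤ ∫⁻ x, ‖f x‖ₑ ^ q ∂μ := by
  have h := eLpNorm'_le_eLpNorm'_of_exponent_le one_pos hq μ hf
  have hq0 : 0 < q := one_pos.trans_le hq
  rw [eLpNorm', eLpNorm'] at h
  simp only [ENNReal.rpow_one, div_one] at h
  have := ENNReal.rpow_le_rpow h hq0.le
  rwa [one_div, ENNReal.rpow_inv_rpow hq0.ne'] at this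

variable {m : ℕ} {M : Type*} [EMetricSpace M] [ChartedSpace (ℰ m) M]
  [RiemannianBundle (fun x : M => TangentSpace (𝓡 m) x)] [MeasurableSpace M] [BorelSpace M]
  {e : OpenPartialHomeomorph M (ℰ m)} {y₀ : ℰ m} {R : ℝ} {Λ : ℝ≥0}

lemma ChartBall.setLIntegral_le (hB : ChartBall e y₀ R Λ) {K : Set (ℰ m)}
    (hK : K ⊆ Metric.ball y₀ R) {g : M → ℝ≥0∞} (hg : Measurable g) :
    ∫⁻ y in K, g (e.symm y) ≤ Λ * ∫⁻ x in e.symm '' K, g x ∂μHE[m] := by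
  have h2 := hB.image_subset_of_subset hK
  exact setLIntegral_comp_chart_symm_le (h2.trans hB.subset_target)
    (fun A hA => hB.volume_le A (hA.trans h2)) hg

/-- A pair of sets on which a map takes two given values and between which many translations of
length close to `ε / 2` act. -/
structure IsOscillating {F : Type*} (h : ℰ m → F) (a b : F) (i₀ : Fin m) (c : ℰ m) (ρ ε : ℝ≥0)
    (P Q : Set (ℰ m)) : Prop where
  eps_pos : 0 < ε
  eps_le : 2 * ε ≤ ρ
  measurableSet_left : MeasurableSet P
  measurableSet_right : MeasurableSet Q
  left_subset : P ⊆ Metric.ball c (ρ / 2)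
  right_subset : Q ⊆ Metric.ball c ρ
  eq_left : ∀ y ∈ P, h y = a
  eq_right : ∀ y ∈ Q, h y = b
  volume_le : ∀ v : ℰ m, ‖v - EuclideanSpace.single i₀ ((ε : ℝ) / 2)‖ ≤ ε / 16 →
    volume (Metric.ball c (ρ / 2)) ≤ 16 * volume {y | y ∈ P ∧ y + v ∈ Q}

lemma volume_ball_eq_mul (y : ℰ m) {t : ℝ} (ht : 0 < t) :
    volume (Metric.ball y t) = ENNReal.ofReal (t ^ m) * volume (Metric.ball (0 : ℰ m) 1) := by
  have := Measure.addHaar_ball_of_pos volume y ht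
  rwa [finrank_euclideanSpace_fin] at this

/-- The fractional energy of a map oscillating at scale `ε`. -/
theorem IsOscillating.le_lintegral_lintegral [SecondCountableTopology M]
    (hB : ChartBall e y₀ R Λ) {q β : ℝ} (hβ : 0 < β) :
    ∃ C : ℝ≥0, ∀ (F : Type*) [EMetricSpace F] [SecondCountableTopology F] [MeasurableSpace F]
      [BorelSpace F] (h : M → F) (a b : F) (i₀ : Fin m) (c : ℰ m) (ρ ε : ℝ≥0) (P Q : Set (ℰ m)),
      Measurable h → Metric.closedBall c ρ ⊆ Metric.ball y₀ R →
      IsOscillating (fun y => h (e.symm y)) a b i₀ c ρ ε P Q →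
      edist a b ^ q * ENNReal.ofReal ((ρ : ℝ) ^ m * (ε : ℝ) ^ (-β)) ≤
        C * ∫⁻ x in e.symm '' Metric.closedBall c ρ, ∫⁻ x' in e.symm '' Metric.closedBall c ρ,
          edist (h x) (h x') ^ q / edist x x' ^ ((m : ℝ) + β) ∂μHE[m] ∂μHE[m] := by
  have hv0 : volume (Metric.ball (0 : ℰ m) 1) ≠ 0 := (Metric.measure_ball_pos _ _ one_pos).ne'
  have hvt : volume (Metric.ball (0 : ℰ m) 1) ≠ ⊤ := measure_ball_lt_top.ne
  set V : ℝ≥0 := (volume (Metric.ball (0 : ℰ m) 1)).toNNReal with hV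
  have hVe : (V : ℝ≥0∞) = volume (Metric.ball (0 : ℰ m) 1) := ENNReal.coe_toNNReal hvt
  have hV0 : 0 < V := ENNReal.toNNReal_pos hv0 hvt
  have hΛ : 0 < Λ := zero_lt_one.trans_le hB.one_le
  refine ⟨Λ ^ 2 * Λ ^ ((m : ℝ) + β) * (16 * 16 ^ m * 2 ^ m) * (V ^ 2)⁻¹, ?_⟩
  intro F _ _ _ _ h a b i₀ c ρ ε P Q hh hc H
  set K := e.symm '' Metric.closedBall c ρ with hK
  let I : M × M → ℝ≥0∞ := fun z => edist (h z.1) (h z.2) ^ q / edist z.1 z.2 ^ ((m : ℝ) + β)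
  have hI : Measurable I := by fun_prop
  have hfin : IsFiniteMeasure ((μHE[m] : Measure M).restrict K) := by
    refine ⟨?_⟩
    rw [Measure.restrict_apply_univ]
    exact (hB.measure_image_le ρ.coe_nonneg hc).trans_lt (by finiteness)
  have hF1 : Measurable fun x => ∫⁻ x' in K, I (x, x') ∂μHE[m] := hI.lintegral_prod_right'
  have up : ∫⁻ y in Metric.closedBall c ρ, ∫⁻ y' in Metric.closedBall c ρ,
      I (e.symm y, e.symm y') ≤ Λ * (Λ * ∫⁻ x in K, ∫⁻ x' in K, I (x, x') ∂μHE[m] ∂μHE[m]) := by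
    calc _ ≤ ∫⁻ y in Metric.closedBall c ρ, Λ * ∫⁻ x' in K, I (e.symm y, x') ∂μHE[m] :=
          lintegral_mono fun y => hB.setLIntegral_le hc (hI.comp measurable_prodMk_left)
      _ = Λ * ∫⁻ y in Metric.closedBall c ρ, ∫⁻ x' in K, I (e.symm y, x') ∂μHE[m] :=
          lintegral_const_mul' _ _ (by simp)
      _ ≤ _ := mul_le_mul_right (hB.setLIntegral_le hc hF1) _
  set v₀ : ℰ m := EuclideanSpace.single i₀ ((ε : ℝ) / 2) with hv₀
  have hε : 0 < ε := H.eps_pos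
  have hρ : 0 < ρ := (by positivity : 0 < 2 * ε).trans_le H.eps_le
  -- On these pairs the values of h are a and b and the points are at distance at most ε. By Fubini
  -- in the translation vector, the measure of S is at least of order ρ^m ε^m, against a kernel of
  -- order ε^(-m-β).
  let S : Set (ℰ m × ℰ m) := {z | z.1 ∈ P ∧ z.2 ∈ Q ∧ z.2 - z.1 ∈ Metric.closedBall v₀ (ε / 16)}
  have hS : MeasurableSet S := (measurable_fst H.measurableSet_left).inter
    ((measurable_snd H.measurableSet_right).inter
      ((measurable_snd.sub measurable_fst) Metric.isClosed_closedBall.measurableSet))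
  set A : ℝ≥0∞ := edist a b ^ q / (Λ * ε : ℝ≥0) ^ ((m : ℝ) + β) with hA
  have hPc : P ⊆ Metric.closedBall c ρ := H.left_subset.trans
    (Metric.ball_subset_closedBall.trans (Metric.closedBall_subset_closedBall (by
      linarith [ρ.coe_nonneg])))
  have hQc : Q ⊆ Metric.closedBall c ρ := H.right_subset.trans Metric.ball_subset_closedBall
  have low : ∀ z ∈ S, A ≤ I (e.symm z.1, e.symm z.2) := by
    rintro ⟨y, y'⟩ ⟨hy, hy', hyy⟩
    simp only [I, A, H.eq_left y hy, H.eq_right y' hy']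
    refine ENNReal.div_le_div_left (ENNReal.rpow_le_rpow ?_ (by positivity)) _
    refine (hB.edist_symm_le y (hB.image_subset_of_subset hc (hPc hy)) y'
      (hB.image_subset_of_subset hc (hQc hy'))).trans ?_
    rw [ENNReal.coe_mul]
    refine mul_le_mul_right ?_ _
    rw [edist_dist, dist_comm, dist_eq_norm, ← ENNReal.ofReal_coe_nnreal]
    refine ENNReal.ofReal_le_ofReal ?_
    have h1 : ‖v₀‖ = ε / 2 := by
      rw [hv₀, PiLp.norm_single, Real.norm_of_nonneg (by positivity)]
    have h2 : ‖y' - y - v₀‖ ≤ ε / 16 := by simpa [dist_eq_norm] using hyy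
    have h3 := norm_add_le (y' - y - v₀) v₀
    rw [sub_add_cancel, h1] at h3
    linarith [ε.coe_nonneg]
  have hball : volume (Metric.ball c ((ρ : ℝ) / 2)) =
      ENNReal.ofReal (((ρ : ℝ) / 2) ^ m) * V := by
    rw [volume_ball_eq_mul c (by positivity), hVe]
  have hball' : volume (Metric.closedBall v₀ ((ε : ℝ) / 16)) =
      ENNReal.ofReal (((ε : ℝ) / 16) ^ m) * V := by
    rw [volume_closedBall_le (by positivity) v₀, hVe]
  have hvol : volume (Metric.ball c ((ρ : ℝ) / 2)) * volume (Metric.closedBall v₀ ((ε : ℝ) / 16)) ≤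
      16 * ∫⁻ y, ∫⁻ y', S.indicator 1 (y, y') := by
    calc volume (Metric.ball c ((ρ : ℝ) / 2)) * volume (Metric.closedBall v₀ ((ε : ℝ) / 16))
        = ∫⁻ v in Metric.closedBall v₀ ((ε : ℝ) / 16), volume (Metric.ball c ((ρ : ℝ) / 2)) := by
          rw [setLIntegral_const]
      _ ≤ ∫⁻ v in Metric.closedBall v₀ ((ε : ℝ) / 16),
          16 * ∫⁻ y, S.indicator (1 : ℰ m × ℰ m → ℝ≥0∞) (y, y + v) := by
          refine setLIntegral_mono' Metric.isClosed_closedBall.measurableSet fun v hv => ?_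
          refine (H.volume_le v (by rwa [Metric.mem_closedBall, dist_eq_norm] at hv)).trans ?_
          refine mul_le_mul_right ?_ _
          have hms : MeasurableSet {y | y ∈ P ∧ y + v ∈ Q} :=
            H.measurableSet_left.inter ((measurable_id.add_const v) H.measurableSet_right)
          rw [← lintegral_indicator_one hms]
          refine lintegral_mono fun y => ?_
          by_cases hy : y ∈ P ∧ y + v ∈ Q
          · rw [Set.indicator_of_mem (show y ∈ {y | y ∈ P ∧ y + v ∈ Q} from hy),
              Set.indicator_of_mem (show (y, y + v) ∈ S from ⟨hy.1, hy.2, by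
                simpa only [add_sub_cancel_left] using hv⟩)]
            exact le_rfl
          · rw [Set.indicator_of_notMem (show y ∉ {y | y ∈ P ∧ y + v ∈ Q} from hy)]
            exact zero_le
      _ ≤ ∫⁻ v, 16 * ∫⁻ y, S.indicator (1 : ℰ m × ℰ m → ℝ≥0∞) (y, y + v) :=
          setLIntegral_le_lintegral _ _
      _ = 16 * ∫⁻ v, ∫⁻ y, S.indicator (1 : ℰ m × ℰ m → ℝ≥0∞) (y, y + v) :=
          lintegral_const_mul' _ _ (by simp)
      _ = 16 * ∫⁻ y, ∫⁻ v, S.indicator (1 : ℰ m × ℰ m → ℝ≥0∞) (y, y + v) := by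
          congr 1
          refine lintegral_lintegral_swap (Measurable.aemeasurable ?_)
          have : Measurable (S.indicator (1 : ℰ m × ℰ m → ℝ≥0∞)) := measurable_one.indicator hS
          exact this.comp (by fun_prop)
      _ = _ := by
          congr 1
          refine lintegral_congr fun y => ?_
          exact lintegral_add_left_eq_self (fun y' => S.indicator (1 : ℰ m × ℰ m → ℝ≥0∞) (y, y')) y
  have hint : A * ∫⁻ y, ∫⁻ y', S.indicator 1 (y, y') ≤ ∫⁻ y in Metric.closedBall c ρ,
      ∫⁻ y' in Metric.closedBall c ρ, I (e.symm y, e.symm y') := by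
    have hmS : Measurable (S.indicator (1 : ℰ m × ℰ m → ℝ≥0∞)) := measurable_one.indicator hS
    rw [← lintegral_const_mul _ hmS.lintegral_prod_right',
      ← lintegral_indicator Metric.isClosed_closedBall.measurableSet]
    refine lintegral_mono fun y => ?_
    rw [← lintegral_const_mul A (f := fun y' => S.indicator (1 : ℰ m × ℰ m → ℝ≥0∞) (y, y'))
      (hmS.comp measurable_prodMk_left)]
    by_cases hy : y ∈ Metric.closedBall c ρ
    · rw [Set.indicator_of_mem hy, ← lintegral_indicator Metric.isClosed_closedBall.measurableSet]
      refine lintegral_mono fun y' => ?_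
      by_cases hz : (y, y') ∈ S
      · rw [Set.indicator_of_mem hz, Set.indicator_of_mem (hQc hz.2.1), Pi.one_apply, mul_one]
        exact low _ hz
      · rw [Set.indicator_of_notMem hz, mul_zero]
        exact zero_le
    · have : ∀ y', S.indicator (1 : ℰ m × ℰ m → ℝ≥0∞) (y, y') = 0 := fun y' =>
        Set.indicator_of_notMem (fun hz => hy (hPc hz.1)) _
      simp [this]
  have key : A * (ENNReal.ofReal (((ρ : ℝ) / 2) ^ m) * V * (ENNReal.ofReal (((ε : ℝ) / 16) ^ m) * V))
      ≤ 16 * (Λ * (Λ * ∫⁻ x in K, ∫⁻ x' in K, I (x, x') ∂μHE[m] ∂μHE[m])) := by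
    rw [← hball, ← hball']
    refine (mul_le_mul_right hvol _).trans ?_
    rw [mul_left_comm]
    exact mul_le_mul_right (hint.trans up) _
  -- comparing the constants
  have e1 : edist a b ^ q * ENNReal.ofReal ((ρ : ℝ) ^ m * (ε : ℝ) ^ (-β)) =
      ((Λ ^ ((m : ℝ) + β) * (16 ^ m * 2 ^ m) * (V ^ 2)⁻¹ : ℝ≥0) : ℝ≥0∞) *
      (A * (ENNReal.ofReal (((ρ : ℝ) / 2) ^ m) * V * (ENNReal.ofReal (((ε : ℝ) / 16) ^ m) * V))) := by
    have hconv : ∀ t : ℝ≥0, ENNReal.ofReal ((t : ℝ)) = t := fun t =>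
      ENNReal.ofReal_coe_nnreal
    have r1 : ENNReal.ofReal ((ρ : ℝ) ^ m * (ε : ℝ) ^ (-β)) = (ρ ^ m * ε ^ (-β) : ℝ≥0) := by
      rw [← hconv]; push_cast; rfl
    have r2 : ENNReal.ofReal (((ρ : ℝ) / 2) ^ m) = ((ρ / 2) ^ m : ℝ≥0) := by
      rw [← hconv]; push_cast; rfl
    have r3 : ENNReal.ofReal (((ε : ℝ) / 16) ^ m) = ((ε / 16) ^ m : ℝ≥0) := by
      rw [← hconv]; push_cast; rfl
    rw [r1, r2, r3, hA, ← ENNReal.coe_rpow_of_ne_zero (mul_pos hΛ hε).ne', ENNReal.div_eq_inv_mul,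
      ← ENNReal.coe_inv (NNReal.rpow_pos (mul_pos hΛ hε)).ne']
    have r4 : (ρ ^ m * ε ^ (-β) : ℝ≥0) = (Λ ^ ((m : ℝ) + β) * (16 ^ m * 2 ^ m) * (V ^ 2)⁻¹) *
        (((Λ * ε) ^ ((m : ℝ) + β))⁻¹ * ((ρ / 2) ^ m * V * ((ε / 16) ^ m * V))) := by
      rw [NNReal.mul_rpow, NNReal.rpow_add hε.ne', NNReal.rpow_natCast, NNReal.rpow_neg, div_pow,
        div_pow]
      have := (NNReal.rpow_pos (p := β) hε).ne'
      have := (NNReal.rpow_pos (p := (m : ℝ) + β) hΛ).ne'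
      field_simp
    rw [r4]
    push_cast
    ring
  rw [e1]
  refine (mul_le_mul_right key _).trans (le_of_eq ?_)
  push_cast
  ring

/-- The truncation at D keeps the distance function real-valued when F is disconnected, and it still
separates a from any point at distance at least D. -/
lemma lipschitzWith_toReal_min_edist {F : Type*} [EMetricSpace F] (a : F) (D : ℝ≥0) :
    LipschitzWith 1 fun y : F => (min (edist y a) D).toReal := by
  intro y y'
  have hfin : ∀ z : F, min (edist z a) (D : ℝ≥0∞) ≠ ⊤ := fun z =>
    ((min_le_right _ _).trans_lt ENNReal.coe_lt_top).ne
  have key : ∀ z z' : F, min (edist z a) (D : ℝ≥0∞) ≤ min (edist z' a) D + edist z z' := by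
    intro z z'
    rcases min_cases (edist z' a) (D : ℝ≥0∞) with ⟨h, -⟩ | ⟨h, -⟩
    · rw [h, add_comm]
      exact (min_le_left _ _).trans (edist_triangle _ _ _)
    · rw [h]
      exact (min_le_right _ _).trans le_self_add
  rw [ENNReal.coe_one, one_mul]
  by_cases ht : edist y y' = ⊤
  · rw [ht]; exact le_top
  have hr : ∀ z z' : F, edist z z' ≠ ⊤ →
      (min (edist z a) (D : ℝ≥0∞)).toReal ≤ (min (edist z' a) (D : ℝ≥0∞)).toReal +
        (edist z z').toReal := by
    intro z z' hz
    rw [← ENNReal.toReal_add (hfin _) hz]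
    exact ENNReal.toReal_mono (ENNReal.add_ne_top.2 ⟨hfin _, hz⟩) (key z z')
  rw [edist_dist, Real.dist_eq]
  refine ENNReal.ofReal_le_of_le_toReal (abs_sub_le_iff.2 ⟨?_, ?_⟩)
  · linarith [hr y y' ht]
  · have := hr y' y (by rwa [edist_comm])
    rw [edist_comm y' y] at this
    linarith

/-- In a chart ball, the weak derivatives of a function are controlled by its weak differential. -/
lemma ChartBall.enorm_weakDeriv_le (hB : ChartBall e y₀ R Λ) {y : ℰ m}
    (hy : y ∈ Metric.ball y₀ R) (ℓ : TangentSpace (𝓡 m) (e.symm y) →L[ℝ] ℝ) (v : ℰ m) :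
    ‖ℓ (mfderiv (𝓡 m) (𝓡 m) e.symm y v)‖ₑ ≤ Λ * ‖v‖ₑ * covectorNorm ℓ := by
  have h2 := hB.image_subset_of_subset Set.Subset.rfl hy
  have := enorm_apply_le_covectorNorm ℓ (mfderiv (𝓡 m) (𝓡 m) e.symm y v) (C := Λ * ‖v‖₊)
    (by push_cast; exact hB.norm_mfderiv_symm_le y h2 v)
  rwa [ENNReal.coe_mul, ← enorm_eq_nnnorm] at this

lemma ChartBall.hasWeakDirDeriv (hB : ChartBall e y₀ R Λ) {g : M → ℝ}
    {G : ∀ x : M, TangentSpace (𝓡 m) x →L[ℝ] ℝ} (hG : HasWeakDifferential g G) (v : ℰ m) :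
    HasWeakDirDeriv (Metric.ball y₀ R) v (fun y => g (e.symm y))
        (fun y => G (e.symm y) (mfderiv (𝓡 m) (𝓡 m) e.symm y v)) ∧
      IntegrableOn (fun y => g (e.symm y)) (Metric.ball y₀ R) ∧
      IntegrableOn (fun y => G (e.symm y) (mfderiv (𝓡 m) (𝓡 m) e.symm y v))
        (Metric.ball y₀ R) := by
  have h := hasWeakDifferential_iff.1 hG e hB.mem_atlas v
  have hsub : Metric.closedBall y₀ R ⊆ e.target := (Metric.closedBall_subset_closedBall
    (by linarith [hB.pos])).trans hB.subset_target
  refine ⟨h.mono (Metric.ball_subset_closedBall.trans hsub), ?_, ?_⟩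
  · exact (h.1.integrableOn_compact_subset hsub (isCompact_closedBall _ _)).mono_set
      Metric.ball_subset_closedBall
  · exact (h.2.1.integrableOn_compact_subset hsub (isCompact_closedBall _ _)).mono_set
      Metric.ball_subset_closedBall

/-- The first-order energy of a map oscillating at scale `ε`. -/
theorem IsOscillating.le_lintegral (hB : ChartBall e y₀ R Λ) [IsManifold (𝓡 m) ∞ M]
    [IsContMDiffRiemannianBundle (𝓡 m) ∞ (ℰ m) (fun x : M => TangentSpace (𝓡 m) x)]
    [IsRiemannianManifold (𝓡 m) M] {q : ℝ} (hq : 1 ≤ q) :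
    ∃ C : ℝ≥0, ∀ (F : Type*) [EMetricSpace F] (h : M → F) (a b : F) (D : ℝ≥0) (i₀ : Fin m)
      (c : ℰ m) (ρ ε : ℝ≥0) (P Q : Set (ℰ m)) (g : M → ℝ≥0∞), (D : ℝ≥0∞) ≤ edist a b →
      Metric.closedBall c ρ ⊆ Metric.ball y₀ R →
      IsOscillating (fun y => h (e.symm y)) a b i₀ c ρ ε P Q → IsWeakDerivBound m h g →
      (D : ℝ≥0∞) ^ q * ENNReal.ofReal ((ρ : ℝ) ^ m * (ε : ℝ) ^ (-q)) ≤
        C * ∫⁻ x in e.symm '' Metric.closedBall c ρ, g x ^ q ∂μHE[m] := by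
  have hq0 : 0 < q := one_pos.trans_le hq
  have hv0 : volume (Metric.ball (0 : ℰ m) 1) ≠ 0 := (Metric.measure_ball_pos _ _ one_pos).ne'
  have hvt : volume (Metric.ball (0 : ℰ m) 1) ≠ ⊤ := measure_ball_lt_top.ne
  set V : ℝ≥0 := (volume (Metric.ball (0 : ℰ m) 1)).toNNReal with hV
  have hVe : (V : ℝ≥0∞) = volume (Metric.ball (0 : ℰ m) 1) := ENNReal.coe_toNNReal hvt
  have hV0 : 0 < V := ENNReal.toNNReal_pos hv0 hvt
  refine ⟨16 * 2 ^ m * Λ ^ q * Λ * V⁻¹, fun F _ h a b D i₀ c ρ ε P Q g hD hc H hg => ?_⟩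
  have hε : 0 < ε := H.eps_pos
  have hρ : 0 < ρ := (by positivity : 0 < 2 * ε).trans_le H.eps_le
  set v : ℰ m := EuclideanSpace.single i₀ ((ε : ℝ) / 2) with hv
  have hvn : ‖v‖ = ε / 2 := by rw [hv, PiLp.norm_single, Real.norm_of_nonneg (by positivity)]
  have hve : ‖v‖ₑ ≤ ε := by
    rw [← ofReal_norm, hvn, ← ENNReal.ofReal_coe_nnreal]
    exact ENNReal.ofReal_le_ofReal (by linarith [ε.coe_nonneg])
  let φ : F → ℝ := fun y => (min (edist y a) D).toReal
  obtain ⟨G, hG, hGg⟩ := hg.bound φ (lipschitzWith_toReal_min_edist a D)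
  obtain ⟨H1, i1, i2⟩ := hB.hasWeakDirDeriv hG v
  set k : ℰ m → ℝ := fun y => G (e.symm y) (mfderiv (𝓡 m) (𝓡 m) e.symm y v) with hk
  set B : Set (ℰ m) := Metric.ball c ρ with hBdef
  have hBs : B ⊆ Metric.ball y₀ R := Metric.ball_subset_closedBall.trans hc
  have hkm : AEStronglyMeasurable k (volume.restrict B) :=
    i2.aestronglyMeasurable.mono_measure (Measure.restrict_mono hBs le_rfl)
  set k' := hkm.mk k with hk'
  have hk'm : Measurable k' := hkm.stronglyMeasurable_mk.measurable
  have hkk' : ∀ᵐ y, y ∈ B → k y = k' y :=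
    (ae_restrict_iff' measurableSet_ball).1 hkm.ae_eq_mk
  have H2 : HasWeakDirDeriv B v (fun y => φ (h (e.symm y))) k' :=
    (H1.mono hBs).congr_ae measurableSet_ball (by simp) hkk'
  have i2' : IntegrableOn k' B := (i2.mono_set hBs).congr_fun_ae
    ((ae_restrict_iff' measurableSet_ball).2 hkk')
  set W : Set (ℰ m) := Metric.ball c (ρ / 2) with hW
  have hWB : ∀ y ∈ W, ∀ t ∈ Set.Icc (0 : ℝ) 1, y + t • v ∈ B := by
    intro y hy t ht
    rw [Metric.mem_ball, dist_eq_norm] at hy ⊢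
    have h1 : ‖t • v‖ ≤ ε / 2 := by
      rw [norm_smul, Real.norm_of_nonneg ht.1, hvn]
      exact mul_le_of_le_one_left (by positivity) ht.2
    have h2 : 2 * (ε : ℝ) ≤ ρ := by exact_mod_cast H.eps_le
    calc ‖y + t • v - c‖ = ‖(y - c) + t • v‖ := by rw [add_sub_right_comm]
      _ ≤ ‖y - c‖ + ‖t • v‖ := norm_add_le _ _
      _ < ρ := by linarith [NNReal.coe_pos.2 hε]
  have htr := H2.ae_sub_eq_integral Metric.isOpen_ball Metric.isOpen_ball hWB (i1.mono_set hBs) i2'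
  let f : ℰ m → ℝ≥0∞ := W.indicator 1
  let I : ℰ m → ℝ≥0∞ := B.indicator fun y => ‖k' y‖ₑ ^ q
  have hkq : Measurable fun y => ‖k' y‖ₑ ^ q := by fun_prop
  have hIm : Measurable I := hkq.indicator measurableSet_ball
  have hprob : IsProbabilityMeasure (volume.restrict (Set.Icc (0 : ℝ) 1)) := ⟨by simp⟩
  have hT : {y | y ∈ P ∧ y + v ∈ Q} ⊆ W := fun y hy => H.left_subset hy.1
  have hTm : MeasurableSet {y | y ∈ P ∧ y + v ∈ Q} :=
    H.measurableSet_left.inter ((measurable_id.add_const v) H.measurableSet_right)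
  -- Between a point of P and its translate in Q the function φ ∘ h increases by D, which bounds the
  -- integral of |k'| over the segment from below; Jensen's inequality raises this to the power q.
  have step1 : (D : ℝ≥0∞) ^ q * volume {y | y ∈ P ∧ y + v ∈ Q} ≤
      ∫⁻ y, f y * ∫⁻ t in Set.Icc (0 : ℝ) 1, I (y + t • v) := by
    rw [← setLIntegral_const, ← lintegral_indicator hTm]
    refine lintegral_mono_ae ?_
    filter_upwards [htr] with y hy
    by_cases hyT : y ∈ {y | y ∈ P ∧ y + v ∈ Q}
    · have hyW := hT hyT
      rw [Set.indicator_of_mem hyT]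
      simp only [f, Set.indicator_of_mem hyW, Pi.one_apply, one_mul]
      have hval : φ (h (e.symm (y + v))) - φ (h (e.symm y)) = D := by
        have hP := H.eq_left y hyT.1
        have hQ := H.eq_right _ hyT.2
        simp only [φ, hP, hQ, edist_self, zero_le, min_eq_left, ENNReal.toReal_zero, sub_zero]
        rw [edist_comm b a, min_eq_right hD, ENNReal.coe_toReal]
      have h1 : (D : ℝ≥0∞) ≤ ∫⁻ t in Set.Icc (0 : ℝ) 1, ‖k' (y + t • v)‖ₑ := by
        refine le_trans ?_ (enorm_integral_le_lintegral_enorm _)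
        rw [← hy hyW, hval, Real.enorm_eq_ofReal D.coe_nonneg, ENNReal.ofReal_coe_nnreal]
      calc (D : ℝ≥0∞) ^ q ≤ (∫⁻ t in Set.Icc (0 : ℝ) 1, ‖k' (y + t • v)‖ₑ) ^ q :=
            ENNReal.rpow_le_rpow h1 hq0.le
        _ ≤ ∫⁻ t in Set.Icc (0 : ℝ) 1, ‖k' (y + t • v)‖ₑ ^ q :=
            lintegral_enorm_rpow_le hq (hk'm.comp (by fun_prop)).aestronglyMeasurable
        _ ≤ _ := by
            refine setLIntegral_mono' measurableSet_Icc fun t ht => ?_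
            simp only [I]
            rw [Set.indicator_of_mem (hWB y hyW t ht)]
    · rw [Set.indicator_of_notMem hyT]
      exact zero_le
  -- Fubini: each translate of W by t v lies in B and contributes at most the integral over B.
  have step2 : ∫⁻ y, f y * ∫⁻ t in Set.Icc (0 : ℝ) 1, I (y + t • v) ≤
      ∫⁻ y in B, ‖k' y‖ₑ ^ q := by
    rw [lintegral_mul_lintegral_translate (measurable_one.indicator measurableSet_ball) hIm]
    calc _ ≤ ∫⁻ _ in Set.Icc (0 : ℝ) 1, ∫⁻ y in B, ‖k' y‖ₑ ^ q := by
          refine lintegral_mono fun t => ?_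
          rw [← lintegral_indicator measurableSet_ball]
          refine lintegral_mono fun y => ?_
          refine mul_le_of_le_one_left zero_le ?_
          exact Set.indicator_le_self' (fun _ _ => zero_le) _
      _ = _ := by simp
  -- measurable majorant of `g`
  obtain ⟨g', hg'm, hgg'⟩ := hg.aemeasurable
  have step3 : ∫⁻ y in B, ‖k' y‖ₑ ^ q ≤
      (Λ * ε : ℝ≥0∞) ^ q * (Λ * ∫⁻ x in e.symm '' Metric.closedBall c ρ, g x ^ q ∂μHE[m]) := by
    have hae := ae_chart_of_ae hB.mem_atlas (hGg.and hgg')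
    have hle : ∀ᵐ y ∂(volume.restrict B), ‖k' y‖ₑ ^ q ≤ (Λ * ε : ℝ≥0∞) ^ q * g' (e.symm y) ^ q := by
      rw [ae_restrict_iff' measurableSet_ball]
      filter_upwards [hae, hkk'] with y hy hky hyB
      have hyt : y ∈ e.target := hB.subset_target (hB.image_subset_of_subset hBs hyB)
      obtain ⟨h1, h2⟩ := hy hyt
      rw [← hky hyB, ← ENNReal.mul_rpow_of_nonneg _ _ hq0.le]
      refine ENNReal.rpow_le_rpow ((hB.enorm_weakDeriv_le (hBs hyB) _ v).trans ?_) hq0.le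
      rw [← h2]
      gcongr
    calc _ ≤ ∫⁻ y in B, (Λ * ε : ℝ≥0∞) ^ q * g' (e.symm y) ^ q := lintegral_mono_ae hle
      _ = (Λ * ε : ℝ≥0∞) ^ q * ∫⁻ y in B, g' (e.symm y) ^ q :=
          lintegral_const_mul' _ _ (by finiteness)
      _ ≤ (Λ * ε : ℝ≥0∞) ^ q * ∫⁻ y in Metric.closedBall c ρ, g' (e.symm y) ^ q := by
          gcongr
          exact Metric.ball_subset_closedBall
      _ ≤ (Λ * ε : ℝ≥0∞) ^ q *
          (Λ * ∫⁻ x in e.symm '' Metric.closedBall c ρ, g' x ^ q ∂μHE[m]) := by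
          gcongr
          exact hB.setLIntegral_le hc (hg'm.pow_const q)
      _ = _ := by
          congr 2
          refine lintegral_congr_ae (ae_restrict_of_ae ?_)
          filter_upwards [hgg'] with x hx
          rw [hx]
  have hvol := H.volume_le v (by rw [sub_self, norm_zero]; positivity)
  have key : (D : ℝ≥0∞) ^ q * volume (Metric.ball c ((ρ : ℝ) / 2)) ≤ 16 *
      ((Λ * ε : ℝ≥0∞) ^ q * (Λ * ∫⁻ x in e.symm '' Metric.closedBall c ρ, g x ^ q ∂μHE[m])) := by
    refine (mul_le_mul_right hvol _).trans ?_
    rw [mul_left_comm]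
    exact mul_le_mul_right (step1.trans (step2.trans step3)) _
  have hball : volume (Metric.ball c ((ρ : ℝ) / 2)) = ((ρ / 2) ^ m * V : ℝ≥0) := by
    rw [volume_ball_eq_mul c (by positivity), ENNReal.coe_mul, hVe, ← ENNReal.ofReal_coe_nnreal]
    push_cast
    rfl
  have r1 : ENNReal.ofReal ((ρ : ℝ) ^ m * (ε : ℝ) ^ (-q)) =
      (2 ^ m * V⁻¹ * ε ^ (-q) : ℝ≥0) * volume (Metric.ball c ((ρ : ℝ) / 2)) := by
    rw [hball, ← ENNReal.coe_mul, ← ENNReal.ofReal_coe_nnreal]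
    congr 1
    push_cast
    have : (V : ℝ) ≠ 0 := by exact_mod_cast hV0.ne'
    rw [div_pow]
    field_simp
  rw [r1, mul_left_comm]
  refine (mul_le_mul_right key _).trans (le_of_eq ?_)
  have r2 : ((Λ : ℝ≥0∞) * ε) ^ q = (Λ ^ q * ε ^ q : ℝ≥0) := by
    rw [← ENNReal.coe_mul, ← ENNReal.coe_rpow_of_nonneg _ hq0.le, NNReal.mul_rpow]
  have r3 : (16 * 2 ^ m * Λ ^ q * Λ * V⁻¹ : ℝ≥0) =
      (2 ^ m * V⁻¹ * ε ^ (-q)) * (16 * ((Λ ^ q * ε ^ q) * Λ)) := by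
    rw [NNReal.rpow_neg]
    have := (NNReal.rpow_pos (p := q) hε).ne'
    field_simp
  rw [r2, r3]
  push_cast
  ring

end LowerBound

/-! ### Uniform form of the lower bounds -/

section LargeEnergy

variable {m : ℕ} {M : Type*} [EMetricSpace M] [ChartedSpace (ℰ m) M]
  [RiemannianBundle (fun x : M => TangentSpace (𝓡 m) x)] [MeasurableSpace M] [BorelSpace M]

/-- Every map that agrees with `h` on `K` has energy at least `1` on `K`. -/
def HasLargeEnergyOn {F : Type*} [EMetricSpace F] (m : ℕ) [ChartedSpace (ℰ m) M]
    [RiemannianBundle (fun x : M => TangentSpace (𝓡 m) x)] (r q : ℝ) (h : M → F)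
    (K : Set M) : Prop :=
  ∀ h' : M → F, (∀ x ∈ K, h' x = h x) →
    if r = 1 then ∀ g, IsWeakDerivBound m h' g → 1 ≤ ∫⁻ x in K, g x ^ q ∂μHE[m]
    else 1 ≤ ∫⁻ x in K, ∫⁻ x' in K,
      edist (h' x) (h' x') ^ q / edist x x' ^ ((m : ℝ) + r * q) ∂μHE[m] ∂μHE[m]

variable {e : OpenPartialHomeomorph M (ℰ m)} {y₀ : ℰ m} {R : ℝ} {Λ : ℝ≥0}

lemma IsOscillating.congr {F : Type*} {h h' : ℰ m → F} {a b : F} {i₀ : Fin m} {c : ℰ m}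
    {ρ ε : ℝ≥0} {P Q : Set (ℰ m)} (H : IsOscillating h a b i₀ c ρ ε P Q)
    (hh : ∀ y ∈ Metric.closedBall c ρ, h' y = h y) : IsOscillating h' a b i₀ c ρ ε P Q where
  eps_pos := H.eps_pos
  eps_le := H.eps_le
  measurableSet_left := H.measurableSet_left
  measurableSet_right := H.measurableSet_right
  left_subset := H.left_subset
  right_subset := H.right_subset
  eq_left y hy := (hh y (Metric.closedBall_subset_closedBall (by linarith [ρ.coe_nonneg])
    (Metric.ball_subset_closedBall (H.left_subset hy)))).trans (H.eq_left y hy)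
  eq_right y hy := (hh y (Metric.ball_subset_closedBall (H.right_subset hy))).trans
    (H.eq_right y hy)
  volume_le := H.volume_le

/-- The two lower bounds in a common form. The oscillation only involves the values on the ball, so
it persists for every map that agrees with h there. -/
theorem IsOscillating.hasLargeEnergyOn [SecondCountableTopology M] [IsManifold (𝓡 m) ∞ M]
    [IsContMDiffRiemannianBundle (𝓡 m) ∞ (ℰ m) (fun x : M => TangentSpace (𝓡 m) x)]
    [IsRiemannianManifold (𝓡 m) M] (hB : ChartBall e y₀ R Λ) {r q : ℝ} (hr : 0 < r) (hq : 1 ≤ q) :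
    ∃ C : ℝ≥0, 0 < C ∧ ∀ (F : Type*) [EMetricSpace F] [SecondCountableTopology F]
      [MeasurableSpace F] [BorelSpace F] (h : M → F) (a b : F) (D : ℝ≥0) (i₀ : Fin m) (c : ℰ m)
      (ρ ε : ℝ≥0) (P Q : Set (ℰ m)) (K : Set M),
      Measurable h → (D : ℝ≥0∞) ≤ edist a b → Metric.closedBall c ρ ⊆ Metric.ball y₀ R →
      e.symm '' Metric.closedBall c ρ ⊆ K →
      IsOscillating (fun y => h (e.symm y)) a b i₀ c ρ ε P Q →
      C ≤ (D : ℝ≥0∞) ^ q * ENNReal.ofReal ((ρ : ℝ) ^ m * (ε : ℝ) ^ (-(r * q))) →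
      HasLargeEnergyOn m r q h K := by
  have hq0 : 0 < q := one_pos.trans_le hq
  -- Replacing C by C + 1 makes the constant positive, and A ≥ C + 1 with A ≤ C X still forces X ≥
  -- 1.
  have aux : ∀ (C : ℝ≥0) (A X : ℝ≥0∞), ((C + 1 : ℝ≥0) : ℝ≥0∞) ≤ A → A ≤ C * X → 1 ≤ X := by
    intro C A X h1 h2
    by_contra! hX
    have h3 : (C : ℝ≥0∞) * X ≤ C := mul_le_of_le_one_right zero_le hX.le
    have h4 := (h1.trans h2).trans h3
    rw [ENNReal.coe_le_coe] at h4
    exact absurd h4 (by simp)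
  by_cases hr1 : r = 1
  · obtain ⟨C, hC⟩ := IsOscillating.le_lintegral hB hq
    refine ⟨C + 1, by positivity, ?_⟩
    intro F _ _ _ _ h a b D i₀ c ρ ε P Q K hh hD hc hK H hle h' hh'
    rw [if_pos hr1]
    intro g hg
    rw [hr1, one_mul] at hle
    have h1 := hC F h' a b D i₀ c ρ ε P Q g hD hc (H.congr fun y hy =>
      hh' _ (hK (Set.mem_image_of_mem _ hy))) hg
    exact (aux C _ _ hle h1).trans (lintegral_mono_set hK)
  · obtain ⟨C, hC⟩ := IsOscillating.le_lintegral_lintegral hB (q := q) (mul_pos hr hq0)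
    refine ⟨C + 1, by positivity, ?_⟩
    intro F _ _ _ _ h a b D i₀ c ρ ε P Q K hh hD hc hK H hle h' hh'
    rw [if_neg hr1]
    have h1 := hC F h a b i₀ c ρ ε P Q hh hc H
    refine (aux C _ _ hle (le_trans ?_ h1)).trans ?_
    · gcongr
    · set K' := e.symm '' Metric.closedBall c ρ with hK'
      have hmK : MeasurableSet K' := hB.measurableSet_image hc
      calc _ = ∫⁻ x in K', ∫⁻ x' in K',
          edist (h' x) (h' x') ^ q / edist x x' ^ ((m : ℝ) + r * q) ∂μHE[m] ∂μHE[m] := by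
            refine setLIntegral_congr_fun hmK fun x hx => setLIntegral_congr_fun hmK fun x' hx' => ?_
            simp only [hh' x (hK hx), hh' x' (hK hx')]
        _ ≤ _ := (lintegral_mono fun x => lintegral_mono_set hK).trans (lintegral_mono_set hK)

end LargeEnergy

/-! ### Approximate continuity of measurable maps -/

section ApproximateContinuity

variable {m : ℕ} {N : Type*} [EMetricSpace N]

/-- A form of approximate continuity at `c`, with the value `b`. -/
def IsApproxContinuousAt (h : ℰ m → N) (c : ℰ m) (b : N) : Prop :=
  ∀ a : ℝ≥0, 0 < a → ∃ ρ₀ : ℝ, 0 < ρ₀ ∧ ∀ ρ : ℝ, 0 < ρ → ρ ≤ ρ₀ →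
    32 * volume (Metric.ball c ρ \ {y | edist (h y) b ≤ a}) ≤ volume (Metric.ball c (ρ / 2))

/-- N is separable, so it suffices to apply the Lebesgue density theorem to the preimages of
countably many balls, with centres in a dense sequence and radii 1/(j+1). -/
lemma ae_isApproxContinuousAt [SecondCountableTopology N] [MeasurableSpace N] [BorelSpace N]
    {h : ℰ m → N} {Ω : Set (ℰ m)} (hΩ : ∀ T : Set N, MeasurableSet T → MeasurableSet (Ω ∩ h ⁻¹' T)) :
    ∀ᵐ y, y ∈ Ω → IsApproxContinuousAt h y (h y) := by
  rcases isEmpty_or_nonempty N with hN | hN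
  · exact Eventually.of_forall fun y => isEmptyElim (h y)
  let A : ℕ → ℕ → Set (ℰ m) := fun i j =>
    Ω ∩ h ⁻¹' Metric.eball (TopologicalSpace.denseSeq N i) ((j : ℝ≥0∞) + 1)⁻¹
  have hA : ∀ i j, MeasurableSet (A i j) := fun i j => hΩ _ Metric.isOpen_eball.measurableSet
  have hae : ∀ᵐ y : ℰ m, ∀ i j, Tendsto (fun t => volume ((A i j)ᶜ ∩ Metric.closedBall y t) /
      volume (Metric.closedBall y t)) (𝓝[>] 0) (𝓝 ((A i j)ᶜ.indicator 1 y)) := by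
    rw [ae_all_iff]; intro i
    rw [ae_all_iff]; intro j
    exact Besicovitch.ae_tendsto_measure_inter_div_of_measurableSet volume (hA i j).compl
  filter_upwards [hae] with y hy hyΩ a ha
  obtain ⟨j, hj⟩ := ENNReal.exists_inv_nat_lt (a := (a / 2 : ℝ≥0))
    (by rw [ENNReal.coe_ne_zero]; positivity)
  have hj' : ((j : ℝ≥0∞) + 1)⁻¹ < (a / 2 : ℝ≥0) := lt_of_le_of_lt (by gcongr; exact le_self_add) hj
  obtain ⟨i, hi⟩ : ∃ i, edist (h y) (TopologicalSpace.denseSeq N i) < ((j : ℝ≥0∞) + 1)⁻¹ := by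
    obtain ⟨i, hi⟩ := (TopologicalSpace.denseRange_denseSeq N).exists_mem_open
      (Metric.isOpen_eball (x := h y) (ε := ((j : ℝ≥0∞) + 1)⁻¹))
      ⟨h y, Metric.mem_eball_self (by simp)⟩
    exact ⟨i, by rwa [edist_comm]⟩
  have hyA : y ∉ (A i j)ᶜ := fun h => h ⟨hyΩ, hi⟩
  have hlim := hy i j
  rw [Set.indicator_of_notMem hyA] at hlim
  -- The factor 2^m compares the ball of radius ρ with the ball of radius ρ/2.
  have hτ : (0 : ℝ≥0∞) < (32 * 2 ^ m)⁻¹ := by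
    rw [ENNReal.inv_pos]; finiteness
  obtain ⟨ρ₁, hρ₁, hsub⟩ := mem_nhdsGT_iff_exists_Ioc_subset.1
    (hlim.eventually_le_const hτ)
  refine ⟨ρ₁, hρ₁, fun ρ hρ hρ1 => ?_⟩
  have h1 := hsub ⟨hρ, hρ1⟩
  simp only [Set.mem_ofPred_eq] at h1
  have hpos : volume (Metric.closedBall y ρ) ≠ 0 := (Metric.measure_closedBall_pos _ _ hρ).ne'
  rw [ENNReal.div_le_iff hpos measure_closedBall_lt_top.ne] at h1
  have h2 : Metric.ball y ρ \ {z | edist (h z) (h y) ≤ a} ⊆ (A i j)ᶜ ∩ Metric.closedBall y ρ := by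
    intro z hz
    refine ⟨fun hzA => hz.2 ?_, Metric.ball_subset_closedBall hz.1⟩
    have h3 : edist (h z) (TopologicalSpace.denseSeq N i) < ((j : ℝ≥0∞) + 1)⁻¹ := hzA.2
    refine (edist_triangle_right _ _ (TopologicalSpace.denseSeq N i)).trans
      ((add_le_add (h3.trans hj').le (hi.trans hj').le).trans ?_)
    rw [← ENNReal.coe_add, add_halves]
  calc 32 * volume (Metric.ball y ρ \ {z | edist (h z) (h y) ≤ a})
      ≤ 32 * ((32 * 2 ^ m)⁻¹ * volume (Metric.closedBall y ρ)) :=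
        mul_le_mul_right ((measure_mono h2).trans h1) _
    _ = volume (Metric.ball y (ρ / 2)) := by
        rw [volume_closedBall_le hρ.le y, volume_ball_eq_mul y (half_pos hρ), div_pow,
          ENNReal.ofReal_div_of_pos (by positivity), ENNReal.div_eq_inv_mul,
          ENNReal.mul_inv (Or.inl (by norm_num)) (Or.inl (by norm_num)),
          ENNReal.ofReal_pow (p := (2 : ℝ)) (by norm_num) m]
        simp only [← mul_assoc]
        rw [ENNReal.mul_inv_cancel (by norm_num) (by norm_num), one_mul]
        norm_num

/-- The oscillation of a map that takes the values `a` and `b` where the oscillating cutoff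
takes the values `0` and `1`, close to a point of approximate continuity. -/
lemma isOscillating_of_cutoff {F : Type*} {H : ℰ m → F} {a b : F} {i₀ : Fin m} {c : ℰ m}
    {ρ ε : ℝ≥0} (hε : 0 < ε) (hερ : 2 * ε ≤ ρ) {A : Set (ℰ m)} (hA : MeasurableSet (Metric.ball c ρ ∩ A))
    (hAv : 32 * volume (Metric.ball c ρ \ A) ≤ volume (Metric.ball c (ρ / 2)))
    {θ : ℰ m → ℝ} (hθ : Continuous θ) {S : Set (ℰ m)} (hS : S ⊆ Metric.ball c (ρ / 2))
    (hSm : MeasurableSet S) (hSv : volume (Metric.ball c (ρ / 2)) ≤ 8 * volume S)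
    (hSθ : ∀ y ∈ S, θ y = 0 ∧ ∀ v, ‖v - EuclideanSpace.single i₀ ((ε : ℝ) / 2)‖ ≤ ε / 16 →
      y + v ∈ Metric.ball c ρ ∧ θ (y + v) = 1)
    (h0 : ∀ y ∈ Metric.ball c ρ, y ∈ A → θ y = 0 → H y = a)
    (h1 : ∀ y ∈ Metric.ball c ρ, y ∈ A → θ y = 1 → H y = b) :
    ∃ P Q, IsOscillating H a b i₀ c ρ ε P Q := by
  have hsub : Metric.ball c ((ρ : ℝ) / 2) ⊆ Metric.ball c ρ :=
    Metric.ball_subset_ball (by linarith [ρ.coe_nonneg])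
  refine ⟨S ∩ (Metric.ball c ρ ∩ A), (Metric.ball c ρ ∩ A) ∩ θ ⁻¹' {1}, hε, hερ, hSm.inter hA,
    hA.inter (hθ.measurable (measurableSet_singleton 1)), fun y hy => hS hy.1, fun y hy => hy.1.1,
    fun y hy => h0 y hy.2.1 hy.2.2 (hSθ y hy.1).1, fun y hy => h1 y hy.1.1 hy.1.2 hy.2,
    fun v hv => ?_⟩
  set X : Set (ℰ m) := Metric.ball c ρ \ A with hX
  set T : Set (ℰ m) := {y | y ∈ S ∩ (Metric.ball c ρ ∩ A) ∧
    y + v ∈ (Metric.ball c ρ ∩ A) ∩ θ ⁻¹' {1}} with hT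
  -- S has at least 1/8 of the volume of the half ball; the points y outside of A and those with y +
  -- v outside of A take at most 1/32 each. At least 1/16 remains.
  have hcover : S ⊆ T ∪ (X ∪ (fun y => y + v) ⁻¹' X) := by
    intro y hy
    obtain ⟨hy1, hy2⟩ := (hSθ y hy).2 v hv
    by_cases hyA : y ∈ A
    · by_cases hyv : y + v ∈ A
      · exact Or.inl ⟨⟨hy, hsub (hS hy), hyA⟩, ⟨hy1, hyv⟩, hy2⟩
      · exact Or.inr (Or.inr ⟨hy1, hyv⟩)
    · exact Or.inr (Or.inl ⟨hsub (hS hy), hyA⟩)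
  set V := volume (Metric.ball c ((ρ : ℝ) / 2)) with hV
  have hVt : V ≠ ⊤ := measure_ball_lt_top.ne
  have e1 : volume ((fun y => y + v) ⁻¹' X) = volume X := measure_preimage_add_right volume v X
  have h3 : volume S ≤ volume T + (volume X + volume X) := by
    refine (measure_mono hcover).trans ((measure_union_le _ _).trans (add_le_add le_rfl
      ((measure_union_le _ _).trans ?_)))
    rw [e1]
  have h4 : V + V ≤ 16 * volume T + V := by
    calc V + V ≤ 8 * volume S + 8 * volume S := add_le_add hSv hSv
      _ ≤ 8 * (volume T + (volume X + volume X)) + 8 * (volume T + (volume X + volume X)) := by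
        gcongr
      _ = 16 * volume T + 32 * volume X := by ring
      _ ≤ _ := by gcongr
  exact (ENNReal.add_le_add_iff_right hVt).1 h4

end ApproximateContinuity

/-! ### Bubbles: small energy, large energy after composition -/

section Bubble

lemma ENNReal.rpow_add_le_two_rpow_mul {p : ℝ} (hp : 1 ≤ p) (a b : ℝ≥0∞) :
    (a + b) ^ p ≤ 2 ^ p * (a ^ p + b ^ p) := by
  refine (ENNReal.rpow_add_le_mul_rpow_add_rpow a b hp).trans ?_
  gcongr
  · norm_num
  · linarith

lemma ENNReal.rpow_add_add_add_le {p : ℝ} (hp : 1 ≤ p) (a b c d : ℝ≥0∞) :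
    (a + (b + (c + d))) ^ p ≤ 8 ^ p * (a ^ p + (b ^ p + (c ^ p + d ^ p))) := by
  have hp0 : 0 ≤ p := zero_le_one.trans hp
  have h1 : (1 : ℝ≥0∞) ≤ 2 ^ p := ENNReal.one_le_rpow (by norm_num) (by linarith)
  have h8 : (8 : ℝ≥0∞) ^ p = 2 ^ p * (2 ^ p * 2 ^ p) := by
    rw [← ENNReal.mul_rpow_of_nonneg _ _ hp0, ← ENNReal.mul_rpow_of_nonneg _ _ hp0]
    norm_num
  have m1 : ∀ t : ℝ≥0∞, t ≤ 2 ^ p * t := fun t => le_mul_of_one_le_left zero_le h1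
  calc (a + (b + (c + d))) ^ p ≤ 2 ^ p * (a ^ p + (b + (c + d)) ^ p) :=
        ENNReal.rpow_add_le_two_rpow_mul hp _ _
    _ ≤ 2 ^ p * (a ^ p + 2 ^ p * (b ^ p + 2 ^ p * (c ^ p + d ^ p))) := by
        gcongr
        refine (ENNReal.rpow_add_le_two_rpow_mul hp _ _).trans ?_
        gcongr
        exact ENNReal.rpow_add_le_two_rpow_mul hp _ _
    _ ≤ 2 ^ p * (2 ^ p * (2 ^ p * a ^ p) + 2 ^ p * (2 ^ p * b ^ p + 2 ^ p * (c ^ p + d ^ p))) := by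
        gcongr
        · exact (m1 _).trans (m1 _)
        · exact m1 _
    _ = _ := by rw [h8]; ring

variable {m : ℕ} {M : Type*} [EMetricSpace M] [ChartedSpace (ℰ m) M]
  [RiemannianBundle (fun x : M => TangentSpace (𝓡 m) x)] [MeasurableSpace M] [BorelSpace M]
  {N : Type*} [EMetricSpace N] [MeasurableSpace N]
  {F : Type*} [EMetricSpace F]
  {e : OpenPartialHomeomorph M (ℰ m)} {y₀ : ℰ m} {R s p : ℝ} {Λ : ℝ≥0}

/-- `w` is a modification of `u₀` in a small ball, with a small energy there, whose composition
with `f` has a large energy. -/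
structure IsBubble (𝒢 : GradientCalculus (M := M) e y₀ R s p) (r q : ℝ) (f : N → F) (u₀ : M → N)
    (G₀ : M × M → ℝ≥0∞) (c : ℰ m) (ϱ : ℝ) (κ : ℝ≥0∞) (w : M → N) (G : M × M → ℝ≥0∞) : Prop where
  measurable : Measurable w
  eq_of_notMem : ∀ x ∉ e.symm '' Metric.closedBall c ϱ, w x = u₀ x
  measurable_gradient : Measurable G
  isGrad : 𝒢.IsGrad (fun x y => edist (w x) (w y)) G
  lintegral_ne_top : ∫⁻ z, G z ^ p ∂𝒢.ν ≠ ⊤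
  energy_le : ∫⁻ z in ballRegion e c ϱ, G z ^ p ∂𝒢.ν ≤ κ
  energy_le' : ∫⁻ z in ballRegion e c ϱ, G₀ z ^ p ∂𝒢.ν ≤ κ
  edist_le : ∫⁻ x in e.symm '' Metric.closedBall c ϱ, edist (w x) (u₀ x) ∂μHE[m] ≤ κ
  edist_rpow_le : ∫⁻ x in e.symm '' Metric.closedBall c ϱ, edist (w x) (u₀ x) ^ p ∂μHE[m] ≤ κ
  hasLargeEnergyOn : HasLargeEnergyOn m r q (fun x => f (w x)) (e.symm '' Metric.closedBall c ϱ)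

/-- The lower bounds of energies of oscillating maps, with constant `C`. -/
def OscillationBound (e : OpenPartialHomeomorph M (ℰ m)) (y₀ : ℰ m) (R r q : ℝ) (F : Type*)
    [EMetricSpace F] [MeasurableSpace F] (C : ℝ≥0) : Prop :=
  ∀ (h : M → F) (a b : F) (D : ℝ≥0) (i₀ : Fin m) (c : ℰ m)
      (ρ ε : ℝ≥0) (P Q : Set (ℰ m)) (K : Set M),
      Measurable h → (D : ℝ≥0∞) ≤ edist a b → Metric.closedBall c ρ ⊆ Metric.ball y₀ R →
      e.symm '' Metric.closedBall c ρ ⊆ K →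
      IsOscillating (fun y => h (e.symm y)) a b i₀ c ρ ε P Q →
      C ≤ (D : ℝ≥0∞) ^ q * ENNReal.ofReal ((ρ : ℝ) ^ m * (ε : ℝ) ^ (-(r * q))) →
      HasLargeEnergyOn m r q h K

/-- The bound of the gradients of cutoff functions, with constant `C`. -/
def GradientCalculus.CutoffBound (𝒢 : GradientCalculus (M := M) e y₀ R s p) (C : ℝ≥0) : Prop :=
  ∀ (c : ℰ m) (ϱ : ℝ) (l : ℝ≥0) (η : ℰ m → ℝ), 0 < l → l ≤ 1 → 0 < ϱ →
    Metric.closedBall c ϱ ⊆ Metric.ball y₀ R → LipschitzWith l⁻¹ η →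
    (∀ y, η y ∈ Set.Icc (0 : ℝ) 1) → (∀ y ∉ Metric.closedBall c ϱ, η y = 0) →
    ∃ G, Measurable G ∧ 𝒢.IsGrad (fun x y => edist (chartLift e η x) (chartLift e η y)) G ∧
      (∀ z : M × M, z.1 ∉ e.symm '' Metric.closedBall c ϱ →
        z.2 ∉ e.symm '' Metric.closedBall c ϱ → G z = 0) ∧
      ∫⁻ z, G z ^ p ∂𝒢.ν ≤ C * ENNReal.ofReal (ϱ ^ m * (l : ℝ) ^ (-(s * p)))

lemma measurableSet_target_inter_preimage {X : Type*} [MeasurableSpace X] {u : M → X}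
    (hu : Measurable u) (T : Set X) (hT : MeasurableSet T) :
    MeasurableSet (e.target ∩ (fun y => u (e.symm y)) ⁻¹' T) := by
  have h1 : Measurable (e.target.domRestrict e.symm) :=
    e.continuousOn_symm.domRestrict.measurable
  have h2 := MeasurableSet.subtype_image e.open_target.measurableSet (h1 (hu hT))
  convert h2 using 1
  ext y
  simp [and_comm]

-- Surgery with the cutoff β for the path to x and the oscillating cutoff for the path from x to y.
-- The gradient of the result is a sum of four terms, due to v, to the two paths and to the target
-- cutoffs; `hκ` sums their energies, and `hDl` makes the oscillation visible after composition with
-- f.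
open GradientCalculus in
theorem IsBubble.of_surgery [BorelSpace N] [ConnectedSpace N] [MeasurableSpace F]
    (hm : 1 ≤ m) (hB : ChartBall e y₀ R Λ)
    (𝒢 : GradientCalculus (M := M) e y₀ R s p) (hp : 1 ≤ p) {r q : ℝ} {f : N → F}
    (hf : Measurable f) {Cl Cc : ℝ≥0} (hCl : OscillationBound e y₀ R r q F Cl)
    (hCc : 𝒢.CutoffBound Cc)
    {u₀ v : M → N} (hu₀ : Measurable u₀) (hv : Measurable v) {G₀ Gv Gβ : M × M → ℝ≥0∞}
    (hG₀ : Measurable G₀) (hGv : Measurable Gv) (hGβ : Measurable Gβ)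
    (gG₀ : 𝒢.IsGrad (fun x y => edist (u₀ x) (u₀ y)) G₀)
    (gGv : 𝒢.IsGrad (fun x y => edist (v x) (v y)) Gv)
    (iG₀ : ∫⁻ z, G₀ z ^ p ∂𝒢.ν ≠ ⊤) (iGv : ∫⁻ z, Gv z ^ p ∂𝒢.ν ≠ ⊤)
    {c : ℰ m} {ϱ ϱ₁ ϱ₂ : ℝ} (hc : Metric.closedBall c ϱ ⊆ Metric.ball y₀ R)
    (hϱ₁ : ϱ₁ ≤ ϱ) (hϱ₂ : ϱ₂ ≤ ϱ₁)
    (hvoff : ∀ x ∉ e.symm '' Metric.closedBall c ϱ, v x = u₀ x) {Av : ℝ≥0}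
    (hAv : ∀ x, edist (v x) (u₀ x) ≤ Av) {β : ℰ m → ℝ} (hβ : IsCutoff c ϱ₁ ϱ₂ 1 β)
    (gGβ : 𝒢.IsGrad (fun x y => edist (chartLift e β x) (chartLift e β y)) Gβ)
    (iGβ : ∫⁻ z, Gβ z ^ p ∂𝒢.ν ≠ ⊤) {a : ℝ≥0} (ha : 0 < a) {b : N}
    (hvb : ∀ z, chartLift e β z ≠ 0 → edist (u₀ z) b < (4 * a : ℝ≥0) → v z = b)
    {ρ ε : ℝ≥0} (hε : 0 < ε) (hε5 : ε ≤ 5) (hερ : 2 * ε ≤ ρ) (hρ : 2 * (ρ : ℝ) ≤ ϱ₂)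
    (happ : 32 * volume (Metric.ball c ρ \ {y | edist (u₀ (e.symm y)) b ≤ a}) ≤
      volume (Metric.ball c ((ρ : ℝ) / 2)))
    {x y : N} {γ σ : ℝ → N} {Λ' L : ℝ≥0} (hγ : LipschitzWith Λ' γ)
    (hσ : LipschitzWith L σ) (hγ0 : γ 0 = b) (hγ1 : γ 1 = x) (hσ0 : σ 0 = x) (hσ1 : σ 1 = y)
    {D : ℝ≥0} (hD : (D : ℝ≥0∞) ≤ edist (f x) (f y))
    (hDl : Cl ≤ (D : ℝ≥0∞) ^ q * ENNReal.ofReal ((ρ : ℝ) ^ m * (ε : ℝ) ^ (-(r * q))))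
    {κ : ℝ≥0∞} (hκ : 8 ^ p * (∫⁻ z in ballRegion e c ϱ, Gv z ^ p ∂𝒢.ν +
      ((Λ' : ℝ≥0∞) ^ p * ∫⁻ z, Gβ z ^ p ∂𝒢.ν + ((L : ℝ≥0∞) ^ p * (Cc *
        ENNReal.ofReal ((2 * (ρ : ℝ)) ^ m * ((ε / 5 : ℝ≥0) : ℝ) ^ (-(s * p)))) +
        (((Λ' + L) * a⁻¹ : ℝ≥0) : ℝ≥0∞) ^ p * ∫⁻ z in ballRegion e c ϱ, G₀ z ^ p ∂𝒢.ν))) ≤ κ)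
    (hκ0 : ∫⁻ z in ballRegion e c ϱ, G₀ z ^ p ∂𝒢.ν ≤ κ)
    (hκ1 : ((Λ' + L + Av : ℝ≥0) : ℝ≥0∞) * (μHE[m] : Measure M) (e.symm '' Metric.closedBall c ϱ) ≤ κ)
    (hκ2 : ((Λ' + L + Av : ℝ≥0) : ℝ≥0∞) ^ p *
      (μHE[m] : Measure M) (e.symm '' Metric.closedBall c ϱ) ≤ κ) :
    ∃ w G, IsBubble 𝒢 r q f u₀ G₀ c ϱ κ w G := by
  have hp0 : 0 < p := one_pos.trans_le hp
  have hρ0 : 0 < ρ := (by positivity : 0 < 2 * ε).trans_le hερ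
  have hρR := NNReal.coe_pos.2 hρ0
  obtain ⟨θ, hθL, hθ1, hθ0, S, hS, hSm, hSv, hSθ⟩ :=
    exists_oscillating_cutoff (⟨0, hm⟩ : Fin m) c hε hερ
  have hsub2 : Metric.closedBall c (2 * (ρ : ℝ)) ⊆ Metric.closedBall c ϱ₂ :=
    Metric.closedBall_subset_closedBall hρ
  have hϱ2 : Metric.closedBall c ϱ₂ ⊆ Metric.closedBall c ϱ :=
    Metric.closedBall_subset_closedBall (hϱ₂.trans hϱ₁)
  have hball1 : Metric.ball c (ρ : ℝ) ⊆ Metric.closedBall c ϱ₂ :=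
    (Metric.ball_subset_closedBall.trans (Metric.closedBall_subset_closedBall (by linarith)))
  have htar : ∀ y ∈ Metric.closedBall c ϱ, y ∈ e.target := fun y hy =>
    hB.subset_target (hB.image_subset_of_subset hc hy)
  -- The length ε/5 must be at most 1 in the scaling law, whence the hypothesis ε ≤ 5.
  obtain ⟨Gθ, hGθ, gGθ, -, iGθ⟩ := hCc c (2 * ρ) (ε / 5) θ (by positivity)
    ((div_le_one (by norm_num)).2 hε5) (by positivity) ((hsub2.trans hϱ2).trans hc) hθL hθ1 hθ0
  have hβθ : ∀ z, chartLift e θ z ≠ 0 → chartLift e β z = 1 := by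
    intro z hz
    by_cases hzK : z ∈ e.symm '' Metric.closedBall c (2 * (ρ : ℝ))
    · obtain ⟨y, hy, rfl⟩ := hzK
      rw [chartLift_symm (htar y (hϱ2 (hsub2 hy)))]
      exact hβ.eq_of_mem y (hsub2 hy)
    · exact absurd (chartLift_eq_zero hθ0 hzK) hz
  obtain ⟨w, hw, hwv, hwd, hwx, hwy, hww⟩ := exists_surgery hu₀ hv
    (measurable_chartLift hβ.continuous) (measurable_chartLift hθL.continuous)
    (chartLift_mem_Icc hβ.mem_Icc) (chartLift_mem_Icc hθ1) ha hvb hβθ hγ hσ hγ0 hγ1 hσ0 hσ1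
  let G : M × M → ℝ≥0∞ := fun z => Gv z + (Λ' * Gβ z + (L * Gθ z +
    ((Λ' + L) * a⁻¹ : ℝ≥0) * G₀ z))
  have hG : Measurable G := by fun_prop
  have hGp : ∀ μ' : Measure (M × M), ∫⁻ z, G z ^ p ∂μ' ≤ 8 ^ p * (∫⁻ z, Gv z ^ p ∂μ' +
      ((Λ' : ℝ≥0∞) ^ p * ∫⁻ z, Gβ z ^ p ∂μ' + ((L : ℝ≥0∞) ^ p * ∫⁻ z, Gθ z ^ p ∂μ' +
        (((Λ' + L) * a⁻¹ : ℝ≥0) : ℝ≥0∞) ^ p * ∫⁻ z, G₀ z ^ p ∂μ'))) := by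
    intro μ'
    rw [← lintegral_const_mul _ (hGβ.pow_const p), ← lintegral_const_mul _ (hGθ.pow_const p),
      ← lintegral_const_mul _ (hG₀.pow_const p), ← lintegral_add_left (by fun_prop),
      ← lintegral_add_left (by fun_prop), ← lintegral_add_left (by fun_prop),
      ← lintegral_const_mul _ (by fun_prop)]
    refine lintegral_mono fun z => (ENNReal.rpow_add_add_add_le hp _ _ _ _).trans (le_of_eq ?_)
    simp only [ENNReal.mul_rpow_of_nonneg _ _ hp0.le]
  have hiGθ : ∫⁻ z, Gθ z ^ p ∂𝒢.ν ≠ ⊤ := (iGθ.trans_lt (by finiteness)).ne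
  have hdist : ∀ z, edist (w z) (u₀ z) ≤ (Λ' + L + Av : ℝ≥0) := by
    intro z
    push_cast
    exact (edist_triangle _ (v z) _).trans (add_le_add (hwd z) (hAv z))
  refine ⟨w, G, hw, ?_, hG, ?_, ?_, ?_, hκ0, ?_, ?_, ?_⟩
  · intro z hz
    rw [← hvoff z hz]
    refine hwv z (chartLift_eq_zero hβ.eq_zero fun h => hz ?_)
    exact Set.image_mono (Metric.closedBall_subset_closedBall hϱ₁) h
  · exact 𝒢.mono hww (𝒢.add gGv (𝒢.add (𝒢.const_mul _ gGβ) (𝒢.add (𝒢.const_mul _ gGθ)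
      (𝒢.const_mul _ gG₀))))
  · exact ((hGp _).trans_lt (by finiteness)).ne
  · refine ((hGp _).trans ?_).trans hκ
    gcongr
    · exact Measure.restrict_le_self
    · exact (lintegral_mono' Measure.restrict_le_self le_rfl).trans iGθ
  · refine le_trans ?_ hκ1
    rw [← setLIntegral_const]
    exact lintegral_mono fun z => hdist z
  · refine le_trans ?_ hκ2
    rw [← setLIntegral_const]
    exact lintegral_mono fun z => ENNReal.rpow_le_rpow (hdist z) hp0.le
  · have hA : MeasurableSet (Metric.ball c (ρ : ℝ) ∩ {y | edist (u₀ (e.symm y)) b ≤ a}) := by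
      have := measurableSet_target_inter_preimage (e := e) hu₀ {y | edist y b ≤ a}
        (by exact (isClosed_le (by fun_prop) continuous_const).measurableSet)
      convert measurableSet_ball (x := c) (ε := (ρ : ℝ)).inter this using 1
      ext y
      simp only [Set.mem_inter_iff, Set.mem_preimage, Set.mem_ofPred_eq]
      exact ⟨fun h => ⟨h.1, htar y (hϱ2 (hball1 h.1)), h.2⟩, fun h => ⟨h.1, h.2.2⟩⟩
    obtain ⟨P, Q, hPQ⟩ := isOscillating_of_cutoff (H := fun y => f (w (e.symm y)))
      (a := f x) (b := f y) hε hερ hA happ hθL.continuous hS hSm hSv hSθ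
      (fun z hz hzA h0 => by
        have hzt := htar z (hϱ2 (hball1 hz))
        rw [hwx (e.symm z) hzA (by rw [chartLift_symm hzt]; exact hβ.eq_of_mem z (hball1 hz))
          (by rw [chartLift_symm hzt]; exact h0)])
      (fun z hz hzA h0 => by
        have hzt := htar z (hϱ2 (hball1 hz))
        rw [hwy (e.symm z) hzA (by rw [chartLift_symm hzt]; exact hβ.eq_of_mem z (hball1 hz))
          (by rw [chartLift_symm hzt]; exact h0)])
    have hsub : Metric.closedBall c (ρ : ℝ) ⊆ Metric.closedBall c ϱ :=
      Metric.closedBall_subset_closedBall (by linarith)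
    exact hCl _ _ _ D _ c ρ ε P Q _ (hf.comp hw) hD (hsub.trans hc) (Set.image_mono hsub) hPQ hDl

end Bubble

/-! ### Choice of the constants -/

section Scales

/-- The equation is solved by ε = (ρ^m/E)^(1/τ), and the hypothesis is a rearrangement of 2ε ≤ ρ. -/
lemma exists_scale {m : ℕ} {τ ρ E : ℝ} (hτ : 0 < τ) (hρ : 0 < ρ) (hE : 0 < E)
    (h : ρ ^ ((m : ℝ) - τ) * 2 ^ τ ≤ E) : ∃ ε : ℝ, 0 < ε ∧ 2 * ε ≤ ρ ∧ ρ ^ m * ε ^ (-τ) = E := by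
  have h0 : 0 < ρ ^ m / E := by positivity
  have h1 : ((ρ ^ m / E) ^ τ⁻¹) ^ τ = ρ ^ m / E := Real.rpow_inv_rpow h0.le hτ.ne'
  refine ⟨(ρ ^ m / E) ^ τ⁻¹, Real.rpow_pos_of_pos h0 _, ?_, ?_⟩
  · refine (Real.rpow_le_rpow_iff (by positivity) hρ.le hτ).1 ?_
    rw [Real.mul_rpow (by norm_num) (by positivity), h1, ← mul_div_assoc, div_le_iff₀ hE]
    rw [Real.rpow_sub hρ, Real.rpow_natCast, div_mul_eq_mul_div, div_le_iff₀ (by positivity)] at h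
    linarith
  · rw [Real.rpow_neg (by positivity), h1]
    field_simp

/-- This is where the exponent p/q matters: (d^(p/q))^q cancels the factor d^p of the cost of the
oscillation, so that only the size of Cb^q ≥ Cb remains. -/
lemma le_rpow_mul_scale {p q κ C' Cb d Cl : ℝ} (hq : 1 ≤ q) (hκ : 0 < κ) (hC' : 0 < C')
    (hCb : 1 ≤ Cb) (hd : 0 < d) (h1 : Cl * C' * 2 ^ p / κ ≤ Cb) :
    Cl ≤ (Cb * d ^ (p / q)) ^ q * (κ / (C' * (2 * d) ^ p)) := by
  have hq0 : 0 < q := one_pos.trans_le hq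
  rw [Real.mul_rpow (by linarith) (by positivity), ← Real.rpow_mul hd.le, div_mul_cancel₀ _ hq0.ne',
    Real.mul_rpow (by norm_num) hd.le]
  have h2 : Cb ≤ Cb ^ q := by
    conv_lhs => rw [← Real.rpow_one Cb]
    exact Real.rpow_le_rpow_of_exponent_le hCb hq
  have h3 : Cb ^ q * d ^ p * (κ / (C' * (2 ^ p * d ^ p))) = Cb ^ q * κ / (C' * 2 ^ p) := by
    field_simp
  rw [h3, le_div_iff₀ (by positivity)]
  rw [div_le_iff₀ hκ] at h1
  nlinarith

/-- As d ≤ 1/Cb ≤ 1 and p ≥ 1, also d^p ≤ 1/Cb, so that the energy density available at scale d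
grows with Cb and exceeds any prescribed X. -/
lemma le_scale {p κ C' Cb d X : ℝ} (hp : 1 ≤ p) (hκ : 0 < κ) (hC' : 0 < C')
    (hCb : 1 ≤ Cb) (hd : 0 < d) (hdC : d ≤ 1 / Cb) (h : X * C' * 2 ^ p / κ ≤ Cb) (hX : 0 ≤ X) :
    X ≤ κ / (C' * (2 * d) ^ p) := by
  have hCb0 : 0 < Cb := one_pos.trans_le hCb
  rw [le_div_iff₀ (by positivity), Real.mul_rpow (by norm_num) hd.le]
  have h1 : d ^ p ≤ 1 / Cb := by
    refine le_trans ?_ hdC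
    conv_rhs => rw [← Real.rpow_one d]
    exact Real.rpow_le_rpow_of_exponent_ge hd (hdC.trans ((div_le_one hCb0).2 hCb)) hp
  rw [div_le_iff₀ hκ] at h
  have h2 : X * C' * 2 ^ p * (1 / Cb) ≤ κ := by
    rw [mul_one_div, div_le_iff₀ hCb0]
    linarith
  have h3 : X * C' * 2 ^ p * d ^ p ≤ X * C' * 2 ^ p * (1 / Cb) :=
    mul_le_mul_of_nonneg_left h1 (by positivity)
  linarith

end Scales

/-! ### The bubble associated with a bad pair -/

section Bubble

variable {m : ℕ} {M : Type*} [EMetricSpace M] [ChartedSpace (ℰ m) M]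
  [RiemannianBundle (fun x : M => TangentSpace (𝓡 m) x)] [MeasurableSpace M] [BorelSpace M]
  {N : Type*} [EMetricSpace N] [MeasurableSpace N]
  {F : Type*} [EMetricSpace F]
  {e : OpenPartialHomeomorph M (ℰ m)} {y₀ : ℰ m} {R s p : ℝ} {Λ : ℝ≥0}

-- The scale ε is determined by ρ^m ε^(-sp) = κ₁ / (C' (2d)^p). The oscillation along a path of
-- length 2d then costs at most κ₁, while `hCb'` makes the composed energy large.
open GradientCalculus in
theorem IsBubble.of_pair [BorelSpace N] [ConnectedSpace N] [MeasurableSpace F]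
    (hm : 1 ≤ m) (hB : ChartBall e y₀ R Λ)
    (𝒢 : GradientCalculus (M := M) e y₀ R s p) (hs : 0 < s) (hp : 1 ≤ p) {r q : ℝ} (hq : 1 ≤ q)
    (hrq : r * q = s * p) {f : N → F}
    (hf : Measurable f) {Cl Cc : ℝ≥0} (hCl : OscillationBound e y₀ R r q F Cl)
    (hCc : 𝒢.CutoffBound Cc)
    {u₀ v : M → N} (hu₀ : Measurable u₀) (hv : Measurable v) {G₀ Gv Gβ : M × M → ℝ≥0∞}
    (hG₀ : Measurable G₀) (hGv : Measurable Gv) (hGβ : Measurable Gβ)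
    (gG₀ : 𝒢.IsGrad (fun x y => edist (u₀ x) (u₀ y)) G₀)
    (gGv : 𝒢.IsGrad (fun x y => edist (v x) (v y)) Gv)
    (iG₀ : ∫⁻ z, G₀ z ^ p ∂𝒢.ν ≠ ⊤) (iGv : ∫⁻ z, Gv z ^ p ∂𝒢.ν ≠ ⊤)
    {c : ℰ m} {ϱ ϱ₁ ϱ₂ : ℝ} (hc : Metric.closedBall c ϱ ⊆ Metric.ball y₀ R)
    (hϱ₁ : ϱ₁ ≤ ϱ) (hϱ₂ : ϱ₂ ≤ ϱ₁)
    (hvoff : ∀ x ∉ e.symm '' Metric.closedBall c ϱ, v x = u₀ x) {Av : ℝ≥0}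
    (hAv : ∀ x, edist (v x) (u₀ x) ≤ Av) {β : ℰ m → ℝ} (hβ : IsCutoff c ϱ₁ ϱ₂ 1 β)
    (gGβ : 𝒢.IsGrad (fun x y => edist (chartLift e β x) (chartLift e β y)) Gβ)
    {a : ℝ≥0} (ha : 0 < a) {b : N}
    (hvb : ∀ z, chartLift e β z ≠ 0 → edist (u₀ z) b < (4 * a : ℝ≥0) → v z = b)
    {ρ : ℝ≥0} (hρ0 : 0 < ρ) (hρ1 : ρ ≤ 1) (hρ : 2 * (ρ : ℝ) ≤ ϱ₂)
    (happ : 32 * volume (Metric.ball c ρ \ {y | edist (u₀ (e.symm y)) b ≤ a}) ≤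
      volume (Metric.ball c ((ρ : ℝ) / 2)))
    {x y : N} {γ σ : ℝ → N} {Λ' L d Cb : ℝ≥0} (hγ : LipschitzWith Λ' γ)
    (hσ : LipschitzWith L σ) (hγ0 : γ 0 = b) (hγ1 : γ 1 = x) (hσ0 : σ 0 = x) (hσ1 : σ 1 = y)
    (hd : 0 < d) (hL : L = 2 * d) (hCb : 1 ≤ Cb)
    (hxy : Cb * (d : ℝ≥0∞) ^ (p / q) ≤ edist (f x) (f y)) {κ₁ : ℝ≥0} (hκ₁ : 0 < κ₁)
    (hCb' : (Cl : ℝ) * (Cc * 2 ^ m * 5 ^ (s * p) + 1) * 2 ^ p / κ₁ ≤ Cb)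
    (hρE : (ρ : ℝ) ^ ((m : ℝ) - s * p) * 2 ^ (s * p) ≤
      κ₁ / ((Cc * 2 ^ m * 5 ^ (s * p) + 1) * (2 * d) ^ p))
    (k1 : ∫⁻ z in ballRegion e c ϱ, Gv z ^ p ∂𝒢.ν ≤ κ₁)
    (k2 : (Λ' : ℝ≥0∞) ^ p * ∫⁻ z, Gβ z ^ p ∂𝒢.ν ≤ κ₁) (iGβ : ∫⁻ z, Gβ z ^ p ∂𝒢.ν ≠ ⊤)
    (k3 : (((Λ' + L) * a⁻¹ : ℝ≥0) : ℝ≥0∞) ^ p * ∫⁻ z in ballRegion e c ϱ, G₀ z ^ p ∂𝒢.ν ≤ κ₁)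
    {κ : ℝ≥0∞} (hκ : 8 ^ p * (4 * (κ₁ : ℝ≥0∞)) ≤ κ)
    (hκ0 : ∫⁻ z in ballRegion e c ϱ, G₀ z ^ p ∂𝒢.ν ≤ κ)
    (hκ1 : ((Λ' + L + Av : ℝ≥0) : ℝ≥0∞) * (μHE[m] : Measure M) (e.symm '' Metric.closedBall c ϱ) ≤ κ)
    (hκ2 : ((Λ' + L + Av : ℝ≥0) : ℝ≥0∞) ^ p *
      (μHE[m] : Measure M) (e.symm '' Metric.closedBall c ϱ) ≤ κ) :
    ∃ w G, IsBubble 𝒢 r q f u₀ G₀ c ϱ κ w G := by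
  have hp0 : 0 < p := one_pos.trans_le hp
  have hq0 : 0 < q := one_pos.trans_le hq
  have hτ : 0 < s * p := mul_pos hs hp0
  have hdR : (0 : ℝ) < d := hd
  have hκR : (0 : ℝ) < κ₁ := hκ₁
  set C' : ℝ := Cc * 2 ^ m * 5 ^ (s * p) + 1 with hC'
  have hC'0 : 0 < C' := by positivity
  set E : ℝ := κ₁ / (C' * (2 * d) ^ p) with hE
  have hE0 : 0 < E := by positivity
  obtain ⟨ε, hε, hερ, hεE⟩ := exists_scale hτ (NNReal.coe_pos.2 hρ0) hE0 hρE
  lift ε to ℝ≥0 using hε.le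
  have hερ' : 2 * ε ≤ ρ := by exact_mod_cast hερ
  have hε5 : ε ≤ 5 := by
    rw [← NNReal.coe_le_coe]
    have : (ρ : ℝ) ≤ 1 := by exact_mod_cast hρ1
    push_cast
    linarith
  refine IsBubble.of_surgery hm hB 𝒢 hp hf hCl hCc hu₀ hv hG₀ hGv hGβ gG₀ gGv iG₀ iGv hc hϱ₁ hϱ₂
    hvoff hAv hβ gGβ iGβ ha hvb (NNReal.coe_pos.1 hε) hε5 hερ' hρ happ hγ hσ hγ0 hγ1 hσ0 hσ1
    (D := Cb * d ^ (p / q)) ?_ ?_ ?_ hκ0 hκ1 hκ2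
  · rwa [ENNReal.coe_mul, ENNReal.coe_rpow_of_nonneg _ (by positivity)]
  · rw [hrq, hεE, ← ENNReal.coe_rpow_of_nonneg _ hq0.le, ← ENNReal.ofReal_coe_nnreal,
      ← ENNReal.ofReal_coe_nnreal (p := (Cb * d ^ (p / q)) ^ q),
      ← ENNReal.ofReal_mul (by positivity)]
    refine ENNReal.ofReal_le_ofReal ?_
    push_cast
    exact le_rpow_mul_scale hq hκR hC'0 (by exact_mod_cast hCb) hdR hCb'
  · refine le_trans ?_ hκ
    have k4 : (L : ℝ≥0∞) ^ p * (Cc *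
        ENNReal.ofReal ((2 * (ρ : ℝ)) ^ m * ((ε / 5 : ℝ≥0) : ℝ) ^ (-(s * p)))) ≤ κ₁ := by
      have e1 : (2 * (ρ : ℝ)) ^ m * ((ε / 5 : ℝ≥0) : ℝ) ^ (-(s * p)) = 2 ^ m * 5 ^ (s * p) * E := by
        rw [← hεE]
        push_cast
        rw [Real.div_rpow ε.coe_nonneg (by norm_num), Real.rpow_neg (x := (5 : ℝ)) (by norm_num), mul_pow]
        field_simp
      rw [e1, hL, ← ENNReal.coe_rpow_of_nonneg _ hp0.le, ← ENNReal.ofReal_coe_nnreal,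
        ← ENNReal.ofReal_coe_nnreal (p := Cc), ← ENNReal.ofReal_coe_nnreal (p := κ₁),
        ← ENNReal.ofReal_mul (by positivity), ← ENNReal.ofReal_mul (by positivity)]
      refine ENNReal.ofReal_le_ofReal ?_
      push_cast
      -- C' is the constant of the scaling law plus 1: it is positive, and the cost is κ₁ (C' -
      -- 1)/C' ≤ κ₁.
      have e2 : (2 * (d : ℝ)) ^ p * (Cc * (2 ^ m * 5 ^ (s * p) * E)) =
          (C' - 1) * (κ₁ / C') := by
        rw [hE, hC']
        have : (0 : ℝ) < (2 * (d : ℝ)) ^ p := by positivity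
        field_simp
        ring
      rw [e2, mul_div_assoc', div_le_iff₀ hC'0]
      nlinarith
    refine mul_le_mul_right ?_ _
    calc _ ≤ (κ₁ : ℝ≥0∞) + (κ₁ + (κ₁ + κ₁)) := by gcongr
      _ = _ := by ring

end Bubble

/-! ### Existence of bubbles when points have zero capacity -/

section ExistsBubble

/-- For τ < α the quantity tends to 0 with ρ. For τ = α it does not depend on ρ, and E itself has to
be large. -/
lemma exists_small_rpow {α τ E δ : ℝ} (hE : 0 < E) (hδ : 0 < δ)
    (h : τ < α ∨ (τ = α ∧ 2 ^ τ ≤ E)) : ∃ ρ : ℝ, 0 < ρ ∧ ρ ≤ δ ∧ ρ ^ (α - τ) * 2 ^ τ ≤ E := by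
  rcases h with h | ⟨h, hE'⟩
  · have h1 : Tendsto (fun ρ : ℝ => ρ ^ (α - τ) * 2 ^ τ) (𝓝[>] 0) (𝓝 0) := by
      have := (Real.continuousAt_rpow_const 0 (α - τ) (Or.inr (sub_pos.2 h).le)).tendsto
      rw [Real.zero_rpow (sub_pos.2 h).ne'] at this
      have := (this.mono_left (nhdsWithin_le_nhds (s := Set.Ioi 0))).mul_const (2 ^ τ)
      rwa [zero_mul] at this
    obtain ⟨ρ, ⟨h2, h3⟩, h4⟩ := (Filter.Eventually.and (p := fun ρ => ρ ∈ Set.Ioc 0 _)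
      (Ioc_mem_nhdsGT hδ) (h1.eventually_le_const hE)).exists
    exact ⟨ρ, h2, h3, h4⟩
  · refine ⟨δ, hδ, le_rfl, ?_⟩
    rw [h, sub_self, Real.rpow_zero, one_mul, ← h]
    exact hE'

variable {m : ℕ} {M : Type*} [EMetricSpace M] [ChartedSpace (ℰ m) M]
  [RiemannianBundle (fun x : M => TangentSpace (𝓡 m) x)] [MeasurableSpace M] [BorelSpace M]
  {e : OpenPartialHomeomorph M (ℰ m)} {y₀ : ℰ m} {R s p : ℝ} {Λ : ℝ≥0}

lemma ChartBall.exists_measure_image_le (hB : ChartBall e y₀ R Λ) (hm : 1 ≤ m) {c : ℰ m} {ϱ₀ : ℝ}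
    (hϱ₀ : 0 < ϱ₀) (hc : Metric.closedBall c ϱ₀ ⊆ Metric.ball y₀ R) {κ : ℝ≥0∞} (hκ : 0 < κ) :
    ∃ ϱ : ℝ, 0 < ϱ ∧ ϱ ≤ ϱ₀ ∧ (μHE[m] : Measure M) (e.symm '' Metric.closedBall c ϱ) ≤ κ := by
  have h1 : Tendsto (fun ϱ : ℝ => Λ * (ENNReal.ofReal (ϱ ^ m) *
      volume (Metric.ball (0 : ℰ m) 1))) (𝓝[>] 0) (𝓝 0) := by
    have h2 : Tendsto (fun ϱ : ℝ => ENNReal.ofReal (ϱ ^ m)) (𝓝[>] 0) (𝓝 0) := by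
      have : Tendsto (fun ϱ : ℝ => ENNReal.ofReal (ϱ ^ m)) (𝓝 0) (𝓝 (ENNReal.ofReal (0 ^ m))) :=
        (ENNReal.continuous_ofReal.comp (continuous_pow m)).tendsto 0
      rw [zero_pow (by omega), ENNReal.ofReal_zero] at this
      exact this.mono_left nhdsWithin_le_nhds
    have h3 := ENNReal.Tendsto.mul_const (b := volume (Metric.ball (0 : ℰ m) 1)) h2
      (Or.inr measure_ball_lt_top.ne)
    have h4 := ENNReal.Tendsto.const_mul (a := (Λ : ℝ≥0∞)) h3 (Or.inr ENNReal.coe_ne_top)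
    rwa [zero_mul, mul_zero] at h4
  obtain ⟨ϱ, ⟨h2, h3⟩, h4⟩ := (Filter.Eventually.and (p := fun ρ => ρ ∈ Set.Ioc 0 _)
      (Ioc_mem_nhdsGT hϱ₀) (h1.eventually_le_const hκ)).exists
  have h2' : 0 < ϱ := h2
  exact ⟨ϱ, h2', h3, (hB.measure_image_le h2'.le
    ((Metric.closedBall_subset_closedBall h3).trans hc)).trans h4⟩

variable {n : ℕ} {N : Type*} [EMetricSpace N] [MeasurableSpace N] [BorelSpace N] [ConnectedSpace N]
  [SecondCountableTopology N] [ChartedSpace (ℰ n) N]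
  [RiemannianBundle (fun x : N => TangentSpace (𝓡 n) x)] [IsRiemannianManifold (𝓡 n) N]
  {F : Type*} [EMetricSpace F] [MeasurableSpace F]

open GradientCalculus in
/-- Bubbles exist if points have zero capacity. -/
theorem exists_isBubble_of_small_capacity [IsManifold (𝓡 n) ∞ N]
    [IsContMDiffRiemannianBundle (𝓡 n) ∞ (ℰ n) (fun x : N => TangentSpace (𝓡 n) x)]
    (hm : 1 ≤ m) (hB : ChartBall e y₀ R Λ)
    (𝒢 : GradientCalculus (M := M) e y₀ R s p) (hs : 0 < s) (hp : 1 ≤ p) {r q : ℝ} (hq : 1 ≤ q)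
    (hrq : r * q = s * p) {f : N → F}
    (hf : Measurable f) {Cl : ℝ≥0} (hCl : OscillationBound e y₀ R r q F Cl)
    (hcrit : s * p < m ∨ (s * p = m ∧ 1 < p)) {u₀ : M → N} (hu₀ : Measurable u₀)
    {G₀ : M × M → ℝ≥0∞} (hG₀ : Measurable G₀)
    (gG₀ : 𝒢.IsGrad (fun x y => edist (u₀ x) (u₀ y)) G₀) (iG₀ : ∫⁻ z, G₀ z ^ p ∂𝒢.ν ≠ ⊤)
    (hbad : ∀ C : ℝ≥0, ∃ x y, (s * p < m ∨ edist x y ≤ 1 / (C : ℝ≥0∞)) ∧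
      C * edist x y ^ (p / q) < edist (f x) (f y)) {c : ℰ m} {ϱ₀ : ℝ} {b : N} (hϱ₀ : 0 < ϱ₀)
    (hc : Metric.closedBall c ϱ₀ ⊆ Metric.ball y₀ R)
    (happ : IsApproxContinuousAt (fun y => u₀ (e.symm y)) c b) {κ : ℝ≥0∞} (hκ : 0 < κ) :
    ∃ ϱ, 0 < ϱ ∧ ϱ ≤ ϱ₀ ∧ ∃ w G, IsBubble 𝒢 r q f u₀ G₀ c ϱ κ w G := by
  have hp0 : 0 < p := one_pos.trans_le hp
  have hq0 : 0 < q := one_pos.trans_le hq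
  obtain ⟨Cc, hCc⟩ : ∃ Cc, 𝒢.CutoffBound Cc := 𝒢.cutoff
  obtain ⟨δ, hδ, Lt, T, T0, T1, TL⟩ := exists_contraction (n := n) b
  lift δ to ℝ≥0 using hδ.le
  have hδ' : 0 < δ := hδ
  have h8 : (8 : ℝ≥0∞) ^ p * 4 ≠ ⊤ := by finiteness
  obtain ⟨κ₁, hκ₁, hκ₁κ⟩ := ENNReal.exists_nnreal_pos_mul_lt h8 hκ.ne'
  have hκ₁' : 8 ^ p * (4 * (κ₁ : ℝ≥0∞)) ≤ κ := by
    refine le_trans (le_of_eq ?_) hκ₁κ.le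
    ring
  have hκ₁le : (κ₁ : ℝ≥0∞) ≤ κ := by
    refine le_trans ?_ hκ₁'
    rw [← mul_assoc]
    refine le_mul_of_one_le_left zero_le ?_
    calc (1 : ℝ≥0∞) = 1 * 1 := by norm_num
      _ ≤ _ := by
        gcongr
        · exact ENNReal.one_le_rpow (by norm_num) (by linarith)
        · norm_num
  have hκR : (0 : ℝ) < κ₁ := hκ₁
  -- the pair of points
  set C' : ℝ := Cc * 2 ^ m * 5 ^ (s * p) + 1 with hC'
  have hC'0 : 0 < C' := by positivity
  -- The first quotient ensures a large composed energy, the second one the solvability for ε in the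
  -- critical case.
  let Cb : ℝ≥0 := 1 + (Real.toNNReal ((Cl : ℝ) * C' * 2 ^ p / κ₁) +
    Real.toNNReal (2 ^ (s * p) * C' * 2 ^ p / κ₁))
  have hCb1 : 1 ≤ Cb := le_self_add
  have hCb2 : (Cl : ℝ) * C' * 2 ^ p / κ₁ ≤ Cb := by
    refine (Real.le_coe_toNNReal _).trans ?_
    rw [NNReal.coe_le_coe]
    exact le_self_add.trans le_add_self
  have hCb3 : 2 ^ (s * p) * C' * 2 ^ p / κ₁ ≤ Cb := by
    refine (Real.le_coe_toNNReal _).trans ?_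
    rw [NNReal.coe_le_coe]
    exact le_add_self.trans le_add_self
  -- The pair is chosen before the radii, which may therefore depend on its distance and on its
  -- position relative to b.
  obtain ⟨x, y, hxyC, hxy⟩ := hbad Cb
  have hne : x ≠ y := by
    rintro rfl
    simp at hxy
  obtain ⟨d, hd⟩ : ∃ d : ℝ≥0, (d : ℝ≥0∞) = edist x y :=
    ⟨_, ENNReal.coe_toNNReal (edist_ne_top_of_connectedSpace x y)⟩
  have hd0 : 0 < d := by
    rw [pos_iff_ne_zero, ← ENNReal.coe_ne_zero, hd]
    exact (edist_pos.2 hne).ne'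
  have hdR : (0 : ℝ) < d := hd0
  set L : ℝ≥0 := 2 * d with hL
  obtain ⟨σ, hσ, hσ0, hσ1⟩ := exists_lipschitzWith_path (n := n) (x := x) (y := y) (L := L) (by
    rw [← hd, ENNReal.coe_lt_coe, hL, two_mul]
    exact lt_add_of_pos_left d hd0)
  obtain ⟨Λ', hΛ'⟩ : ∃ d : ℝ≥0, (d : ℝ≥0∞) = edist b x :=
    ⟨_, ENNReal.coe_toNNReal (edist_ne_top_of_connectedSpace b x)⟩
  obtain ⟨γ, hγ, hγ0, hγ1⟩ := exists_lipschitzWith_path (n := n) (x := b) (y := x) (L := Λ' + 1) (by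
    rw [← hΛ', ENNReal.coe_lt_coe]
    exact lt_add_one Λ')
  -- the first radius
  set a : ℝ≥0 := δ / 4 with ha
  have ha0 : 0 < a := by positivity
  set A : ℝ≥0 := Λ' + 1 + L + Lt with hA
  obtain ⟨κ₂, hκ₂, hκ₂'⟩ := ENNReal.exists_nnreal_pos_mul_lt
    (a := (((Λ' + 1 + L) * a⁻¹ : ℝ≥0) : ℝ≥0∞) ^ p + (2 * (2 ^ p * (Lt : ℝ≥0∞) ^ p) + 1))
    (b := κ₁) (by finiteness) (by rw [ENNReal.coe_ne_zero]; exact hκ₁.ne')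
  obtain ⟨κ₀, hκ₀, hκ₀'⟩ := ENNReal.exists_nnreal_pos_mul_lt
    (a := (A : ℝ≥0∞) + (A : ℝ≥0∞) ^ p) (by finiteness) hκ.ne'
  obtain ⟨ϱ', hϱ'0, hϱ', hμ⟩ := hB.exists_measure_image_le hm hϱ₀ hc
    (κ := κ₀) (by exact_mod_cast hκ₀)
  obtain ⟨ϱ, hϱ0, hϱϱ', hI⟩ := 𝒢.exists_setLIntegral_ballRegion_le hB hϱ'0
    ((Metric.closedBall_subset_closedBall hϱ').trans hc) iG₀ (κ := κ₂) (by exact_mod_cast hκ₂)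
  have hcϱ : Metric.closedBall c ϱ ⊆ Metric.ball y₀ R :=
    (Metric.closedBall_subset_closedBall (hϱϱ'.trans hϱ')).trans hc
  have hμ' : (μHE[m] : Measure M) (e.symm '' Metric.closedBall c ϱ) ≤ κ₀ :=
    (measure_mono (Set.image_mono (Metric.closedBall_subset_closedBall hϱϱ'))).trans hμ
  -- the contraction
  obtain ⟨ϱ₁, hϱ₁0, hϱ₁, η, hη, Gη, hGη, gGη, iGη⟩ := 𝒢.exists_cutoff_of_small_capacity hB hp hcrit
    hϱ0 hcϱ (κ := κ₂) (by exact_mod_cast hκ₂)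
  obtain ⟨κ₃, hκ₃, hκ₃'⟩ := ENNReal.exists_nnreal_pos_mul_lt
    (a := ((Λ' + 1 : ℝ≥0) : ℝ≥0∞) ^ p) (b := κ₁) (by finiteness)
    (by rw [ENNReal.coe_ne_zero]; exact hκ₁.ne')
  have hcϱ₁ : Metric.closedBall c ϱ₁ ⊆ Metric.ball y₀ R :=
    (Metric.closedBall_subset_closedBall hϱ₁).trans hcϱ
  -- The path from b to x may be long; the energy of β is small relative to the power p of its
  -- Lipschitz constant Λ' + 1. This is possible because points have zero capacity.
  obtain ⟨ϱ₂, hϱ₂0, hϱ₂, β, hβ, Gβ, hGβ, gGβ, iGβ⟩ := 𝒢.exists_cutoff_of_small_capacity hB hp hcrit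
    hϱ₁0 hcϱ₁ (κ := κ₃) (by exact_mod_cast hκ₃)
  obtain ⟨ρ₀, hρ₀, hρapp⟩ := happ a ha0
  obtain ⟨ρ, hρ0, hρle, hρE⟩ := exists_small_rpow (α := m) (τ := s * p)
    (E := κ₁ / (C' * (2 * d) ^ p)) (by positivity)
    (lt_min one_pos (lt_min (half_pos hϱ₂0) hρ₀)) (by
      rcases hcrit with h | ⟨h, -⟩
      · exact Or.inl h
      -- In the critical case shrinking ρ does not help; the smallness of d does, and this is why
      -- the estimate is then claimed only for close points.
      · refine Or.inr ⟨h, ?_⟩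
        have hdC : d ≤ 1 / Cb := by
          rcases hxyC with h' | h'
          · exact absurd h (ne_of_lt h')
          · rw [← hd] at h'
            have hCb0 : Cb ≠ 0 := (one_pos.trans_le hCb1).ne'
            rw [← ENNReal.coe_one, ← ENNReal.coe_div hCb0, ENNReal.coe_le_coe] at h'
            exact h'
        exact le_scale hp hκR hC'0 (by exact_mod_cast hCb1) hdR (by exact_mod_cast hdC) hCb3
          (by positivity))
  lift ρ to ℝ≥0 using hρ0.le
  -- The contraction driven by η: near the centre, v equals b wherever u₀ is close to b.
  let v : M → N := fun z => T (chartLift e η z) (u₀ z)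
  have hTc : Continuous fun z : ℝ × N => T z.1 z.2 := by
    refine LipschitzWith.continuous (K := Lt * 2) fun z z' => (TL _ _ _ _).trans ?_
    rw [ENNReal.coe_mul, mul_assoc]
    refine mul_le_mul_right ?_ _
    rw [ENNReal.coe_ofNat, two_mul]
    exact add_le_add (le_max_right _ _) (le_max_left _ _)
  have hv : Measurable v := hTc.measurable.comp
    ((measurable_chartLift hη.continuous).prodMk hu₀)
  have htar : ∀ y ∈ Metric.closedBall c ϱ, y ∈ e.target := fun y hy =>
    hB.subset_target (hB.image_subset_of_subset hcϱ hy)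
  let Gv : M × M → ℝ≥0∞ := fun z => Lt * (G₀ z + Gη z)
  have hGv : Measurable Gv := by fun_prop
  have hGvp : ∀ μ' : Measure (M × M), ∫⁻ z, Gv z ^ p ∂μ' ≤
      (2 ^ p * (Lt : ℝ≥0∞) ^ p) * (∫⁻ z, G₀ z ^ p ∂μ' + ∫⁻ z, Gη z ^ p ∂μ') := by
    intro μ'
    rw [← lintegral_add_left (by fun_prop), ← lintegral_const_mul _ (by fun_prop)]
    refine lintegral_mono fun z => ?_
    simp only [Gv, ENNReal.mul_rpow_of_nonneg _ _ hp0.le]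
    rw [mul_comm (2 ^ p), mul_assoc]
    exact mul_le_mul_right (ENNReal.rpow_add_le_two_rpow_mul hp _ _) _
  have iGη' : ∫⁻ z, Gη z ^ p ∂𝒢.ν ≠ ⊤ := (iGη.trans_lt ENNReal.coe_lt_top).ne
  have iGβ' : ∫⁻ z, Gβ z ^ p ∂𝒢.ν ≠ ⊤ := (iGβ.trans_lt ENNReal.coe_lt_top).ne
  have hk : ∀ X : ℝ≥0∞, X ≤ (((Λ' + 1 + L) * a⁻¹ : ℝ≥0) : ℝ≥0∞) ^ p +
      (2 * (2 ^ p * (Lt : ℝ≥0∞) ^ p) + 1) → X * κ₂ ≤ κ₁ := fun X hX =>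
    (mul_comm _ _).trans_le ((mul_le_mul_right hX _).trans hκ₂'.le)
  refine ⟨ϱ, hϱ0, hϱϱ'.trans hϱ', IsBubble.of_pair hm hB 𝒢 hs hp hq hrq hf hCl hCc hu₀ hv hG₀ hGv hGβ
    gG₀ ?_ iG₀ ?_ hcϱ hϱ₁ hϱ₂ ?_ (Av := Lt) ?_ hβ gGβ ha0 (b := b) ?_ (ρ := ρ) ?_ ?_ ?_ ?_
    hγ hσ hγ0 hγ1 hσ0 hσ1 hd0 hL hCb1 ?_ hκ₁ hCb2 hρE ?_ ?_ iGβ' ?_ hκ₁' ?_ ?_ ?_⟩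
  · exact 𝒢.mono (fun z z' => TL _ _ _ _) (𝒢.const_mul _ (𝒢.add gG₀ gGη))
  · exact ((hGvp _).trans_lt (by finiteness)).ne
  · intro z hz
    simp only [v]
    rw [chartLift_eq_zero hη.eq_zero hz, T0]
  · intro z
    have h1 := TL (chartLift e η z) 0 (u₀ z) (u₀ z)
    rw [T0, edist_self, zero_add] at h1
    refine h1.trans ?_
    have := chartLift_mem_Icc (e := e) hη.mem_Icc z
    refine (mul_le_mul_right (show edist (chartLift e η z) 0 ≤ 1 from ?_) _).trans (by rw [mul_one])
    rw [edist_dist, Real.dist_eq, sub_zero, ← ENNReal.ofReal_one]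
    exact ENNReal.ofReal_le_ofReal (abs_le.2 ⟨by linarith [this.1], this.2⟩)
  · intro z hz hzb
    have hzK : z ∈ e.symm '' Metric.closedBall c ϱ₁ := by
      by_contra h
      exact hz (chartLift_eq_zero hβ.eq_zero h)
    obtain ⟨y', hy', rfl⟩ := hzK
    simp only [v]
    rw [chartLift_symm (htar y' (Metric.closedBall_subset_closedBall hϱ₁ hy')),
      hη.eq_of_mem y' hy']
    refine T1 _ (hzb.le.trans (le_of_eq ?_))
    rw [ha, mul_div_cancel₀ _ (by norm_num : (4 : ℝ≥0) ≠ 0), ENNReal.ofReal_coe_nnreal]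
  · exact hρ0
  · exact_mod_cast hρle.trans (min_le_left _ _)
  · have := hρle.trans ((min_le_right _ _).trans (min_le_left _ _))
    linarith
  · exact hρapp ρ hρ0 (hρle.trans ((min_le_right _ _).trans (min_le_right _ _)))
  · rw [hd]
    exact hxy.le
  · calc _ ≤ (2 ^ p * (Lt : ℝ≥0∞) ^ p) * (κ₂ + κ₂) := by
          refine (hGvp _).trans ?_
          gcongr
          exact (lintegral_mono' Measure.restrict_le_self le_rfl).trans iGη
      _ = (2 * (2 ^ p * (Lt : ℝ≥0∞) ^ p)) * κ₂ := by ring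
      _ ≤ κ₁ := hk _ (le_self_add.trans le_add_self)
  · refine (mul_le_mul_right iGβ _).trans ?_
    rw [mul_comm]
    exact hκ₃'.le
  · exact (mul_le_mul_right hI _).trans (hk _ le_self_add)
  · refine le_trans ?_ hκ₁le
    have := hk 1 (le_add_self.trans le_add_self)
    rw [one_mul] at this
    exact hI.trans this
  · refine (mul_le_mul_right hμ' _).trans (le_trans ?_ hκ₀'.le)
    rw [mul_comm]
    exact mul_le_mul_right le_self_add _
  · refine (mul_le_mul_right hμ' _).trans (le_trans ?_ hκ₀'.le)
    rw [mul_comm]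
    exact mul_le_mul_right le_add_self _

end ExistsBubble

/-! ### Bubbles on a constant map -/

section ExistsBubbleConst

variable {m : ℕ} {M : Type*} [EMetricSpace M] [ChartedSpace (ℰ m) M]
  [RiemannianBundle (fun x : M => TangentSpace (𝓡 m) x)] [MeasurableSpace M] [BorelSpace M]
  {e : OpenPartialHomeomorph M (ℰ m)} {y₀ : ℰ m} {R s p : ℝ} {Λ : ℝ≥0}

lemma GradientCalculus.isGrad_zero (𝒢 : GradientCalculus (M := M) e y₀ R s p) (hR : 0 < R) :
    𝒢.IsGrad (fun _ _ => 0) (fun _ => 0) := by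
  obtain ⟨C, hC⟩ := 𝒢.cutoff
  obtain ⟨G, -, h, -⟩ := hC y₀ (R / 2) 1 (fun _ => 0) one_pos le_rfl (half_pos hR)
    (Metric.closedBall_subset_ball (by linarith)) (LipschitzWith.const 0 |>.weaken zero_le)
    (fun _ => ⟨le_rfl, zero_le_one⟩) (fun _ _ => rfl)
  simpa using 𝒢.const_mul 0 h

variable {N : Type*} [EMetricSpace N] [MeasurableSpace N] [BorelSpace N] [ConnectedSpace N]
  {F : Type*} [EMetricSpace F] [MeasurableSpace F]

open GradientCalculus in
/-- Bubbles on a constant map, from pairs of points close to its value. -/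
theorem exists_isBubble_const {n : ℕ} [ChartedSpace (ℰ n) N]
    [RiemannianBundle (fun x : N => TangentSpace (𝓡 n) x)] [IsRiemannianManifold (𝓡 n) N]
    (hm : 1 ≤ m) (hB : ChartBall e y₀ R Λ)
    (𝒢 : GradientCalculus (M := M) e y₀ R s p) (hs : 0 < s) (hp : 1 ≤ p) {r q : ℝ} (hq : 1 ≤ q)
    (hrq : r * q = s * p) {f : N → F}
    (hf : Measurable f) {Cl : ℝ≥0} (hCl : OscillationBound e y₀ R r q F Cl) {b : N}
    (hbad : ∀ C τ : ℝ≥0, 0 < τ → ∃ x y, edist x y ≤ 1 / (C : ℝ≥0∞) ∧ edist b x < τ ∧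
      C * edist x y ^ (p / q) < edist (f x) (f y)) {c : ℰ m} {ϱ₀ : ℝ} (hϱ₀ : 0 < ϱ₀)
    (hc : Metric.closedBall c ϱ₀ ⊆ Metric.ball y₀ R) {κ : ℝ≥0∞} (hκ : 0 < κ) :
    ∃ ϱ, 0 < ϱ ∧ ϱ ≤ ϱ₀ ∧ ∃ w G, IsBubble 𝒢 r q f (fun _ => b) (fun _ => 0) c ϱ κ w G := by
  have hp0 : 0 < p := one_pos.trans_le hp
  have hq0 : 0 < q := one_pos.trans_le hq
  obtain ⟨Cc, hCc⟩ : ∃ Cc, 𝒢.CutoffBound Cc := 𝒢.cutoff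
  have h8 : (8 : ℝ≥0∞) ^ p * 4 ≠ ⊤ := by finiteness
  obtain ⟨κ₁, hκ₁, hκ₁κ⟩ := ENNReal.exists_nnreal_pos_mul_lt h8 hκ.ne'
  have hκ₁' : 8 ^ p * (4 * (κ₁ : ℝ≥0∞)) ≤ κ := by
    refine le_trans (le_of_eq ?_) hκ₁κ.le
    ring
  have hκR : (0 : ℝ) < κ₁ := hκ₁
  -- the radii
  obtain ⟨κ₀, hκ₀, hκ₀'⟩ := ENNReal.exists_nnreal_pos_mul_lt
    (a := (3 : ℝ≥0∞) + (3 : ℝ≥0∞) ^ p) (by finiteness) hκ.ne'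
  obtain ⟨ϱ', hϱ'0, hϱ', hμ'⟩ := hB.exists_measure_image_le hm hϱ₀ hc
    (κ := κ₀) (by exact_mod_cast hκ₀)
  obtain ⟨ρ, hρdef⟩ : ∃ ρ : ℝ≥0, (ρ : ℝ) = min 1 (ϱ' / 4) :=
    ⟨⟨min 1 (ϱ' / 4), by positivity⟩, rfl⟩
  have hρ0 : 0 < ρ := by
    rw [← NNReal.coe_pos, hρdef]
    positivity
  have hρ1 : ρ ≤ 1 := by
    rw [← NNReal.coe_le_coe, hρdef]
    exact min_le_left _ _
  have hρR := NNReal.coe_pos.2 hρ0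
  set ϱ : ℝ := 4 * ρ with hϱ
  have hϱle : ϱ ≤ ϱ' := by
    have := min_le_right 1 (ϱ' / 4)
    rw [hϱ, hρdef]
    linarith
  have hcϱ : Metric.closedBall c ϱ ⊆ Metric.ball y₀ R :=
    (Metric.closedBall_subset_closedBall (hϱle.trans hϱ')).trans hc
  have hμ : (μHE[m] : Measure M) (e.symm '' Metric.closedBall c ϱ) ≤ κ₀ :=
    (measure_mono (Set.image_mono (Metric.closedBall_subset_closedBall hϱle))).trans hμ'
  have h2ρ : (0 : ℝ≥0) < 2 * ρ := by positivity
  have hβ := isCutoff_tent c h2ρ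
  have hϱ2 : 2 * ((2 * ρ : ℝ≥0) : ℝ) = ϱ := by push_cast; ring
  have hϱ1 : ((2 * ρ : ℝ≥0) : ℝ) ≤ ϱ := by push_cast; linarith
  rw [hϱ2] at hβ
  -- An ordinary cutoff, of finite but possibly large energy. The minimum with 1 meets the
  -- requirement l ≤ 1 of the scaling law.
  obtain ⟨Gβ, hGβ, gGβ, -, iGβ⟩ := hCc c ϱ (min (2 * ρ) 1) (fun y => tent (2 * ρ : ℝ≥0) (dist y c))
    (lt_min h2ρ one_pos) (min_le_right _ _) (by positivity) hcϱ
    ((lipschitzWith_tent_dist (2 * ρ) c).weaken (by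
      exact inv_anti₀ (lt_min h2ρ one_pos) (min_le_left _ _))) hβ.mem_Icc hβ.eq_zero
  have iGβ' : ∫⁻ z, Gβ z ^ p ∂𝒢.ν ≠ ⊤ := (iGβ.trans_lt (by finiteness)).ne
  -- The smallness comes from the length τ of the path from b to x instead of the capacity.
  obtain ⟨τ, hτ, hτ'⟩ : ∃ τ : ℝ≥0, 0 < τ ∧ τ ≤ 1 ∧ (τ : ℝ≥0∞) ^ p * ∫⁻ z, Gβ z ^ p ∂𝒢.ν ≤ κ₁ := by
    obtain ⟨t, ht, ht'⟩ := ENNReal.exists_nnreal_pos_mul_lt iGβ'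
      (b := κ₁) (by rw [ENNReal.coe_ne_zero]; exact hκ₁.ne')
    refine ⟨min 1 t, lt_min one_pos ht, min_le_left _ _, le_trans ?_ ht'.le⟩
    rw [mul_comm (t : ℝ≥0∞), mul_comm]
    refine mul_le_mul_right ?_ _
    have h1 : ((min 1 t : ℝ≥0) : ℝ≥0∞) ≤ 1 := by exact_mod_cast min_le_left _ _
    calc ((min 1 t : ℝ≥0) : ℝ≥0∞) ^ p ≤ ((min 1 t : ℝ≥0) : ℝ≥0∞) ^ (1 : ℝ) :=
          ENNReal.rpow_le_rpow_of_exponent_ge h1 hp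
      _ ≤ t := by
          rw [ENNReal.rpow_one]
          exact_mod_cast min_le_right _ _
  -- the pair of points
  set C' : ℝ := Cc * 2 ^ m * 5 ^ (s * p) + 1 with hC'
  have hC'0 : 0 < C' := by positivity
  let X : ℝ := (ρ : ℝ) ^ ((m : ℝ) - s * p) * 2 ^ (s * p)
  -- Now ρ is fixed before the pair, so a large Cb, hence a small d, must make the equation for ε
  -- solvable. The summand 2 gives 2d ≤ 1 and bounds the displacement.
  let Cb : ℝ≥0 := 2 + (Real.toNNReal ((Cl : ℝ) * C' * 2 ^ p / κ₁) +
    Real.toNNReal (X * C' * 2 ^ p / κ₁))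
  have hCb2' : 2 ≤ Cb := le_self_add
  have hCb1 : 1 ≤ Cb := le_trans (by norm_num) hCb2'
  have hCb2 : (Cl : ℝ) * C' * 2 ^ p / κ₁ ≤ Cb := by
    refine (Real.le_coe_toNNReal _).trans ?_
    rw [NNReal.coe_le_coe]
    exact le_self_add.trans le_add_self
  have hCb3 : X * C' * 2 ^ p / κ₁ ≤ Cb := by
    refine (Real.le_coe_toNNReal _).trans ?_
    rw [NNReal.coe_le_coe]
    exact le_add_self.trans le_add_self
  obtain ⟨x, y, hxyC, hbx, hxy⟩ := hbad Cb τ hτ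
  have hne : x ≠ y := by
    rintro rfl
    simp at hxy
  obtain ⟨d, hd⟩ : ∃ d : ℝ≥0, (d : ℝ≥0∞) = edist x y :=
    ⟨_, ENNReal.coe_toNNReal (edist_ne_top_of_connectedSpace x y)⟩
  have hd0 : 0 < d := by
    rw [pos_iff_ne_zero, ← ENNReal.coe_ne_zero, hd]
    exact (edist_pos.2 hne).ne'
  have hdR : (0 : ℝ) < d := hd0
  have hdC : d ≤ 1 / Cb := by
    have hCb0 : Cb ≠ 0 := (one_pos.trans_le hCb1).ne'
    rwa [← hd, ← ENNReal.coe_one, ← ENNReal.coe_div hCb0, ENNReal.coe_le_coe] at hxyC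
  have hd2 : 2 * d ≤ 1 := by
    calc 2 * d ≤ Cb * (1 / Cb) := by gcongr
      _ = 1 := mul_one_div_cancel (one_pos.trans_le hCb1).ne'
  set L : ℝ≥0 := 2 * d with hL
  obtain ⟨σ, hσ, hσ0, hσ1⟩ := exists_lipschitzWith_path (n := n) (x := x) (y := y) (L := L) (by
    rw [← hd, ENNReal.coe_lt_coe, hL, two_mul]
    exact lt_add_of_pos_left d hd0)
  obtain ⟨γ, hγ, hγ0, hγ1⟩ := exists_lipschitzWith_path (n := n) hbx
  have gz : 𝒢.IsGrad (fun _ _ => edist b b) (fun _ => 0) := by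
    simpa using 𝒢.isGrad_zero hB.pos
  have h3 : ((τ + L + 0 : ℝ≥0) : ℝ≥0∞) ≤ 3 := by
    have : τ + L + 0 ≤ 3 := (add_le_add (add_le_add hτ'.1 hd2) zero_le_one).trans
      (by norm_num)
    exact_mod_cast this
  have zp : ∀ μ' : Measure (M × M), ∫⁻ z, (fun _ : M × M => (0 : ℝ≥0∞)) z ^ p ∂μ' = 0 := by
    intro μ'
    simp [ENNReal.zero_rpow_of_pos hp0]
  refine ⟨ϱ, by positivity, hϱle.trans hϱ', IsBubble.of_pair hm hB 𝒢 hs hp hq hrq hf hCl hCc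
    measurable_const measurable_const (Gv := fun _ => 0) measurable_const measurable_const hGβ gz gz
    ?_ ?_ hcϱ le_rfl hϱ1 (fun _ _ => rfl) (Av := 0) ?_ hβ gGβ one_pos (fun _ _ _ => rfl)
    hρ0 hρ1 ?_ ?_ hγ hσ hγ0 hγ1 hσ0 hσ1 hd0 hL hCb1 ?_ hκ₁ hCb2 ?_ ?_ hτ'.2 iGβ' ?_ hκ₁' ?_ ?_ ?_⟩
  · rw [zp]; simp
  · rw [zp]; simp
  · simp
  · push_cast; exact le_rfl
  · simp
  · rw [hd]; exact hxy.le
  · exact le_scale hp hκR hC'0 (by exact_mod_cast hCb1) hdR (by exact_mod_cast hdC) hCb3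
      (by positivity)
  · rw [zp]; exact zero_le
  · rw [zp, mul_zero]; exact zero_le
  · rw [zp]; exact zero_le
  · refine (mul_le_mul' h3 hμ).trans (le_trans ?_ hκ₀'.le)
    rw [mul_comm]
    exact mul_le_mul_right le_self_add _
  · refine (mul_le_mul' (ENNReal.rpow_le_rpow h3 hp0.le) hμ).trans (le_trans ?_ hκ₀'.le)
    rw [mul_comm]
    exact mul_le_mul_right le_add_self _

end ExistsBubbleConst

/-! ### Gluing maps or covector fields over disjoint sets -/

section Glue

/-- The section equal to `w k` on `K k` for `k ≥ j`, and to `u` outside of these sets. -/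
def glue {M : Type*} {β : M → Type*} (K : ℕ → Set M) (w : ℕ → ∀ x, β x) (u : ∀ x, β x) (j : ℕ)
    (x : M) : β x :=
  open Classical in if h : ∃ i, x ∈ K (i + j) then w (h.choose + j) x else u x

variable {M : Type*} {β : M → Type*} {K : ℕ → Set M} {w : ℕ → ∀ x, β x} {u : ∀ x, β x} {j : ℕ}

lemma glue_of_mem (hK : Pairwise (Function.onFun Disjoint K)) {i : ℕ} {x : M}
    (hx : x ∈ K (i + j)) : glue K w u j x = w (i + j) x := by
  have h : ∃ i, x ∈ K (i + j) := ⟨i, hx⟩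
  rw [glue, dif_pos h]
  have : h.choose + j = i + j := by
    by_contra hne
    exact Set.disjoint_left.1 (hK hne) h.choose_spec hx
  rw [this]

lemma glue_of_notMem {x : M} (hx : x ∉ ⋃ i, K (i + j)) : glue K w u j x = u x := by
  rw [glue, dif_neg]
  simpa using hx

lemma measurable_glue {N : Type*} [MeasurableSpace M] [MeasurableSpace N]
    (hK : Pairwise (Function.onFun Disjoint K)) (hKm : ∀ k, MeasurableSet (K k)) {w : ℕ → M → N}
    {u : M → N} (hw : ∀ k, Measurable (w k)) (hu : Measurable u) : Measurable (glue K w u j) := by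
  intro T hT
  have : glue K w u j ⁻¹' T = (⋃ i, K (i + j) ∩ w (i + j) ⁻¹' T) ∪
      ((⋃ i, K (i + j))ᶜ ∩ u ⁻¹' T) := by
    ext x
    by_cases hx : x ∈ ⋃ i, K (i + j)
    · obtain ⟨i, hi⟩ := Set.mem_iUnion.1 hx
      simp only [Set.mem_preimage, glue_of_mem hK hi, Set.mem_union, Set.mem_iUnion, Set.mem_inter_iff,
        Set.mem_compl_iff, hx, not_true_eq_false, false_and, or_false]
      refine ⟨fun h => ⟨i, hi, h⟩, fun ⟨i', hi', h⟩ => ?_⟩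
      have h1 := glue_of_mem (w := w) (u := u) hK hi
      rw [glue_of_mem hK hi'] at h1
      rwa [← h1]
    · have hx' := hx
      simp only [Set.mem_iUnion, not_exists] at hx'
      simp [glue_of_notMem hx, hx']
  rw [this]
  exact (MeasurableSet.iUnion fun i => (hKm _).inter (hw _ hT)).union
    ((MeasurableSet.iUnion fun i => hKm _).compl.inter (hu hT))

end Glue

/-! ### Families of bubbles and the contradiction -/

section Gluing

/-- The remainders of the series `∑ 2⁻ᵏ`. -/
def geomTail (j : ℕ) : ℝ≥0∞ := ∑' i, 2⁻¹ ^ (i + j)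

lemma geomTail_zero : geomTail 0 = 2 := by
  simp [geomTail, ENNReal.tsum_geometric, ENNReal.one_sub_inv_two]

lemma tendsto_geomTail : Tendsto geomTail atTop (𝓝 0) := by
  refine ENNReal.tendsto_sum_nat_add (fun i => 2⁻¹ ^ i) ?_
  have := geomTail_zero
  simp only [geomTail, add_zero] at this
  rw [this]
  norm_num

lemma geomTail_ne_top (j : ℕ) : geomTail j ≠ ⊤ := by
  refine ne_top_of_le_ne_top (b := geomTail 0) (by rw [geomTail_zero]; norm_num) ?_
  refine ENNReal.tsum_le_tsum fun i => ?_
  rw [add_zero]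
  exact pow_le_pow_of_le_one zero_le (by norm_num) (by omega)

lemma setLIntegral_iUnion_le_geomTail {α : Type*} [MeasurableSpace α] {μ : Measure α}
    {S : ℕ → Set α} {g : α → ℝ≥0∞} (h : ∀ k, ∫⁻ x in S k, g x ∂μ ≤ 2⁻¹ ^ k) (j : ℕ) :
    ∫⁻ x in ⋃ i, S (i + j), g x ∂μ ≤ geomTail j :=
  (lintegral_iUnion_le _ _).trans (ENNReal.tsum_le_tsum fun i => h (i + j))

lemma tendsto_of_le_add_of_le_add {E : ℕ → ℝ≥0∞} {E₀ : ℝ≥0∞} (hE₀ : E₀ ≠ ⊤) {a : ℕ → ℝ≥0∞}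
    (ha : Tendsto a atTop (𝓝 0)) (h1 : ∀ j, E j ≤ E₀ + a j) (h2 : ∀ j, E₀ ≤ E j + a j) :
    Tendsto E atTop (𝓝 E₀) := by
  have e1 : Tendsto (fun j => E₀ + a j) atTop (𝓝 E₀) := by
    simpa using tendsto_const_nhds.add ha
  have e2 : Tendsto (fun j => E₀ - a j) atTop (𝓝 E₀) := by
    simpa using ENNReal.Tendsto.sub tendsto_const_nhds ha (Or.inl hE₀)
  exact tendsto_of_tendsto_of_tendsto_of_le_of_le e2 e1 (fun j => tsub_le_iff_right.2 (h2 j)) h1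

variable {m : ℕ} {M : Type*} [EMetricSpace M] [ChartedSpace (ℰ m) M]
  [RiemannianBundle (fun x : M => TangentSpace (𝓡 m) x)] [MeasurableSpace M] [BorelSpace M]
  {e : OpenPartialHomeomorph M (ℰ m)} {y₀ : ℰ m} {R s p : ℝ} {Λ : ℝ≥0}
  {N : Type*} [EMetricSpace N] [MeasurableSpace N]
  {F : Type*} [EMetricSpace F]

/-- A sequence of bubbles in disjoint balls, of summable energies. -/
structure IsBubbleFamily (𝒢 : GradientCalculus (M := M) e y₀ R s p) (r q : ℝ) (f : N → F)
    (u₀ : M → N) (G₀ : M × M → ℝ≥0∞) (c : ℕ → ℰ m) (ϱ : ℕ → ℝ) (w : ℕ → M → N)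
    (G : ℕ → M × M → ℝ≥0∞) : Prop where
  isBubble : ∀ k, IsBubble 𝒢 r q f u₀ G₀ (c k) (ϱ k) (2⁻¹ ^ k) (w k) (G k)
  subset : ∀ k, Metric.closedBall (c k) (ϱ k) ⊆ Metric.closedBall y₀ (R / 2)
  disjoint : Pairwise (Function.onFun Disjoint fun k => Metric.closedBall (c k) (ϱ k))

/-- The supports of the bubbles of a family. -/
def bubbleSupport (e : OpenPartialHomeomorph M (ℰ m)) (c : ℕ → ℰ m) (ϱ : ℕ → ℝ) (k : ℕ) : Set M :=
  e.symm '' Metric.closedBall (c k) (ϱ k)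

namespace IsBubbleFamily

variable {𝒢 : GradientCalculus (M := M) e y₀ R s p} {r q : ℝ} {f : N → F}
    {u₀ : M → N} {G₀ : M × M → ℝ≥0∞} {c : ℕ → ℰ m} {ϱ : ℕ → ℝ} {w : ℕ → M → N}
    {G : ℕ → M × M → ℝ≥0∞}

lemma subset_ball (H : IsBubbleFamily 𝒢 r q f u₀ G₀ c ϱ w G) (hR : 0 < R) (k : ℕ) :
    Metric.closedBall (c k) (ϱ k) ⊆ Metric.ball y₀ R :=
  (H.subset k).trans (Metric.closedBall_subset_ball (by linarith))

lemma disjoint_support (H : IsBubbleFamily 𝒢 r q f u₀ G₀ c ϱ w G) (hB : ChartBall e y₀ R Λ) :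
    Pairwise (Function.onFun Disjoint (bubbleSupport e c ϱ)) := by
  intro k k' hk
  have ht : ∀ k, Metric.closedBall (c k) (ϱ k) ⊆ e.symm.source := fun k =>
    (hB.image_subset_of_subset (H.subset_ball hB.pos k)).trans hB.subset_target
  refine Set.disjoint_left.2 ?_
  rintro _ ⟨y, hy, rfl⟩ ⟨y', hy', hyy⟩
  have := e.symm.injOn (ht _ hy') (ht _ hy) hyy
  subst this
  exact Set.disjoint_left.1 (H.disjoint hk) hy hy'

lemma measurableSet_support (H : IsBubbleFamily 𝒢 r q f u₀ G₀ c ϱ w G) (hB : ChartBall e y₀ R Λ)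
    (k : ℕ) : MeasurableSet (bubbleSupport e c ϱ k) :=
  hB.measurableSet_image (H.subset_ball hB.pos k)

lemma glue_eq (H : IsBubbleFamily 𝒢 r q f u₀ G₀ c ϱ w G) (hB : ChartBall e y₀ R Λ) {i j : ℕ}
    {x : M} (hx : x ∈ bubbleSupport e c ϱ (i + j)) :
    glue (bubbleSupport e c ϱ) w u₀ j x = w (i + j) x :=
  glue_of_mem (H.disjoint_support hB) hx

lemma measurable_glue (H : IsBubbleFamily 𝒢 r q f u₀ G₀ c ϱ w G) (hB : ChartBall e y₀ R Λ)
    (hu₀ : Measurable u₀) (j : ℕ) : Measurable (glue (bubbleSupport e c ϱ) w u₀ j) :=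
  _root_.measurable_glue (H.disjoint_support hB) (H.measurableSet_support hB)
    (fun k => (H.isBubble k).measurable) hu₀

lemma tendsto_lintegral_edist (H : IsBubbleFamily 𝒢 r q f u₀ G₀ c ϱ w G)
    (hB : ChartBall e y₀ R Λ) (hp : 0 < p) :
    Tendsto (fun j => ∫⁻ x, edist (glue (bubbleSupport e c ϱ) w u₀ j x) (u₀ x) ^ p
      ∂(μHE[m] : Measure M)) atTop (𝓝 0) := by
  refine tendsto_of_tendsto_of_tendsto_of_le_of_le tendsto_const_nhds tendsto_geomTail
    (fun _ => zero_le) fun j => ?_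
  have h1 : ∀ k, ∫⁻ x in bubbleSupport e c ϱ k,
      edist (glue (bubbleSupport e c ϱ) w u₀ j x) (u₀ x) ^ p ∂(μHE[m] : Measure M) ≤ 2⁻¹ ^ k := by
    intro k
    refine le_trans (setLIntegral_mono' (H.measurableSet_support hB k) fun x hx => ?_)
      (H.isBubble k).edist_rpow_le
    by_cases hk : j ≤ k
    · obtain ⟨i, rfl⟩ := Nat.exists_eq_add_of_le' hk
      rw [H.glue_eq hB hx]
    · rw [glue_of_notMem, edist_self, ENNReal.zero_rpow_of_pos hp]
      · exact zero_le
      · intro hx'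
        obtain ⟨i, hi⟩ := Set.mem_iUnion.1 hx'
        exact Set.disjoint_left.1 (H.disjoint_support hB (by omega : i + j ≠ k)) hi hx
  refine le_trans (le_of_eq ?_) (setLIntegral_iUnion_le_geomTail h1 j)
  refine (setLIntegral_eq_of_support_subset ?_).symm
  intro x hx
  by_contra hx'
  exact hx (by simp only [glue_of_notMem hx', edist_self, ENNReal.zero_rpow_of_pos hp])

lemma lintegral_eq_top (H : IsBubbleFamily 𝒢 r q f u₀ G₀ c ϱ w G) (hB : ChartBall e y₀ R Λ) (j : ℕ)
    {g : M → ℝ≥0∞} (hg : ∀ i, 1 ≤ ∫⁻ x in bubbleSupport e c ϱ (i + j), g x ∂μHE[m]) :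
    ∫⁻ x, g x ∂(μHE[m] : Measure M) = ⊤ := by
  refine top_le_iff.1 ?_
  calc (⊤ : ℝ≥0∞) = ∑' _ : ℕ, 1 := (ENNReal.tsum_const_eq_top_of_ne_zero one_ne_zero).symm
    _ ≤ ∑' i, ∫⁻ x in bubbleSupport e c ϱ (i + j), g x ∂μHE[m] := ENNReal.tsum_le_tsum hg
    _ = ∫⁻ x in ⋃ i, bubbleSupport e c ϱ (i + j), g x ∂μHE[m] :=
        (lintegral_iUnion (fun i => H.measurableSet_support hB (i + j))
          (fun i i' h => H.disjoint_support hB (by simpa using h)) _).symm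
    _ ≤ _ := setLIntegral_le_lintegral _ _

/-- On each support of index at least j the glued map is a bubble, whose composed energy is at least
1. In the fractional case it suffices to keep the pairs of points of the same support. -/
lemma sobolevEnergy_eq_top (H : IsBubbleFamily 𝒢 r q f u₀ G₀ c ϱ w G) (hB : ChartBall e y₀ R Λ)
    (j : ℕ) :
    sobolevEnergy m r q (fun x => f (glue (bubbleSupport e c ϱ) w u₀ j x)) = ⊤ := by
  have key := fun i => (H.isBubble (i + j)).hasLargeEnergyOn
    (fun x => f (glue (bubbleSupport e c ϱ) w u₀ j x)) (fun x hx => by rw [H.glue_eq hB hx])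
  rw [sobolevEnergy]
  split_ifs with hr
  · simp only [hr, if_true] at key
    rw [dirichletEnergy]
    refine iInf₂_eq_top.2 fun g hg => H.lintegral_eq_top hB j fun i => key i g hg
  · simp only [hr, if_false] at key
    refine H.lintegral_eq_top hB j fun i => (key i).trans ?_
    exact lintegral_mono fun x => setLIntegral_le_lintegral _ _

/-- The contradiction with the openness of `U`, provided that the glued maps converge. -/
theorem false_of_tendsto [BorelSpace N] {n : ℕ} [ChartedSpace (ℰ n) N] [MeasurableSpace F]
    (H : IsBubbleFamily 𝒢 r q f u₀ G₀ c ϱ w G)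
    (hB : ChartBall e y₀ R Λ) (hu₀ : Measurable u₀) {U : Set (M → N)}
    (hU : IsSobolevOpen m n s p U) (huU : u₀ ∈ U)
    (hact : ∀ u ∈ U, MemSobolev m r q (fun x => f (u x)))
    (hfin : ∀ j, sobolevEnergy m s p (glue (bubbleSupport e c ϱ) w u₀ j) ≠ ⊤)
    (hlim : TendstoSobolev m n s p (glue (bubbleSupport e c ϱ) w u₀) u₀) : False := by
  obtain ⟨j, hj⟩ := (hU.eventually_mem u₀ huU _ (fun j =>
    ⟨(H.measurable_glue hB hu₀ j).aemeasurable, (hfin j).lt_top⟩) hlim).exists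
  exact (hact _ hj).energy_lt_top.ne (H.sobolevEnergy_eq_top hB j)

end IsBubbleFamily

end Gluing

/-! ### Convergence of the glued maps in fractional spaces -/

section FractionalGluing

variable {m : ℕ} {M : Type*} [EMetricSpace M] [ChartedSpace (ℰ m) M]
  [RiemannianBundle (fun x : M => TangentSpace (𝓡 m) x)] [MeasurableSpace M] [BorelSpace M]
  [SecondCountableTopology M] [IsManifold (𝓡 m) ∞ M]
  [IsContMDiffRiemannianBundle (𝓡 m) ∞ (ℰ m) (fun x : M => TangentSpace (𝓡 m) x)]
  [IsRiemannianManifold (𝓡 m) M]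
  {e : OpenPartialHomeomorph M (ℰ m)} {y₀ : ℰ m} {R s p : ℝ} {Λ : ℝ≥0}
  {N : Type*} [EMetricSpace N] [MeasurableSpace N] [BorelSpace N] [SecondCountableTopology N]
  {F : Type*} [EMetricSpace F]

lemma gagliardoEnergy_eq_lintegral (hm : 1 ≤ m) (hB : ChartBall e y₀ R Λ) (hs : 0 < s) (hs1 : s < 1)
    (hp : 0 < p) {u : M → N} (hu : Measurable u) :
    gagliardoEnergy m s p u = ∫⁻ z, edist (u z.1) (u z.2) ^ p
      ∂(fractionalGradientCalculus hm hB hs hs1 hp).ν := by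
  have := isLocallyFiniteMeasure_euclideanHausdorffMeasure (m := m) (M := M)
  have h1 : Measurable fun z : M × M => (edist z.1 z.2 ^ ((m : ℝ) + s * p))⁻¹ := by fun_prop
  have h2 : Measurable fun z : M × M => edist (u z.1) (u z.2) ^ p := by fun_prop
  change _ = ∫⁻ z, _ ∂(((μHE[m] : Measure M).prod μHE[m]).withDensity
    fun z => (edist z.1 z.2 ^ ((m : ℝ) + s * p))⁻¹)
  rw [lintegral_withDensity_eq_lintegral_mul _ h1 h2, lintegral_prod _ (h1.mul h2).aemeasurable]
  simp only [gagliardoEnergy, Pi.mul_apply, ENNReal.div_eq_inv_mul]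

/-- Pairs of points outside of the supports of index at least j contribute equally to the energies
of the glued map and of u₀. On the other pairs both energies are bounded by a multiple of the tail
of ∑ 2⁻ᵏ, so that the energies converge. -/
theorem IsBubbleFamily.false_of_fractional {hm : 1 ≤ m} {hB : ChartBall e y₀ R Λ} {hs : 0 < s}
    {hs1 : s < 1} (hp : 1 ≤ p) {hp0 : 0 < p} {r q : ℝ} {f : N → F} {n : ℕ} [ChartedSpace (ℰ n) N]
    [MeasurableSpace F]
    {u₀ : M → N} {G₀ : M × M → ℝ≥0∞} {c : ℕ → ℰ m} {ϱ : ℕ → ℝ} {w : ℕ → M → N}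
    {G : ℕ → M × M → ℝ≥0∞}
    (H : IsBubbleFamily (fractionalGradientCalculus hm hB hs hs1 hp0) r q f u₀ G₀ c ϱ w G)
    (hG₀ : ∀ x y, edist (u₀ x) (u₀ y) ≤ G₀ (x, y))
    (hu₀ : Measurable u₀) {U : Set (M → N)}
    (hU : IsSobolevOpen m n s p U) (huU : u₀ ∈ U)
    (hact : ∀ u ∈ U, MemSobolev m r q (fun x => f (u x))) : False := by
  set 𝒢 := fractionalGradientCalculus hm hB hs hs1 hp0 with h𝒢
  set K := bubbleSupport e c ϱ with hK
  have hKd := H.disjoint_support hB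
  have hEn : ∀ u : M → N, Measurable u → sobolevEnergy m s p u =
      ∫⁻ z, edist (u z.1) (u z.2) ^ p ∂𝒢.ν := by
    intro u hu
    rw [sobolevEnergy, if_neg hs1.ne, gagliardoEnergy_eq_lintegral hm hB hs hs1 hp0 hu]
  have hmj := H.measurable_glue hB hu₀
  let Y : ℕ → Set (M × M) := fun k => ballRegion e (c k) (ϱ k)
  have hYm : ∀ k, MeasurableSet (Y k) := fun k => hB.measurableSet_ballRegion (H.subset_ball hB.pos k)
  let Z : ℕ → Set (M × M) := fun j => ⋃ i, Y (i + j)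
  have hZm : ∀ j, MeasurableSet (Z j) := fun j => MeasurableSet.iUnion fun i => hYm _
  have hZK : ∀ j z, z ∉ Z j → z.1 ∉ ⋃ i, K (i + j) ∧ z.2 ∉ ⋃ i, K (i + j) := by
    intro j z hz
    simp only [Z, Set.mem_iUnion, not_exists] at hz ⊢
    exact ⟨fun i hi => hz i (Or.inl hi), fun i hi => hz i (Or.inr hi)⟩
  have hG : ∀ k x y, edist (w k x) (w k y) ≤ G k (x, y) := fun k => (H.isBubble k).isGrad
  let S : ℕ → M × M → ℝ≥0∞ := fun j z => ∑' i, (Y (i + j)).indicator (fun z => G (i + j) z ^ p) z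
  have hS : ∀ j, ∫⁻ z, S j z ∂𝒢.ν ≤ geomTail j := by
    intro j
    rw [lintegral_tsum fun i => ((((H.isBubble _).measurable_gradient.pow_const p).indicator
      (hYm _)).aemeasurable)]
    refine ENNReal.tsum_le_tsum fun i => ?_
    rw [lintegral_indicator (hYm _)]
    exact (H.isBubble _).energy_le
  have hSmem : ∀ j i z, z ∈ Y (i + j) → edist (w (i + j) z.1) (w (i + j) z.2) ^ p ≤ S j z := by
    intro j i z hz
    refine le_trans ?_ (ENNReal.le_tsum i)
    rw [Set.indicator_of_mem hz]
    exact ENNReal.rpow_le_rpow (hG _ _ _) hp0.le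
  have hDZ : ∀ j z, edist (glue K w u₀ j z.1) (glue K w u₀ j z.2) ^ p ≤
      8 ^ p * (S j z + (edist (u₀ z.1) (u₀ z.2) ^ p + (S j z + 0))) := by
    rintro j ⟨x, y⟩
    have h8 : (1 : ℝ≥0∞) ≤ 8 ^ p := ENNReal.one_le_rpow (by norm_num) hp0
    have hle : ∀ t T : ℝ≥0∞, t ≤ T → t ≤ 8 ^ p * T := fun t T h =>
      h.trans (le_mul_of_one_le_left zero_le h8)
    have hoff : ∀ k x, x ∉ K k → w k x = u₀ x := fun k => (H.isBubble k).eq_of_notMem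
    simp only
    by_cases hx : x ∈ ⋃ i, K (i + j)
    · obtain ⟨i, hi⟩ := Set.mem_iUnion.1 hx
      rw [H.glue_eq hB hi]
      by_cases hy : y ∈ K (i + j)
      · rw [H.glue_eq hB hy]
        exact hle _ _ ((hSmem j i (x, y) (Or.inl hi)).trans le_self_add)
      by_cases hy' : y ∈ ⋃ i, K (i + j)
      · obtain ⟨i', hi'⟩ := Set.mem_iUnion.1 hy'
        rw [H.glue_eq hB hi']
        have hx' : x ∉ K (i' + j) := by
          intro hx'
          by_cases hii : i' + j = i + j
          · rw [hii] at hi'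
            exact hy hi'
          · exact Set.disjoint_left.1 (hKd hii) hx' hi
        -- For points in two different supports each bubble equals u₀ at the other point, and the
        -- triangle inequality passes through u₀ y and u₀ x. No energy of interaction between
        -- bubbles arises.
        calc _ ≤ (edist (w (i + j) x) (w (i + j) y) + (edist (u₀ x) (u₀ y) +
              (edist (w (i' + j) x) (w (i' + j) y) + 0))) ^ p := by
              refine ENNReal.rpow_le_rpow ?_ hp0.le
              rw [hoff _ y hy, hoff _ x hx', add_zero, edist_comm (u₀ x) (u₀ y)]
              exact (edist_triangle _ (u₀ y) _).trans (add_le_add le_rfl (edist_triangle _ (u₀ x) _))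
          _ ≤ _ := ENNReal.rpow_add_add_add_le hp _ _ _ _
          _ ≤ _ := by
              gcongr
              · exact hSmem j i (x, y) (Or.inl hi)
              · exact hSmem j i' (x, y) (Or.inr hi')
              · rw [ENNReal.zero_rpow_of_pos hp0]
      · rw [glue_of_notMem hy', ← hoff _ y hy]
        exact hle _ _ ((hSmem j i (x, y) (Or.inl hi)).trans le_self_add)
    · rw [glue_of_notMem hx]
      by_cases hy' : y ∈ ⋃ i, K (i + j)
      · obtain ⟨i, hi⟩ := Set.mem_iUnion.1 hy'
        have hx' : x ∉ K (i + j) := fun h => hx (Set.mem_iUnion.2 ⟨i, h⟩)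
        rw [H.glue_eq hB hi, ← hoff _ x hx']
        exact hle _ _ ((hSmem j i (x, y) (Or.inr hi)).trans le_self_add)
      · rw [glue_of_notMem hy']
        exact hle _ _ (le_self_add.trans le_add_self)
  have hD0m : Measurable fun z : M × M => edist (u₀ z.1) (u₀ z.2) ^ p := by fun_prop
  have hSm : ∀ j, Measurable (S j) := fun j => Measurable.tsum fun i =>
    (((H.isBubble _).measurable_gradient.pow_const p).indicator (hYm _))
  have h0Z : ∀ j, ∫⁻ z in Z j, edist (u₀ z.1) (u₀ z.2) ^ p ∂𝒢.ν ≤ geomTail j := by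
    refine setLIntegral_iUnion_le_geomTail fun k => le_trans (lintegral_mono fun z => ?_)
      (H.isBubble k).energy_le'
    exact ENNReal.rpow_le_rpow (hG₀ _ _) hp0.le
  have hjZ : ∀ j, ∫⁻ z in Z j, edist (glue K w u₀ j z.1) (glue K w u₀ j z.2) ^ p ∂𝒢.ν ≤
      8 ^ p * (3 * geomTail j) := by
    intro j
    refine (lintegral_mono fun z => hDZ j z).trans ?_
    rw [lintegral_const_mul _ (by fun_prop), lintegral_add_left (hSm j), lintegral_add_left hD0m]
    refine mul_le_mul_right ?_ _
    have h1 : ∫⁻ z in Z j, S j z ∂𝒢.ν ≤ geomTail j := (setLIntegral_le_lintegral _ _).trans (hS j)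
    simp only [add_zero]
    calc _ ≤ geomTail j + (geomTail j + geomTail j) := by gcongr; exact h0Z j
      _ = _ := by ring
  have hcompl : ∀ j, ∫⁻ z in (Z j)ᶜ, edist (glue K w u₀ j z.1) (glue K w u₀ j z.2) ^ p ∂𝒢.ν =
      ∫⁻ z in (Z j)ᶜ, edist (u₀ z.1) (u₀ z.2) ^ p ∂𝒢.ν := by
    intro j
    refine setLIntegral_congr_fun (hZm j).compl fun z hz => ?_
    obtain ⟨h1, h2⟩ := hZK j z hz
    simp only [glue_of_notMem h1, glue_of_notMem h2]
  let a : ℕ → ℝ≥0∞ := fun j => 8 ^ p * (3 * geomTail j) + geomTail j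
  have ha : Tendsto a atTop (𝓝 0) := by
    have h1 := ENNReal.Tendsto.const_mul (a := 3) tendsto_geomTail (Or.inr (by norm_num))
    have h2 := ENNReal.Tendsto.const_mul (a := (8 : ℝ≥0∞) ^ p) h1 (Or.inr (by finiteness))
    have h3 := h2.add tendsto_geomTail
    simpa using h3
  have up : ∀ j, sobolevEnergy m s p (glue K w u₀ j) ≤ sobolevEnergy m s p u₀ + a j := by
    intro j
    rw [hEn _ (hmj j), hEn _ hu₀, ← lintegral_add_compl _ (hZm j), hcompl, add_comm]
    exact add_le_add (setLIntegral_le_lintegral _ _) ((hjZ j).trans le_self_add)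
  have low : ∀ j, sobolevEnergy m s p u₀ ≤ sobolevEnergy m s p (glue K w u₀ j) + a j := by
    intro j
    rw [hEn _ (hmj j), hEn _ hu₀, ← lintegral_add_compl (fun z : M × M => edist (u₀ z.1) (u₀ z.2) ^ p)
      (hZm j), ← hcompl, add_comm]
    exact add_le_add (setLIntegral_le_lintegral _ _) ((h0Z j).trans le_add_self)
  have hE0 := (hU.mem u₀ huU).energy_lt_top.ne
  refine H.false_of_tendsto hB hu₀ hU huU hact (fun j => ?_)
    ⟨H.tendsto_lintegral_edist hB hp0, tendsto_of_le_add_of_le_add hE0 ha up low,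
      fun h => absurd h hs1.ne⟩
  have := geomTail_ne_top j
  exact ((up j).trans_lt (by simp only [a]; finiteness)).ne

end FractionalGluing

/-! ### Series of weakly differentiable functions -/

section Series

lemma integrable_of_hasSum {α : Type*} [MeasurableSpace α] {μ : Measure α} {f : ℕ → α → ℝ}
    {g : α → ℝ} (hf : ∀ i, Integrable (f i) μ) (hsum : ∑' i, ∫⁻ x, ‖f i x‖ₑ ∂μ ≠ ⊤)
    (hg : ∀ᵐ x ∂μ, HasSum (fun i => f i x) (g x)) : Integrable g μ := by
  refine ⟨aestronglyMeasurable_of_tendsto_ae atTop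
    (f := fun n x => ∑ i ∈ Finset.range n, f i x)
    (fun n => (integrable_finsetSum _ fun i _ => hf i).aestronglyMeasurable)
    (hg.mono fun x hx => hx.tendsto_sum_nat), ?_⟩
  rw [hasFiniteIntegral_iff_enorm]
  calc ∫⁻ x, ‖g x‖ₑ ∂μ ≤ ∫⁻ x, ∑' i, ‖f i x‖ₑ ∂μ := by
        refine lintegral_mono_ae ?_
        filter_upwards [hg] with x hx
        exact le_of_tendsto' (hx.tendsto_sum_nat.enorm) fun n =>
          (enorm_sum_le _ _).trans (ENNReal.sum_le_tsum _)
    _ = ∑' i, ∫⁻ x, ‖f i x‖ₑ ∂μ := lintegral_tsum fun i => (hf i).aestronglyMeasurable.enorm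
    _ < ⊤ := lt_top_iff_ne_top.2 hsum

variable {m : ℕ}

/-- Summability of the L¹ norms allows interchanging the sum with the integral against a test
function. -/
lemma HasWeakDirDeriv.hasSum {Ω : Set (ℰ m)} (hΩ : IsOpen Ω) {v : ℰ m} {h k : ℕ → ℰ m → ℝ}
    {h' k' : ℰ m → ℝ} (H : ∀ i, HasWeakDirDeriv Ω v (h i) (k i)) (ih : ∀ i, IntegrableOn (h i) Ω)
    (ik : ∀ i, IntegrableOn (k i) Ω) (sh : ∑' i, ∫⁻ y in Ω, ‖h i y‖ₑ ≠ ⊤)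
    (sk : ∑' i, ∫⁻ y in Ω, ‖k i y‖ₑ ≠ ⊤) (hh : ∀ y ∈ Ω, HasSum (fun i => h i y) (h' y))
    (hk : ∀ y ∈ Ω, HasSum (fun i => k i y) (k' y)) :
    HasWeakDirDeriv Ω v h' k' ∧ IntegrableOn h' Ω ∧ IntegrableOn k' Ω := by
  have hΩm := hΩ.measurableSet
  have ih' : IntegrableOn h' Ω := integrable_of_hasSum ih sh (ae_restrict_of_forall_mem hΩm hh)
  have ik' : IntegrableOn k' Ω := integrable_of_hasSum ik sk (ae_restrict_of_forall_mem hΩm hk)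
  refine ⟨⟨ih'.locallyIntegrableOn, ik'.locallyIntegrableOn, fun ψ hψ hc hs => ?_⟩, ih', ik'⟩
  have key : ∀ (f : ℕ → ℰ m → ℝ) (f' χ : ℰ m → ℝ), (∀ i, IntegrableOn (f i) Ω) →
      ∑' i, ∫⁻ y in Ω, ‖f i y‖ₑ ≠ ⊤ → (∀ y ∈ Ω, HasSum (fun i => f i y) (f' y)) →
      Continuous χ → HasCompactSupport χ →
      ∫ y in Ω, f' y * χ y = ∑' i, ∫ y in Ω, f i y * χ y := by
    intro f f' χ hf sf hf' hχ hχc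
    obtain ⟨C, hC⟩ := hχc.exists_bound_of_continuous hχ
    have h1 : ∀ i, ∫⁻ y in Ω, ‖f i y * χ y‖ₑ ≤ ENNReal.ofReal C * ∫⁻ y in Ω, ‖f i y‖ₑ := by
      intro i
      rw [← lintegral_const_mul'' _ (hf i).aestronglyMeasurable.enorm]
      refine lintegral_mono fun y => ?_
      rw [enorm_mul, mul_comm, ← ofReal_norm (χ y)]
      gcongr
      exact hC y
    rw [← integral_tsum (f := fun i y => f i y * χ y)
      (fun i => (hf i).aestronglyMeasurable.mul hχ.aestronglyMeasurable)]
    · refine setIntegral_congr_fun hΩm fun y hy => ?_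
      exact ((hf' y hy).mul_right (χ y)).tsum_eq.symm
    · refine ne_top_of_le_ne_top ?_ (ENNReal.tsum_le_tsum h1)
      rw [ENNReal.tsum_mul_left]
      finiteness
  have e1 := key h h' (fun y => fderiv ℝ ψ y v) ih sh hh
    ((hψ.continuous_fderiv (by simp)).clm_apply continuous_const) (hc.fderiv_apply ℝ v)
  have e2 := key k k' ψ ik sk hk hψ.continuous hc
  rw [e1, e2, ← tsum_neg]
  exact tsum_congr fun i => (H i).2.2 ψ hψ hc hs

lemma HasWeakDirDeriv.add_fun {Ω : Set (ℰ m)} {v : ℰ m} {h h' k k' : ℰ m → ℝ}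
    (H : HasWeakDirDeriv Ω v h k) (H' : HasWeakDirDeriv Ω v h' k') :
    HasWeakDirDeriv Ω v (fun y => h y + h' y) (fun y => k y + k' y) := by
  refine of_integral_eq (H.1.add H'.1) (H.2.1.add H'.2.1) fun ψ hψ hc hs => ?_
  have e1 := H.integral_eq hψ hc hs
  have e2 := H'.integral_eq hψ hc hs
  have i1 := integrable_mul_of_hasCompactSupport H.2.1 hψ.continuous hc hs
  have i2 := integrable_mul_of_hasCompactSupport H'.2.1 hψ.continuous hc hs
  have j1 := integrable_mul_fderiv_of_hasCompactSupport H.1 hψ hc hs v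
  have j2 := integrable_mul_fderiv_of_hasCompactSupport H'.1 hψ hc hs v
  simp only [add_mul]
  rw [integral_add j1 j2, integral_add i1 i2]
  linarith

end Series

/-! ### Weak derivatives in a chart from first-order gradients -/

section ChartFields

variable {m : ℕ} {M : Type*} [EMetricSpace M] [ChartedSpace (ℰ m) M]
  [RiemannianBundle (fun x : M => TangentSpace (𝓡 m) x)] [MeasurableSpace M] [BorelSpace M]
  [SecondCountableTopology M] [IsManifold (𝓡 m) ∞ M]
  [IsContMDiffRiemannianBundle (𝓡 m) ∞ (ℰ m) (fun x : M => TangentSpace (𝓡 m) x)]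
  [IsRiemannianManifold (𝓡 m) M]
  {e : OpenPartialHomeomorph M (ℰ m)} {y₀ : ℰ m} {R p : ℝ} {Λ : ℝ≥0}
  {N : Type*} [EMetricSpace N]

/-- Weak derivatives, in a chart ball, of a map with a first-order gradient. -/
theorem exists_chart_field {hm : 1 ≤ m} {hB : ChartBall e y₀ R Λ} {hp : 0 < p} {w : M → N}
    {G : M × M → ℝ≥0∞} (hG : Measurable G)
    (gG : (firstOrderGradientCalculus hm hB hp).IsGrad (fun x y => edist (w x) (w y)) G)
    (hGi : ∫⁻ y in Metric.ball y₀ R, G (e.symm y, e.symm y) ≠ ⊤) {φ : N → ℝ}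
    (hφ : LipschitzWith 1 φ) (hi : IntegrableOn (fun y => φ (w (e.symm y))) (Metric.ball y₀ R)) :
    ∃ ℓ : ℰ m → (ℰ m →L[ℝ] ℝ),
      (∀ v, HasWeakDirDeriv (Metric.ball y₀ R) v (fun y => φ (w (e.symm y))) (fun y => ℓ y v) ∧
        IntegrableOn (fun y => ℓ y v) (Metric.ball y₀ R)) ∧
      ∀ᵐ y, y ∈ Metric.ball y₀ R → ∀ v, ‖ℓ y v‖ₑ ≤ ‖v‖ₑ * G (e.symm y, e.symm y) := by
  classical
  set B := Metric.ball y₀ R with hBdef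
  have hBt : B ⊆ e.target := (hB.image_subset_of_subset Set.Subset.rfl).trans hB.subset_target
  let Ĝ : ℰ m → ℝ≥0∞ := B.indicator fun y => G (e.symm y, e.symm y)
  have hĜ : Measurable Ĝ := by
    have hd : Measurable fun x : M => G (x, x) := hG.comp (measurable_id.prodMk measurable_id)
    refine measurable_of_restrict_of_restrict_compl (s := B) measurableSet_ball ?_ ?_
    · have h1 : Measurable (B.domRestrict e.symm) :=
        (e.continuousOn_symm.mono hBt).domRestrict.measurable
      convert hd.comp h1 using 1
      ext y
      simp [Ĝ, Set.domRestrict]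
    · convert measurable_const (a := (0 : ℝ≥0∞)) using 1
      ext y
      exact Set.indicator_of_notMem y.2 (fun y => G (e.symm y, e.symm y))
  have hĜi : ∫⁻ y in B, Ĝ y ≠ ⊤ := by
    rwa [setLIntegral_congr_fun measurableSet_ball (fun y hy => Set.indicator_of_mem hy _)]
  have key : ∀ v : ℰ m, ∃ k : ℰ m → ℝ, HasWeakDirDeriv B v (fun y => φ (w (e.symm y))) k ∧
      IntegrableOn k B ∧ ∀ᵐ y, y ∈ B → ‖k y‖ₑ ≤ ‖v‖ₑ * Ĝ y := by
    intro v
    refine exists_hasWeakDirDeriv_of_translation Metric.isOpen_ball measure_ball_lt_top.ne hi hĜ hĜi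
      fun ε hε => ?_
    filter_upwards [gG (ε • v)] with y hy hyB hyv
    have h1 : ‖φ (w (e.symm (y + ε • v))) - φ (w (e.symm y))‖ₑ ≤
        edist (w (e.symm y)) (w (e.symm (y + ε • v))) := by
      rw [← edist_eq_enorm_sub, edist_comm]
      simpa using hφ (w (e.symm y)) (w (e.symm (y + ε • v)))
    refine h1.trans ((hy hyB hyv).trans (le_of_eq ?_))
    congr 1
    refine setLIntegral_congr_fun measurableSet_Icc fun t ht => ?_
    have hmem : y + t • ε • v ∈ B := (convex_ball y₀ R).add_smul_mem hyB hyv ht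
    exact (Set.indicator_of_mem hmem (fun y => G (e.symm y, e.symm y))).symm
  choose k hk1 hk2 hk3 using key
  let b : Fin m → ℰ m := fun i => EuclideanSpace.single i 1
  -- The derivatives k v depend linearly on v only up to null sets, so a linear field is built from
  -- the basis directions. Its bound is valid almost everywhere for a countable dense set of
  -- directions at once, then for all by continuity.
  let ℓ : ℰ m → (ℰ m →L[ℝ] ℝ) := fun y => ∑ i, k (b i) y • EuclideanSpace.proj i
  have hℓ : ∀ y v, ℓ y v = ∑ i, v i * k (b i) y := by
    intro y v
    simp [ℓ, mul_comm]
  have hw : ∀ v, HasWeakDirDeriv B v (fun y => φ (w (e.symm y))) (fun y => ℓ y v) := by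
    intro v
    have h1 := HasWeakDirDeriv.sum Finset.univ (fun i => v i) b (fun i => k (b i)) (hk1 0).1
      (fun i _ => hk1 (b i))
    have h2 : ∑ i, v i • b i = v := by
      simpa [b] using (EuclideanSpace.basisFun (Fin m) ℝ).sum_repr v
    rw [h2] at h1
    simpa only [hℓ] using h1
  refine ⟨ℓ, fun v => ⟨hw v, ?_⟩, ?_⟩
  · simp only [hℓ]
    exact integrable_finsetSum _ fun i _ => (hk2 (b i)).const_mul _
  · have hae : ∀ᵐ y, ∀ n, y ∈ B → ‖ℓ y (TopologicalSpace.denseSeq (ℰ m) n)‖ₑ ≤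
        ‖TopologicalSpace.denseSeq (ℰ m) n‖ₑ * Ĝ y := by
      rw [ae_all_iff]
      intro n
      filter_upwards [(hw _).ae_eq (hk1 (TopologicalSpace.denseSeq (ℰ m) n)) Metric.isOpen_ball,
        hk3 (TopologicalSpace.denseSeq (ℰ m) n)] with y h1 h2 hy
      rw [h1 hy]
      exact h2 hy
    filter_upwards [hae] with y hy hyB v
    have hGy : Ĝ y = G (e.symm y, e.symm y) := Set.indicator_of_mem hyB _
    rw [← hGy]
    by_cases ht : Ĝ y = ⊤
    · rcases eq_or_ne v 0 with rfl | hv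
      · simp
      · rw [ht, ENNReal.mul_top (by simpa using hv)]
        exact le_top
    · refine (TopologicalSpace.denseRange_denseSeq (ℰ m)).induction_on
        (p := fun v => ‖ℓ y v‖ₑ ≤ ‖v‖ₑ * Ĝ y) v ?_ fun n => hy n hyB
      exact isClosed_le (by fun_prop) ((ENNReal.continuous_mul_const ht).comp continuous_enorm)

end ChartFields

/-! ### The weak differential of a glued map -/

section GluedField

variable {m : ℕ} {M : Type*} [EMetricSpace M] [ChartedSpace (ℰ m) M]
  [RiemannianBundle (fun x : M => TangentSpace (𝓡 m) x)] [MeasurableSpace M] [BorelSpace M]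
  [SecondCountableTopology M] [IsManifold (𝓡 m) ∞ M]
  [IsContMDiffRiemannianBundle (𝓡 m) ∞ (ℰ m) (fun x : M => TangentSpace (𝓡 m) x)]
  [IsRiemannianManifold (𝓡 m) M]
  {e : OpenPartialHomeomorph M (ℰ m)} {y₀ : ℰ m} {R p : ℝ} {Λ : ℝ≥0}
  {N : Type*} [EMetricSpace N] [MeasurableSpace N] [BorelSpace N] [SecondCountableTopology N]
  {F : Type*} [EMetricSpace F]

lemma lintegral_firstOrder (hm : 1 ≤ m) (hB : ChartBall e y₀ R Λ) (hp : 0 < p)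
    {g : M × M → ℝ≥0∞} (hg : Measurable g) :
    ∫⁻ z, g z ∂(firstOrderGradientCalculus hm hB hp).ν = ∫⁻ x, g (x, x) ∂μHE[m] :=
  lintegral_map hg (by fun_prop)

lemma setLIntegral_firstOrder (hm : 1 ≤ m) (hB : ChartBall e y₀ R Λ) (hp : 0 < p)
    {g : M × M → ℝ≥0∞} (hg : Measurable g) {c : ℰ m} {ϱ : ℝ}
    (hc : Metric.closedBall c ϱ ⊆ Metric.ball y₀ R) :
    ∫⁻ z in ballRegion e c ϱ, g z ∂(firstOrderGradientCalculus hm hB hp).ν =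
      ∫⁻ x in e.symm '' Metric.closedBall c ϱ, g (x, x) ∂μHE[m] := by
  change ∫⁻ z in _, g z ∂((μHE[m] : Measure M).map fun x => (x, x)) = _
  rw [setLIntegral_map (hB.measurableSet_ballRegion hc) hg (by fun_prop)]
  congr 2
  ext x
  simp [ballRegion]

lemma mfderiv_chart_comp_symm (hB : ChartBall e y₀ R Λ) {y : ℰ m} (hy : y ∈ e.target) (v : ℰ m) :
    mfderiv (𝓡 m) (𝓡 m) e (e.symm y) (mfderiv (𝓡 m) (𝓡 m) e.symm y v) = v := by
  have h := (mdifferentiable_of_mem_atlas (I := 𝓡 m) hB.mem_atlas).comp_symm_deriv hy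
  exact congrArg (fun T : ℰ m →L[ℝ] ℰ m => T v) h

/-- In the chart ball, the composition of φ with the glued map is φ ∘ u₀ plus the series of the
differences `d k`, which have disjoint supports and summable norms together with their derivatives.
Away from the closed ball of radius R/2 nothing has changed and T is kept; the two local
descriptions determine a weak differential on M. -/
theorem IsBubbleFamily.exists_glued_field {hm : 1 ≤ m} {hB : ChartBall e y₀ R Λ} (hp : 1 ≤ p)
    {hp0 : 0 < p} {r q : ℝ} {f : N → F} {u₀ : M → N} {G₀ : M × M → ℝ≥0∞} {c : ℕ → ℰ m}
    {ϱ : ℕ → ℝ} {w : ℕ → M → N} {G : ℕ → M × M → ℝ≥0∞}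
    (H : IsBubbleFamily (firstOrderGradientCalculus hm hB hp0) r q f u₀ G₀ c ϱ w G)
    (hu₀ : Measurable u₀) {φ : N → ℝ} (hφ : LipschitzWith 1 φ)
    {T : ∀ x : M, TangentSpace (𝓡 m) x →L[ℝ] ℝ} (hT : HasWeakDifferential (fun x => φ (u₀ x)) T)
    (j : ℕ) :
    ∃ W : ∀ x : M, TangentSpace (𝓡 m) x →L[ℝ] ℝ,
      HasWeakDifferential (fun x => φ (glue (bubbleSupport e c ϱ) w u₀ j x)) W ∧
      (∀ x ∉ ⋃ i, bubbleSupport e c ϱ (i + j), W x = T x) ∧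
      ∀ᵐ x ∂(μHE[m] : Measure M), ∀ i, x ∈ bubbleSupport e c ϱ (i + j) →
        covectorNorm (W x) ≤ Λ * G (i + j) (x, x) := by
  set K := bubbleSupport e c ϱ with hK
  set B := Metric.ball y₀ R with hBdef
  let K' : ℕ → Set (ℰ m) := fun k => Metric.closedBall (c k) (ϱ k)
  have hKd := H.disjoint_support hB
  have hK'B : ∀ k, K' k ⊆ B := H.subset_ball hB.pos
  have hBt : B ⊆ e.target := (hB.image_subset_of_subset Set.Subset.rfl).trans hB.subset_target
  have hK'm : ∀ k, MeasurableSet (K' k) := fun k => Metric.isClosed_closedBall.measurableSet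
  have hmemK : ∀ k, ∀ y ∈ B, e.symm y ∈ K k ↔ y ∈ K' k := by
    refine fun k y hy => ⟨?_, fun h => ⟨y, h, rfl⟩⟩
    rintro ⟨z, hz, hzy⟩
    exact e.symm.injOn (hBt (hK'B k hz)) (hBt hy) hzy ▸ hz
  have hsm : AEMeasurable e.symm (volume.restrict B) :=
    (e.continuousOn_symm.mono hBt).aemeasurable measurableSet_ball
  let g : ℕ → M → ℝ≥0∞ := fun k x => G k (x, x)
  have hg : ∀ k, Measurable (g k) := fun k =>
    (H.isBubble k).measurable_gradient.comp (by fun_prop)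
  have hgp : ∀ k, Measurable fun x => g k x ^ p := fun k => (hg k).pow_const p
  -- Turns the bounds in L^p into bounds in L¹ on sets of finite measure.
  have hle1 : ∀ t : ℝ≥0∞, t ≤ 1 + t ^ p := by
    intro t
    rcases le_total t 1 with h | h
    · exact h.trans le_self_add
    · refine le_trans ?_ le_add_self
      simpa using ENNReal.rpow_le_rpow_of_exponent_le h hp
  have hvB : volume B ≠ ⊤ := measure_ball_lt_top.ne
  have hgB : ∀ k, ∫⁻ y in B, g k (e.symm y) ≠ ⊤ := by
    intro k
    have h1 : ∫⁻ x, g k x ^ p ∂(μHE[m] : Measure M) ≠ ⊤ := by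
      have := (H.isBubble k).lintegral_ne_top
      rwa [lintegral_firstOrder hm hB hp0 ((H.isBubble k).measurable_gradient.pow_const p)] at this
    have h2 := (hB.setLIntegral_le Set.Subset.rfl (hgp k)).trans
      (mul_le_mul_right (setLIntegral_le_lintegral _ _) _)
    refine ne_top_of_le_ne_top ?_ (lintegral_mono fun y => hle1 _)
    rw [lintegral_add_left measurable_const, setLIntegral_const, one_mul]
    exact ENNReal.add_ne_top.2 ⟨hvB, (h2.trans_lt (by finiteness)).ne⟩
  have hgK : ∀ k, ∫⁻ y in K' k, g k (e.symm y) ^ p ≤ Λ * 2⁻¹ ^ k := by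
    intro k
    refine (hB.setLIntegral_le (hK'B k) (hgp k)).trans (mul_le_mul_right ?_ _)
    have := (H.isBubble k).energy_le
    rwa [setLIntegral_firstOrder hm hB hp0 ((H.isBubble k).measurable_gradient.pow_const p)
      (hK'B k)] at this
  -- the differences of the functions
  let h₀ : ℰ m → ℝ := fun y => φ (u₀ (e.symm y))
  let d : ℕ → ℰ m → ℝ := fun k y => φ (w k (e.symm y)) - h₀ y
  have hd0 : ∀ k, ∀ y ∈ B, y ∉ K' k → d k y = 0 := by
    intro k y hy hyk
    simp only [d, h₀]
    rw [(H.isBubble k).eq_of_notMem _ (mt (hmemK k y hy).1 hyk), sub_self]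
  have hdm : ∀ k, AEStronglyMeasurable (d k) (volume.restrict B) := fun k =>
    ((hφ.continuous.measurable.comp (H.isBubble k).measurable).comp_aemeasurable hsm
      |>.sub ((hφ.continuous.measurable.comp hu₀).comp_aemeasurable hsm)).aestronglyMeasurable
  have hdi : ∀ k, ∫⁻ y in B, ‖d k y‖ₑ ≤ Λ * 2⁻¹ ^ k := by
    intro k
    calc ∫⁻ y in B, ‖d k y‖ₑ ≤ ∫⁻ y in B, (K' k).indicator
          (fun y => edist (w k (e.symm y)) (u₀ (e.symm y))) y := by
          refine setLIntegral_mono' measurableSet_ball fun y hy => ?_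
          by_cases hyk : y ∈ K' k
          · rw [Set.indicator_of_mem hyk, ← edist_eq_enorm_sub]
            simpa using hφ (w k (e.symm y)) (u₀ (e.symm y))
          · rw [hd0 k y hy hyk, enorm_zero]
            exact zero_le
      _ = ∫⁻ y in K' k, edist (w k (e.symm y)) (u₀ (e.symm y)) := by
          rw [lintegral_indicator (hK'm k), Measure.restrict_restrict (hK'm k),
            Set.inter_eq_left.2 (hK'B k)]
      _ ≤ Λ * ∫⁻ x in K k, edist (w k x) (u₀ x) ∂μHE[m] :=
          hB.setLIntegral_le (hK'B k) ((H.isBubble k).measurable.edist hu₀)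
      _ ≤ _ := mul_le_mul_right (H.isBubble k).edist_le _
  have hT' := fun v => hB.hasWeakDirDeriv hT v
  have hdI : ∀ k, IntegrableOn (d k) B := fun k =>
    ⟨hdm k, (hdi k).trans_lt (ENNReal.mul_lt_top (by simp) (by finiteness))⟩
  have hhI : ∀ k, IntegrableOn (fun y => φ (w k (e.symm y))) B := by
    intro k
    have := (hdI k).add (hT' 0).2.1
    refine this.congr_fun (fun y _ => ?_) measurableSet_ball
    simp [d, h₀]
  choose ℓ hℓ hℓn using fun k => exists_chart_field (H.isBubble k).measurable_gradient
    (H.isBubble k).isGrad (hgB k) hφ (hhI k)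
  let t : ℰ m → ℰ m → ℝ := fun v y => T (e.symm y) (mfderiv (𝓡 m) (𝓡 m) e.symm y v)
  let D : ℕ → ℰ m → ℰ m → ℝ := fun k v => (K' k).indicator fun y => ℓ k y v - t v y
  have hD : ∀ k v, HasWeakDirDeriv B v (d k) (D k v) := by
    intro k v
    have h1 := ((hℓ k v).1.add_fun ((hT' v).1.const_mul (-1)))
    refine h1.congr_ae measurableSet_ball (Eventually.of_forall fun y _ => by simp [d, h₀]; ring) ?_
    -- The ball is closed, so `d k` vanishes on an open set and so does its weak derivative there;
    -- cutting the derivative by the indicator of the ball is harmless.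
    have hO : IsOpen (B \ K' k) := Metric.isOpen_ball.sdiff Metric.isClosed_closedBall
    have h2 := ((hℓ k v).1.mono (Set.sdiff_subset (t := K' k))).ae_eq_of_ae_eq
      ((hT' v).1.mono Set.sdiff_subset) hO (Eventually.of_forall fun y hy =>
        sub_eq_zero.1 (hd0 k y hy.1 hy.2))
    filter_upwards [h2] with y hy hyB
    by_cases hyk : y ∈ K' k
    · simp only [D, Set.indicator_of_mem hyk, t]
      ring
    · simp only [D, Set.indicator_of_notMem hyk, hy ⟨hyB, hyk⟩]
      ring
  have hDI : ∀ k v, IntegrableOn (D k v) B := fun k v =>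
    (((hℓ k v).2.sub (hT' v).2.2)).indicator (hK'm k)
  have hgeo := geomTail_ne_top j
  have hsd : ∑' i, ∫⁻ y in B, ‖d (i + j) y‖ₑ ≠ ⊤ := by
    refine ne_top_of_le_ne_top ?_ (ENNReal.tsum_le_tsum fun i => hdi (i + j))
    rw [ENNReal.tsum_mul_left]
    exact ENNReal.mul_ne_top (by simp) hgeo
  have hsD : ∀ v, ∑' i, ∫⁻ y in B, ‖D (i + j) v y‖ₑ ≠ ⊤ := by
    intro v
    have htv : AEMeasurable (fun y => ‖v‖ₑ + ‖t v y‖ₑ) (volume.restrict B) :=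
      aemeasurable_const.add (hT' v).2.2.aestronglyMeasurable.enorm
    have h1 : ∀ k, ∫⁻ y in B, ‖D k v y‖ₑ ≤
        ‖v‖ₑ * (Λ * 2⁻¹ ^ k) + ∫⁻ y in K' k, (‖v‖ₑ + ‖t v y‖ₑ) := by
      intro k
      calc ∫⁻ y in B, ‖D k v y‖ₑ ≤ ∫⁻ y in B, (K' k).indicator
            (fun y => ‖v‖ₑ * g k (e.symm y) ^ p + (‖v‖ₑ + ‖t v y‖ₑ)) y := by
            refine lintegral_mono_ae ((ae_restrict_iff' measurableSet_ball).2 ?_)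
            filter_upwards [hℓn k] with y hy hyB
            by_cases hyk : y ∈ K' k
            · simp only [D, Set.indicator_of_mem hyk]
              refine (enorm_sub_le).trans ?_
              rw [← add_assoc]
              refine add_le_add ((hy hyB v).trans ?_) le_rfl
              calc _ ≤ ‖v‖ₑ * (1 + g k (e.symm y) ^ p) := mul_le_mul_right (hle1 _) _
                _ = _ := by ring
            · simp only [D, Set.indicator_of_notMem hyk, enorm_zero, le_refl]
        _ = ∫⁻ y in K' k, (‖v‖ₑ * g k (e.symm y) ^ p + (‖v‖ₑ + ‖t v y‖ₑ)) := by
            rw [lintegral_indicator (hK'm k), Measure.restrict_restrict (hK'm k),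
              Set.inter_eq_left.2 (hK'B k)]
        _ = ‖v‖ₑ * (∫⁻ y in K' k, g k (e.symm y) ^ p) + ∫⁻ y in K' k, (‖v‖ₑ + ‖t v y‖ₑ) := by
            rw [lintegral_add_right' _ (htv.mono_set (hK'B k)),
              lintegral_const_mul' _ _ (by simp)]
        _ ≤ _ := by gcongr; exact hgK k
    refine ne_top_of_le_ne_top ?_ (ENNReal.tsum_le_tsum fun i => h1 (i + j))
    rw [ENNReal.tsum_add, ENNReal.tsum_mul_left, ENNReal.tsum_mul_left]
    refine ENNReal.add_ne_top.2 ⟨by have := hgeo; simp only [geomTail] at this; finiteness, ?_⟩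
    rw [← lintegral_iUnion (fun i => hK'm (i + j)) fun i i' h => H.disjoint (by simpa using h)]
    refine ne_top_of_le_ne_top ?_ (lintegral_mono_set (Set.iUnion_subset fun i => hK'B (i + j)))
    rw [lintegral_add_left measurable_const, setLIntegral_const]
    exact ENNReal.add_ne_top.2 ⟨ENNReal.mul_ne_top (by simp) hvB, (hT' v).2.2.2.ne⟩
  -- the glued field
  let W : ∀ x : M, TangentSpace (𝓡 m) x →L[ℝ] ℝ := glue K
    (fun k x => (show TangentSpace (𝓡 m) (e x) →L[ℝ] ℝ from ℓ k (e x)).comp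
      (mfderiv (𝓡 m) (𝓡 m) e x)) T j
  have hWmem : ∀ i, ∀ x ∈ K (i + j), W x = (show TangentSpace (𝓡 m) (e x) →L[ℝ] ℝ from
      ℓ (i + j) (e x)).comp (mfderiv (𝓡 m) (𝓡 m) e x) := fun i x hx => glue_of_mem hKd hx
  have hWoff : ∀ x ∉ ⋃ i, K (i + j), W x = T x := fun x hx => glue_of_notMem hx
  have hsum : ∀ (a : ℕ → ℰ m → ℝ) (b : ℰ m → ℝ) (y : ℰ m), (∀ k, y ∉ K' k → a k y = 0) →
      (∀ i, y ∈ K' (i + j) → b y = a (i + j) y) → (y ∉ ⋃ i, K' (i + j) → b y = 0) →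
      HasSum (fun i => a (i + j) y) (b y) := by
    intro a b y ha hb hb0
    by_cases hy : y ∈ ⋃ i, K' (i + j)
    · obtain ⟨i, hi⟩ := Set.mem_iUnion.1 hy
      rw [hb i hi]
      refine hasSum_single i fun i' hi' => ha _ fun h => ?_
      exact Set.disjoint_left.1 (H.disjoint (by simpa using hi' : i' + j ≠ i + j)) h hi
    · rw [hb0 hy]
      simp only [Set.mem_iUnion, not_exists] at hy
      simp [ha _ (hy _), hasSum_zero]
  have hU : ∀ y ∈ B, y ∉ ⋃ i, K' (i + j) → e.symm y ∉ ⋃ i, K (i + j) := by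
    intro y hy h h'
    obtain ⟨i, hi⟩ := Set.mem_iUnion.1 h'
    exact h (Set.mem_iUnion.2 ⟨i, (hmemK _ y hy).1 hi⟩)
  refine ⟨W, hasWeakDifferential_of_local fun x => ?_, hWoff, ?_⟩
  · by_cases hx : x ∈ e.symm '' Metric.closedBall y₀ (R / 2)
    · obtain ⟨y, hy, rfl⟩ := hx
      have hyB : y ∈ B := Metric.closedBall_subset_ball (by linarith [hB.pos]) hy
      refine ⟨e, hB.mem_atlas, B, Metric.isOpen_ball, e.map_target (hBt hyB),
        by rwa [e.right_inv (hBt hyB)], fun v => ?_⟩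
      have key := HasWeakDirDeriv.hasSum Metric.isOpen_ball
        (h' := fun y => φ (glue K w u₀ j (e.symm y)) - h₀ y)
        (k' := fun y => W (e.symm y) (mfderiv (𝓡 m) (𝓡 m) e.symm y v) - t v y)
        (fun i => hD (i + j) v) (fun i => hdI (i + j)) (fun i => hDI (i + j) v) hsd (hsD v)
        (fun y hy => hsum d (fun y => φ (glue K w u₀ j (e.symm y)) - h₀ y) y (fun k => hd0 k y hy)
          (fun i hi => by simp only [d, K, H.glue_eq hB ((hmemK _ y hy).2 hi)])
          (fun hi => by simp only [glue_of_notMem (hU y hy hi), h₀, sub_self]))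
        (fun y hy => hsum (fun k => D k v)
          (fun y => W (e.symm y) (mfderiv (𝓡 m) (𝓡 m) e.symm y v) - t v y) y (fun k hk => Set.indicator_of_notMem hk _)
          (fun i hi => by
            simp only [D, Set.indicator_of_mem hi]
            rw [hWmem i _ ((hmemK _ y hy).2 hi)]
            have h1 := mfderiv_chart_comp_symm hB (hBt hy) v
            congr 1
            change ℓ (i + j) (e (e.symm y)) (mfderiv (𝓡 m) (𝓡 m) e (e.symm y)
              (mfderiv (𝓡 m) (𝓡 m) e.symm y v)) = _
            rw [e.right_inv (hBt hy)]
            exact congrArg (ℓ (i + j) y) h1)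
          (fun hi => by simp only [hWoff _ (hU y hy hi), t, sub_self]))
      exact (key.1.add_fun (hT' v).1).congr measurableSet_ball (fun y _ => by simp [h₀])
        (fun y _ => by simp [t])
    · have hcl : IsClosed (e.symm '' Metric.closedBall y₀ (R / 2)) :=
        ((isCompact_closedBall _ _).image_of_continuousOn (e.continuousOn_symm.mono
          ((Metric.closedBall_subset_ball (by linarith [hB.pos])).trans hBt))).isClosed
      set e' := chartAt (ℰ m) x
      have he' : e' ∈ atlas (ℰ m) M := chart_mem_atlas (ℰ m) x
      have hx' : x ∈ e'.source := mem_chart_source (ℰ m) x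
      refine ⟨e', he', e'.target ∩ e'.symm ⁻¹' (e.symm '' Metric.closedBall y₀ (R / 2))ᶜ,
        e'.isOpen_inter_preimage_symm hcl.isOpen_compl, hx',
        ⟨e'.map_source hx', by rwa [Set.mem_preimage, e'.left_inv hx']⟩, fun v => ?_⟩
      have hoff : ∀ z ∉ e.symm '' Metric.closedBall y₀ (R / 2), z ∉ ⋃ i, K (i + j) := by
        intro z hz hz'
        obtain ⟨i, hi⟩ := Set.mem_iUnion.1 hz'
        exact hz (Set.image_mono (H.subset (i + j)) hi)
      refine ((hasWeakDifferential_iff.1 hT e' he' v).mono Set.inter_subset_left).congr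
        (e'.isOpen_inter_preimage_symm hcl.isOpen_compl).measurableSet (fun y hy => ?_)
        fun y hy => ?_
      · simp only [glue_of_notMem (hoff _ hy.2)]
      · rw [hWoff _ (hoff _ hy.2)]
  · have h1 : ∀ᵐ y, y ∈ B → ∀ k, ∀ v, ‖ℓ k (e (e.symm y)) v‖ₑ ≤ ‖v‖ₑ * G k (e.symm y, e.symm y) := by
      filter_upwards [ae_all_iff.2 hℓn] with y hy hyB k v
      rw [e.right_inv (hBt hyB)]
      exact hy k hyB v
    filter_upwards [ae_of_ae_chart (M := M) hB.mem_atlas (W := B)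
      (P := fun x => ∀ k v, ‖ℓ k (e x) v‖ₑ ≤ ‖v‖ₑ * G k (x, x)) h1] with x hx i hxi
    rw [hWmem i x hxi]
    obtain ⟨y, hy, rfl⟩ := hxi
    have hyB := hK'B _ hy
    have hx' := hx (e.map_target (hBt hyB)) (by rwa [e.right_inv (hBt hyB)]) (i + j)
    refine iSup₂_le fun v hv => (hx' _).trans (mul_le_mul_left ?_ _)
    have h2 := hB.norm_mfderiv_le y (hB.image_subset_of_subset Set.Subset.rfl hyB) v
    have h3 : ‖(show ℰ m from mfderiv (𝓡 m) (𝓡 m) e (e.symm y) v)‖ ≤ Λ :=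
      h2.trans (mul_le_of_le_one_right Λ.coe_nonneg hv)
    exact ENNReal.coe_le_coe.2 h3

end GluedField

/-! ### Uniqueness and scaling of weak differentials -/

section WeakDifferentials

/-- Reduces Lipschitz functions to 1-Lipschitz ones; L + 1 is invertible even if L = 0. -/
lemma LipschitzWith.inv_mul {X : Type*} [PseudoEMetricSpace X] {φ : X → ℝ} {L : ℝ≥0}
    (hφ : LipschitzWith L φ) : LipschitzWith 1 fun z => ((L + 1 : ℝ≥0) : ℝ)⁻¹ * φ z := by
  intro x y
  have h1 : ENNReal.ofReal ((L + 1 : ℝ≥0) : ℝ)⁻¹ * L ≤ 1 := by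
    rw [← ENNReal.ofReal_coe_nnreal, ← ENNReal.ofReal_mul (by positivity),
      ENNReal.ofReal_le_one, inv_mul_le_iff₀ (by positivity), mul_one]
    push_cast
    linarith
  rw [edist_eq_enorm_sub, ← mul_sub, enorm_mul, Real.enorm_eq_ofReal (by positivity),
    ← edist_eq_enorm_sub]
  calc _ ≤ _ * (L * edist x y) := mul_le_mul_right (hφ x y) _
    _ = _ * L * edist x y := (mul_assoc _ _ _).symm
    _ ≤ _ := mul_le_mul_left h1 _

variable {m : ℕ} {M : Type*} [EMetricSpace M] [ChartedSpace (ℰ m) M]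
  [RiemannianBundle (fun x : M => TangentSpace (𝓡 m) x)] [MeasurableSpace M] [BorelSpace M]
  [SecondCountableTopology M] [IsManifold (𝓡 m) ∞ M]
  [IsContMDiffRiemannianBundle (𝓡 m) ∞ (ℰ m) (fun x : M => TangentSpace (𝓡 m) x)]
  [IsRiemannianManifold (𝓡 m) M]

/-- In each chart the components in a basis agree almost everywhere and the derivative of the chart
is invertible; countably many charts cover M. -/
lemma HasWeakDifferential.ae_eq {g : M → ℝ} {G G' : ∀ x : M, TangentSpace (𝓡 m) x →L[ℝ] ℝ}
    (H : HasWeakDifferential g G) (H' : HasWeakDifferential g G') :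
    ∀ᵐ x ∂(μHE[m] : Measure M), G x = G' x := by
  have key : ∀ e ∈ atlas (ℰ m) M, ∀ᵐ x ∂(μHE[m] : Measure M), x ∈ e.source → G x = G' x := by
    intro e he
    have h1 : ∀ᵐ y, y ∈ e.target → G (e.symm y) = G' (e.symm y) := by
      have h2 : ∀ᵐ y, ∀ i : Fin m, y ∈ e.target →
          G (e.symm y) (mfderiv (𝓡 m) (𝓡 m) e.symm y (EuclideanSpace.basisFun (Fin m) ℝ i)) =
          G' (e.symm y) (mfderiv (𝓡 m) (𝓡 m) e.symm y (EuclideanSpace.basisFun (Fin m) ℝ i)) :=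
        ae_all_iff.2 fun i => (hasWeakDifferential_iff.1 H e he _).ae_eq
          (hasWeakDifferential_iff.1 H' e he _) e.open_target
      filter_upwards [h2] with y hy hyt
      have h3 : (G (e.symm y)).comp (mfderiv (𝓡 m) (𝓡 m) e.symm y) =
          (G' (e.symm y)).comp (mfderiv (𝓡 m) (𝓡 m) e.symm y) := by
        have : ∀ T T' : ℰ m →L[ℝ] ℝ, (∀ i, T (EuclideanSpace.basisFun (Fin m) ℝ i) =
            T' (EuclideanSpace.basisFun (Fin m) ℝ i)) → T = T' := fun T T' h =>
          ContinuousLinearMap.coe_injective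
            ((EuclideanSpace.basisFun (Fin m) ℝ).toBasis.ext fun i => by simpa using h i)
        exact this _ _ fun i => hy i hyt
      have h4 := (mdifferentiable_of_mem_atlas (I := 𝓡 m) he).symm_comp_deriv (e.map_target hyt)
      rw [e.right_inv hyt] at h4
      ext v
      have h5 : mfderiv (𝓡 m) (𝓡 m) e.symm y (mfderiv (𝓡 m) (𝓡 m) e (e.symm y) v) = v :=
        congrArg (fun T : ℰ m →L[ℝ] ℰ m => T v) h4
      have h6 : G (e.symm y) (mfderiv (𝓡 m) (𝓡 m) e.symm y (mfderiv (𝓡 m) (𝓡 m) e (e.symm y) v)) =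
          G' (e.symm y) (mfderiv (𝓡 m) (𝓡 m) e.symm y (mfderiv (𝓡 m) (𝓡 m) e (e.symm y) v)) :=
        congrArg (fun T : ℰ m →L[ℝ] ℝ => T (mfderiv (𝓡 m) (𝓡 m) e (e.symm y) v)) h3
      rwa [h5] at h6
    filter_upwards [ae_of_ae_chart (M := M) he (P := fun x => G x = G' x) h1] with x hx hxe
    exact hx hxe (e.map_source hxe)
  obtain ⟨S, hS, hSu⟩ := TopologicalSpace.countable_cover_nhds
    (fun x : M => (chartAt (ℰ m) x).open_source.mem_nhds (mem_chart_source (ℰ m) x))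
  filter_upwards [(ae_ball_iff hS).2 fun x _ => key (chartAt (ℰ m) x) (chart_mem_atlas (ℰ m) x)]
    with x hx
  obtain ⟨z, hz, hxz⟩ := Set.mem_iUnion₂.1 (hSu.symm ▸ Set.mem_univ x : x ∈ ⋃ x ∈ S, _)
  exact hx z hz hxz

lemma HasWeakDifferential.const_smul {g : M → ℝ} {G : ∀ x : M, TangentSpace (𝓡 m) x →L[ℝ] ℝ}
    (H : HasWeakDifferential g G) (a : ℝ) :
    HasWeakDifferential (fun x => a * g x) (fun x => a • G x) :=
  hasWeakDifferential_iff.2 fun e he v => (hasWeakDifferential_iff.1 H e he v).const_mul a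

lemma covectorNorm_smul_sub_le {x : M} (a : ℝ≥0) (ℓ ℓ' : TangentSpace (𝓡 m) x →L[ℝ] ℝ) :
    covectorNorm ((a : ℝ) • ℓ - (a : ℝ) • ℓ') ≤ a * (covectorNorm ℓ + covectorNorm ℓ') := by
  refine iSup₂_le fun v hv => ?_
  have h1 := enorm_apply_le_covectorNorm ℓ v (C := 1) (by simpa using hv)
  have h2 := enorm_apply_le_covectorNorm ℓ' v (C := 1) (by simpa using hv)
  rw [ENNReal.coe_one, one_mul] at h1 h2
  have h3 : ((a : ℝ) • ℓ - (a : ℝ) • ℓ') v = a * (ℓ v - ℓ' v) := by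
    simp [mul_sub]
  rw [h3, enorm_mul, Real.enorm_eq_ofReal a.coe_nonneg, ENNReal.ofReal_coe_nnreal]
  exact mul_le_mul_right (enorm_sub_le.trans (add_le_add h1 h2)) _

end WeakDifferentials

/-! ### Integrals of glued densities -/

section GlueIntegral

variable {M : Type*} [MeasurableSpace M] {μ : Measure M} {K : ℕ → Set M}

lemma lintegral_glue_rpow_le (hK : Pairwise (Function.onFun Disjoint K))
    (hKm : ∀ k, MeasurableSet (K k)) {a : ℕ → M → ℝ≥0∞} {p : ℝ} {C : ℝ≥0∞}
    (ha : ∀ k, ∫⁻ x in K k, a k x ^ p ∂μ ≤ C * 2⁻¹ ^ k) (g : M → ℝ≥0∞) (j : ℕ) :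
    ∫⁻ x, glue K a g j x ^ p ∂μ ≤ ∫⁻ x, g x ^ p ∂μ + C * geomTail j := by
  have hm : MeasurableSet (⋃ i, K (i + j)) := MeasurableSet.iUnion fun i => hKm _
  rw [← lintegral_add_compl _ hm, add_comm]
  refine add_le_add ((setLIntegral_mono' hm.compl fun x hx => ?_).trans
    (setLIntegral_le_lintegral _ _)) ?_
  · rw [glue_of_notMem hx]
  · rw [geomTail, ← ENNReal.tsum_mul_left]
    refine (lintegral_iUnion_le _ _).trans (ENNReal.tsum_le_tsum fun i => le_trans ?_ (ha (i + j)))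
    exact setLIntegral_mono' (hKm _) fun x hx => by rw [glue_of_mem hK hx]

lemma aemeasurable_glue (hK : Pairwise (Function.onFun Disjoint K))
    (hKm : ∀ k, MeasurableSet (K k)) {a : ℕ → M → ℝ≥0∞} (ha : ∀ k, Measurable (a k))
    {g : M → ℝ≥0∞} (hg : AEMeasurable g μ) (j : ℕ) : AEMeasurable (glue K a g j) μ := by
  refine ⟨glue K a (hg.mk g) j, measurable_glue hK hKm ha hg.measurable_mk, ?_⟩
  filter_upwards [hg.ae_eq_mk] with x hx
  by_cases h : x ∈ ⋃ i, K (i + j)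
  · obtain ⟨i, hi⟩ := Set.mem_iUnion.1 h
    rw [glue_of_mem hK hi, glue_of_mem hK hi]
  · rw [glue_of_notMem h, glue_of_notMem h, hx]

end GlueIntegral

/-! ### Convergence of the glued maps in first-order spaces -/

section FirstOrderGluing

variable {m : ℕ} {M : Type*} [EMetricSpace M] [ChartedSpace (ℰ m) M]
  [RiemannianBundle (fun x : M => TangentSpace (𝓡 m) x)] [MeasurableSpace M] [BorelSpace M]
  [SecondCountableTopology M] [IsManifold (𝓡 m) ∞ M]
  [IsContMDiffRiemannianBundle (𝓡 m) ∞ (ℰ m) (fun x : M => TangentSpace (𝓡 m) x)]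
  [IsRiemannianManifold (𝓡 m) M]
  {e : OpenPartialHomeomorph M (ℰ m)} {y₀ : ℰ m} {R p : ℝ} {Λ : ℝ≥0}
  {N : Type*} [EMetricSpace N] [MeasurableSpace N] [BorelSpace N] [SecondCountableTopology N]
  {F : Type*} [EMetricSpace F]

/-- The weak differentials of the glued map and of u₀ agree outside of the supports of index at
least j, where the bounds for the bubbles and for u₀ have small energy. This gives the convergence
of the energies, in both directions, and that of the derivatives. -/
theorem IsBubbleFamily.false_of_first_order {hm : 1 ≤ m} {hB : ChartBall e y₀ R Λ} (hp : 1 ≤ p)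
    {hp0 : 0 < p} {r q : ℝ} {f : N → F} {n : ℕ} [ChartedSpace (ℰ n) N] [MeasurableSpace F]
    {u₀ : M → N} {G₀ : M × M → ℝ≥0∞} {c : ℕ → ℰ m} {ϱ : ℕ → ℝ} {w : ℕ → M → N}
    {G : ℕ → M × M → ℝ≥0∞}
    (H : IsBubbleFamily (firstOrderGradientCalculus hm hB hp0) r q f u₀ G₀ c ϱ w G)
    (hG₀m : Measurable G₀) (hG₀ : IsWeakDerivBound m u₀ fun x => G₀ (x, x))
    (hu₀ : Measurable u₀) {U : Set (M → N)}
    (hU : IsSobolevOpen m n 1 p U) (huU : u₀ ∈ U)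
    (hact : ∀ u ∈ U, MemSobolev m r q (fun x => f (u x))) : False := by
  set K := bubbleSupport e c ϱ with hK
  have hKd := H.disjoint_support hB
  have hKm := H.measurableSet_support hB
  have hg0 : Measurable fun x : M => G₀ (x, x) := hG₀m.comp (by fun_prop)
  have hg : ∀ k, Measurable fun x : M => G k (x, x) := fun k =>
    (H.isBubble k).measurable_gradient.comp (by fun_prop)
  have hb0 : ∀ k, ∫⁻ x in K k, G₀ (x, x) ^ p ∂μHE[m] ≤ 2⁻¹ ^ k := by
    intro k
    have := (H.isBubble k).energy_le'
    rwa [setLIntegral_firstOrder hm hB hp0 (hG₀m.pow_const p) (H.subset_ball hB.pos k)] at this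
  have hb : ∀ k, ∫⁻ x in K k, G k (x, x) ^ p ∂μHE[m] ≤ 2⁻¹ ^ k := by
    intro k
    have := (H.isBubble k).energy_le
    rwa [setLIntegral_firstOrder hm hB hp0 ((H.isBubble k).measurable_gradient.pow_const p)
      (H.subset_ball hB.pos k)] at this
  have hbΛ : ∀ k, ∫⁻ x in K k, (Λ * G k (x, x)) ^ p ∂μHE[m] ≤ (Λ : ℝ≥0∞) ^ p * 2⁻¹ ^ k := by
    intro k
    simp only [ENNReal.mul_rpow_of_nonneg _ _ hp0.le]
    rw [lintegral_const_mul _ ((hg k).pow_const p)]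
    exact mul_le_mul_right (hb k) _
  set E := sobolevEnergy m 1 p (M := M) (N := N)
  have hE : ∀ u : M → N, E u = dirichletEnergy m p u := fun u => if_pos rfl
  -- Any derivative bound for u, replaced by `a k` on the supports, must be a bound for u'; the
  -- infimum over the bounds for u then compares the energies.
  have le_add : ∀ (u u' : M → N) (j : ℕ) (C : ℝ≥0∞) (a : ℕ → M → ℝ≥0∞), (∀ k, Measurable (a k)) →
      (∀ k, ∫⁻ x in K k, a k x ^ p ∂(μHE[m] : Measure M) ≤ C * 2⁻¹ ^ k) →
      (∀ g, IsWeakDerivBound m u g → ∀ φ : N → ℝ, LipschitzWith 1 φ →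
        ∃ T : ∀ x : M, TangentSpace (𝓡 m) x →L[ℝ] ℝ, HasWeakDifferential (fun x => φ (u' x)) T ∧
          ∀ᵐ x ∂(μHE[m] : Measure M), covectorNorm (T x) ≤ glue K a g j x) →
      E u' ≤ E u + C * geomTail j := by
    intro u u' j C a ham ha h
    rw [hE, hE, dirichletEnergy, dirichletEnergy, ENNReal.iInf_add]
    refine le_iInf fun g => ?_
    rw [ENNReal.iInf_add]
    refine le_iInf fun hgu => (iInf₂_le (glue K a g j) ⟨?_, h g hgu⟩).trans
      (lintegral_glue_rpow_le hKd hKm ha g j)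
    exact aemeasurable_glue hKd hKm ham hgu.aemeasurable j
  have up : ∀ j, E (glue K w u₀ j) ≤ E u₀ + (Λ : ℝ≥0∞) ^ p * geomTail j := by
    intro j
    refine le_add u₀ _ j _ (fun k x => Λ * G k (x, x)) (fun k => (hg k).const_mul _) hbΛ
      fun g hgu φ hφ => ?_
    obtain ⟨T, hT, hTg⟩ := hgu.bound φ hφ
    obtain ⟨W, hW, hWT, hWG⟩ := H.exists_glued_field hp hu₀ hφ hT j
    refine ⟨W, hW, ?_⟩
    filter_upwards [hTg, hWG] with x h1 h2
    by_cases hx : x ∈ ⋃ i, K (i + j)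
    · obtain ⟨i, hi⟩ := Set.mem_iUnion.1 hx
      rw [glue_of_mem hKd hi]
      exact h2 i hi
    · rwa [glue_of_notMem hx, hWT x hx]
  have low : ∀ j, E u₀ ≤ E (glue K w u₀ j) + 1 * geomTail j := by
    intro j
    refine le_add _ u₀ j 1 (fun _ x => G₀ (x, x)) (fun _ => hg0) (by simpa using hb0)
      fun g hgu φ hφ => ?_
    obtain ⟨T, hT, hTg⟩ := hG₀.bound φ hφ
    obtain ⟨W, hW, hWT, -⟩ := H.exists_glued_field hp hu₀ hφ hT j
    obtain ⟨W', hW', hWg⟩ := hgu.bound φ hφ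
    refine ⟨T, hT, ?_⟩
    -- An arbitrary bound for the glued map controls some weak differential W'; by uniqueness it
    -- also controls W, which is T outside of the supports.
    filter_upwards [hTg, hWg, hW.ae_eq hW'] with x h1 h2 h3
    by_cases hx : x ∈ ⋃ i, K (i + j)
    · obtain ⟨i, hi⟩ := Set.mem_iUnion.1 hx
      rwa [glue_of_mem hKd hi]
    · rwa [glue_of_notMem hx, ← hWT x hx, h3]
  have htail : ∀ C : ℝ≥0∞, C ≠ ⊤ → Tendsto (fun j => C * geomTail j) atTop (𝓝 0) := fun C hC => by
    simpa using ENNReal.Tendsto.const_mul tendsto_geomTail (Or.inr hC)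
  have hE0 := (hU.mem u₀ huU).energy_lt_top.ne
  have hΛ : (Λ : ℝ≥0∞) ^ p ≠ ⊤ := by finiteness
  refine H.false_of_tendsto hB hu₀ hU huU hact (fun j => ?_)
    ⟨H.tendsto_lintegral_edist hB hp0, ?_, fun _ φ L _ hφ => ?_⟩
  · have := geomTail_ne_top j
    exact ((up j).trans_lt (ENNReal.add_lt_top.2 ⟨hE0.lt_top, by finiteness⟩)).ne
  · refine tendsto_of_le_add_of_le_add hE0 (htail ((Λ : ℝ≥0∞) ^ p + 1) (by finiteness))
      (fun j => (up j).trans ?_) fun j => (low j).trans ?_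
    · gcongr; exact le_self_add
    · gcongr; exact le_add_self
  · set a : ℝ≥0 := L + 1 with ha
    have hφ' : LipschitzWith 1 fun z => (a : ℝ)⁻¹ * φ z := hφ.inv_mul
    have haφ : ∀ z, (a : ℝ) * ((a : ℝ)⁻¹ * φ z) = φ z := fun z =>
      mul_inv_cancel_left₀ (by positivity) _
    obtain ⟨T, hT, hTg⟩ := hG₀.bound _ hφ'
    choose W hW hWT hWG using fun j => H.exists_glued_field hp hu₀ hφ' hT j
    refine ⟨fun x => (a : ℝ) • T x, fun j x => (a : ℝ) • W j x, ?_, fun j => ?_, ?_⟩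
    · simpa only [haφ] using hT.const_smul (a : ℝ)
    · simpa only [haφ] using (hW j).const_smul (a : ℝ)
    have hbd : ∀ k, ∫⁻ x in K k, (a * (Λ * G k (x, x) + G₀ (x, x))) ^ p ∂(μHE[m] : Measure M) ≤
        ((a : ℝ≥0∞) ^ p * (2 ^ p * ((Λ : ℝ≥0∞) ^ p + 1))) * 2⁻¹ ^ k := by
      intro k
      simp only [ENNReal.mul_rpow_of_nonneg (a : ℝ≥0∞) _ hp0.le]
      rw [lintegral_const_mul' _ _ (by finiteness), mul_assoc, mul_assoc]
      refine mul_le_mul_right ((lintegral_mono fun x =>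
        ENNReal.rpow_add_le_two_rpow_mul hp _ _).trans ?_) _
      rw [lintegral_const_mul' _ _ (by finiteness), lintegral_add_right _ (hg0.pow_const p), add_mul, one_mul]
      exact mul_le_mul_right (add_le_add (hbΛ k) (hb0 k)) _
    refine tendsto_of_tendsto_of_tendsto_of_le_of_le tendsto_const_nhds
      (htail ((a : ℝ≥0∞) ^ p * (2 ^ p * ((Λ : ℝ≥0∞) ^ p + 1))) (by finiteness))
      (fun _ => zero_le) fun j => ?_
    have h1 := lintegral_glue_rpow_le hKd hKm hbd (fun _ => 0) j
    simp only [ENNReal.zero_rpow_of_pos hp0, lintegral_zero, zero_add] at h1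
    refine (lintegral_mono_ae ?_).trans h1
    filter_upwards [hTg, hWG j] with x h2 h3
    refine ENNReal.rpow_le_rpow ?_ hp0.le
    by_cases hx : x ∈ ⋃ i, K (i + j)
    · obtain ⟨i, hi⟩ := Set.mem_iUnion.1 hx
      rw [glue_of_mem hKd hi]
      exact (covectorNorm_smul_sub_le a _ _).trans (mul_le_mul_right (add_le_add (h3 i hi) h2) _)
    · rw [hWT j x hx, sub_self]
      simp [covectorNorm]

end FirstOrderGluing

/-! ### First-order gradients of Sobolev maps, and null sets -/

section SobolevGradients

/-- By Fubini and translation invariance, almost every segment in the direction v meets a null set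
in a null set of parameters. -/
lemma ae_ae_add_smul {m : ℕ} {P : ℰ m → Prop} (h : ∀ᵐ y, P y) (v : ℰ m) :
    ∀ᵐ y : ℰ m, ∀ᵐ t : ℝ ∂volume.restrict (Set.Icc 0 1), P (y + t • v) := by
  obtain ⟨S, hS, hSm, hS0⟩ := exists_measurable_superset_of_null (ae_iff.1 h)
  have h1 : ∀ᵐ t : ℝ ∂volume.restrict (Set.Icc 0 1), ∀ᵐ y : ℰ m, y + t • v ∉ S :=
    Eventually.of_forall fun t => by
      rw [ae_iff]
      simp only [not_not]
      exact (measure_preimage_add_right volume (t • v) S).trans hS0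
  have h2 : MeasurableSet {z : ℝ × ℰ m | z.2 + z.1 • v ∉ S} :=
    (by fun_prop : Measurable fun z : ℝ × ℰ m => z.2 + z.1 • v) hSm.compl
  filter_upwards [(Measure.ae_ae_comm h2).1 h1] with y hy
  filter_upwards [hy] with t ht
  by_contra hP
  exact ht (hS hP)

/-- By density the bound passes to the distance function from x itself, whose increment is the
distance from x to y. -/
lemma edist_le_of_forall_dense {N : Type*} [EMetricSpace N] [ConnectedSpace N] {a : ℕ → N}
    (ha : DenseRange a) {x y : N} {D : ℝ≥0∞}
    (h : ∀ i, edist (edist x (a i)).toReal (edist y (a i)).toReal ≤ D) : edist x y ≤ D := by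
  have h1 : ∀ z : N, Continuous fun b => (edist z b).toReal := fun z => by
    simpa only [edist_comm z] using (lipschitzWith_toReal_edist z).continuous
  have h2 : edist (edist x x).toReal (edist y x).toReal ≤ D :=
    ha.induction_on (p := fun b => edist (edist x b).toReal (edist y b).toReal ≤ D) x
      (isClosed_le ((h1 x).edist (h1 y)) continuous_const) h
  rwa [edist_self, ENNReal.toReal_zero, edist_dist, dist_zero_left,
    Real.norm_of_nonneg ENNReal.toReal_nonneg,
    ENNReal.ofReal_toReal (edist_ne_top_of_connectedSpace y x), edist_comm] at h2

variable {m : ℕ} {M : Type*} [EMetricSpace M] [ChartedSpace (ℰ m) M]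
  [RiemannianBundle (fun x : M => TangentSpace (𝓡 m) x)] [MeasurableSpace M] [BorelSpace M]
  [SecondCountableTopology M] [IsManifold (𝓡 m) ∞ M]
  [IsContMDiffRiemannianBundle (𝓡 m) ∞ (ℰ m) (fun x : M => TangentSpace (𝓡 m) x)]
  [IsRiemannianManifold (𝓡 m) M]
  {e : OpenPartialHomeomorph M (ℰ m)} {y₀ : ℰ m} {R s p : ℝ} {Λ : ℝ≥0}
  {N : Type*} [EMetricSpace N]

/-- The increments of u are recovered from the distance functions to a dense sequence of points. For
each of these the increment is the integral of the weak derivative along a segment, bounded by g up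
to the factor Λ of the chart; countability makes the exceptional set null. -/
theorem exists_firstOrder_gradient [SecondCountableTopology N] [ConnectedSpace N] (hm : 1 ≤ m)
    (hB : ChartBall e y₀ R Λ) (hp : 0 < p) {u : M → N} (hu : dirichletEnergy m p u < ⊤) :
    ∃ G, Measurable G ∧
      (firstOrderGradientCalculus hm hB hp).IsGrad (fun x y => edist (u x) (u y)) G ∧
      ∫⁻ z, G z ^ p ∂(firstOrderGradientCalculus hm hB hp).ν ≠ ⊤ ∧
      IsWeakDerivBound m u fun x => G (x, x) := by
  obtain ⟨g₀, hg₀⟩ := iInf_lt_iff.1 hu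
  obtain ⟨hg, hgi⟩ := iInf_lt_iff.1 hg₀
  set g := hg.aemeasurable.mk g₀ with hgdef
  have hgm : Measurable g := hg.aemeasurable.measurable_mk
  have hgg : g₀ =ᵐ[(μHE[m] : Measure M)] g := hg.aemeasurable.ae_eq_mk
  have hΛg : Measurable fun z : M × M => (Λ : ℝ≥0∞) * g z.1 := by fun_prop
  refine ⟨fun z => Λ * g z.1, hΛg, fun v => ?_, ?_, ⟨by fun_prop, fun φ hφ => ?_⟩⟩
  · set B := Metric.ball y₀ R
    have hBt : B ⊆ e.target := (hB.image_subset_of_subset Set.Subset.rfl).trans hB.subset_target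
    let W : Set (ℰ m) := B ∩ (fun y => y + v) ⁻¹' B
    have hW : IsOpen W := Metric.isOpen_ball.inter (Metric.isOpen_ball.preimage (by fun_prop))
    have hWB : ∀ y ∈ W, ∀ t ∈ Set.Icc (0 : ℝ) 1, y + t • v ∈ B := fun y hy t ht =>
      (convex_ball y₀ R).add_smul_mem hy.1 hy.2 ht
    rcases isEmpty_or_nonempty N with hN | hN
    · exact Eventually.of_forall fun y => isEmptyElim (u (e.symm y))
    let a := TopologicalSpace.denseSeq N
    have key : ∀ i, ∀ᵐ y, y ∈ W → edist (edist (u (e.symm y)) (a i)).toReal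
        (edist (u (e.symm (y + v))) (a i)).toReal ≤
        ‖v‖ₑ * ∫⁻ t in Set.Icc (0 : ℝ) 1, Λ * g (e.symm (y + t • v)) := by
      intro i
      obtain ⟨T, hT, hTg⟩ := hg.bound _ (lipschitzWith_toReal_edist (a i))
      obtain ⟨h1, h2, h3⟩ := hB.hasWeakDirDeriv hT v
      have h4 : ∀ᵐ y, y ∈ B → ‖T (e.symm y) (mfderiv (𝓡 m) (𝓡 m) e.symm y v)‖ₑ ≤
          ‖v‖ₑ * (Λ * g (e.symm y)) := by
        filter_upwards [ae_chart_of_ae (M := M) hB.mem_atlas (hTg.and hgg)] with y hy hyB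
        obtain ⟨h5, h6⟩ := hy (hBt hyB)
        refine (hB.enorm_weakDeriv_le hyB _ v).trans ?_
        rw [mul_comm (Λ : ℝ≥0∞), mul_assoc, ← h6]
        gcongr
      filter_upwards [h1.ae_sub_eq_integral Metric.isOpen_ball hW hWB h2 h3, ae_ae_add_smul h4 v]
        with y h5 h6 hy
      rw [edist_comm, edist_eq_enorm_sub, h5 hy, ← lintegral_const_mul' _ _ (by simp)]
      refine (enorm_integral_le_lintegral_enorm _).trans (lintegral_mono_ae ?_)
      filter_upwards [h6, ae_restrict_mem measurableSet_Icc] with t h7 ht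
      exact h7 (hWB y hy t ht)
    filter_upwards [ae_all_iff.2 key] with y hy h1 h2
    exact edist_le_of_forall_dense (TopologicalSpace.denseRange_denseSeq N) fun i => hy i ⟨h1, h2⟩
  · rw [lintegral_firstOrder hm hB hp (hΛg.pow_const p)]
    simp only [ENNReal.mul_rpow_of_nonneg _ _ hp.le]
    rw [lintegral_const_mul' _ _ (by finiteness),
      lintegral_congr_ae (hgg.mono fun x hx => by simp only [← hx]) (g := fun x => g₀ x ^ p)]
    finiteness
  · obtain ⟨T, hT, hTg⟩ := hg.bound φ hφ
    refine ⟨T, hT, ?_⟩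
    filter_upwards [hTg, hgg] with x h1 h2
    refine h1.trans (h2.trans_le (le_mul_of_one_le_left zero_le ?_))
    exact_mod_cast hB.one_le

lemma HasWeakDifferential.congr_ae {g g' : M → ℝ} {G : ∀ x : M, TangentSpace (𝓡 m) x →L[ℝ] ℝ}
    (H : HasWeakDifferential g G) (h : g =ᵐ[μHE[m]] g') : HasWeakDifferential g' G :=
  hasWeakDifferential_iff.2 fun e he v => (hasWeakDifferential_iff.1 H e he v).congr_ae
    e.open_target.measurableSet (ae_chart_of_ae (M := M) he h) (by simp)

lemma sobolevEnergy_congr_ae {u u' : M → N} (h : u =ᵐ[(μHE[m] : Measure M)] u') :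
    sobolevEnergy m s p u = sobolevEnergy m s p u' := by
  have key : ∀ {u u' : M → N} {g}, u =ᵐ[(μHE[m] : Measure M)] u' → IsWeakDerivBound m u g →
      IsWeakDerivBound m u' g := fun h H => ⟨H.aemeasurable, fun φ hφ => by
    obtain ⟨T, hT, hTg⟩ := H.bound φ hφ
    exact ⟨T, hT.congr_ae (h.mono fun x hx => by simp only [hx]), hTg⟩⟩
  rw [sobolevEnergy, sobolevEnergy]
  split_ifs
  · refine iInf_congr fun g => iInf_congr_Prop ⟨key h, key h.symm⟩ fun _ => rfl
  · refine lintegral_congr_ae (h.mono fun x hx => lintegral_congr_ae (h.mono fun y hy => ?_))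
    simp only [hx, hy]

/-- The constant sequence u' converges to u, so openness forces invariance under equality almost
everywhere. This permits choosing a measurable representative. -/
lemma IsSobolevOpen.mem_of_ae_eq [MeasurableSpace N] {n : ℕ} [ChartedSpace (ℰ n) N] (hp : 0 < p)
    {U : Set (M → N)} (hU : IsSobolevOpen m n s p U) {u u' : M → N} (hu : u ∈ U)
    (h : u =ᵐ[(μHE[m] : Measure M)] u') : u' ∈ U := by
  have hE := sobolevEnergy_congr_ae (s := s) (p := p) h
  have hmem := hU.mem u hu
  have hlim : TendstoSobolev m n s p (fun _ => u') u := by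
    refine ⟨?_, by rw [hE]; exact tendsto_const_nhds, fun hs φ L _ hφ => ?_⟩
    · have : ∫⁻ x, edist (u' x) (u x) ^ p ∂(μHE[m] : Measure M) = 0 := by
        rw [lintegral_congr_ae (h.mono fun x hx => by
          simp only [hx, edist_self, ENNReal.zero_rpow_of_pos hp]) (g := fun _ => 0), lintegral_zero]
      simp only [this, tendsto_const_nhds]
    · have h1 := hmem.energy_lt_top
      rw [sobolevEnergy, if_pos hs] at h1
      obtain ⟨g, hg⟩ := iInf_lt_iff.1 h1
      obtain ⟨hg, -⟩ := iInf_lt_iff.1 hg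
      obtain ⟨T, hT, -⟩ := hg.bound _ hφ.inv_mul
      have hT' := hT.const_smul ((L + 1 : ℝ≥0) : ℝ)
      simp only [mul_inv_cancel_left₀ (show ((L + 1 : ℝ≥0) : ℝ) ≠ 0 by positivity)] at hT'
      refine ⟨_, fun _ => _, hT', fun _ => hT'.congr_ae (h.mono fun x hx => by simp only [hx]), ?_⟩
      simp [covectorNorm, hp]
  obtain ⟨_, hk⟩ := (hU.eventually_mem u hu _ (fun _ =>
    ⟨hmem.aemeasurable.congr h, hE ▸ hmem.energy_lt_top⟩) hlim).exists
  exact hk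

lemma isWeakDerivBound_const (b : N) : IsWeakDerivBound m (fun _ : M => b) fun _ => 0 := by
  refine ⟨aemeasurable_const, fun φ _ => ⟨fun _ => 0, hasWeakDifferential_iff.2 fun e he v => ?_,
    by simp [covectorNorm]⟩⟩
  refine HasWeakDirDeriv.of_integral_eq ((continuous_const.locallyIntegrable).locallyIntegrableOn _)
    (by simpa using (locallyIntegrable_zero (μ := volume)).locallyIntegrableOn e.target)
    fun ψ hψ hc _ => ?_
  have h1 := integral_mul_fderiv_eq_neg_fderiv_mul_of_integrable (𝕜 := ℝ) (f := fun _ => φ b) (g := ψ)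
    (v := v) (μ := volume) (by simp) (((hψ.continuous_fderiv (by simp)).clm_apply
      continuous_const).integrable_of_hasCompactSupport (hc.fderiv_apply ℝ v) |>.const_mul _)
    ((hψ.continuous.integrable_of_hasCompactSupport hc).const_mul _) (by fun_prop)
    fun x _ => hψ.differentiable (by simp) x
  simpa using h1

lemma memSobolev_const [MeasurableSpace N] (hp : 0 < p) (b : N) :
    MemSobolev m s p (fun _ : M => b) := by
  refine ⟨aemeasurable_const, ?_⟩
  rw [sobolevEnergy]
  split_ifs
  · refine (iInf₂_le _ (isWeakDerivBound_const b)).trans_lt ?_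
    simp [hp]
  · simp [gagliardoEnergy, hp]

end SobolevGradients

/-! ### Placing infinitely many disjoint bubbles -/

section BubbleFamilies

variable {m : ℕ} {M : Type*} [EMetricSpace M] [ChartedSpace (ℰ m) M]
  [RiemannianBundle (fun x : M => TangentSpace (𝓡 m) x)] [MeasurableSpace M] [BorelSpace M]
  {e : OpenPartialHomeomorph M (ℰ m)} {y₀ : ℰ m} {R s p : ℝ} {Λ : ℝ≥0}
  {N : Type*} [EMetricSpace N] [MeasurableSpace N] {F : Type*} [EMetricSpace F]

/-- The admissible centres have full measure and are therefore dense, so that they can be chosen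
close to the points y₀ + a_k b with a_k = (R/4) 2⁻ᵏ. The balls then lie between the distances 3a_k/4
and 5a_k/4 from y₀, and are disjoint since (5/4)(1/2) < 3/4. -/
theorem exists_isBubbleFamily (hm : 1 ≤ m) (hR : 0 < R)
    {𝒢 : GradientCalculus (M := M) e y₀ R s p} {r q : ℝ} {f : N → F} {u₀ : M → N}
    {G₀ : M × M → ℝ≥0∞}
    (H : ∀ᵐ c, c ∈ Metric.ball y₀ R → ∀ ϱ₀ : ℝ, 0 < ϱ₀ → Metric.closedBall c ϱ₀ ⊆ Metric.ball y₀ R →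
      ∀ κ : ℝ≥0∞, 0 < κ → ∃ ϱ, 0 < ϱ ∧ ϱ ≤ ϱ₀ ∧ ∃ w G, IsBubble 𝒢 r q f u₀ G₀ c ϱ κ w G) :
    ∃ c ϱ w G, IsBubbleFamily 𝒢 r q f u₀ G₀ c ϱ w G := by
  let a : ℕ → ℝ := fun k => R / 4 * (1 / 2) ^ k
  have ha : ∀ k, 0 < a k := fun k => by positivity
  have haR : ∀ k, a k ≤ R / 4 := fun k =>
    mul_le_of_le_one_right (by positivity) (pow_le_one₀ (by norm_num) (by norm_num))
  let b : ℰ m := EuclideanSpace.single ⟨0, hm⟩ 1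
  have hb : ∀ k, dist (y₀ + a k • b) y₀ = a k := fun k => by simp [b, norm_smul, (ha k).le]
  have hc : ∀ k, ∃ c, dist c (y₀ + a k • b) < a k / 8 ∧ ∀ ϱ₀ : ℝ, 0 < ϱ₀ →
      Metric.closedBall c ϱ₀ ⊆ Metric.ball y₀ R →
      ∀ κ : ℝ≥0∞, 0 < κ → ∃ ϱ, 0 < ϱ ∧ ϱ ≤ ϱ₀ ∧ ∃ w G, IsBubble 𝒢 r q f u₀ G₀ c ϱ κ w G := by
    intro k
    obtain ⟨c, hc, hck⟩ := (Measure.dense_of_ae H).exists_dist_lt (y₀ + a k • b)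
      (by have := ha k; positivity : 0 < a k / 8)
    rw [dist_comm] at hck
    exact ⟨c, hck, hc (Metric.mem_ball.2 (by
      linarith [dist_triangle c (y₀ + a k • b) y₀, hb k, haR k]))⟩
  choose c hck hc using hc
  have hsub : ∀ k, ∀ y ∈ Metric.closedBall (c k) (a k / 8),
      3 / 4 * a k ≤ dist y y₀ ∧ dist y y₀ ≤ 5 / 4 * a k := by
    intro k y hy
    have h1 := hb k
    have h2 := dist_triangle y (c k) (y₀ + a k • b)
    have h3 := dist_triangle y (y₀ + a k • b) y₀
    have h4 := dist_triangle (y₀ + a k • b) y y₀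
    have h5 := hck k
    rw [Metric.mem_closedBall] at hy
    rw [dist_comm (y₀ + a k • b) y] at h4
    constructor <;> linarith
  have hball : ∀ k, Metric.closedBall (c k) (a k / 8) ⊆ Metric.closedBall y₀ (R / 2) := fun k y hy =>
    Metric.mem_closedBall.2 (by linarith [(hsub k y hy).2, haR k])
  choose ϱ hϱ hϱa w G hw using fun k => hc k (a k / 8) (by have := ha k; positivity)
    ((hball k).trans (Metric.closedBall_subset_ball (by linarith))) (2⁻¹ ^ k)
    (ENNReal.pow_pos (by simp) k)
  have hsub' : ∀ k, Metric.closedBall (c k) (ϱ k) ⊆ Metric.closedBall (c k) (a k / 8) := fun k =>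
    Metric.closedBall_subset_closedBall (hϱa k)
  refine ⟨c, ϱ, w, G, hw, fun k => (hsub' k).trans (hball k), ?_⟩
  have key : ∀ k l, k < l → Disjoint (Metric.closedBall (c k) (ϱ k)) (Metric.closedBall (c l) (ϱ l)) := by
    refine fun k l hkl => Set.disjoint_left.2 fun y hy hy' => ?_
    have h1 := (hsub k y (hsub' k hy)).1
    have h2 := (hsub l y (hsub' l hy')).2
    have h3 : a l ≤ a k * (1 / 2) := by
      rw [mul_assoc, ← pow_succ]
      exact mul_le_mul_of_nonneg_left (pow_le_pow_of_le_one (by norm_num) (by norm_num) hkl)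
        (by positivity)
    linarith [ha k]
  intro k l hkl
  rcases lt_or_gt_of_ne hkl with h | h
  · exact key k l h
  · exact (key l k h).symm

end BubbleFamilies

/-! ### The local estimate by contradiction -/

section ActingCondition

variable {m : ℕ} {M : Type*} [EMetricSpace M] [ChartedSpace (ℰ m) M]
  [RiemannianBundle (fun x : M => TangentSpace (𝓡 m) x)] [MeasurableSpace M] [BorelSpace M]
  [SecondCountableTopology M] [IsManifold (𝓡 m) ∞ M]
  [IsContMDiffRiemannianBundle (𝓡 m) ∞ (ℰ m) (fun x : M => TangentSpace (𝓡 m) x)]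
  [IsRiemannianManifold (𝓡 m) M]
  {e : OpenPartialHomeomorph M (ℰ m)} {y₀ : ℰ m} {R s p : ℝ} {Λ : ℝ≥0}
  {N : Type*} [EMetricSpace N] [MeasurableSpace N] [BorelSpace N] [SecondCountableTopology N]
  [ConnectedSpace N]
  {F : Type*} [EMetricSpace F] [MeasurableSpace F]

/-- The two kinds of gradients, and the maps on which no bubbles can be glued. -/
theorem exists_gradientCalculus {n : ℕ} [ChartedSpace (ℰ n) N] (hm : 1 ≤ m) (hB : ChartBall e y₀ R Λ) (hs : 0 < s) (hs1 : s ≤ 1)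
    (hp : 1 ≤ p) {r q : ℝ} {f : N → F} {U : Set (M → N)} (hU : IsSobolevOpen m n s p U)
    (hact : ∀ u ∈ U, MemSobolev m r q (fun x => f (u x))) :
    ∃ 𝒢 : GradientCalculus (M := M) e y₀ R s p,
      (∀ u₀ ∈ U, Measurable u₀ → ∃ G₀, Measurable G₀ ∧
        𝒢.IsGrad (fun x y => edist (u₀ x) (u₀ y)) G₀ ∧ ∫⁻ z, G₀ z ^ p ∂𝒢.ν ≠ ⊤ ∧
        ∀ c ϱ w G, ¬ IsBubbleFamily 𝒢 r q f u₀ G₀ c ϱ w G) ∧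
      ∀ b, (fun _ => b) ∈ U →
        ∀ c ϱ w G, ¬ IsBubbleFamily 𝒢 r q f (fun _ => b) (fun _ => 0) c ϱ w G := by
  have hp0 : 0 < p := one_pos.trans_le hp
  rcases hs1.lt_or_eq with hs1 | rfl
  · refine ⟨fractionalGradientCalculus hm hB hs hs1 hp0, fun u₀ hu₀ hm₀ => ?_, fun b hb c ϱ w G H =>
      H.false_of_fractional hp (fun _ _ => by simp) measurable_const hU hb hact⟩
    refine ⟨fun z => edist (u₀ z.1) (u₀ z.2), by fun_prop, fun _ _ => le_rfl, ?_,
      fun c ϱ w G H => H.false_of_fractional hp (fun _ _ => le_rfl) hm₀ hU hu₀ hact⟩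
    rw [← gagliardoEnergy_eq_lintegral hm hB hs hs1 hp0 hm₀]
    have := (hU.mem u₀ hu₀).energy_lt_top.ne
    rwa [sobolevEnergy, if_neg hs1.ne] at this
  · refine ⟨firstOrderGradientCalculus hm hB hp0, fun u₀ hu₀ hm₀ => ?_, fun b hb c ϱ w G H =>
      H.false_of_first_order hp measurable_const (isWeakDerivBound_const b) measurable_const hU hb
        hact⟩
    have h1 := (hU.mem u₀ hu₀).energy_lt_top
    rw [sobolevEnergy, if_pos rfl] at h1
    obtain ⟨G₀, h2, h3, h4, h5⟩ := exists_firstOrder_gradient hm hB hp0 h1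
    exact ⟨G₀, h2, h3, h4, fun c ϱ w G H => H.false_of_first_order hp h2 h5 hm₀ hU hu₀ hact⟩

variable [SecondCountableTopology F] [BorelSpace F]

/-- The negation supplies a bad pair for every constant. Bubbles exist at almost every centre, those
at which a measurable representative of the given map is approximately continuous, and their gluing
is impossible. -/
theorem exists_edist_le_of_small_capacity {n : ℕ} [ChartedSpace (ℰ n) N]
    [RiemannianBundle (fun x : N => TangentSpace (𝓡 n) x)] [IsRiemannianManifold (𝓡 n) N] [IsManifold (𝓡 n) ∞ N]
    [IsContMDiffRiemannianBundle (𝓡 n) ∞ (ℰ n) (fun x : N => TangentSpace (𝓡 n) x)]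
    (hm : 1 ≤ m) (hB : ChartBall e y₀ R Λ) (hs : 0 < s) (hs1 : s ≤ 1)
    (hp : 1 ≤ p) {r q : ℝ} (hr : 0 < r) (hq : 1 ≤ q) (hrq : r * q = s * p) {f : N → F}
    (hf : Measurable f) {U : Set (M → N)} (hU : IsSobolevOpen m n s p U) (hne : U.Nonempty)
    (hact : ∀ u ∈ U, MemSobolev m r q (fun x => f (u x)))
    (hcrit : s * p < m ∨ (s * p = m ∧ 1 < p)) :
    ∃ C : ℝ≥0, ∀ x y : N, s * p < m ∨ edist x y ≤ 1 / (C : ℝ≥0∞) →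
      edist (f x) (f y) ≤ C * edist x y ^ (p / q) := by
  by_contra! hbad
  obtain ⟨u, hu⟩ := hne
  have hum := (hU.mem u hu).aemeasurable
  have hu₀ := hU.mem_of_ae_eq (one_pos.trans_le hp) hu hum.ae_eq_mk
  obtain ⟨𝒢, h𝒢, -⟩ := exists_gradientCalculus hm hB hs hs1 hp hU hact
  obtain ⟨G₀, h1, h2, h3, h4⟩ := h𝒢 _ hu₀ hum.measurable_mk
  obtain ⟨Cl, -, hCl⟩ := IsOscillating.hasLargeEnergyOn hB hr hq
  obtain ⟨c, ϱ, w, G, H⟩ := exists_isBubbleFamily hm hB.pos (𝒢 := 𝒢) (r := r) (q := q) (f := f)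
    (u₀ := hum.mk u) (G₀ := G₀) (by
      filter_upwards [ae_isApproxContinuousAt (measurableSet_target_inter_preimage (e := e)
        hum.measurable_mk)] with c hc hcB ϱ₀ hϱ₀ hsub κ hκ
      exact exists_isBubble_of_small_capacity (n := n) hm hB 𝒢 hs hp hq hrq hf (hCl F) hcrit
        hum.measurable_mk h1 h2 h3 hbad hϱ₀ hsub (hc (hB.subset_target
          (hB.image_subset_of_subset Set.Subset.rfl hcB))) hκ)
  exact h4 _ _ _ _ H

/-- Bad pairs for the constants C = k accumulate at some b by compactness. The constant map b is a
Sobolev map, and the whole space is open. -/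
theorem exists_edist_le_of_compactSpace {n : ℕ} [ChartedSpace (ℰ n) N]
    [RiemannianBundle (fun x : N => TangentSpace (𝓡 n) x)] [IsRiemannianManifold (𝓡 n) N] [CompactSpace N]
    (hm : 1 ≤ m) (hB : ChartBall e y₀ R Λ) (hs : 0 < s) (hs1 : s ≤ 1)
    (hp : 1 ≤ p) {r q : ℝ} (hr : 0 < r) (hq : 1 ≤ q) (hrq : r * q = s * p) {f : N → F}
    (hf : Measurable f) (hact : ∀ u : M → N, MemSobolev m s p u → MemSobolev m r q (fun x => f (u x))) :
    ∃ C : ℝ≥0, ∀ x y : N, edist x y ≤ 1 / (C : ℝ≥0∞) →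
      edist (f x) (f y) ≤ C * edist x y ^ (p / q) := by
  by_contra! hbad
  choose x y hxy hfxy using fun k : ℕ => hbad k
  obtain ⟨b, -, φ, hφ, hb⟩ := isCompact_univ.tendsto_subseq fun k => Set.mem_univ (x k)
  have hbad' : ∀ C τ : ℝ≥0, 0 < τ → ∃ x y, edist x y ≤ 1 / (C : ℝ≥0∞) ∧ edist b x < τ ∧
      C * edist x y ^ (p / q) < edist (f x) (f y) := by
    intro C τ hτ
    obtain ⟨k, hk1, hk2⟩ := ((EMetric.tendsto_nhds.1 hb τ (by exact_mod_cast hτ)).and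
      (hφ.tendsto_atTop.eventually_ge_atTop ⌈C⌉₊)).exists
    have hC : (C : ℝ≥0∞) ≤ ((φ k : ℕ) : ℝ≥0) := by
      exact_mod_cast (Nat.le_ceil C).trans (by exact_mod_cast hk2)
    refine ⟨x (φ k), y (φ k), (hxy _).trans (ENNReal.div_le_div_left hC 1), by rwa [edist_comm],
      (mul_le_mul_left hC _).trans_lt (hfxy _)⟩
  have hU : IsSobolevOpen m n s p {u : M → N | MemSobolev m s p u} :=
    ⟨fun _ h => h, fun _ _ w hw _ => Eventually.of_forall hw⟩
  obtain ⟨𝒢, -, h𝒢⟩ := exists_gradientCalculus hm hB hs hs1 hp hU hact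
  obtain ⟨Cl, -, hCl⟩ := IsOscillating.hasLargeEnergyOn hB hr hq
  obtain ⟨c, ϱ, w, G, H⟩ := exists_isBubbleFamily hm hB.pos (𝒢 := 𝒢) (r := r) (q := q) (f := f)
    (u₀ := fun _ => b) (G₀ := fun _ => 0) (Eventually.of_forall fun c _ ϱ₀ hϱ₀ hsub κ hκ =>
      exists_isBubble_const (n := n) hm hB 𝒢 hs hp hq hrq hf (hCl F) hbad' hϱ₀ hsub hκ)
  exact h𝒢 b (memSobolev_const (one_pos.trans_le hp) b) _ _ _ _ H

end ActingCondition

/-! ### From local Hölder estimates to global conclusions -/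

section LocalHolder

variable {N F : Type*} [EMetricSpace N] [ConnectedSpace N] [EMetricSpace F] {f : N → F} {C : ℝ≥0}

lemma eventually_div_le (C L : ℝ≥0) :
    ∀ᶠ k : ℕ in atTop, ((L / k : ℝ≥0) : ℝ≥0∞) ≤ 1 / (C : ℝ≥0∞) :=
  (ENNReal.tendsto_coe.2 (tendsto_const_div_atTop_nhds_zero_nat L)).eventually_le_const
    (by simp : ((0 : ℝ≥0) : ℝ≥0∞) < 1 / (C : ℝ≥0∞))

/-- Subdivision into k pieces gives the bound C L^α k^(1-α), which tends to 0. If C = 0, then 1/C =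
∞ and no smallness is required. -/
lemma eq_of_forall_edist_le_rpow {n : ℕ} [ChartedSpace (ℰ n) N]
    [RiemannianBundle (fun x : N => TangentSpace (𝓡 n) x)] [IsRiemannianManifold (𝓡 n) N] {α : ℝ} (hα : 1 < α)
    (hf : ∀ x y, edist x y ≤ 1 / (C : ℝ≥0∞) → edist (f x) (f y) ≤ C * edist x y ^ α) (x y : N) :
    f x = f y := by
  lift α to ℝ≥0 using (one_pos.trans hα).le
  obtain ⟨L, hL⟩ := ENNReal.lt_iff_exists_nnreal_btwn.1
    (edist_ne_top_of_connectedSpace x y).lt_top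
  have hlim : Tendsto (fun k : ℕ => ((k * (C * (L / k) ^ (α : ℝ)) : ℝ≥0) : ℝ≥0∞)) atTop (𝓝 0) := by
    refine ENNReal.tendsto_coe.2 (NNReal.tendsto_coe.1 ?_)
    have h1 := ((tendsto_rpow_neg_atTop (sub_pos.2 hα)).comp
      tendsto_natCast_atTop_atTop).const_mul ((C : ℝ) * (L : ℝ) ^ (α : ℝ))
    rw [mul_zero] at h1
    refine h1.congr' ?_
    filter_upwards [eventually_gt_atTop 0] with k hk
    have hk' : (0 : ℝ) < k := by exact_mod_cast hk
    push_cast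
    rw [Function.comp_apply, Real.div_rpow L.coe_nonneg hk'.le, neg_sub, Real.rpow_sub hk',
      Real.rpow_one]
    ring
  refine edist_eq_zero.1 (le_antisymm (ge_of_tendsto hlim ?_) zero_le)
  filter_upwards [eventually_div_le C L, eventually_gt_atTop 0] with k h1 h2
  exact edist_le_of_forall_edist_le (n := n) hf hL.1 h2 h1

/-- For α = 1 subdivision gives C L whatever k is, and L decreases to the distance: the constant
does not deteriorate. -/
lemma lipschitzWith_of_forall_edist_le {n : ℕ} [ChartedSpace (ℰ n) N]
    [RiemannianBundle (fun x : N => TangentSpace (𝓡 n) x)] [IsRiemannianManifold (𝓡 n) N]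
    (hf : ∀ x y, edist x y ≤ 1 / (C : ℝ≥0∞) → edist (f x) (f y) ≤ C * edist x y) :
    LipschitzWith C f := by
  intro x y
  have hd := edist_ne_top_of_connectedSpace x y
  have hlim : Tendsto (fun L : ℝ≥0 => ((C * L : ℝ≥0) : ℝ≥0∞)) (𝓝[>] (edist x y).toNNReal)
      (𝓝 (C * edist x y)) := by
    rw [← ENNReal.coe_toNNReal hd, ← ENNReal.coe_mul]
    exact ENNReal.tendsto_coe.2 ((continuous_const_mul C).tendsto _ |>.mono_left nhdsWithin_le_nhds)
  refine ge_of_tendsto hlim ?_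
  filter_upwards [self_mem_nhdsWithin] with L hL
  obtain ⟨k, h1, h2⟩ := ((eventually_div_le C L).and (eventually_gt_atTop 0)).exists
  refine (edist_le_of_forall_edist_le (n := n) (α := 1) (by simpa using hf)
    (by rw [← ENNReal.coe_toNNReal hd]; exact_mod_cast hL) h2 h1).trans (le_of_eq ?_)
  have : (k : ℝ≥0) ≠ 0 := by positivity
  congr 1
  rw [NNReal.coe_one, NNReal.rpow_one, mul_left_comm, mul_div_cancel₀ _ this]

end LocalHolder

end

/-! ### The acting condition -/

theorem mainTheorem8
    (m n l : ℕ) (hm : 1 ≤ m)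
    (s r p q : ℝ) (hs : 0 < s) (hs1 : s ≤ 1) (hr : 0 < r) (hr1 : r ≤ 1) (hp : 1 ≤ p) (hq : 1 ≤ q)
    (hrq : r * q = s * p)
    -- `M` is a nonempty Riemannian manifold of dimension `m`
    {M : Type*} [Nonempty M] [EMetricSpace M] [ChartedSpace (EuclideanSpace ℝ (Fin m)) M]
    [IsManifold (𝓡 m) ∞ M] [RiemannianBundle (fun x : M => TangentSpace (𝓡 m) x)]
    [IsContMDiffRiemannianBundle (𝓡 m) ∞ (EuclideanSpace ℝ (Fin m))
      (fun x : M => TangentSpace (𝓡 m) x)]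
    [IsRiemannianManifold (𝓡 m) M] [MeasurableSpace M] [BorelSpace M]
    -- `N` is a connected Riemannian manifold of dimension `n`
    {N : Type*} [EMetricSpace N] [ChartedSpace (EuclideanSpace ℝ (Fin n)) N]
    [IsManifold (𝓡 n) ∞ N] [RiemannianBundle (fun x : N => TangentSpace (𝓡 n) x)]
    [IsContMDiffRiemannianBundle (𝓡 n) ∞ (EuclideanSpace ℝ (Fin n))
      (fun x : N => TangentSpace (𝓡 n) x)]
    [IsRiemannianManifold (𝓡 n) N] [SecondCountableTopology N] [MeasurableSpace N] [BorelSpace N]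
    [ConnectedSpace N]
    -- `F` is a Riemannian manifold of dimension `l`
    {F : Type*} [EMetricSpace F] [ChartedSpace (EuclideanSpace ℝ (Fin l)) F]
    [IsManifold (𝓡 l) ∞ F] [RiemannianBundle (fun x : F => TangentSpace (𝓡 l) x)]
    [IsContMDiffRiemannianBundle (𝓡 l) ∞ (EuclideanSpace ℝ (Fin l))
      (fun x : F => TangentSpace (𝓡 l) x)]
    [IsRiemannianManifold (𝓡 l) F] [SecondCountableTopology F] [MeasurableSpace F] [BorelSpace F]
    -- `M` is compact or the Euclidean space (up to a Riemannian isometry)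
    (hM : CompactSpace M ∨
      ∃ Φ : M ≃ₘ⟮𝓡 m, 𝓡 m⟯ EuclideanSpace ℝ (Fin m), Isometry Φ)
    (hN : (m : ℝ) < s * p ∨ (s = 1 ∧ p = 1 ∧ m = 1) → CompactSpace N)
    (f : N → F) (hf : Measurable f)
    -- the superposition operator acts on the whole space or, if `sp ≤ m` and `s < m`, on a
    -- nonempty open set
    (hact : (∀ u : M → N, MemSobolev m s p u → MemSobolev m r q (fun x => f (u x))) ∨
      (s * p ≤ m ∧ s < m ∧ ∃ U : Set (M → N), U.Nonempty ∧ IsSobolevOpen m n s p U ∧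
        ∀ u ∈ U, MemSobolev m r q (fun x => f (u x)))) :
    (∃ C : ℝ≥0, ∀ x y : N, s * p < m ∨ edist x y ≤ 1 / (C : ℝ≥0∞) →
      edist (f x) (f y) ≤ C * edist x y ^ (p / q)) ∧
    (q < p → ∀ x y : N, f x = f y) ∧
    (p = q → ∃ K : ℝ≥0, LipschitzWith K f) := by
  have hM2 : SecondCountableTopology M := by
    rcases hM with hM | ⟨Φ, -⟩
    · exact EMetric.secondCountable_of_sigmaCompact M
    · exact Φ.toHomeomorph.secondCountableTopology
  have hp0 : 0 < p := one_pos.trans_le hp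
  have hq0 : 0 < q := one_pos.trans_le hq
  have hm1 : (1 : ℝ) ≤ m := by exact_mod_cast hm
  obtain ⟨e, R, Λ, -, hB⟩ := exists_chartBall hM (Classical.arbitrary M)
  have main : ∃ C : ℝ≥0, ∀ x y : N, s * p < m ∨ edist x y ≤ 1 / (C : ℝ≥0∞) →
      edist (f x) (f y) ≤ C * edist x y ^ (p / q) := by
    by_cases hcase : s * p ≤ m ∧ s < m
    -- If sp = m with p = 1, then s = m, which the assumption s < m excludes.
    · have hcrit : s * p < m ∨ (s * p = m ∧ 1 < p) := by
        refine hcase.1.lt_or_eq.imp_right fun h => ⟨h, hp.lt_of_ne fun h1 => ?_⟩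
        rw [← h1, mul_one] at h
        exact hcase.2.ne h
      rcases hact with hact | ⟨-, -, U, hne, hU, hact⟩
      · obtain ⟨b⟩ := (inferInstance : Nonempty N)
        exact exists_edist_le_of_small_capacity (n := n) hm hB hs hs1 hp hr hq hrq hf
          (U := {u : M → N | MemSobolev m s p u})
          ⟨fun _ h => h, fun _ _ w hw _ => Eventually.of_forall hw⟩ ⟨_, memSobolev_const hp0 b⟩ hact
          hcrit
      · exact exists_edist_le_of_small_capacity (n := n) hm hB hs hs1 hp hr hq hrq hf hU hne hact hcrit
    · have hact := hact.resolve_right fun h => hcase ⟨h.1, h.2.1⟩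
      -- If sp ≤ m, the failure of s < m leaves only m ≤ s ≤ 1 ≤ m, that is s = m = 1, and then p =
      -- 1: these are the cases where N is assumed to be compact.
      have hsp : (m : ℝ) < s * p ∨ (s * p = m ∧ s = 1 ∧ p = 1 ∧ m = 1) := by
        refine (lt_or_ge _ _).imp_right fun h => ?_
        have h1 : (m : ℝ) ≤ s := not_lt.1 fun h1 => hcase ⟨h, h1⟩
        have h2 : s = 1 := hs1.antisymm (hm1.trans h1)
        have h3 : (m : ℝ) = 1 := (h1.trans hs1).antisymm hm1
        have h4 : p = 1 := by
          rw [h2, h3, one_mul] at h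
          exact h.antisymm hp
        exact ⟨by rw [h2, h4, h3, one_mul], h2, h4, by exact_mod_cast h3⟩
      have := hN (hsp.imp_right fun h => h.2)
      obtain ⟨C, hC⟩ := exists_edist_le_of_compactSpace (n := n) hm hB hs hs1 hp hr hq hrq hf hact
      refine ⟨C, fun x y h => hC x y (h.resolve_left ?_)⟩
      rcases hsp with h | h
      · exact h.not_gt
      · exact h.1.not_lt
  obtain ⟨C, hC⟩ := main
  refine ⟨⟨C, hC⟩, ?_, ?_⟩
  · exact fun hqp => eq_of_forall_edist_le_rpow (n := n) ((one_lt_div hq0).2 hqp) fun x y h =>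
      hC x y (Or.inr h)
  · rintro rfl
    refine ⟨C, lipschitzWith_of_forall_edist_le (n := n) fun x y h => ?_⟩
    simpa [div_self hp0.ne'] using hC x y (Or.inr h)
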